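/- **Conventions.** An $\ell$-group is a Hausdorff, locally compact, totally disconnected topological group that is a union of countably many compact subsets. Subgroups are closed, representations are smooth and complex, and characters are locally constant homomorphisms to $\mathbb C^\times$. $\mathrm{Rep}(K)$ is the category of representations of $K$, $\pi^\vee$ is the contragredient (the smooth vectors of the linear dual), $\tau^g(h)=\tau(ghg^{-1})$, $\psi^g(b)=\psi(gbg^{-1})$, $Z_{G_2}(G_1)$ is the centralizer of $G_1$ in $G_2$ and $Z(G)$ is the center. For a character $\chi$ of a central subgroup $B$ of $K$, $\mathrm{Rep}_\chi(K)$ is the full subcategory of the $(\pi,V)$ such that for every $v\in V$ there is $m\ge 0$ with $(\pi(b)-\chi(b))^mv=0$ for all $b\in B$, and $\mathrm{Irr}_\chi(K)$ is the set of isomorphism classes of its irreducible objects. Characters of two subgroups are consistent if they agree on the intersection. **Setting.** Let $A$ be a finite cyclic group, $\bar G$ an $\ell$-group, and $1\to A\to G\xrightarrow{\mathrm{pr}}\bar G\to1$ a central topological extension. A character of a subgroup of $G$ containing $A$ is genuine if its restriction to $A$ is faithful. Let $H\le G$ be the preimage of a finite index normal subgroup of $\bar G$ and $N\le G$ the preimage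 of a subgroup of $Z(\bar G)$, such that $N\le Z_G(H)$ and $Z_G(H\cap N)=NH$ (that is, $(H,N)$ is a special pair). Let $[N:Z(N)]=d^2$, $d\ge0$. Let $\chi$ and $\psi$ be consistent genuine characters of $N\cap Z(G)=Z_N(G)$ and of $N\cap H$, and let $\varphi$ be their common restriction to $Z_{N\cap H}(G)=N\cap H\cap Z(G)$. A Lagrangian subgroup of $N$ is a subgroup $L\le N$ with $Z_N(L)=L$. Given a Lagrangian subgroup $L$ of $N$ and a character $\theta$ of $L$ extending both $\chi$ and $\psi$, Lagrangian induction is the functor $\tau\mapsto \mathrm{Ind}_{LH}^G\,\tau_{[\theta]}$, where $\tau_{[\theta]}\in \mathrm{Rep}_\theta(LH)$ is the extension of $\tau\in\mathrm{Rep}_\psi(H)$ to $LH$. **Claim.** 1. Such $L$ exist, for each of them such $\theta$ exist, and for every choice of $(L,\theta)$ the construction gives a functor $\mathrm{LInd}_{H,\psi}^{G,\chi}:\mathrm{Rep}_\psi(H)\to\mathrm{Rep}_\chi(G)$, which is an equivalence of categories. Up to natural equivalence it does not depend on $(L,\theta)$. 2. For $\tau\in\mathrm{Rep}_\psi(H)$,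 naturally $\mathrm{Ind}_H^G\tau\simeq d\cdot\bigoplus_{\chi'}\mathrm{LInd}_{H,\psi}^{G,\chi'}\tau$, where $\chi'$ ranges over the characters of $N\cap Z(G)$ that are consistent with $\psi$. Their number is finite and equals $[Z_N(G):Z_{N\cap H}(G)]=[Z(N):N\cap H]$. 3. For $\pi\in\mathrm{Rep}_\chi(G)$, naturally $\mathrm{Res}_H^G\pi\simeq d\cdot\bigoplus_{\psi'}\mathrm{LRes}_{H,\psi'}^{G,\chi}\pi$, where $\psi'$ ranges over the characters of $N\cap H$ that are consistent with $\chi$ and $\mathrm{LRes}_{H,\psi'}^{G,\chi}$ is an inverse of $\mathrm{LInd}_{H,\psi'}^{G,\chi}$. Their number is finite and equals $[N\cap H:Z_{N\cap H}(G)]=[Z(N):Z_N(G)]$. 4. $(\mathrm{LInd}_{H,\psi}^{G,\chi}\tau)^\vee\simeq\mathrm{LInd}_{H,\psi^{-1}}^{G,\chi^{-1}}\tau^\vee$, naturally in those $\tau\in\mathrm{Rep}_\psi(H)$ for which $\tau^\vee\in\mathrm{Rep}_{\psi^{-1}}(H)$. 5. $\mathrm{LInd}_{H,\psi^g}^{G,\chi}(\tau^g)\simeq\mathrm{LInd}_{H,\psi}^{G,\chi}\tau$,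 naturally in $\tau\in\mathrm{Rep}_\psi(H)$, for every $g\in G$. Moreover $NH$ acts trivially by conjugation on $\mathrm{Irr}_\varphi(H)$, and for every irreducible $\pi\in\mathrm{Rep}_\chi(G)$ the classes of $\mathrm{LRes}_{H,\psi'}^{G,\chi}\pi$, where $\psi'$ ranges over the characters of $N\cap H$ consistent with $\chi$, form a $G/NH$-orbit in $\mathrm{Irr}_\varphi(H)$ under conjugation. 6. For every character $\omega$ of $\bar G$ (viewed as a character of $G$), naturally in $\tau\in\mathrm{Rep}_\psi(H)$, $\mathrm{LInd}_{H,\psi\omega}^{G,\chi\omega}(\tau\cdot\omega|_H)\simeq(\mathrm{LInd}_{H,\psi}^{G,\chi}\tau)\cdot\omega$, where $\psi\omega$ and $\chi\omega$ are the products with the restrictions of $\omega$ to $N\cap H$ and to $Z_N(G)$. We have $HZ(N)=HZ_N(G)$, and if $\omega$ is trivial on this group then $(\mathrm{LInd}_{H,\psi}^{G,\chi}\tau)\cdot\omega\simeq\mathrm{LInd}_{H,\psi}^{G,\chi}\tau$. Thus, for $\pi\in\mathrm{Rep}_\chi(G)$, up to isomorphism $\pi\cdot\omega$ depends only on the restriction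 of $\omega$ to $HZ(N)$. 7. Suppose that $\Gamma=G/H$ is abelian, with Pontryagin dual $\hat\Gamma$. For every irreducible $\tau\in\mathrm{Rep}_\psi(H)$ the classes of $\mathrm{LInd}_{H,\psi}^{G,\chi'}\tau$, where $\chi'$ ranges over the characters of $Z_N(G)$ consistent with $\psi$, form a $\hat\Gamma$-orbit in $\mathrm{Irr}_\varphi(G)$ under twisting. 8. Suppose that $\Gamma$ is abelian. There is a unique bijection between the $\Gamma$-orbits in $\mathrm{Irr}_\varphi(H)$ under conjugation and the $\hat\Gamma$-orbits in $\mathrm{Irr}_\varphi(G)$ under twisting that sends the orbit of $\tau$ to the orbit of $\mathrm{LInd}_{H,\psi'}^{G,\chi'}\tau$ for all characters $\psi'$ of $N\cap H$ and $\chi'$ of $Z_N(G)$ extending $\varphi$ and all irreducible $\tau\in\mathrm{Rep}_{\psi'}(H)$. 9. Suppose that $N\cap H$ is cocompact in $Z(H)$, let $\tau\in\mathrm{Rep}_\psi(H)$ be irreducible and $\pi=\mathrm{LInd}_{H,\psi}^{G,\chi}\tau$. Call an irreducible representation essentially square-integrable if some twist of it by a character has unitary central character and matrix coefficients that are square-integrable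 modulo the center. Then $\pi$ is essentially square-integrable if and only if $\tau$ is. Suppose that they are. For a cocompact subgroup $B$ of the center of an $\ell$-group $K$, the formal degree $d_\rho^{B\backslash K}$ of an irreducible representation $\rho$ of $K$ is the Haar measure on $B\backslash K$ with $$\int_{B\backslash K}\langle\rho(g)v,v^\vee\rangle\langle u,\rho^\vee(g)u^\vee\rangle\,d_\rho^{B\backslash K}g=\langle v,u^\vee\rangle\langle u,v^\vee\rangle\quad\text{for all }u,v\in\rho,\ u^\vee,v^\vee\in\rho^\vee,$$ the integrals being absolutely convergent. The formal degree of $\pi$ on $Z_N(G)\backslash G$ exists if and only if that of $\tau$ on $(H\cap N)\backslash H$ does, and likewise for $Z_{N\cap H}(G)\backslash G$ and $Z_{N\cap H}(G)\backslash H$. When they exist, $$d_\tau^{(H\cap N)\backslash H}=d^{-1}\cdot p_*\bigl(d_\pi^{Z_N(G)\backslash G}\big|_{Z_N(G)\backslash NH}\bigr),$$ where $p:Z_N(G)\backslash NH\to N\backslash NH\simeq(H\cap N)\backslash H$ is the projection, and $$d_\tau^{Z_{N\cap H}(G)\backslash H}=\bigl([N:N\cap H]\,[Z_N(G):Z_{N\cap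 H}(G)]\bigr)^{1/2}\cdot d_\pi^{Z_{N\cap H}(G)\backslash G}\big|_{Z_{N\cap H}(G)\backslash H}.$$ -/

import Mathlib

open CategoryTheory MeasureTheory

/-! ### Coverings and special pairs -/

/-- `ι : A → G` and `pr : G → Gbar` exhibit `G` as a central topological extension of `Gbar`
by `A`. -/
structure IsCentralCovering {A Gbar G : Type*} [Group A] [Group Gbar] [Group G]
    [TopologicalSpace A] [TopologicalSpace Gbar] [TopologicalSpace G]
    (ι : A →* G) (pr : G →* Gbar) : Prop where
  isSES : TopologicalGroup.IsSES ι pr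
  central : ι.range ≤ Subgroup.center G

theorem IsCentralCovering.continuous_pr {A Gbar G : Type*} [Group A] [Group Gbar] [Group G]
    [TopologicalSpace A] [TopologicalSpace Gbar] [TopologicalSpace G]
    {ι : A →* G} {pr : G →* Gbar} (h : IsCentralCovering ι pr) : Continuous pr :=
  h.isSES.isOpenQuotientMap.continuous

/-- `(H, N)` is a special pair in the covering `pr : G → Gbar`: `H` is the preimage of a closed
normal subgroup of finite index, `N` is the preimage of a closed central subgroup, `N` centralizes
`H`, and the centralizer of `H ∩ N` in `G` is `N H`. -/
structure IsSpecialPair {Gbar G : Type*} [Group Gbar] [Group G] [TopologicalSpace Gbar]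
    (pr : G →* Gbar) (H N : Subgroup G) : Prop where
  exists_base_H : ∃ Hbar : Subgroup Gbar, IsClosed (Hbar : Set Gbar) ∧ Hbar.Normal ∧
    Hbar.FiniteIndex ∧ H = Hbar.comap pr
  exists_base_N : ∃ Nbar : Subgroup Gbar, IsClosed (Nbar : Set Gbar) ∧
    Nbar ≤ Subgroup.center Gbar ∧ N = Nbar.comap pr
  le_centralizer : N ≤ Subgroup.centralizer (H : Set G)
  centralizer_inf : Subgroup.centralizer ((H ⊓ N : Subgroup G) : Set G) = N ⊔ H

namespace IsSpecialPair

variable {Gbar G : Type*} [Group Gbar] [Group G] [TopologicalSpace Gbar]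
  {pr : G →* Gbar} {H N : Subgroup G}

theorem normal_left (h : IsSpecialPair pr H N) : H.Normal := by
  obtain ⟨Hbar, -, hn, -, rfl⟩ := h.exists_base_H
  exact hn.comap pr

theorem normal_right (h : IsSpecialPair pr H N) : N.Normal := by
  obtain ⟨Nbar, -, hc, rfl⟩ := h.exists_base_N
  have : Nbar.Normal := ⟨fun n hn g => by
    have := Subgroup.mem_center_iff.1 (hc hn) g
    rw [this, mul_inv_cancel_right]; exact hn⟩
  exact this.comap pr

theorem normal_inf (h : IsSpecialPair pr H N) : (N ⊓ H).Normal :=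
  ⟨fun n hn g => ⟨h.normal_right.conj_mem n hn.1 g, h.normal_left.conj_mem n hn.2 g⟩⟩

end IsSpecialPair

/-! ### Smooth characters -/

/-- The group of locally constant homomorphisms `B → ℂˣ`. -/
def smoothChars (B : Type*) [Group B] [TopologicalSpace B] : Subgroup (B →* ℂˣ) where
  carrier := {χ | IsLocallyConstant χ}
  one_mem' := IsLocallyConstant.const 1
  mul_mem' h₁ h₂ := IsLocallyConstant.mul h₁ h₂
  inv_mem' h := IsLocallyConstant.inv h

/-- A (smooth) character of the topological group `B`. -/
abbrev SmoothChar (B : Type*) [Group B] [TopologicalSpace B] : Type _ := ↥(smoothChars B)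

namespace SmoothChar

/-- The value of a character, as a complex number. -/
def val {B : Type*} [Group B] [TopologicalSpace B] (χ : SmoothChar B) (b : B) : ℂ :=
  ((χ.1 b : ℂˣ) : ℂ)

/-- Pullback of a character along a continuous homomorphism. -/
def comap {B C : Type*} [Group B] [TopologicalSpace B] [Group C] [TopologicalSpace C]
    (χ : SmoothChar C) (f : B →* C) (hf : Continuous f) : SmoothChar B :=
  ⟨χ.1.comp f, (show IsLocallyConstant χ.1 from χ.2).comp_continuous hf⟩

variable {G : Type*} [Group G] [TopologicalSpace G]

/-- Restriction of a character of `G` to a subgroup. -/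
def res (ω : SmoothChar G) (B : Subgroup G) : SmoothChar B :=
  ω.comap B.subtype continuous_subtype_val

/-- Restriction of a character of a subgroup to a smaller subgroup. -/
def restrict {B C : Subgroup G} (χ : SmoothChar C) (h : B ≤ C) : SmoothChar B :=
  χ.comap (Subgroup.inclusion h) (continuous_inclusion h)

/-- The conjugate `χ ^ g : b ↦ χ (g b g⁻¹)` of a character of a normal subgroup. -/
def conj [IsTopologicalGroup G] {B : Subgroup G} (hB : B.Normal) (χ : SmoothChar B) (g : G) :
    SmoothChar B :=
  χ.comap
    { toFun := fun b => ⟨g * b * g⁻¹, hB.conj_mem b b.2 g⟩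
      map_one' := by ext; simp
      map_mul' := fun a b => by ext; simp [mul_assoc] }
    (Continuous.subtype_mk (by fun_prop) _)

/-- Two characters of subgroups are consistent if they agree on the intersection. -/
def Consistent {B C : Subgroup G} (χ : SmoothChar B) (ψ : SmoothChar C) : Prop :=
  ∀ (x : G) (hB : x ∈ B) (hC : x ∈ C), χ.val ⟨x, hB⟩ = ψ.val ⟨x, hC⟩

/-- The characters of `B` that are consistent with `ψ`. -/
abbrev _root_.ConsistentChars (B : Subgroup G) {C : Subgroup G} (ψ : SmoothChar C) : Type _ :=
  {χ : SmoothChar B // χ.Consistent ψ}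

/-- A character of a subgroup `B` of the covering group, `B` containing the image of `ι : A → G`,
is genuine if its restriction to `A` is faithful. -/
def Genuine {A : Type*} [Group A] (ι : A →* G) {B : Subgroup G} (χ : SmoothChar B) : Prop :=
  ∀ (a : A) (ha : ι a ∈ B), χ.val ⟨ι a, ha⟩ = 1 → a = 1

end SmoothChar

/-! ### Smooth representations -/

universe u

/-- Smoothness: all stabilizers of vectors are open. -/
def isSmooth (K : Type u) [Group K] [TopologicalSpace K] : ObjectProperty (Rep.{u} ℂ K) :=
  fun V => ∀ v : V, IsOpen {k : K | V.ρ k v = v}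

/-- The category of smooth complex representations of `K`. -/
abbrev SmoothRep (K : Type u) [Group K] [TopologicalSpace K] : Type _ :=
  (isSmooth K).FullSubcategory

section SmoothPart

variable {K : Type u} [Group K] [TopologicalSpace K] [IsTopologicalGroup K]
variable {V : Type*} [AddCommGroup V] [Module ℂ V] (ρ : Representation ℂ K V)

theorem isOpen_stab_of_le {v w : V} (hv : IsOpen {k : K | ρ k v = v})
    (h : ∀ k, ρ k v = v → ρ k w = w) : IsOpen {k : K | ρ k w = w} := by
  rw [isOpen_iff_mem_nhds]
  intro g hg
  have h1 : {k : K | ρ (g⁻¹ * k) v = v} ∈ nhds g :=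
    (hv.preimage (continuous_const_mul g⁻¹)).mem_nhds (by simp)
  refine Filter.mem_of_superset h1 fun k hk => ?_
  have h2 := h _ hk
  have h3 : ρ k w = ρ g (ρ (g⁻¹ * k) w) := by
    rw [← Module.End.mul_apply, ← map_mul, mul_inv_cancel_left]
  exact h3.trans (by rw [h2]; exact hg)

/-- The subspace of vectors with open stabilizer. -/
def smoothVectors : Submodule ℂ V where
  carrier := {v | IsOpen {k : K | ρ k v = v}}
  zero_mem' := by simp
  smul_mem' c v hv := isOpen_stab_of_le ρ hv fun k hk => by rw [map_smul, hk]
  add_mem' {v w} hv hw := by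
    have hvw : IsOpen {k : K | ρ k v = v ∧ ρ k w = w} := IsOpen.inter hv hw
    have := isOpen_stab_of_le (Representation.prod ρ ρ) (v := (v, w)) (w := (v + w, 0))
      (by simpa [Prod.ext_iff] using hvw) (fun k hk => by
        simp only [Representation.prod_apply_apply, Prod.mk.injEq] at hk
        simp [hk.1, hk.2])
    simpa [Prod.ext_iff] using this

theorem smoothVectors_stable (k : K) {v : V} (hv : v ∈ smoothVectors ρ) :
    ρ k v ∈ smoothVectors ρ := by
  have hv' : IsOpen {g : K | ρ g v = v} := hv
  have h1 : IsOpen {g : K | ρ (k⁻¹ * g * k) v = v} :=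
    hv'.preimage (f := fun g : K => k⁻¹ * g * k) (by fun_prop)
  have h2 : {g : K | ρ (k⁻¹ * g * k) v = v} = {g : K | ρ g (ρ k v) = ρ k v} := by
    ext g
    simp only [Set.mem_ofPred_eq, map_mul, Module.End.mul_apply]
    constructor
    · intro h
      simpa using congrArg (ρ k) h
    · intro h
      simp [h]
  show IsOpen {g : K | ρ g (ρ k v) = ρ k v}
  rwa [← h2]

/-- The action of `K` on the smooth vectors. -/
def smoothSubrep : Representation ℂ K (smoothVectors ρ) where
  toFun k := (ρ k).restrict fun _ hv => smoothVectors_stable ρ k hv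
  map_one' := by ext; simp
  map_mul' _ _ := by ext; simp

theorem smoothSubrep_coe (k : K) (v : smoothVectors ρ) :
    ((smoothSubrep ρ k v : smoothVectors ρ) : V) = ρ k v := rfl

theorem map_mem_smoothVectors {V W : Rep.{u} ℂ K} (f : V ⟶ W) {v : V}
    (hv : v ∈ smoothVectors V.ρ) : f.hom v ∈ smoothVectors W.ρ := by
  have hv' : IsOpen {k : K | V.ρ k v = v} := hv
  have h := isOpen_stab_of_le (Representation.prod V.ρ W.ρ) (v := (v, 0)) (w := (0, f.hom v))
    (by simpa [Prod.ext_iff] using hv') (fun k hk => by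
      have hk' : V.ρ k v = v := by simpa [Prod.ext_iff] using hk
      simp [← Rep.hom_comm_apply, hk'])
  show IsOpen {k : K | W.ρ k (f.hom v) = f.hom v}
  simpa [Prod.ext_iff] using h

variable (K) in
/-- The functor sending a representation to its smooth part. -/
noncomputable def smoothPart : Rep.{u} ℂ K ⥤ SmoothRep K where
  obj V := ⟨Rep.of (smoothSubrep V.ρ), fun v => by
    have hv : IsOpen {k : K | V.ρ k v.1 = v.1} := v.2
    simpa [Subtype.ext_iff, smoothSubrep_coe] using hv⟩
  map {V W} f := ObjectProperty.homMk (Rep.ofHom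
    { toLinearMap := f.hom.toLinearMap.restrict fun _ hv => map_mem_smoothVectors f hv
      isIntertwining' := fun k => by
        ext v
        exact Rep.hom_comm_apply f k v.1 })
  map_id V := by
    apply ObjectProperty.hom_ext
    ext v
    rfl
  map_comp f g := by
    apply ObjectProperty.hom_ext
    ext v
    rfl

variable (K) in
/-- The functor sending a representation to its full linear dual. -/
noncomputable def dualFunctor : (Rep.{u} ℂ K)ᵒᵖ ⥤ Rep.{u} ℂ K where
  obj V := Rep.of V.unop.ρ.dual
  map {V W} f := Rep.ofHom
    { toLinearMap := Module.Dual.transpose (R := ℂ) f.unop.hom.toLinearMap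
      isIntertwining' := fun k => by
        ext ξ w
        exact congrArg ξ (Rep.hom_comm_apply f.unop k⁻¹ w).symm }
  map_id V := by ext; rfl
  map_comp f g := by ext; rfl

variable (K) in
/-- The contragredient functor `π ↦ π^∨`: the smooth part of the linear dual. -/
noncomputable def contragredient : (SmoothRep K)ᵒᵖ ⥤ SmoothRep K :=
  (isSmooth K).ι.op ⋙ dualFunctor K ⋙ smoothPart K

end SmoothPart

/-- Restriction of smooth representations along a continuous homomorphism. -/
noncomputable def smoothRes {K M : Type u} [Group K] [TopologicalSpace K] [Group M]
    [TopologicalSpace M] (f : K →* M) (hf : Continuous f) : SmoothRep M ⥤ SmoothRep K :=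
  (isSmooth K).lift ((isSmooth M).ι ⋙ Rep.resFunctor f) fun V v => (V.property v).preimage hf

/-- Full smooth induction along `f : K → M` (in the applications, the inclusion of a subgroup):
the functions `φ : M → V` with `φ (f k * m) = τ k (φ m)` which are right invariant under an open
subgroup, with `M` acting by right translation. -/
noncomputable def smoothInd {K M : Type u} [Group K] [TopologicalSpace K] [Group M]
    [TopologicalSpace M] [IsTopologicalGroup M] (f : K →* M) : SmoothRep K ⥤ SmoothRep M :=
  (isSmooth K).ι ⋙ Rep.coindFunctor.{u} ℂ f ⋙ smoothPart M

section Twist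

variable {K : Type u} [Group K] [TopologicalSpace K]

/-- The action `k ↦ ω(k) ρ(k)`. -/
def twistAction {V : Type*} [AddCommGroup V] [Module ℂ V] (ω : SmoothChar K)
    (ρ : Representation ℂ K V) : Representation ℂ K V where
  toFun k := ω.val k • ρ k
  map_one' := by simp [SmoothChar.val]
  map_mul' a b := by
    ext v
    simp [SmoothChar.val, mul_smul, smul_comm ((ω.1 b : ℂˣ) : ℂ)]

theorem twistAction_apply {V : Type*} [AddCommGroup V] [Module ℂ V] (ω : SmoothChar K)
    (ρ : Representation ℂ K V) (k : K) (v : V) : twistAction ω ρ k v = ω.val k • ρ k v := rfl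

theorem isOpen_stab_twistAction [IsTopologicalGroup K] {V : Type*} [AddCommGroup V] [Module ℂ V]
    (ω : SmoothChar K) (ρ : Representation ℂ K V) {v : V} (hv : IsOpen {k : K | ρ k v = v}) :
    IsOpen {k : K | twistAction ω ρ k v = v} := by
  rw [isOpen_iff_mem_nhds]
  intro g hg
  have h1 : IsOpen {k : K | ρ (g⁻¹ * k) v = v} := hv.preimage (continuous_const_mul g⁻¹)
  have h2 : IsOpen {k : K | ω.1 k = ω.1 g} := ω.2 {ω.1 g}
  refine Filter.mem_of_superset ((h1.inter h2).mem_nhds ⟨by simp, rfl⟩) ?_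
  rintro k ⟨hk1, hk2⟩
  have hk1' : ρ (g⁻¹ * k) v = v := hk1
  have hk2' : ω.1 k = ω.1 g := hk2
  have h3 : ρ k v = ρ g v := by
    conv_rhs => rw [← hk1', ← Module.End.mul_apply, ← map_mul, mul_inv_cancel_left]
  have hg' : ω.val g • ρ g v = v := hg
  show ω.val k • ρ k v = v
  rw [h3, SmoothChar.val, hk2']
  exact hg'

/-- Twisting a smooth representation by a character. -/
noncomputable def smoothTwist [IsTopologicalGroup K] (ω : SmoothChar K) :
    SmoothRep K ⥤ SmoothRep K where
  obj V := ⟨Rep.of (twistAction ω V.obj.ρ),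
    fun v => isOpen_stab_twistAction ω V.obj.ρ (V.property v)⟩
  map {V W} f := ObjectProperty.homMk (Rep.ofHom
    { toLinearMap := f.hom.hom.toLinearMap
      isIntertwining' := fun k => by
        ext v
        have := Rep.hom_comm_apply f.hom k v
        simp [twistAction_apply, this] })
  map_id V := rfl
  map_comp f g := rfl

end Twist

/-- `τ ↦ τ ^ g`, where `τ ^ g (h) = τ (g h g⁻¹)`, for a normal subgroup `H` of `G` and `g ∈ G`. -/
noncomputable def smoothConj {G : Type u} [Group G] [TopologicalSpace G] [IsTopologicalGroup G]
    {H : Subgroup G} (hH : H.Normal) (g : G) : SmoothRep H ⥤ SmoothRep H :=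
  smoothRes
    { toFun := fun b => ⟨g * b * g⁻¹, hH.conj_mem b b.2 g⟩
      map_one' := by ext; simp
      map_mul' := fun a b => by ext; simp [mul_assoc] }
    (Continuous.subtype_mk (by fun_prop) _)

/-! ### Locally-`χ` representations -/

section Loc

variable {G : Type u} [Group G] [TopologicalSpace G]
  {K : Type u} [Group K] [TopologicalSpace K]

/-- Let `f : K → G` be a homomorphism (the inclusion of a subgroup, or the identity of `G`) and let
`χ` be a character of a subgroup `B` of `G`, central in `K`. A representation of `K` is locally-`χ`
if every vector is annihilated by a power, uniform in `b ∈ B`, of `b - χ(b)`. -/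
def isLocally (f : K →* G) {B : Subgroup G} (χ : SmoothChar B) : ObjectProperty (Rep.{u} ℂ K) :=
  fun V => ∀ v : V, ∃ m : ℕ, ∀ (k : K) (hk : f k ∈ B),
    ((V.ρ k - χ.val ⟨f k, hk⟩ • (1 : Module.End ℂ V)) ^ m) v = 0

/-- Smooth and locally-`χ`. -/
def isSmoothLocally (f : K →* G) {B : Subgroup G} (χ : SmoothChar B) :
    ObjectProperty (Rep.{u} ℂ K) :=
  fun V => isSmooth K V ∧ isLocally f χ V

/-- The category of smooth locally-`χ` representations of `K`. -/
abbrev RepLoc (f : K →* G) {B : Subgroup G} (χ : SmoothChar B) : Type _ :=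
  (isSmoothLocally f χ).FullSubcategory

/-- The inclusion of the locally-`χ` representations in all smooth representations. -/
noncomputable def RepLoc.incl (f : K →* G) {B : Subgroup G} (χ : SmoothChar B) :
    RepLoc f χ ⥤ SmoothRep K :=
  ObjectProperty.ιOfLE fun _ h => h.1

/-- `τ ↦ τ · ω` from locally-`χ` representations to locally-`χω` representations. -/
noncomputable def RepLoc.twist [IsTopologicalGroup K] (f : K →* G) (hf : Continuous f)
    {B : Subgroup G} (χ : SmoothChar B) (ω : SmoothChar G) :
    RepLoc f χ ⥤ RepLoc f (χ * ω.res B) :=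
  (isSmoothLocally f (χ * ω.res B)).lift
    (RepLoc.incl f χ ⋙ smoothTwist (ω.comap f hf) ⋙ (isSmooth K).ι) fun V =>
    ⟨((smoothTwist (ω.comap f hf)).obj ((RepLoc.incl f χ).obj V)).property, fun v => by
      obtain ⟨m, hm⟩ := V.property.2 v
      refine ⟨m, fun k hk => ?_⟩
      have h1 : (ω.comap f hf).val k • V.obj.ρ k -
          (χ * ω.res B).val ⟨f k, hk⟩ • (1 : Module.End ℂ V.obj) =
          (ω.comap f hf).val k • (V.obj.ρ k - χ.val ⟨f k, hk⟩ • (1 : Module.End ℂ V.obj)) := by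
        rw [smul_sub, smul_smul]
        congr 2
        simp [SmoothChar.val, SmoothChar.comap, SmoothChar.res, mul_comm]
      show (((ω.comap f hf).val k • V.obj.ρ k -
          (χ * ω.res B).val ⟨f k, hk⟩ • (1 : Module.End ℂ V.obj)) ^ m) v = 0
      rw [h1, smul_pow]
      exact (congrArg (fun w => (ω.comap f hf).val k ^ m • w) (hm k hk)).trans (smul_zero _)⟩

/-- `τ ↦ τ ^ g` from locally-`ψ` representations to locally-`ψ ^ g` representations. -/
noncomputable def RepLoc.conj [IsTopologicalGroup G] {H B : Subgroup G} (hH : H.Normal)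
    (hB : B.Normal) (ψ : SmoothChar B) (g : G) :
    RepLoc H.subtype ψ ⥤ RepLoc H.subtype (ψ.conj hB g) :=
  (isSmoothLocally H.subtype (ψ.conj hB g)).lift
    (RepLoc.incl H.subtype ψ ⋙ smoothConj hH g ⋙ (isSmooth H).ι) fun V =>
    ⟨((smoothConj hH g).obj ((RepLoc.incl H.subtype ψ).obj V)).property, fun v => by
      obtain ⟨m, hm⟩ := V.property.2 v
      exact ⟨m, fun k hk =>
        hm ⟨g * k * g⁻¹, hH.conj_mem k k.2 g⟩ (hB.conj_mem (k : G) hk g)⟩⟩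

/-- The locally-`χ` representations whose contragredient is locally-`χ⁻¹`. -/
def RepLoc.hasLocalDual [IsTopologicalGroup K] (f : K →* G) {B : Subgroup G} (χ : SmoothChar B) :
    ObjectProperty (RepLoc f χ) :=
  fun V => isLocally f χ⁻¹
    ((contragredient K).obj (Opposite.op ((RepLoc.incl f χ).obj V))).obj

/-- The contragredient, from the locally-`χ` representations whose contragredient is
locally-`χ⁻¹` to the locally-`χ⁻¹` representations. -/
noncomputable def RepLoc.contragredient [IsTopologicalGroup K] (f : K →* G) {B : Subgroup G}
    (χ : SmoothChar B) : (RepLoc.hasLocalDual f χ).FullSubcategoryᵒᵖ ⥤ RepLoc f χ⁻¹ :=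
  (isSmoothLocally f χ⁻¹).lift
    (((RepLoc.hasLocalDual f χ).ι ⋙ RepLoc.incl f χ).op ⋙ _root_.contragredient K ⋙
      (isSmooth K).ι)
    fun V => ⟨((_root_.contragredient K).obj
      (Opposite.op ((RepLoc.incl f χ).obj V.unop.obj))).property, V.unop.property⟩

end Loc

/-! ### Natural direct sums -/

open Classical in
/-- The functor `T` is, naturally, the direct sum of the functors `F i`: there are natural
transformations `F i ⟶ T` that identify each `T X` with the direct sum of the `F i X`. -/
def IsNatDirectSum {C : Type*} [Category C] {K : Type u} [Group K] [TopologicalSpace K]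
    (T : C ⥤ SmoothRep K) {I : Type*} (F : I → C ⥤ SmoothRep K) : Prop :=
  ∃ j : ∀ i, F i ⟶ T, ∀ X : C, Function.Bijective
    (DirectSum.toModule ℂ I (T.obj X).obj fun i => ((j i).app X).hom.hom.toLinearMap)

/-! ### Lagrangian induction -/

section LInd

variable {G : Type u} [Group G] [TopologicalSpace G] [IsTopologicalGroup G]

/-- `L` is a Lagrangian subgroup of `N` : it is its own centralizer in `N`. -/
def IsLagrangian (N L : Subgroup G) : Prop :=
  N ⊓ Subgroup.centralizer (L : Set G) = L

/-- The choices in Lagrangian induction: a Lagrangian subgroup `L` of `N` and a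
character `θ` of `L` that extends both `χ` and `ψ`. -/
structure LagrangianDatum (H N : Subgroup G)
    (ψ : SmoothChar ↥(N ⊓ H)) (χ : SmoothChar ↥(N ⊓ Subgroup.center G)) where
  L : Subgroup G
  isLagrangian : IsLagrangian N L
  θ : SmoothChar L
  extends_left : θ.Consistent χ
  extends_right : θ.Consistent ψ

variable {H N : Subgroup G} {ψ : SmoothChar ↥(N ⊓ H)}
  {χ : SmoothChar ↥(N ⊓ Subgroup.center G)}

/-- The functor `F` is the Lagrangian induction built from `(L, θ)`: it is
`τ ↦ Ind_{LH}^G (E τ)`, where `E τ` is the extension of `τ` from `H` to a locally-`θ`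
representation of `L H`. -/
def LagrangianDatum.IsLInd (D : LagrangianDatum H N ψ χ)
    (F : RepLoc H.subtype ψ ⥤ RepLoc (MonoidHom.id G) χ) : Prop :=
  ∃ E : RepLoc H.subtype ψ ⥤ RepLoc (D.L ⊔ H).subtype D.θ,
    Nonempty (E ⋙ RepLoc.incl (D.L ⊔ H).subtype D.θ ⋙
        smoothRes (Subgroup.inclusion (le_sup_right : H ≤ D.L ⊔ H))
          (continuous_inclusion (le_sup_right : H ≤ D.L ⊔ H)) ≅
      RepLoc.incl H.subtype ψ) ∧
    Nonempty (F ⋙ RepLoc.incl (MonoidHom.id G) χ ≅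
      E ⋙ RepLoc.incl (D.L ⊔ H).subtype D.θ ⋙ smoothInd (D.L ⊔ H).subtype)

/-- `F` is a Lagrangian induction functor from locally-`ψ` representations of `H` to locally-`χ`
representations of `G`, for some choice of `(L, θ)`. -/
def IsLInd (H N : Subgroup G) (ψ : SmoothChar ↥(N ⊓ H))
    (χ : SmoothChar ↥(N ⊓ Subgroup.center G))
    (F : RepLoc H.subtype ψ ⥤ RepLoc (MonoidHom.id G) χ) : Prop :=
  ∃ D : LagrangianDatum H N ψ χ, D.IsLInd F

end LInd

/-! ### Classes of irreducible representations and orbits -/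

/-- Isomorphism classes of smooth representations. -/
abbrev SmoothCls (K : Type u) [Group K] [TopologicalSpace K] : Type _ :=
  Quotient (isIsomorphicSetoid (SmoothRep K))

/-- The isomorphism class of a smooth representation. -/
def SmoothRep.cls {K : Type u} [Group K] [TopologicalSpace K] (V : SmoothRep K) : SmoothCls K :=
  Quotient.mk _ V

/-- The map on isomorphism classes induced by a functor. -/
def SmoothCls.map {K M : Type u} [Group K] [TopologicalSpace K] [Group M] [TopologicalSpace M]
    (F : SmoothRep K ⥤ SmoothRep M) : SmoothCls K → SmoothCls M :=
  Quotient.map F.obj fun _ _ ⟨e⟩ => ⟨F.mapIso e⟩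

section Orbits

variable {G : Type u} [Group G] [TopologicalSpace G]

/-- The set `Irr_χ(K)` of isomorphism classes of irreducible smooth locally-`χ`
representations. -/
def IrrLoc {K : Type u} [Group K] [TopologicalSpace K] (f : K →* G) {B : Subgroup G}
    (χ : SmoothChar B) : Set (SmoothCls K) :=
  {c | ∃ V : RepLoc f χ, V.obj.ρ.IsIrreducible ∧ ((RepLoc.incl f χ).obj V).cls = c}

variable [IsTopologicalGroup G]

/-- The orbit of a class of representations of `H` under conjugation by `G`. -/
def conjOrbit {H : Subgroup G} (hH : H.Normal) (c : SmoothCls H) : Set (SmoothCls H) :=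
  Set.range fun g : G => SmoothCls.map (smoothConj hH g) c

/-- The orbits in `Irr_φ(H)` under conjugation by `G`. -/
def conjOrbits {H B : Subgroup G} (hH : H.Normal) (φ : SmoothChar B) :
    Set (Set (SmoothCls H)) :=
  conjOrbit hH '' IrrLoc H.subtype φ

/-- The orbit of a class of representations of `G` under twisting by the characters of `G / H`. -/
def twistOrbit (H : Subgroup G) (c : SmoothCls G) : Set (SmoothCls G) :=
  Set.range fun ω : {ω : SmoothChar G // ∀ h ∈ H, ω.val h = 1} =>
    SmoothCls.map (smoothTwist ω.1) c

/-- The orbits in `Irr_φ(G)` under twisting by the characters of `G / H`. -/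
def twistOrbits (H : Subgroup G) {B : Subgroup G} (φ : SmoothChar B) : Set (Set (SmoothCls G)) :=
  twistOrbit H '' IrrLoc (MonoidHom.id G) φ

end Orbits

/-! ### Square-integrability and formal degree -/

/-- Coset spaces carry their Borel σ-algebra. -/
instance cosetBorel (K : Type*) [Group K] [TopologicalSpace K] (B : Subgroup K) :
    MeasurableSpace (K ⧸ B) := borel _

/-- The map on coset spaces induced by a homomorphism. -/
def cosetMap {K M : Type*} [Group K] [Group M] (f : K →* M) (B : Subgroup K) (C : Subgroup M)
    (h : B ≤ C.comap f) : K ⧸ B → M ⧸ C :=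
  Quotient.map' f fun a b hab => by
    rw [QuotientGroup.leftRel_apply] at hab ⊢
    simpa using h hab

section Formal

variable {K : Type u} [Group K] [TopologicalSpace K] [IsTopologicalGroup K]

/-- A nonzero `K`-invariant Radon measure on `K ⧸ B`; for normal `B`, a Haar measure of the
quotient group. -/
structure IsHaarOnQuotient (B : Subgroup K) (μ : Measure (K ⧸ B)) : Prop where
  invariant : SMulInvariantMeasure K (K ⧸ B) μ
  regular : μ.Regular
  ne_zero : μ ≠ 0

/-- An (irreducible) smooth representation is essentially square-integrable if it has a twist by a
character with unitary central character, all of whose matrix coefficients are square-integrable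
modulo the center. -/
def IsEssSquareIntegrable (V : Rep.{u} ℂ K) : Prop :=
  ∃ ω : SmoothChar K,
    (∀ z ∈ Subgroup.center K, ∃ c : ℂ, ‖c‖ = 1 ∧ ∀ v : V, ω.val z • V.ρ z v = c • v) ∧
    ∃ μ : Measure (K ⧸ Subgroup.center K), IsHaarOnQuotient (Subgroup.center K) μ ∧
      ∀ (v : V) (ξ : smoothVectors V.ρ.dual),
        Integrable (fun x : K ⧸ Subgroup.center K =>
          ‖ω.val x.out * ξ.1 (V.ρ x.out v)‖ ^ 2) μ

/-- The Haar measure `μ` on `K ⧸ B` is the formal degree of the irreducible representation `V`,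
where `B` is a cocompact subgroup of the center of `K`: the Schur orthogonality relations
`∫ ⟨π(g) v, ξ⟩ ⟨u, π^∨(g) η⟩ dμ = ⟨v, η⟩ ⟨u, ξ⟩` hold. (The integrand is `B`-invariant, so the choice of
coset representatives is immaterial.) -/
def IsFormalDegree (V : Rep.{u} ℂ K) (B : Subgroup K) (μ : Measure (K ⧸ B)) : Prop :=
  IsHaarOnQuotient B μ ∧ ∀ (v u : V) (ξ η : smoothVectors V.ρ.dual),
    Integrable (fun x : K ⧸ B => ξ.1 (V.ρ x.out v) * (V.ρ.dual x.out η.1) u) μ ∧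
    ∫ x : K ⧸ B, ξ.1 (V.ρ x.out v) * (V.ρ.dual x.out η.1) u ∂μ = η.1 v * ξ.1 u

end Formal

noncomputable section
set_option linter.unusedSectionVars false
open Subgroup (center inclusion centralizer mem_center_iff mem_centralizer_iff quotientMapOfLE
  zpowers isOpen_mono mem_subgroupOf relIndex_eq_zero_of_le_right relIndex_eq_zero_of_le_left
  mem_sup_of_normal_right mem_sup_of_normal_left isClosed_of_isOpen inf_relIndex_right
  inf_relIndex_left finiteIndex_of_le relIndex_self relIndex_mul_relIndex relIndex_sup_right coe_mul
  coe_inv mem_inf)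
open QuotientGroup (mk_surjective mk_out_eq_mul continuous_mk quotientKerEquivRange isOpenMap_coe
  discreteTopology mk_mul eq_one_iff mk_pow leftRel_apply mk')
open RepLoc (incl)
open Module (Dual)
open Module.End (mul_apply one_apply)
open CategoryTheory.Functor (isoWhiskerLeft isoWhiskerRight leftUnitor rightUnitor)
open Function (Injective Bijective bijective_id)
open Fintype (ofFinite)
open PowerSeries (coeff_trunc)
open Subgroup.FiniteIndex (index_ne_zero)
open Polynomial (aeval)
open _root_.Quotient (sound inductionOn)
open Finset (sum_congr sum_const card_univ mem_univ sum_eq_zero)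
open LinearEquiv (ofBijective)
open MeasureTheory.Measure (map_apply)
open CategoryTheory.Functor.FullyFaithful (ofFullyFaithful)
open CategoryTheory.ObjectProperty (full_ιOfLE faithful_ιOfLE)
open CategoryTheory.NatIso (ofComponents)
open Subrepresentation (toSubmodule toSubmodule_injective)
open MulAction (toPerm)
open Submodule (subset_span span)
open LinearMap (mem_ker)
open Units (val_one)
open IsLocallyConstant (isOpen_fiber)
open CategoryTheory.Functor renaming associator → fassoc
open MonoidHom renaming id → hid, ext → mext, mul_apply → mmul_apply, comp_apply → mcomp_apply,
  inv_apply → minv_apply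
open Subtype renaming ext → sext, val → sval
open LinearMap renaming ext → lext, smul_apply → lsmul_apply, sub_apply → lsub_apply, add_apply →
  ladd_apply, comp_apply → lcomp_apply, id → lid
open Units renaming ext → uext, val → uval
local notation "Endℂ" => Module.End ℂ
local notation "idG" => MonoidHom.id _
local notation "Z[" N "]" => (N ⊓ Subgroup.center _ : Subgroup _)
local postfix:max "°" => Subgroup.subtype
local notation "csv" => continuous_subtype_val
local notation "cosetRes" H:max B:max => cosetMap (Subgroup.subtype H) (Subgroup.subgroupOf B H) B le_rfl
local notation "Repn" => Representation ℂ

section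

/-- There is a compact open subgroup. -/
abbrev HasCompactOpen (K : Type*) [Group K] [TopologicalSpace K] : Prop :=
  ∃ U : Subgroup K, IsOpen (U : Set K) ∧ IsCompact (U : Set K)

lemma HasCompactOpen.subgroup {K : Type*} [Group K] [TopologicalSpace K] [IsTopologicalGroup K]
    (hU : HasCompactOpen K) {H : Subgroup K} (hH : IsOpen (H : Set K)) : HasCompactOpen H := by
  obtain ⟨U, h1, h2⟩ := hU
  exact ⟨U.subgroupOf H, h1.preimage csv,
    (isClosed_of_isOpen H hH).isClosedEmbedding_subtypeVal.isCompact_preimage h2⟩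


variable {G : Type u} [Group G] [TopologicalSpace G] [IsTopologicalGroup G]
  {K : Type u} [Group K] [TopologicalSpace K] [IsTopologicalGroup K] {C H N L : Subgroup G}
  {V V' : Type*} [AddCommGroup V] [Module ℂ V] [AddCommGroup V'] [Module ℂ V'] {ε : C →* ℂˣ}

/-! ### Characters of finite-index quotients -/

lemma exists_eq_pairing {M Γ : Type*} [Group M] [Group Γ] (b : M →* Γ →* ℂˣ) [b.ker.FiniteIndex]
    (μ : M →* ℂˣ) (hμ : ∀ m, b m = 1 → μ m = 1) : ∃ g : Γ, ∀ m, μ m = b m g := by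
  have hfin : Finite b.range := Finite.of_equiv _ (quotientKerEquivRange b).toEquiv
  let μ' : b.range →* ℂˣ := (QuotientGroup.lift b.ker μ fun m hm => hμ m hm).comp
      (quotientKerEquivRange b).symm.toMonoidHom
  have hμ' : ∀ m, μ' ⟨b m, m, rfl⟩ = μ m := by
    intro m
    have : (quotientKerEquivRange b).symm ⟨b m, m, rfl⟩ = (m : M ⧸ b.ker) := by
      rw [MulEquiv.symm_apply_eq]; rfl
    show QuotientGroup.lift b.ker μ (fun m hm => hμ m hm) ((quotientKerEquivRange b).symm _) = _
    rw [this]; rfl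
  let e : Γ →* (b.range →* ℂˣ) :=
    { toFun := fun g => { toFun := fun q => q.1 g, map_one' := rfl, map_mul' := fun _ _ => rfl }
      map_one' := by ext q; simp
      map_mul' := fun g h => by ext q; simp }
  have key : μ' ∈ e.range := by
    have hexp2 : NeZero (Monoid.exponent b.range) :=
      ⟨Monoid.ExponentExists.of_finite.exponent_ne_zero⟩
    have hfin2 : Finite (b.range →* ℂˣ) := Finite.of_equiv _
      (CommGroup.monoidHom_mulEquiv_of_hasEnoughRootsOfUnity b.range ℂ).some.toEquiv.symm
    have hexp : NeZero (Monoid.exponent (b.range →* ℂˣ)) := by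
      rw [Monoid.exponent_eq_of_mulEquiv
        (CommGroup.monoidHom_mulEquiv_of_hasEnoughRootsOfUnity b.range ℂ).some]
      exact hexp2
    rw [← CommGroup.forall_monoidHom_apply_eq_one_iff (M := ℂ) e.range μ']; intro η hη
    have h1 := CommGroup.apply_monoidHomMonoidHomEquiv (M := ℂ) (G := b.range)
    set q := CommGroup.monoidHomMonoidHomEquiv b.range ℂ η with hq
    have h2 : ∀ φ : b.range →* ℂˣ, φ q = η φ := fun φ => h1 φ η
    have hq1 : q = 1 := by
      ext g; have := hη (e g) ⟨g, rfl⟩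
      rw [← h2] at this; exact congrArg uval this
    rw [← h2, hq1, map_one]
  obtain ⟨g, hg⟩ := key
  exact ⟨g, fun m => by rw [← hμ' m, ← hg]; rfl⟩

lemma exists_extend_char {M : Type*} [Group M] (hM : ∀ a b : M, a * b = b * a)
    (P : Subgroup M) (μ : P →* ℂˣ) : ∃ ν : M →* ℂˣ, ∀ p : P, ν p = μ p := by
  let _ : CommGroup M := { mul_comm := hM }
  let _ : DivisibleBy (Additive ℂˣ) ℤ := by
    have : RootableBy ℂˣ ℕ := rootableByOfPowLeftSurj _ _ fun {n} hn x => by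
      obtain ⟨z, hz⟩ := IsAlgClosed.exists_pow_nat_eq (x : ℂ) (Nat.pos_of_ne_zero hn)
      have hz0 : z ≠ 0 := by
        rintro rfl
        rw [zero_pow hn] at hz; exact x.ne_zero hz.symm
      exact ⟨Units.mk0 z hz0, uext (by simpa using hz)⟩
    have : DivisibleBy (Additive ℂˣ) ℕ :=
      { div := fun x n => Additive.ofMul (RootableBy.root x.toMul n)
        div_zero := fun x => congrArg Additive.ofMul (RootableBy.root_zero x.toMul)
        div_cancel := fun x hn => congrArg Additive.ofMul (RootableBy.root_cancel x.toMul hn) }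
    exact AddGroup.divisibleByIntOfDivisibleByNat _
  obtain ⟨h, hh⟩ := (Module.Baer.of_divisible (Additive ℂˣ)).extension_property_addMonoidHom
    (MonoidHom.toAdditive P°) P.subtype_injective (MonoidHom.toAdditive μ)
  refine ⟨MonoidHom.toAdditive.symm h, fun p => ?_⟩
  exact congrArg Additive.toMul (DFunLike.congr_fun hh (Additive.ofMul p))

lemma finite_card_chars {M : Type*} [Group M] (hM : ∀ a b : M, a * b = b * a) (P : Subgroup M)
    [P.FiniteIndex] : Finite {ν : M →* ℂˣ // ∀ p ∈ P, ν p = 1} ∧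
    Nat.card {ν : M →* ℂˣ // ∀ p ∈ P, ν p = 1} = P.index := by
  let _ : CommGroup M := { mul_comm := hM }
  have : P.Normal := inferInstance
  let e : {ν : M →* ℂˣ // ∀ p ∈ P, ν p = 1} ≃ (M ⧸ P →* ℂˣ) :=
    { toFun := fun ν => QuotientGroup.lift P ν.1 ν.2
      invFun := fun ν => ⟨ν.comp (mk' P), fun p hp => by
        have : mk' P p = 1 := (eq_one_iff p).2 hp; rw [mcomp_apply, this, map_one]⟩
      left_inv := fun ν => by ext x; rfl
      right_inv := fun ν => by ext x; rfl }
  have : NeZero (Monoid.exponent (M ⧸ P)) := ⟨Monoid.ExponentExists.of_finite.exponent_ne_zero⟩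
  have : Finite (M ⧸ P →* ℂˣ) := Finite.of_equiv _
    (CommGroup.monoidHom_mulEquiv_of_hasEnoughRootsOfUnity (M ⧸ P) ℂ).some.toEquiv.symm
  refine ⟨Finite.of_equiv _ e.symm, ?_⟩
  rw [Nat.card_congr e]
  exact CommGroup.card_monoidHom_of_hasEnoughRootsOfUnity (M ⧸ P) ℂ

lemma exists_char_ne_one {M : Type*} [Group M] (hM : ∀ a b : M, a * b = b * a) (P : Subgroup M)
    [P.FiniteIndex] {x : M} (hx : x ∉ P) : ∃ ν : M →* ℂˣ, (∀ p ∈ P, ν p = 1) ∧ ν x ≠ 1 := by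
  let _ : CommGroup M := { mul_comm := hM }
  have : P.Normal := inferInstance
  have : NeZero (Monoid.exponent (M ⧸ P)) := ⟨Monoid.ExponentExists.of_finite.exponent_ne_zero⟩
  obtain ⟨ν, hν⟩ := CommGroup.exists_apply_ne_one_of_hasEnoughRootsOfUnity (M ⧸ P) ℂ
    (a := (x : M ⧸ P)) (by rwa [Ne, eq_one_iff])
  refine ⟨ν.comp (mk' P), fun p hp => ?_, hν⟩
  have : mk' P p = 1 := (eq_one_iff p).2 hp
  rw [mcomp_apply, this, map_one]

lemma locConst_of_open {M : Type*} [Group M] [TopologicalSpace M]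
    [IsTopologicalGroup M] (μ : M →* ℂˣ) {P : Subgroup M} (hP : IsOpen (P : Set M))
    (h : ∀ p ∈ P, μ p = 1) : IsLocallyConstant μ := by
  rw [IsLocallyConstant.iff_exists_open]
  intro x
  refine ⟨(fun y => x⁻¹ * y) ⁻¹' (P : Set M), hP.preimage (continuous_const_mul x⁻¹),
    by simp [P.one_mem], fun y hy => ?_⟩
  have := h _ hy
  rw [map_mul, map_inv, inv_mul_eq_one] at this
  exact this.symm

lemma SmoothChar.ext_val {B : Type*} [Group B] [TopologicalSpace B] {χ χ' : SmoothChar B}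
    (h : ∀ b, χ.val b = χ'.val b) : χ = χ' :=
  sext (mext fun b => uext (h b))

/-! ### Eigenspace decomposition for finite commutative groups -/

lemma sum_chars_apply {M : Type*} [Group M] (hM : ∀ a b : M, a * b = b * a) (P : Subgroup M)
    [P.FiniteIndex] [Fintype {ν : M →* ℂˣ // ∀ p ∈ P, ν p = 1}] [DecidablePred (· ∈ P)] (m : M) :
    ∑ ν : {ν : M →* ℂˣ // ∀ p ∈ P, ν p = 1}, ((ν.1 m : ℂˣ) : ℂ) =
    if m ∈ P then (P.index : ℂ) else 0 := by
  split_ifs with h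
  · have : ∀ ν : {ν : M →* ℂˣ // ∀ p ∈ P, ν p = 1}, ((ν.1 m : ℂˣ) : ℂ) = 1 := fun ν => by
      rw [ν.2 m h, val_one]
    simp only [this, sum_const, card_univ, nsmul_eq_mul, mul_one]
    rw [← Nat.card_eq_fintype_card, (finite_card_chars hM P).2]
  · obtain ⟨ν₀, hν₀, hm⟩ := exists_char_ne_one hM P h
    have h1 : ∑ ν : {ν : M →* ℂˣ // ∀ p ∈ P, ν p = 1}, ((ν.1 m : ℂˣ) : ℂ) =
        (ν₀ m : ℂ) * ∑ ν : {ν : M →* ℂˣ // ∀ p ∈ P, ν p = 1}, ((ν.1 m : ℂˣ) : ℂ) := by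
      rw [Finset.mul_sum]
      let e : {ν : M →* ℂˣ // ∀ p ∈ P, ν p = 1} ≃ {ν : M →* ℂˣ // ∀ p ∈ P, ν p = 1} :=
        { toFun := fun ν => ⟨ν₀ * ν.1, fun p hp => by simp [hν₀ p hp, ν.2 p hp]⟩
          invFun := fun ν => ⟨ν₀⁻¹ * ν.1, fun p hp => by simp [hν₀ p hp, ν.2 p hp]⟩
          left_inv := fun ν => sext (inv_mul_cancel_left ν₀ ν.1)
          right_inv := fun ν => sext (mul_inv_cancel_left ν₀ ν.1) }
      exact (Fintype.sum_equiv e _ _ fun ν => by simp [e]).symm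
    have h2 : ((ν₀ m : ℂ) - 1) * ∑ ν : {ν : M →* ℂˣ // ∀ p ∈ P, ν p = 1}, ((ν.1 m : ℂˣ) : ℂ) = 0 := by
      rw [sub_mul, one_mul, ← h1, sub_self]
    rcases mul_eq_zero.1 h2 with h3 | h3
    · exact absurd (uext (sub_eq_zero.1 h3)) hm
    · exact h3

lemma sum_quotient_char {M : Type*} [Group M] (P : Subgroup M) [P.Normal] [Fintype (M ⧸ P)]
    (ν : M →* ℂˣ) (hν : ∀ p ∈ P, ν p = 1) (h : ν ≠ 1) : ∑ q : M ⧸ P, ((ν q.out : ℂˣ) : ℂ) = 0 := by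
  obtain ⟨m, hm⟩ : ∃ q, ν q ≠ 1 := by
    by_contra! hc
    exact h (mext hc)
  have h0 : ∀ q : M ⧸ P, ν q.out = QuotientGroup.lift P ν hν q := fun q => by
    conv_rhs => rw [← q.out_eq']
    rfl
  simp only [h0]
  set ν' := QuotientGroup.lift P ν hν
  have h1 : ∑ q : M ⧸ P, ((ν' q : ℂˣ) : ℂ) = (ν m : ℂ) * ∑ q : M ⧸ P, ((ν' q : ℂˣ) : ℂ) := by
    rw [Finset.mul_sum]
    exact (Fintype.sum_equiv (Equiv.mulLeft (m : M ⧸ P)) _ _ fun q => by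
      rw [Equiv.coe_mulLeft, map_mul, Units.val_mul]; rfl).symm
  have h2 : ((ν m : ℂ) - 1) * ∑ q : M ⧸ P, ((ν' q : ℂˣ) : ℂ) = 0 := by
    rw [sub_mul, one_mul, ← h1, sub_self]
  rcases mul_eq_zero.1 h2 with h3 | h3
  · exact absurd (uext (sub_eq_zero.1 h3)) hm
  · exact h3

section

variable {M : Type*} [Group M]

/-- The subspace on which `M` acts through the character `θ`. -/
def charSpace (s : M →* Endℂ V) (θ : M →* ℂˣ) : Submodule ℂ V where
  carrier := {v | ∀ m, s m v = (θ m : ℂ) • v}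
  zero_mem' := by simp
  add_mem' hv hw m := by rw [map_add, hv m, hw m, smul_add]
  smul_mem' c v hv m := by rw [map_smul, hv m, smul_comm]

lemma mem_charSpace {s : M →* Endℂ V} {θ : M →* ℂˣ} {v : V} :
    v ∈ charSpace s θ ↔ ∀ m, s m v = (θ m : ℂ) • v := Iff.rfl

/-- The averaging projection onto the `θ`-eigenspace of `M`, for an action of `M` that is given by
`θ` on the finite index subgroup `P`. -/
def charProj (P : Subgroup M) (s : M →* Endℂ V) (θ : M →* ℂˣ) : Endℂ V :=
  (P.index : ℂ)⁻¹ • ∑ᶠ q : M ⧸ P, ((θ q.out)⁻¹ : ℂˣ).val • s q.out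

variable (P : Subgroup M) {s : M →* Endℂ V} {θ : M →* ℂˣ}

lemma charProj_eq_sum [Fintype (M ⧸ P)] (v : V) :
    charProj P s θ v = (P.index : ℂ)⁻¹ • ∑ q : M ⧸ P, ((θ q.out)⁻¹ : ℂˣ).val • s q.out v := by
  rw [charProj, finsum_eq_sum_of_fintype]
  simp

lemma charProj_term (hs : ∀ p ∈ P, ∀ v, s p v = (θ p : ℂ) • v) {a b : M} (hab : (a : M ⧸ P) = b)
    (v : V) : ((θ a)⁻¹ : ℂˣ).val • s a v = ((θ b)⁻¹ : ℂˣ).val • s b v := by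
  obtain ⟨p, hp, rfl⟩ : ∃ p ∈ P, b = a * p := ⟨a⁻¹ * b, QuotientGroup.eq.1 hab, by group⟩
  rw [map_mul s, mul_apply, hs p hp, map_smul, smul_smul, map_mul, mul_inv, ← Units.val_mul,
    inv_mul_cancel_right]

lemma charProj_mem [P.FiniteIndex] (hs : ∀ p ∈ P, ∀ v, s p v = (θ p : ℂ) • v) (v : V) :
    charProj P s θ v ∈ charSpace s θ := by
  have := ofFinite (M ⧸ P)
  intro m
  rw [charProj_eq_sum, map_smul, map_sum, smul_comm (θ m : ℂ) ((P.index : ℂ)⁻¹),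
    Finset.smul_sum (r := (θ m : ℂ))]
  refine congrArg (fun w : V => (P.index : ℂ)⁻¹ • w) ?_
  refine Fintype.sum_equiv (toPerm m : Equiv.Perm (M ⧸ P)) _ _ fun q => ?_
  have h1 := charProj_term P hs (a := ((toPerm m : Equiv.Perm (M ⧸ P)) q).out) (b := m * q.out) (by
      have : (q.out : M ⧸ P) = q := q.out_eq'
      simp
      nth_rw 1 [← this]
      rfl) v
  rw [h1, map_smul, smul_smul, map_mul s, mul_apply, map_mul, mul_inv, Units.val_mul,
    ← mul_assoc, ← Units.val_mul (θ m), mul_inv_cancel, val_one, one_mul]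

lemma charProj_of_mem [P.FiniteIndex] {v : V} (hv : v ∈ charSpace s θ) : charProj P s θ v = v := by
  have := ofFinite (M ⧸ P)
  rw [charProj_eq_sum]
  have : ∀ q : M ⧸ P, ((θ q.out)⁻¹ : ℂˣ).val • s q.out v = v := fun q => by
    rw [hv, smul_smul, ← Units.val_mul, inv_mul_cancel, val_one, one_smul]
  simp only [this, sum_const, card_univ, ← Nat.card_eq_fintype_card]
  rw [← Nat.cast_smul_eq_nsmul ℂ, smul_smul]
  change ((P.index : ℂ)⁻¹ * (P.index : ℂ)) • v = v
  rw [inv_mul_cancel₀ (Nat.cast_ne_zero.2 index_ne_zero), one_smul]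

lemma charProj_of_mem_of_ne [P.FiniteIndex] [P.Normal] {θ' : M →* ℂˣ} (hθ : ∀ p ∈ P, θ' p = θ p) (hne : θ' ≠ θ)
    {v : V} (hv : v ∈ charSpace s θ') : charProj P s θ v = 0 := by
  have := ofFinite (M ⧸ P)
  rw [charProj_eq_sum]
  have h1 : ∀ q : M ⧸ P, ((θ q.out)⁻¹ : ℂˣ).val • s q.out v =
      (((θ⁻¹ * θ') q.out : ℂˣ) : ℂ) • v := fun q => by
    rw [hv, smul_smul, ← Units.val_mul]; rfl
  simp only [h1, ← Finset.sum_smul]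
  rw [sum_quotient_char P (θ⁻¹ * θ') (fun p hp => by simp [hθ p hp])
    (fun h => hne (inv_mul_eq_one.1 h).symm), zero_smul, smul_zero]

lemma map_charProj_of_comm [P.FiniteIndex] {s' : M →* Endℂ V'} (f : V →ₗ[ℂ] V')
    (hf : ∀ m v, f (s m v) = s' m (f v)) (v : V) :
    f (charProj P s θ v) = charProj P s' θ (f v) := by
  have := ofFinite (M ⧸ P)
  rw [charProj_eq_sum, charProj_eq_sum, map_smul, map_sum]
  simp only [map_smul, hf]

lemma sum_charProj [P.FiniteIndex] (hM : ∀ a b : M, a * b = b * a)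
    [Fintype {ν : M →* ℂˣ // ∀ p ∈ P, ν p = 1}] (hs : ∀ p ∈ P, ∀ v, s p v = (θ p : ℂ) • v) (v : V) :
    ∑ ν : {ν : M →* ℂˣ // ∀ p ∈ P, ν p = 1}, charProj P s (θ * ν.1) v = v := by
  classical
  have := ofFinite (M ⧸ P)
  simp only [charProj_eq_sum, ← Finset.smul_sum]
  rw [Finset.sum_comm]
  have h1 : ∀ q : M ⧸ P, ∑ ν : {ν : M →* ℂˣ // ∀ p ∈ P, ν p = 1},
      (((θ * ν.1) q.out)⁻¹ : ℂˣ).val • s q.out v =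
      if q = ((1 : M) : M ⧸ P) then (P.index : ℂ) • v else 0 := by
    intro q
    have h2 : ∀ ν : {ν : M →* ℂˣ // ∀ p ∈ P, ν p = 1}, (((θ * ν.1) q.out)⁻¹ : ℂˣ).val • s q.out v =
          ((ν.1 q.out⁻¹ : ℂˣ) : ℂ) • ((θ q.out)⁻¹ : ℂˣ).val • s q.out v := fun ν => by
      rw [smul_smul, ← Units.val_mul, map_inv, mmul_apply, mul_inv, mul_comm]
    simp only [h2, ← Finset.sum_smul]
    rw [sum_chars_apply hM P]
    have h3 : q.out⁻¹ ∈ P ↔ q = ((1 : M) : M ⧸ P) := by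
      conv_rhs => rw [← q.out_eq']
      rw [show (Quotient.mk'' q.out : M ⧸ P) = ((q.out : M) : M ⧸ P) from rfl, QuotientGroup.eq]
      simp
    simp only [h3]
    split_ifs with h
    · have := charProj_term P hs (a := q.out) (b := 1) (by rw [← h]; exact q.out_eq') v
      rw [this]; simp
    · rw [zero_smul]
  simp only [h1, Finset.sum_ite_eq', mem_univ, if_true]
  rw [smul_smul, inv_mul_cancel₀ (Nat.cast_ne_zero.2 index_ne_zero), one_smul]

end

instance [H.FiniteIndex] : (L ⊔ H).FiniteIndex := finiteIndex_of_le le_sup_right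

lemma exists_common_extension {M : Type*} [Group M] (hM : ∀ a b : M, a * b = b * a)
    (P Q : Subgroup M) (α : P →* ℂˣ) (β : Q →* ℂˣ)
    (h : ∀ (x : M) (hP : x ∈ P) (hQ : x ∈ Q), α ⟨x, hP⟩ = β ⟨x, hQ⟩) :
    ∃ ν : M →* ℂˣ, (∀ p : P, ν p = α p) ∧ ∀ q : Q, ν q = β q := by
  let f : P × Q →* M := P.subtype.noncommCoprod Q° fun a b => hM _ _
  let γ : P × Q →* ℂˣ := α.coprod β
  have hker : ∀ x ∈ f.ker, γ x = 1 := by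
    rintro ⟨p, q⟩ hx
    have hx' : (p : M) * q = 1 := hx
    have hpq : (p : M) = (q⁻¹ : Q) := by rw [coe_inv]; exact eq_inv_of_mul_eq_one_left hx'
    have h1 : α p = β q⁻¹ := by
      exact (h p p.2 (hpq ▸ (q⁻¹).2)).trans (congrArg β (sext hpq))
    show α p * β q = 1
    rw [h1, map_inv, inv_mul_cancel]
  let μ : f.range →* ℂˣ := (QuotientGroup.lift f.ker γ hker).comp
    (quotientKerEquivRange f).symm.toMonoidHom
  have hμ : ∀ x, μ ⟨f x, x, rfl⟩ = γ x := by
    intro x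
    have : (quotientKerEquivRange f).symm ⟨f x, x, rfl⟩ = (x : (P × Q) ⧸ f.ker) := by
      rw [MulEquiv.symm_apply_eq]; rfl
    show QuotientGroup.lift f.ker γ hker ((quotientKerEquivRange f).symm _) = _
    rw [this]; rfl
  obtain ⟨ν, hν⟩ := exists_extend_char hM f.range μ
  refine ⟨ν, fun p => ?_, fun q => ?_⟩
  · have := hν ⟨f (p, 1), (p, 1), rfl⟩
    rw [hμ] at this; have e1 : f (p, 1) = p := mul_one (p : M)
    have e2 : γ (p, 1) = α p := by simp [γ]
    rw [e2] at this; exact (congrArg ν e1).symm.trans this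
  · have := hν ⟨f (1, q), (1, q), rfl⟩
    rw [hμ] at this; have e1 : f (1, q) = q := one_mul (q : M)
    have e2 : γ (1, q) = β q := by simp [γ]
    rw [e2] at this; exact (congrArg ν e1).symm.trans this

section

lemma locConst_of_restrict {L M H : Subgroup G}
    (hH : IsOpen (H : Set G)) (hML : M ≤ L) (hLH : L ⊓ H ≤ M) (ψ : SmoothChar M) (μ : L →* ℂˣ)
    (h : ∀ m : M, μ (inclusion hML m) = ψ.1 m) : IsLocallyConstant μ := by
  obtain ⟨U, hU, hU'⟩ := isOpen_induced_iff.1 (ψ.2 {1})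
  have hP : IsOpen (((MonoidHom.ker ψ.1).map (inclusion hML) ⊓ H.subgroupOf L : Subgroup L) :
      Set L) := by
    convert (hU.inter hH).preimage (csv : Continuous (sval : L → G)) using 1
    ext ⟨x, hx⟩
    constructor
    · rintro ⟨⟨m, hm, hmx⟩, hxH⟩
      have : m ∈ sval ⁻¹' U := by rw [hU']; exact hm
      have hmx' : (m : G) = x := congrArg sval hmx
      exact ⟨hmx' ▸ this, hxH⟩
    · rintro ⟨hxU, hxH⟩
      have h1 : (⟨x, hLH ⟨hx, hxH⟩⟩ : M) ∈ sval ⁻¹' U := hxU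
      rw [hU'] at h1; exact ⟨⟨_, h1, rfl⟩, hxH⟩
  refine locConst_of_open μ hP ?_
  rintro _ ⟨⟨m, hm, rfl⟩, -⟩
  rw [h]; exact hm

/-- The group-theoretic properties of a special pair `(H, N)` in a central extension with
finite kernel `C`. -/
structure PairData (C H N : Subgroup G) : Prop where
  finite_C : Finite C
  C_le_center : C ≤ center G
  C_le_H : C ≤ H
  C_le_N : C ≤ N
  normal_H : H.Normal
  normal_N : N.Normal
  isOpen_H : IsOpen (H : Set G)
  finiteIndex_H : H.FiniteIndex
  comm_mem : ∀ n ∈ N, ∀ g : G, n * g * n⁻¹ * g⁻¹ ∈ C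
  le_centralizer : N ≤ centralizer (H : Set G)
  centralizer_inf : centralizer ((H ⊓ N : Subgroup G) : Set G) = N ⊔ H
  exists_isolated : ∃ U : Set G, IsOpen U ∧ 1 ∈ U ∧ ∀ c ∈ C, c ∈ U → c = 1

lemma IsSpecialPair.data {A Gbar : Type*} [Group A] [Finite A] [TopologicalSpace A]
    [DiscreteTopology A] [Group Gbar] [TopologicalSpace Gbar] [IsTopologicalGroup Gbar] {ι : A →* G}
    {pr : G →* Gbar} (hcov : IsCentralCovering ι pr) {H N : Subgroup G} (hs : IsSpecialPair pr H N)
    : PairData ι.range H N := by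
  have hker : ∀ x, pr x = 1 → x ∈ ι.range := fun x hx => (hcov.isSES.mulExact x).1 hx
  have hker' : ∀ x ∈ ι.range, pr x = 1 := fun x hx => (hcov.isSES.mulExact x).2 hx
  have hnH := hs.normal_left
  have hnN := hs.normal_right
  obtain ⟨Hbar, hHc, hHn, hHf, hH⟩ := hs.exists_base_H
  obtain ⟨Nbar, hNc, hNz, hN⟩ := hs.exists_base_N
  refine ⟨Finite.of_surjective (ι.rangeRestrict) ι.rangeRestrict_surjective, hcov.central,
    ?_, ?_, hnH, hnN, ?_, ?_, ?_, hs.le_centralizer, hs.centralizer_inf, ?_⟩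
  · intro x hx; rw [hH, Subgroup.mem_comap, hker' x hx]; exact one_mem _
  · intro x hx; rw [hN, Subgroup.mem_comap, hker' x hx]; exact one_mem _
  · rw [hH]; exact (Subgroup.isOpen_of_isClosed_of_finiteIndex Hbar hHc).preimage hcov.continuous_pr
  · rw [hH]
    exact ⟨by rw [Subgroup.index_comap_of_surjective _ hcov.isSES.isOpenQuotientMap.surjective]; exact hHf.index_ne_zero⟩
  · intro n hn g; apply hker
    rw [hN] at hn; have := mem_center_iff.1 (hNz hn) (pr g)
    simp only [map_mul, map_inv]
    rw [← this]; group
  · obtain ⟨U, hU, hU1⟩ := isOpen_induced_iff.1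
      (hcov.isSES.isClosedEmbedding.isInducing.eq_induced ▸ isOpen_discrete ({1} : Set A))
    refine ⟨U, hU, ?_, ?_⟩
    · have h1 : (1 : A) ∈ ι ⁻¹' U := by rw [hU1]; rfl
      simpa using h1
    · rintro _ ⟨a, rfl⟩ ha
      have h1 : a ∈ ι ⁻¹' U := ha; rw [hU1] at h1; rw [h1, map_one]

namespace PairData

variable (hs : PairData C H N)
include hs

lemma comm_C {c : G} (hc : c ∈ C) (g : G) : g * c = c * g := mem_center_iff.1 (hs.C_le_center hc) g

lemma comm_NH {n h : G} (hn : n ∈ N) (hh : h ∈ H) : h * n = n * h :=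
  mem_centralizer_iff.1 (hs.le_centralizer hn) h hh

lemma normal_of_C_le (hLN : L ≤ N) (hC : C ≤ L) : L.Normal := by
  refine ⟨fun n hn g => ?_⟩
  have h1 := hs.comm_mem n (hLN hn) g
  have : g * n * g⁻¹ = (n * g * n⁻¹ * g⁻¹)⁻¹ * n := by group
  rw [this]
  exact mul_mem (inv_mem (hC h1)) hn

/-- The commutator pairing `N × G → ℂˣ` attached to a character of `C`. -/
def pairing (ε : C →* ℂˣ) : N →* G →* ℂˣ where
  toFun n :=
    { toFun := fun g => ε ⟨n * g * (n : G)⁻¹ * g⁻¹, hs.comm_mem n n.2 g⟩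
      map_one' := by
        rw [← map_one ε]; congr 1; ext; simp
      map_mul' := fun g g' => by
        rw [← map_mul]; congr 1; ext
        simp only [coe_mul]
        have hc := hs.comm_C (hs.comm_mem n n.2 g'); have e1 := hc (n * g * (n : G)⁻¹)
        have e2 := hc g
        calc (n : G) * (g * g') * (n : G)⁻¹ * (g * g')⁻¹
            = (n * g * (n : G)⁻¹) * (n * g' * (n : G)⁻¹ * g'⁻¹) * g⁻¹ := by group
          _ = (n * g' * (n : G)⁻¹ * g'⁻¹) * (n * g * (n : G)⁻¹ * g⁻¹) := by rw [e1]; group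
          _ = (n * g * (n : G)⁻¹ * g⁻¹) * (n * g' * (n : G)⁻¹ * g'⁻¹) := (hc _).symm }
  map_one' := by
    ext g; simp only [MonoidHom.coe_mk, OneHom.coe_mk, MonoidHom.one_apply]
    rw [← map_one ε]; congr 2; ext; simp
  map_mul' n n' := by
    ext g; simp only [MonoidHom.coe_mk, OneHom.coe_mk, mmul_apply]
    rw [← map_mul]; congr 2; ext
    simp only [coe_mul]
    have hc := hs.comm_C (hs.comm_mem n' n'.2 g)
    calc (n : G) * n' * g * ((n : G) * n')⁻¹ * g⁻¹
        = n * (n' * g * (n' : G)⁻¹ * g⁻¹) * (g * (n : G)⁻¹ * g⁻¹) := by group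
      _ = (n' * g * (n' : G)⁻¹ * g⁻¹) * (n * g * (n : G)⁻¹ * g⁻¹) := by rw [hc]; group
      _ = (n * g * (n : G)⁻¹ * g⁻¹) * (n' * g * (n' : G)⁻¹ * g⁻¹) := (hc _).symm

lemma pairing_apply (ε : C →* ℂˣ) (n : N) (g : G) :
    hs.pairing ε n g = ε ⟨n * g * (n : G)⁻¹ * g⁻¹, hs.comm_mem n n.2 g⟩ := rfl

lemma pairing_eq_one_iff (hε : Injective ε) (n : N) (g : G) :
    hs.pairing ε n g = 1 ↔ g * n = n * g := by
  rw [hs.pairing_apply, map_eq_one_iff ε hε, Subtype.ext_iff]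
  simp only [Subgroup.coe_one]
  rw [mul_inv_eq_one, mul_inv_eq_iff_eq_mul (b := (n : G)), eq_comm]

lemma pairing_of_mem_H (ε : C →* ℂˣ) (n : N) {g : G} (hg : g ∈ H) : hs.pairing ε n g = 1 := by
  rw [hs.pairing_apply, ← map_one ε]; congr 1; ext
  simp [← hs.comm_NH n.2 hg]

lemma finite_range_pairing (ε : C →* ℂˣ) : Finite (hs.pairing ε).range := by
  have := hs.finite_C
  have := hs.finiteIndex_H
  have : Finite ε.range := Finite.of_surjective _ ε.rangeRestrict_surjective
  have := hs.normal_H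
  let F : (hs.pairing ε).range → (G ⧸ H → ε.range) := fun r q => ⟨r.1 q.out, by
    obtain ⟨_, ⟨n, rfl⟩⟩ := r; exact ⟨_, rfl⟩⟩
  refine Finite.of_injective F fun r r' h => ?_
  have htriv : ∀ (r : (hs.pairing ε).range) (g : G), r.1 g = r.1 (g : G ⧸ H).out := by
    rintro ⟨_, ⟨n, rfl⟩⟩ g
    obtain ⟨h, hh⟩ := mk_out_eq_mul H g
    show hs.pairing ε n g = hs.pairing ε n (g : G ⧸ H).out
    rw [hh, map_mul, hs.pairing_of_mem_H ε n h.2, mul_one]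
  ext g
  have := congrArg sval (congrFun h (g : G ⧸ H))
  rw [htriv r, htriv r']
  exact congrArg uval this

lemma exists_pairing (hε : Injective ε) {M : Subgroup G} (hM : M ≤ N)
    (Γ : Subgroup G) (μ : M →* ℂˣ) (hμ : ∀ m : M, (∀ g ∈ Γ, g * m = m * g) → μ m = 1) :
    ∃ g ∈ Γ, ∀ m : M, μ m = hs.pairing ε (inclusion hM m) g := by
  classical
  have := hs.finite_range_pairing ε
  let r : (G →* ℂˣ) →* (Γ →* ℂˣ) :=
    { toFun := fun f => f.comp Γ.subtype, map_one' := rfl, map_mul' := fun _ _ => rfl }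
  let b : M →* Γ →* ℂˣ := r.comp ((hs.pairing ε).comp (inclusion hM))
  have : Finite b.range := by
    refine Finite.of_surjective (fun x : (hs.pairing ε).range => if h : r x.1 ∈ b.range then
      (⟨r x.1, h⟩ : b.range) else 1) ?_
    rintro ⟨_, ⟨m, rfl⟩⟩
    refine ⟨⟨hs.pairing ε (inclusion hM m), _, rfl⟩, ?_⟩
    exact dif_pos ⟨m, rfl⟩
  have : b.ker.FiniteIndex := inferInstance
  obtain ⟨g, hg⟩ := exists_eq_pairing b μ fun m hm => hμ m fun g hg =>
    (hs.pairing_eq_one_iff hε (inclusion hM m) g).1 (DFunLike.congr_fun hm ⟨g, hg⟩)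
  exact ⟨g, g.2, hg⟩

lemma isLocallyConstant_pairing (ε : C →* ℂˣ) (g : G) :
    IsLocallyConstant fun n : N => hs.pairing ε n g := by
  obtain ⟨U, hU, h1, hCU⟩ := hs.exists_isolated
  refine locConst_of_open ((hs.pairing ε).flip g)
    (P := ((hs.pairing ε).flip g).ker) (Subgroup.isOpen_of_mem_nhds _ (g := 1) ?_) fun _ h => h
  have h2 : Continuous fun n : N => (n : G) * g * (n : G)⁻¹ * g⁻¹ := by fun_prop
  refine Filter.mem_of_superset ((hU.preimage h2).mem_nhds (by simpa using h1)) fun n hn => ?_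
  have h3 := hCU _ (hs.comm_mem n n.2 g) hn
  show ε ⟨(n : G) * g * (n : G)⁻¹ * g⁻¹, _⟩ = 1
  exact (congrArg ε (sext h3)).trans (map_one ε)

lemma locConst_of_trivial (hε : Injective ε) {M : Subgroup G} (hM : M ≤ N) (μ : M →* ℂˣ)
    (hμ : ∀ m : M, (m : G) ∈ center G → μ m = 1) : IsLocallyConstant μ := by
  obtain ⟨g, -, hg⟩ := hs.exists_pairing hε hM ⊤ μ
    fun m hm => hμ m (mem_center_iff.2 fun g => hm g trivial)
  have h1 := (hs.isLocallyConstant_pairing ε g).comp_continuous (continuous_inclusion hM)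
  exact (funext hg : (μ : M → ℂˣ) = _) ▸ h1

lemma relIndex_inf_center_ne_zero (hε : Injective ε) : Z[N].relIndex N ≠ 0 := by
  have := hs.finite_range_pairing ε
  have h1 : (hs.pairing ε).ker.FiniteIndex := inferInstance
  have h2 : Z[N].subgroupOf N = (hs.pairing ε).ker := by
    ext n; rw [mem_subgroupOf, MonoidHom.mem_ker]
    constructor
    · intro h; ext g
      rw [(hs.pairing_eq_one_iff hε n g).2 (mem_center_iff.1 h.2 g)]; rfl
    · intro h; refine ⟨n.2, mem_center_iff.2 fun g => ?_⟩
      rw [← hs.pairing_eq_one_iff hε n g, h]; rfl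
  rw [Subgroup.relIndex, h2]
  exact h1.index_ne_zero

lemma relIndex_base_ne_zero (hε : Injective ε) : (N ⊓ H ⊓ center G).relIndex N ≠ 0 := by
  have h1 := hs.relIndex_inf_center_ne_zero hε
  have h2 : H.relIndex N ≠ 0 := by
    have := hs.finiteIndex_H
    exact (inferInstance : (H.subgroupOf N).FiniteIndex).index_ne_zero
  have : N ⊓ H ⊓ center G = Z[N] ⊓ H := by
    rw [inf_assoc, inf_assoc, inf_comm H]
  rw [this]
  exact Subgroup.relIndex_inf_ne_zero h1 h2

lemma comm_inf : ∀ a ∈ N ⊓ H, ∀ b ∈ N, a * b = b * a := fun _ ha _ hb => hs.comm_NH hb ha.2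

lemma inf_le_Z : N ⊓ H ≤ N ⊓ centralizer (N : Set G) := fun x hx =>
  ⟨hx.1, mem_centralizer_iff.2 fun n hn => (hs.comm_inf x hx n hn).symm⟩

omit hs in
lemma center_le_Z : Z[N] ≤ N ⊓ centralizer (N : Set G) :=
  inf_le_inf_left _ (Subgroup.center_le_centralizer _)

lemma center_eq_sup (hε : Injective ε) : N ⊓ centralizer (N : Set G) = (N ⊓ H) ⊔ Z[N] := by
  refine le_antisymm ?_ (sup_le hs.inf_le_Z center_le_Z)
  intro z hz
  by_contra hzn
  set Z := N ⊓ centralizer (N : Set G) with hZ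
  have hcomm : ∀ a b : Z, a * b = b * a := fun a b =>
    sext (mem_centralizer_iff.1 b.2.2 a a.2.1)
  set P := ((N ⊓ H) ⊔ Z[N]).subgroupOf Z with hP
  have hle : Z[N] ≤ (N ⊓ H) ⊔ Z[N] := le_sup_right
  have hfin : P.FiniteIndex := by
    refine ⟨fun h => hs.relIndex_inf_center_ne_zero hε ?_⟩
    have h1 : ((N ⊓ H) ⊔ Z[N]).relIndex N = 0 := relIndex_eq_zero_of_le_right inf_le_left h
    exact relIndex_eq_zero_of_le_left hle h1
  obtain ⟨ν, hν, hνz⟩ := exists_char_ne_one hcomm P (x := ⟨z, hz⟩) hzn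
  obtain ⟨g, -, hg⟩ := hs.exists_pairing hε (M := Z) inf_le_left ⊤ ν fun m hm =>
    hν m (hle ⟨m.2.1, mem_center_iff.2 fun g => hm g trivial⟩)
  have hgc : g ∈ N ⊔ H := by
    rw [← hs.centralizer_inf, mem_centralizer_iff]; intro x hx
    have hx' : x ∈ N ⊓ H := ⟨hx.2, hx.1⟩
    have := hν ⟨x, hs.inf_le_Z hx'⟩ (le_sup_left (b := Z[N]) hx')
    rw [hg] at this; exact ((hs.pairing_eq_one_iff hε _ _).1 this).symm
  apply hνz
  rw [hg, hs.pairing_eq_one_iff hε]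
  have hnn := hs.normal_N
  obtain ⟨n, hn, h, hh, rfl⟩ := mem_sup_of_normal_left.1 hgc
  show n * h * z = z * (n * h)
  have e1 := mem_centralizer_iff.1 hz.2 n hn
  have e2 := hs.comm_NH hz.1 hh
  rw [mul_assoc, e2, ← mul_assoc, e1, mul_assoc]

lemma sup_center_eq (hε : Injective ε) : H ⊔ (N ⊓ centralizer (N : Set G)) = H ⊔ Z[N] := by
  rw [hs.center_eq_sup hε, ← sup_assoc]
  congr 1
  exact sup_eq_left.2 inf_le_right

lemma relIndex_center_eq (hε : Injective ε) : (N ⊓ H ⊓ center G).relIndex Z[N] =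
      (N ⊓ H).relIndex (N ⊓ centralizer (N : Set G)) := by
  have hn : (N ⊓ H).Normal := hs.normal_of_C_le inf_le_left (le_inf hs.C_le_N hs.C_le_H)
  rw [hs.center_eq_sup hε, sup_comm, relIndex_sup_right, ← inf_relIndex_right (N ⊓ H)]
  congr 1
  ext x; simp only [mem_inf]; tauto

lemma relIndex_inf_eq (hε : Injective ε) : (N ⊓ H ⊓ center G).relIndex (N ⊓ H) =
      Z[N].relIndex (N ⊓ centralizer (N : Set G)) := by
  have hn : Z[N].Normal := by
    have := hs.normal_N; infer_instance
  rw [hs.center_eq_sup hε, relIndex_sup_right, ← inf_relIndex_right Z[N]]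
  congr 1
  ext x; simp only [mem_inf]; tauto

end PairData

end

variable {ρ : Repn G V}

section

lemma IsLagrangian.le (hL : IsLagrangian N L) : L ≤ N :=
  hL ▸ (inf_le_left : N ⊓ centralizer (L : Set G) ≤ N)

lemma IsLagrangian.comm (hL : IsLagrangian N L) {a b : G} (ha : a ∈ L)
    (hb : b ∈ L) : a * b = b * a := by
  have : b ∈ N ⊓ centralizer (L : Set G) := by rw [hL]; exact hb
  exact mem_centralizer_iff.1 this.2 a ha

lemma IsLagrangian.mem_of_comm (hL : IsLagrangian N L) {n : G} (hn : n ∈ N)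
    (h : ∀ l ∈ L, l * n = n * l) : n ∈ L := by
  rw [← hL]; exact ⟨hn, mem_centralizer_iff.2 h⟩

lemma IsLagrangian.Z_le (hL : IsLagrangian N L) : N ⊓ centralizer (N : Set G) ≤ L := fun _ hx =>
  hL.mem_of_comm hx.1 fun l hl => mem_centralizer_iff.1 hx.2 l (hL.le hl)

lemma IsLagrangian.center_le (hL : IsLagrangian N L) :
    Z[N] ≤ L := PairData.center_le_Z.trans hL.Z_le

namespace PairData

variable (hs : PairData C H N)
include hs

lemma le_lagrangian (hL : IsLagrangian N L) : N ⊓ H ≤ L := hs.inf_le_Z.trans hL.Z_le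

lemma C_le_lagrangian (hL : IsLagrangian N L) : C ≤ L :=
  (le_inf hs.C_le_N hs.C_le_H).trans (hs.le_lagrangian hL)

lemma lagrangian_normal (hL : IsLagrangian N L) : L.Normal :=
  hs.normal_of_C_le hL.le (hs.C_le_lagrangian hL)

lemma relIndex_H_ne_zero (K : Subgroup G) : H.relIndex K ≠ 0 := by
  have := hs.finiteIndex_H
  exact (inferInstance : (H.subgroupOf K).FiniteIndex).index_ne_zero

lemma exists_lagrangian : ∃ L, IsLagrangian N L := by
  let S : Set ℕ := {k | ∃ A : Subgroup G, N ⊓ H ≤ A ∧ A ≤ N ∧ A ≤ centralizer (A : Set G) ∧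
    A.relIndex N = k}
  have hS : S.Nonempty := ⟨_, N ⊓ H, le_rfl, inf_le_left, fun x hx =>
    mem_centralizer_iff.2 fun y hy => (hs.comm_inf x hx y hy.1).symm, rfl⟩
  obtain ⟨A, hHA, hAN, hAA, hk⟩ := Nat.sInf_mem hS
  refine ⟨A, le_antisymm ?_ (le_inf hAN hAA)⟩
  rintro x ⟨hxN, hxA⟩
  have hle : A ≤ A ⊔ zpowers x := le_sup_left
  have hA'N : A ⊔ zpowers x ≤ N := sup_le hAN (by simpa using hxN)
  have hx' : x ∈ centralizer ((A ⊔ zpowers x : Subgroup G) : Set G) := by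
    rw [← Subgroup.zpowers_le, Subgroup.le_centralizer_iff, sup_le_iff]; refine ⟨?_, ?_⟩
    · rw [Subgroup.le_centralizer_iff]; simpa using hxA
    · rw [Subgroup.zpowers_le]; rw [mem_centralizer_iff]; rintro _ ⟨k, rfl⟩
      exact (Commute.refl x).zpow_left k
  have hA'comm : A ⊔ zpowers x ≤ centralizer ((A ⊔ zpowers x : Subgroup G) : Set G) := by
    refine sup_le ?_ (by simpa using hx')
    rw [Subgroup.le_centralizer_iff]; exact sup_le hAA (by simpa using hxA)
  have h1 : sInf S ≤ (A ⊔ zpowers x).relIndex N :=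
    Nat.sInf_le ⟨_, hHA.trans hle, hA'N, hA'comm, rfl⟩
  have h2 := relIndex_mul_relIndex A _ N hle hA'N
  have h0 : A.relIndex N ≠ 0 := fun h => hs.relIndex_H_ne_zero N (by
    rw [← inf_relIndex_left]; exact relIndex_eq_zero_of_le_left hHA h)
  rw [← hk] at h1
  have h3 : A.relIndex (A ⊔ zpowers x) = 1 := by
    have hpos : 0 < (A ⊔ zpowers x).relIndex N :=
      Nat.pos_of_ne_zero fun h => h0 (by rw [← h2, h, mul_zero])
    have hpos' : A.relIndex (A ⊔ zpowers x) ≠ 0 := fun h => h0 (by rw [← h2, h, zero_mul])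
    by_contra hne
    have : 2 ≤ A.relIndex (A ⊔ zpowers x) := by omega
    nlinarith
  rw [Subgroup.relIndex_eq_one] at h3
  exact h3 ((le_sup_right : zpowers x ≤ _) (Subgroup.mem_zpowers x))

lemma relIndex_H_lagrangian (hL : IsLagrangian N L) :
    (N ⊓ H).relIndex L ≠ 0 := fun h => hs.relIndex_H_ne_zero N (by
  rw [← inf_relIndex_left]
  exact relIndex_eq_zero_of_le_right hL.le h)

lemma relIndex_Z_lagrangian (hL : IsLagrangian N L) :
    (N ⊓ centralizer (N : Set G)).relIndex L ≠ 0 := fun h =>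
  hs.relIndex_H_lagrangian hL (relIndex_eq_zero_of_le_left hs.inf_le_Z h)

lemma relIndex_lagrangian (hε : Injective ε) (hL : IsLagrangian N L) :
    L.relIndex N = (N ⊓ centralizer (N : Set G)).relIndex L := by
  set Z := N ⊓ centralizer (N : Set G) with hZ
  have hcomm : ∀ a b : L, a * b = b * a := fun a b => sext (hL.comm a.2 b.2)
  have hfin : (Z.subgroupOf L).FiniteIndex := ⟨hs.relIndex_Z_lagrangian hL⟩
  let f : N →* (L →* ℂˣ) :=
    { toFun := fun n =>
        { toFun := fun l => hs.pairing ε (inclusion hL.le l) n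
          map_one' := by simp
          map_mul' := fun a b => by simp }
      map_one' := by ext l; simp
      map_mul' := fun a b => by ext l; simp }
  have hfa : ∀ n l, f n l = hs.pairing ε (inclusion hL.le l) n := fun _ _ => rfl
  have hker : f.ker = L.subgroupOf N := by
    ext n; rw [MonoidHom.mem_ker, mem_subgroupOf]
    constructor
    · intro h; refine hL.mem_of_comm n.2 fun l hl => ?_
      have := DFunLike.congr_fun h ⟨l, hl⟩
      rw [hfa, MonoidHom.one_apply, hs.pairing_eq_one_iff hε] at this; exact this.symm
    · intro h; ext l
      rw [hfa, (hs.pairing_eq_one_iff hε _ _).2 (hL.comm h l.2)]; rfl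
  have hrange : ∀ ν : L →* ℂˣ, ν ∈ f.range ↔ ∀ p ∈ Z.subgroupOf L, ν p = 1 := by
    intro ν; constructor
    · rintro ⟨n, rfl⟩ p hp
      rw [hfa, hs.pairing_eq_one_iff hε]; exact mem_centralizer_iff.1 hp.2 n n.2
    · intro h
      obtain ⟨g, hg, hgν⟩ := hs.exists_pairing hε hL.le N ν fun m hm =>
        h m ⟨hL.le m.2, mem_centralizer_iff.2 hm⟩
      exact ⟨⟨g, hg⟩, mext fun l => (hgν l).symm⟩
  rw [Subgroup.relIndex, ← hker, Subgroup.index_ker, Subgroup.relIndex,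
    ← (finite_card_chars hcomm (Z.subgroupOf L)).2]
  exact Nat.card_congr (Equiv.subtypeEquivRight hrange)

omit hs in
lemma index_center_eq (N : Subgroup G) : (center N).index =
    (N ⊓ centralizer (N : Set G)).relIndex N := by
  rw [Subgroup.relIndex]
  congr 1
  ext n
  rw [mem_center_iff, mem_subgroupOf]
  constructor
  · intro h; exact ⟨n.2, mem_centralizer_iff.2 fun m hm => congrArg sval (h ⟨m, hm⟩)⟩
  · intro h m; exact sext (mem_centralizer_iff.1 h.2 m m.2)

lemma relIndex_Z_lagrangian_eq (hε : Injective ε) (hL : IsLagrangian N L) {d : ℕ}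
    (hd : (center N).index = d ^ 2) : (N ⊓ centralizer (N : Set G)).relIndex L = d := by
  have h1 := relIndex_mul_relIndex _ _ _ hL.Z_le hL.le
  rw [← index_center_eq, hd, hs.relIndex_lagrangian hε hL, ← sq] at h1
  exact Nat.pow_left_injective (two_ne_zero) h1

lemma exists_extension_char (hL : IsLagrangian N L) (ψ : SmoothChar ↥(N ⊓ H)) (χ : SmoothChar Z[N])
    (h : ψ.Consistent χ) : ∃ D : LagrangianDatum H N ψ χ, D.L = L := by
  have hcomm : ∀ a b : L, a * b = b * a := fun a b => sext (hL.comm a.2 b.2)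
  have hHL := hs.le_lagrangian hL
  obtain ⟨ν, hν1, hν2⟩ := exists_common_extension hcomm ((N ⊓ H).subgroupOf L) (Z[N].subgroupOf L)
    (ψ.1.comp ((L.subtype.comp (Subgroup.subtype _)).codRestrict _ fun x => x.2))
    (χ.1.comp ((L.subtype.comp (Subgroup.subtype _)).codRestrict _ fun x => x.2))
    (fun x hP hQ => uext (h x.1 hP hQ))
  have hsm : IsLocallyConstant ν := locConst_of_restrict hs.isOpen_H hHL
    (fun x hx => ⟨hL.le hx.1, hx.2⟩) ψ ν fun m => hν1 ⟨⟨m, hHL m.2⟩, m.2⟩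
  exact ⟨⟨L, hL, ⟨ν, hsm⟩, fun x hx hx' => congrArg uval (hν2 ⟨⟨x, hx⟩, hx'⟩),
    fun x hx hx' => congrArg uval (hν1 ⟨⟨x, hx⟩, hx'⟩)⟩, rfl⟩

omit hs in
lemma finite_consistentChars (B B' : Subgroup G)
    (hB : ∀ a ∈ B, ∀ b ∈ B, a * b = b * a) (ψ : SmoothChar B')
    (hopen : ∀ ν : B →* ℂˣ, (∀ p ∈ B'.subgroupOf B, ν p = 1) → IsLocallyConstant ν)
    (hfin : B'.relIndex B ≠ 0) (χ₀ : SmoothChar B) (h₀ : χ₀.Consistent ψ) :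
    Finite (ConsistentChars B ψ) ∧ Nat.card (ConsistentChars B ψ) = B'.relIndex B := by
  have hcomm : ∀ a b : B, a * b = b * a := fun a b => sext (hB _ a.2 _ b.2)
  have : (B'.subgroupOf B).FiniteIndex := ⟨hfin⟩
  let e : {ν : B →* ℂˣ // ∀ p ∈ B'.subgroupOf B, ν p = 1} ≃ ConsistentChars B ψ :=
    { toFun := fun ν => ⟨χ₀ * ⟨ν.1, hopen ν.1 ν.2⟩, fun x hx hx' => by
        rw [← h₀ x hx hx']; show ((χ₀.1 ⟨x, hx⟩ * ν.1 ⟨x, hx⟩ : ℂˣ) : ℂ) = χ₀.1 ⟨x, hx⟩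
        rw [ν.2 ⟨x, hx⟩ hx', mul_one]⟩
      invFun := fun χ => ⟨(χ₀⁻¹ * χ.1).1, fun p hp => by
        show (χ₀.1 p)⁻¹ * χ.1.1 p = 1
        rw [inv_mul_eq_one]; exact uext ((h₀ p p.2 hp).trans (χ.2 p p.2 hp).symm)⟩
      left_inv := fun ν => sext (inv_mul_cancel_left χ₀.1 ν.1)
      right_inv := fun χ => sext (mul_inv_cancel_left χ₀ χ.1) }
  obtain ⟨h1, h2⟩ := finite_card_chars hcomm (B'.subgroupOf B)
  exact ⟨Finite.of_equiv _ e, by rw [← Nat.card_congr e, h2]; rfl⟩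

end PairData

end

/-! ### Roots of locally unipotent operators -/

section

/-- An operator `x` is locally unipotent if every vector is killed by a power of `x - 1`. -/
def IsLocUnip (x : Endℂ V) : Prop := ∀ v, ∃ m : ℕ, ((x - 1) ^ m) v = 0

lemma pow_apply_eq_zero_of_le {t : Endℂ V} {v : V} {m n : ℕ} (h : (t ^ m) v = 0)
    (hmn : m ≤ n) : (t ^ n) v = 0 := by
  rw [← Nat.sub_add_cancel hmn, pow_add, mul_apply, h, map_zero]

open Polynomial in
lemma aeval_apply_eq_of_coeff {t : Endℂ V} {v : V} {m : ℕ} (h : (t ^ m) v = 0)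
    {P Q : ℂ[X]} (hPQ : ∀ j < m, P.coeff j = Q.coeff j) : aeval t P v = aeval t Q v := by
  obtain ⟨R, hR⟩ : (X : ℂ[X]) ^ m ∣ P - Q :=
    X_pow_dvd_iff.2 fun j hj => by rw [coeff_sub, hPQ j hj, sub_self]
  rw [← sub_eq_zero, ← lsub_apply, ← map_sub, hR, mul_comm, map_mul, mul_apply,
    map_pow, aeval_X, h, map_zero]

lemma aeval_trunc_eq {t : Endℂ V} {v : V} {m m' : ℕ} (h : (t ^ m) v = 0) (hm : m ≤ m')
    (p : PowerSeries ℂ) : aeval t (p.trunc m) v = aeval t (p.trunc m') v :=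
  aeval_apply_eq_of_coeff h fun j hj => by
    rw [coeff_trunc, coeff_trunc, if_pos hj, if_pos (hj.trans_le hm)]

/-- Evaluation of a power series at a locally nilpotent operator `x - 1`. -/
def psEval (x : Endℂ V) (hx : IsLocUnip x) (p : PowerSeries ℂ) : Endℂ V where
  toFun v := aeval (x - 1) (p.trunc (hx v).choose) v
  map_add' v w := by
    set m := max (max (hx v).choose (hx w).choose) (hx (v + w)).choose
    have key := fun z (hz : _ ≤ m) => aeval_trunc_eq (hx z).choose_spec hz p
    rw [key v (by omega), key w (by omega), key (v + w) (by omega), map_add]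
  map_smul' c v := by
    set m := max (hx v).choose (hx (c • v)).choose
    have key := fun z (hz : _ ≤ m) => aeval_trunc_eq (hx z).choose_spec hz p
    rw [key v (by omega), key (c • v) (by omega), map_smul, RingHom.id_apply]

variable {x : Endℂ V} (hx : IsLocUnip x)
include hx

lemma psEval_apply (p : PowerSeries ℂ) {v : V} {m : ℕ} (hm : ((x - 1) ^ m) v = 0) :
    psEval x hx p v = aeval (x - 1) (p.trunc m) v := by
  exact (aeval_trunc_eq (hx v).choose_spec (le_max_right m _) p).trans
    (aeval_trunc_eq hm (le_max_left _ _) p).symm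

lemma psEval_mul (p q : PowerSeries ℂ) : psEval x hx (p * q) = psEval x hx p * psEval x hx q := by
  ext v
  obtain ⟨m, hm⟩ := hx v
  have hm' : ((x - 1) ^ m) (psEval x hx q v) = 0 := by
    rw [psEval_apply hx q hm, ← mul_apply]
    have : Commute ((x - 1) ^ m) (aeval (x - 1) (q.trunc m)) := by
      nth_rw 1 [← Polynomial.aeval_X (R := ℂ) (x - 1)]
      rw [← map_pow]; exact (Commute.all _ _).map (aeval (x - 1))
    rw [this.eq, mul_apply, hm, map_zero]
  rw [mul_apply, psEval_apply hx p hm', psEval_apply hx q hm, psEval_apply hx _ hm,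
    ← mul_apply, ← map_mul]
  refine aeval_apply_eq_of_coeff hm fun j hj => ?_
  rw [coeff_trunc, if_pos hj, PowerSeries.coeff_mul, Polynomial.coeff_mul]
  refine sum_congr rfl fun ij hij => ?_
  have := Finset.HasAntidiagonal.mem_antidiagonal.1 hij
  rw [coeff_trunc, coeff_trunc, if_pos (by omega), if_pos (by omega)]

lemma psEval_add (p q : PowerSeries ℂ) : psEval x hx (p + q) = psEval x hx p + psEval x hx q := by
  ext v
  obtain ⟨m, hm⟩ := hx v
  rw [ladd_apply, psEval_apply hx p hm, psEval_apply hx q hm, psEval_apply hx _ hm,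
    ← ladd_apply, ← map_add, map_add]

lemma psEval_one : psEval x hx 1 = 1 := by
  ext v
  obtain ⟨m, hm⟩ := hx v
  rw [psEval_apply hx 1 hm, aeval_apply_eq_of_coeff hm (Q := 1) fun j hj => ?_, map_one]
  rw [coeff_trunc, if_pos hj, PowerSeries.coeff_one, Polynomial.coeff_one]

lemma psEval_X : psEval x hx PowerSeries.X = x - 1 := by
  ext v
  obtain ⟨m, hm⟩ := hx v
  rw [psEval_apply hx _ hm, aeval_apply_eq_of_coeff hm (Q := Polynomial.X) fun j hj => ?_,
    Polynomial.aeval_X]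
  rw [coeff_trunc, if_pos hj, PowerSeries.coeff_X, Polynomial.coeff_X]
  simp [eq_comm]

lemma psEval_pow (p : PowerSeries ℂ) (k : ℕ) : psEval x hx (p ^ k) = psEval x hx p ^ k := by
  induction k with
  | zero => rw [pow_zero, pow_zero, psEval_one]
  | succ k ih => rw [pow_succ, pow_succ, psEval_mul, ih]

lemma psEval_natural {x' : Endℂ V'} (hx' : IsLocUnip x') (f : V →ₗ[ℂ] V')
    (hf : ∀ v, f (x v) = x' (f v)) (p : PowerSeries ℂ) (v : V) :
    f (psEval x hx p v) = psEval x' hx' p (f v) := by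
  have hpow : ∀ (m : ℕ) (w : V), f (((x - 1) ^ m) w) = ((x' - 1) ^ m) (f w) := by
    intro m
    induction m with
    | zero => intro w; rfl
    | succ m ih =>
      intro w; rw [pow_succ, pow_succ, mul_apply, mul_apply, ih]
      congr 1; simp [hf]
  obtain ⟨m, hm⟩ := hx v
  have hm' : ((x' - 1) ^ m) (f v) = 0 := by rw [← hpow, hm, map_zero]
  rw [psEval_apply hx p hm, psEval_apply hx' p hm', Polynomial.aeval_endomorphism,
    Polynomial.aeval_endomorphism, Polynomial.sum, Polynomial.sum, map_sum]
  exact sum_congr rfl fun j _ => by rw [map_smul, hpow]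

lemma psEval_sub_one {p : PowerSeries ℂ} (hp : PowerSeries.constantCoeff p = 1) :
    ∃ s : Endℂ V, Commute (x - 1) s ∧ psEval x hx p - 1 = (x - 1) * s := by
  obtain ⟨q, hq⟩ : PowerSeries.X ∣ p - 1 := by
    rw [PowerSeries.X_dvd_iff, map_sub, hp, map_one, sub_self]
  refine ⟨psEval x hx q, ?_, ?_⟩
  · rw [← psEval_X hx, Commute, SemiconjBy, ← psEval_mul, ← psEval_mul, mul_comm]
  · rw [sub_eq_iff_eq_add] at hq
    rw [hq, psEval_add, psEval_mul, psEval_X, psEval_one, add_sub_cancel_right]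

lemma psEval_sub_one_pow {p : PowerSeries ℂ} (hp : PowerSeries.constantCoeff p = 1) {v : V}
    {m : ℕ} (hm : ((x - 1) ^ m) v = 0) : ((psEval x hx p - 1) ^ m) v = 0 := by
  obtain ⟨s, hs, h⟩ := psEval_sub_one hx hp
  rw [h, hs.mul_pow, (hs.pow_pow m m).eq, mul_apply, hm, map_zero]

lemma psEval_isLocUnip {p : PowerSeries ℂ} (hp : PowerSeries.constantCoeff p = 1) :
    IsLocUnip (psEval x hx p) := fun v =>
  let ⟨m, hm⟩ := hx v
  ⟨m, psEval_sub_one_pow hx hp hm⟩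

omit hx in
lemma binomialSeries_pow (r : ℚ) (k : ℕ) :
    PowerSeries.binomialSeries ℂ r ^ k = PowerSeries.binomialSeries ℂ (k * r) := by
  induction k with
  | zero => simp
  | succ k ih => rw [pow_succ, ih, ← PowerSeries.binomialSeries_add]; congr 1; push_cast; ring

lemma IsLocUnip.eq_one_of_pow {k : ℕ} (hk : k ≠ 0) (h : x ^ k = 1) : x = 1 := by
  open Polynomial in
  have hg : ¬ (X - C (1 : ℂ)) ∣ ∑ i ∈ Finset.range k, (X : ℂ[X]) ^ i := by
    rw [dvd_iff_isRoot, IsRoot.def, eval_finsetSum]; simpa using hk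
  have hcop := ((irreducible_X_sub_C (1 : ℂ)).coprime_iff_not_dvd.2 hg)
  ext v
  obtain ⟨m, hm⟩ := hx v
  obtain ⟨a, b, hab⟩ := hcop.pow_left (m := m)
  have h1 : aeval x (∑ i ∈ Finset.range k, (X : ℂ[X]) ^ i) ((x - 1) v) = 0 := by
    have : (∑ i ∈ Finset.range k, (X : ℂ[X]) ^ i) * (X - 1) = X ^ k - 1 := geom_sum_mul _ _
    have h2 := congrArg (fun P => aeval x P v) this
    simpa [h] using h2
  have h2 : aeval x ((X - C (1 : ℂ)) ^ m) ((x - 1) v) = 0 := by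
    have : aeval x (X - C (1 : ℂ)) = x - 1 := by simp
    rw [map_pow, this, ← mul_apply, ← pow_succ, pow_succ', mul_apply, hm, map_zero]
  have h3 := congrArg (fun P => aeval x P ((x - 1) v)) hab
  simp only [map_one C] at h2
  simp only [map_add, map_mul, ladd_apply, mul_apply, h1, h2, map_zero, add_zero,
    map_one, one_apply] at h3
  exact sub_eq_zero.1 h3.symm

omit hx in
lemma IsLocUnip.mul_of_commute {a b : Endℂ V} (ha : IsLocUnip a)
    (hb : IsLocUnip b) (hab : Commute a b) : IsLocUnip (a * b) := by
  intro v
  obtain ⟨m, hm⟩ := ha v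
  obtain ⟨n, hn⟩ := hb v
  refine ⟨m + n, ?_⟩
  have hc : Commute ((a - 1) * b) (b - 1) :=
    Commute.mul_left (((hab.sub_right (Commute.one_right _)).sub_left (Commute.one_left _)))
      ((Commute.refl b).sub_right (Commute.one_right _))
  have : a * b - 1 = (a - 1) * b + (b - 1) := by noncomm_ring
  rw [this, hc.add_pow, LinearMap.sum_apply]
  refine sum_eq_zero fun i hi => ?_
  rw [mul_apply]
  have key : (((a - 1) * b) ^ i * (b - 1) ^ (m + n - i)) v = 0 := by
    by_cases him : m ≤ i
    · have hc2 : Commute (a - 1) b := hab.sub_left (Commute.one_left _)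
      rw [hc2.mul_pow, mul_assoc, ((hc2.pow_pow i i).mul_right ((Commute.pow_pow
        ((hab.sub_right (Commute.one_right _)).sub_left (Commute.one_left _)) i _))).eq,
        mul_apply, pow_apply_eq_zero_of_le hm him, map_zero]
    · rw [mul_apply, pow_apply_eq_zero_of_le hn (by omega), map_zero]
  rw [Module.End.natCast_apply, map_nsmul, key, smul_zero]

/-- The unique locally unipotent `k`-th root of a locally unipotent operator. -/
def unipRoot (k : ℕ) (x : Endℂ V) (hx : IsLocUnip x) : Endℂ V :=
  psEval x hx (PowerSeries.binomialSeries ℂ ((k : ℚ)⁻¹))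

lemma unipRoot_pow {k : ℕ} (hk : k ≠ 0) : unipRoot k x hx ^ k = x := by
  rw [unipRoot, ← psEval_pow, binomialSeries_pow, mul_inv_cancel₀ (by exact_mod_cast hk)]
  have : PowerSeries.binomialSeries ℂ (1 : ℚ) = 1 + PowerSeries.X := by
    simpa using PowerSeries.binomialSeries_nat (R := ℚ) (A := ℂ) 1
  rw [this, psEval_add, psEval_one, psEval_X, add_sub_cancel]

lemma eq_unipRoot {k : ℕ} (hk : k ≠ 0) {y : Endℂ V} (hy : IsLocUnip y)
    (hyx : y ^ k = x) : y = unipRoot k x hx := by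
  have hk' : (k : ℚ) ≠ 0 := by exact_mod_cast hk
  set r' := psEval x hx (PowerSeries.binomialSeries ℂ (-(k : ℚ)⁻¹)) with hr'
  have h1 : r' * unipRoot k x hx = 1 := by
    rw [hr', unipRoot, ← psEval_mul, ← PowerSeries.binomialSeries_add, neg_add_cancel,
      PowerSeries.binomialSeries_zero, psEval_one]
  have hr'k : r' ^ k * x = 1 := by
    conv_lhs => rw [← unipRoot_pow hx hk]
    have : Commute r' (unipRoot k x hx) := by
      rw [hr', unipRoot, Commute, SemiconjBy, ← psEval_mul, ← psEval_mul, mul_comm]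
    rw [← this.mul_pow, h1, one_pow]
  have hcomm : Commute y r' := by
    ext v; rw [mul_apply, mul_apply]
    refine psEval_natural hx hx y (fun v => ?_) _ v
    rw [← hyx, ← mul_apply, ← mul_apply, ← pow_succ, pow_succ']
  have hw : y * r' = 1 := by
    refine IsLocUnip.eq_one_of_pow (hy.mul_of_commute (psEval_isLocUnip hx ?_) hcomm) hk ?_
    · simp
    · rw [hcomm.mul_pow, hyx, ← hr'k, ← hyx, (hcomm.pow_pow k k).eq]
  calc y = y * (r' * unipRoot k x hx) := by rw [h1, mul_one]
    _ = unipRoot k x hx := by rw [← mul_assoc, hw, one_mul]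

lemma unipRoot_isLocUnip (k : ℕ) : IsLocUnip (unipRoot k x hx) :=
  psEval_isLocUnip hx (by simp)

lemma unipRoot_sub_one_pow (k : ℕ) {v : V} {m : ℕ} (hm : ((x - 1) ^ m) v = 0) :
    ((unipRoot k x hx - 1) ^ m) v = 0 := psEval_sub_one_pow hx (by simp) hm

lemma unipRoot_natural (k : ℕ) {x' : Endℂ V'} (hx' : IsLocUnip x')
    (f : V →ₗ[ℂ] V') (hf : ∀ v, f (x v) = x' (f v)) (v : V) :
    f (unipRoot k x hx v) = unipRoot k x' hx' (f v) := psEval_natural hx hx' f hf _ v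

omit hx in
lemma comp_sub_one_pow_eq_zero {k : ℕ} (hk : k ≠ 0) (hx : IsLocUnip x)
    (hxk : IsLocUnip (x ^ k)) {m : ℕ} (ξ : V →ₗ[ℂ] V')
    (h : ∀ v, ξ (((x ^ k - 1) ^ m) v) = 0) (v : V) : ξ (((x - 1) ^ m) v) = 0 := by
  obtain ⟨s, hs, hs'⟩ := psEval_sub_one hxk (p := PowerSeries.binomialSeries ℂ ((k : ℚ)⁻¹)) (by simp)
  have : x - 1 = (x ^ k - 1) * s := by
    rw [← hs']; exact congrArg (· - 1) (eq_unipRoot hxk hk hx rfl)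
  rw [this, hs.mul_pow, mul_apply, h]

omit hx in
lemma IsLocUnip.pow (hx : IsLocUnip x) (k : ℕ) : IsLocUnip (x ^ k) := by
  induction k with
  | zero => intro v; exact ⟨1, by simp⟩
  | succ k ih => rw [pow_succ]; exact ih.mul_of_commute hx (Commute.refl x |>.pow_left k)

end

/-! ### The unipotent action of `N` -/


/-- The base subgroup `N ∩ H ∩ Z(G)`. -/
abbrev base (H N : Subgroup G) : Subgroup G := N ⊓ H ⊓ center G

/-- An action of a group through operators whose difference with the scalars `φ` is locally
nilpotent, uniformly in the group. -/
def IsUnipOver {B : Type*} [Group B] (φ : B →* ℂˣ) (s : B →* Endℂ V) : Prop :=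
  ∀ v, ∃ m : ℕ, ∀ b, ((s b - (φ b : ℂ) • (1 : Endℂ V)) ^ m) v = 0

section

lemma inv_smul_sub_one_pow (c : ℂˣ) (x : Endℂ V) (m : ℕ) :
    (((c⁻¹ : ℂˣ) : ℂ) • x - 1) ^ m = ((c⁻¹ : ℂˣ) : ℂ) ^ m • (x - (c : ℂ) • (1 : Endℂ V)) ^ m := by
  rw [← smul_pow]
  congr 1
  rw [smul_sub, smul_smul, ← Units.val_mul, inv_mul_cancel, val_one, one_smul]

lemma inv_smul_mul_inv_smul (a b c : ℂˣ) (x y : Endℂ V) :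
    ((a⁻¹ : ℂˣ) : ℂ) • x * ((b⁻¹ : ℂˣ) : ℂ) • y =
      (((a * b * c)⁻¹ : ℂˣ) : ℂ) • (x * y * (c : ℂ) • (1 : Endℂ V)) := by
  rw [smul_mul_assoc, mul_smul_comm, mul_smul_comm, mul_one, smul_smul, smul_smul,
    ← Units.val_mul, ← Units.val_mul]
  congr 2
  rw [mul_inv, inv_mul_cancel_right, mul_inv]

lemma inv_smul_sub_one_pow_apply (c : ℂˣ) (x : Endℂ V) (m : ℕ) (v : V) :
    ((((c⁻¹ : ℂˣ) : ℂ) • x - 1) ^ m) v = 0 ↔ ((x - (c : ℂ) • (1 : Endℂ V)) ^ m) v = 0 := by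
  rw [inv_smul_sub_one_pow, lsmul_apply, smul_eq_zero]
  exact or_iff_right (pow_ne_zero _ (Units.ne_zero _))

variable {B : Type*} [Group B] {φ : B →* ℂˣ} {s : B →* Endℂ V}

lemma IsUnipOver.isLocUnip (h : IsUnipOver φ s) (b : B) :
    IsLocUnip (((φ b)⁻¹ : ℂˣ).val • s b) := fun v =>
  let ⟨m, hm⟩ := h v
  ⟨m, (inv_smul_sub_one_pow_apply _ _ _ _).2 (hm b)⟩

lemma IsUnipOver.eq_of_pow (h : IsUnipOver φ s) {b : B} {k : ℕ} (hk : k ≠ 0) (hb : b ^ k = 1) :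
    s b = (φ b : ℂ) • (1 : Endℂ V) := by
  have h1 : ((φ b)⁻¹ : ℂˣ).val • s b = 1 := by
    refine (h.isLocUnip b).eq_one_of_pow hk ?_
    rw [smul_pow, ← map_pow, hb, map_one, ← Units.val_pow_eq_pow_val, inv_pow, ← map_pow, hb,
      map_one, inv_one, val_one, one_smul]
  rw [← h1, smul_smul, ← Units.val_mul, mul_inv_cancel, val_one, one_smul]

end

namespace PairData

variable (hs : PairData C H N)
include hs

lemma C_le_base : C ≤ base H N := le_inf (le_inf hs.C_le_N hs.C_le_H) hs.C_le_center

lemma base_normal : (base H N).Normal :=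
  hs.normal_of_C_le (inf_le_left.trans inf_le_left) hs.C_le_base

lemma pow_mem_base {n : G} (hn : n ∈ N) : n ^ (base H N).relIndex N ∈ base H N := by
  have := hs.base_normal
  have : ((base H N).subgroupOf N).Normal := inferInstance
  exact Subgroup.pow_index_mem ((base H N).subgroupOf N) (⟨n, hn⟩ : N)

/-- The power map from `N` to the base group. -/
def basePow (n : N) : base H N := ⟨(n : G) ^ (base H N).relIndex N, hs.pow_mem_base n.2⟩

lemma basePow_mul (n n' : N) : ∃ (c : G) (hc : c ∈ C), hs.basePow (n * n') =
    hs.basePow n * hs.basePow n' * ⟨c, hs.C_le_base hc⟩ := by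
  have hCn : C.Normal := ⟨fun c hc g => by
    rw [hs.comm_C hc g, mul_inv_cancel_right]; exact hc⟩
  set k := (base H N).relIndex N
  have hcomm : Commute (n.1 : G ⧸ C) (n'.1 : G ⧸ C) := by
    rw [Commute, SemiconjBy, ← mk_mul, ← mk_mul, QuotientGroup.eq]
    have := hs.comm_mem _ (inv_mem n'.2) (n : G)⁻¹
    convert this using 1
    group
  have h1 : (((n.1 ^ k * n'.1 ^ k : G)) : G ⧸ C) = ((n.1 * n'.1) ^ k : G) := by
    rw [mk_mul, mk_pow, mk_pow, mk_pow, mk_mul, hcomm.mul_pow]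
  refine ⟨_, QuotientGroup.eq.1 h1, ?_⟩
  ext
  exact (mul_inv_cancel_left _ _).symm

section

variable {φ : base H N →* ℂˣ} {s : base H N →* Endℂ V} (hk : (base H N).relIndex N ≠ 0)

lemma apply_C (h : IsUnipOver φ s) {c : G} (hc : c ∈ C) :
    s ⟨c, hs.C_le_base hc⟩ = (φ ⟨c, hs.C_le_base hc⟩ : ℂ) • (1 : Endℂ V) := by
  have := hs.finite_C
  have h1 := pow_card_eq_one' (x := (⟨c, hc⟩ : C))
  refine h.eq_of_pow (k := Nat.card C) Nat.card_pos.ne' ?_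
  exact sext (congrArg sval h1 : (⟨c, hc⟩ ^ Nat.card C : C).1 = 1)

omit hs in
lemma base_comm (s : base H N →* Endℂ V) (b b' : base H N) : Commute (s b) (s b') := by
  have : b * b' = b' * b := sext (mem_center_iff.1 b'.2.2 b)
  rw [Commute, SemiconjBy, ← map_mul, this, map_mul]

/-- The unique locally unipotent action of `N` that extends the unipotent part of the action of
the base group. -/
def unipAct (h : IsUnipOver φ s) : N →* Endℂ V where
  toFun n := unipRoot ((base H N).relIndex N) _ (h.isLocUnip (hs.basePow n))
  map_one' := by
    refine (eq_unipRoot _ hk (fun v => ⟨1, by simp⟩) ?_).symm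
    have : hs.basePow 1 = 1 := by ext; simp [basePow]
    rw [one_pow, this, map_one, map_one, inv_one, val_one, one_smul]
  map_mul' n n' := by
    have hc : ∀ b b', Commute (((φ b)⁻¹ : ℂˣ).val • s b) (((φ b')⁻¹ : ℂˣ).val • s b') := fun b b' =>
      ((base_comm s b b').smul_left _).smul_right _
    have hc' : Commute (unipRoot ((base H N).relIndex N) _ (h.isLocUnip (hs.basePow n)))
        (unipRoot ((base H N).relIndex N) _ (h.isLocUnip (hs.basePow n'))) := by
      ext v; rw [mul_apply, mul_apply]
      refine unipRoot_natural _ _ (h.isLocUnip (hs.basePow n')) _ (fun w => ?_) v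
      rw [← mul_apply, ← mul_apply]; refine LinearMap.congr_fun (lext fun w => ?_) w
      rw [mul_apply, mul_apply]; refine (unipRoot_natural (h.isLocUnip (hs.basePow n)) _
        (h.isLocUnip (hs.basePow n)) _ (fun w => ?_) w).symm
      exact LinearMap.congr_fun (hc (hs.basePow n') (hs.basePow n)).eq w
    refine (eq_unipRoot _ hk ((unipRoot_isLocUnip _ _).mul_of_commute
      (unipRoot_isLocUnip _ _) hc') ?_).symm
    rw [hc'.mul_pow, unipRoot_pow _ hk, unipRoot_pow _ hk]
    obtain ⟨c, hcC, hmul⟩ := hs.basePow_mul n n'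
    have hcu := hs.apply_C h hcC; rw [hmul, map_mul s, map_mul s, map_mul φ, map_mul φ, hcu]
    exact inv_smul_mul_inv_smul _ _ _ _ _

variable (h : IsUnipOver φ s)

lemma unipAct_natural {s' : base H N →* Endℂ V'} (h' : IsUnipOver φ s')
    (f : V →ₗ[ℂ] V') (hf : ∀ b v, f (s b v) = s' b (f v)) (n : N) (v : V) :
    f (hs.unipAct hk h n v) = hs.unipAct hk h' n (f v) :=
  unipRoot_natural _ _ _ f (fun v => by
    rw [lsmul_apply, lsmul_apply, map_smul, hf]) v

lemma unipAct_isLocUnip (n : N) : IsLocUnip (hs.unipAct hk h n) :=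
  unipRoot_isLocUnip _ _

lemma unipAct_sub_one_pow {v : V} {m : ℕ} (hm : ∀ b, ((s b - (φ b : ℂ) • (1 : Endℂ V)) ^ m) v = 0)
    (n : N) : ((hs.unipAct hk h n - 1) ^ m) v = 0 :=
  unipRoot_sub_one_pow _ _ ((inv_smul_sub_one_pow_apply _ _ _ _).2 (hm _))

lemma unipAct_comm (n n' : N) (v : V) :
    hs.unipAct hk h n (hs.unipAct hk h n' v) = hs.unipAct hk h n' (hs.unipAct hk h n v) := by
  refine hs.unipAct_natural hk h h _ (fun b v => ?_) n' v |>.symm ▸ rfl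
  refine (hs.unipAct_natural hk h h (s b) (fun b' v => ?_) n v).symm
  exact LinearMap.congr_fun (base_comm s b b').eq v

lemma eq_smul_unipAct {M : Subgroup G} (hM : M ≤ N) (hBM : base H N ≤ M) (r : M →* Endℂ V)
    (α : M →* ℂˣ) (hr : ∀ b, r (inclusion hBM b) = s b) (hα : ∀ b, α (inclusion hBM b) = φ b)
    (hu : IsUnipOver α r) (m : M) : r m = (α m : ℂ) • hs.unipAct hk h (inclusion hM m) := by
  have h1 : ((α m)⁻¹ : ℂˣ).val • r m = hs.unipAct hk h (inclusion hM m) := by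
    refine eq_unipRoot _ hk (hu.isLocUnip m) ?_
    have h2 : inclusion hBM (hs.basePow (inclusion hM m)) = m ^ (base H N).relIndex N := sext rfl
    rw [smul_pow, ← map_pow, ← h2, hr, ← hα, h2, map_pow, ← inv_pow, Units.val_pow_eq_pow_val]
  rw [← h1, smul_smul, ← Units.val_mul, mul_inv_cancel, val_one, one_smul]

end

end PairData

lemma rep_mul (ρ : Repn K V) (a b : K) (v : V) : ρ (a * b) v = ρ a (ρ b v) := by
  rw [map_mul, mul_apply]

/-- A special pair together with a faithful character of `C`, given as a character of the base
group. -/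
structure CharData (C H N : Subgroup G)
    (φ : base H N →* ℂˣ) : Prop where
  data : PairData C H N
  injective : ∀ (c : G) (h : c ∈ C), φ ⟨c, data.C_le_base h⟩ = 1 → c = 1

namespace CharData

variable {φ : base H N →* ℂˣ} (hc : CharData C H N φ)

/-- The faithful character of `C`. -/
def genuineChar : C →* ℂˣ := φ.comp (inclusion hc.1.C_le_base)

lemma genuine_inj : Injective hc.genuineChar :=
  (injective_iff_map_eq_one _).2 fun c h => sext (hc.injective c c.2 h)

include hc in
lemma relIndex_ne_zero : (base H N).relIndex N ≠ 0 :=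
  hc.1.relIndex_base_ne_zero hc.genuine_inj

/-- The commutator pairing. -/
def pair : N →* G →* ℂˣ := hc.1.pairing hc.genuineChar

/-- The commutator pairing with `g ∈ G`, as a character of a subgroup of `N`. -/
def pairChar (hL : L ≤ N) : G →* L →* ℂˣ := (hc.pair.comp (inclusion hL)).flip

lemma pairChar_apply (hL : L ≤ N) (g : G) (l : L) :
    hc.pairChar hL g l = hc.pair (inclusion hL l) g := rfl

lemma pair_eq_one_iff (n : N) (g : G) : hc.pair n g = 1 ↔ g * n = n * g :=
  hc.1.pairing_eq_one_iff hc.genuine_inj n g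

lemma exists_pairChar (hL : L ≤ N) (Γ : Subgroup G) (μ : L →* ℂˣ)
    (hμ : ∀ m : L, (∀ g ∈ Γ, g * m = m * g) → μ m = 1) : ∃ g ∈ Γ, μ = hc.pairChar hL g :=
  let ⟨g, hg, h⟩ := hc.1.exists_pairing hc.genuine_inj hL Γ μ hμ
  ⟨g, hg, mext h⟩

lemma pairChar_eq_one_iff (hL : L ≤ N) (g : G) : hc.pairChar hL g = 1 ↔ ∀ l ∈ L, g * l = l * g := by
  rw [MonoidHom.ext_iff]
  exact ⟨fun h l hl => (hc.pair_eq_one_iff _ _).1 (h ⟨l, hl⟩),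
    fun h l => (hc.pair_eq_one_iff _ _).2 (h l l.2)⟩

lemma pairChar_of_mem_center (hL : L ≤ N) (g : G) {l : L}
    (hl : (l : G) ∈ center G) : hc.pairChar hL g l = 1 :=
  (hc.pair_eq_one_iff _ _).2 (mem_center_iff.1 hl g)

include hc in
lemma centralizer_lagrangian (hL : IsLagrangian N L) {g : G} :
    g ∈ L ⊔ H ↔ ∀ l ∈ L, g * l = l * g := by
  have hn := hc.1.normal_H
  constructor
  · intro hg l hl; obtain ⟨a, ha, b, hb, rfl⟩ := mem_sup_of_normal_right.1 hg
    rw [mul_assoc, hc.1.comm_NH (hL.le hl) hb, ← mul_assoc, hL.comm ha hl, mul_assoc]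
  · intro h
    have h1 : g ∈ N ⊔ H := by
      rw [← hc.1.centralizer_inf, mem_centralizer_iff]
      exact fun x hx => (h x (hc.1.le_lagrangian hL ⟨hx.2, hx.1⟩)).symm
    obtain ⟨n, hn, b, hb, rfl⟩ := mem_sup_of_normal_right.1 h1
    refine Subgroup.mul_mem_sup (hL.mem_of_comm hn fun l hl => ?_) hb
    have h2 := h l hl
    rw [mul_assoc, hc.1.comm_NH (hL.le hl) hb, ← mul_assoc, ← mul_assoc] at h2
    exact (mul_right_cancel h2).symm

lemma pairChar_eq_one_iff_mem (hL : IsLagrangian N L) (g : G) :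
    hc.pairChar hL.le g = 1 ↔ g ∈ L ⊔ H := by
  rw [hc.pairChar_eq_one_iff, hc.centralizer_lagrangian hL]

section

variable {s : base H N →* Endℂ V} (h : IsUnipOver φ s) {s' : base H N →* Endℂ V'}
  (h' : IsUnipOver φ s')

/-- The locally unipotent action of `N`. -/
def unip : N →* Endℂ V := hc.1.unipAct hc.relIndex_ne_zero h

lemma unip_natural (f : V →ₗ[ℂ] V') (hf : ∀ b v, f (s b v) = s' b (f v)) (n : N) (v : V) :
    f (hc.unip h n v) = hc.unip h' n (f v) :=
  hc.1.unipAct_natural _ h h' f hf n v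

lemma unip_mul_apply (n n' : N) (v : V) : hc.unip h (n * n') v = hc.unip h n (hc.unip h n' v) := by
  rw [map_mul, mul_apply]

lemma unip_inv_apply (n : N) (v : V) : hc.unip h n⁻¹ (hc.unip h n v) = v := by
  rw [← unip_mul_apply, inv_mul_cancel, map_one, one_apply]

lemma unip_apply_inv (n : N) (v : V) : hc.unip h n (hc.unip h n⁻¹ v) = v := by
  rw [← unip_mul_apply, mul_inv_cancel, map_one, one_apply]

lemma unip_comm (n n' : N) (v : V) : hc.unip h n (hc.unip h n' v) = hc.unip h n' (hc.unip h n v) :=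
  hc.1.unipAct_comm _ h n n' v

lemma apply_eq_smul_unip {M : Subgroup G} (hM : M ≤ N) (hBM : base H N ≤ M) (r : M →* Endℂ V)
    (α : M →* ℂˣ) (hr : ∀ b, r (inclusion hBM b) = s b) (hα : ∀ b, α (inclusion hBM b) = φ b)
    (hu : IsUnipOver α r) (m : M) (v : V) : r m v = (α m : ℂ) • hc.unip h (inclusion hM m) v := by
  rw [hc.1.eq_smul_unipAct hc.relIndex_ne_zero h hM hBM r α hr hα hu]; rfl

lemma isUnipOver_smul_unip {M : Type*} [Group M] (j : M →* N) (r : M →* Endℂ V)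
    (α : M →* ℂˣ) (hr : ∀ m v, r m v = (α m : ℂ) • hc.unip h (j m) v) : IsUnipOver α r := by
  intro v
  obtain ⟨m, hm⟩ := h v
  refine ⟨m, fun b => ?_⟩
  have h1 := hc.1.unipAct_sub_one_pow hc.relIndex_ne_zero h hm (j b)
  have h2 : r b - (α b : ℂ) • (1 : Endℂ V) = (α b : ℂ) • (hc.unip h (j b) - 1) := by
    ext w; simp [hr, smul_sub]
  rw [h2, smul_pow, lsmul_apply]
  exact (congrArg _ h1).trans (smul_zero _)

end

section

variable (h : IsUnipOver φ (ρ.comp (base H N)°))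
  {ρ' : Repn G V'} (h' : IsUnipOver φ (ρ'.comp (base H N)°))

lemma unip_rho (n : N) (g : G) (v : V) : hc.unip h n (ρ g v) = ρ g (hc.unip h n v) := by
  refine (hc.unip_natural h h (ρ g) (fun b v => ?_) n v).symm
  show ρ g (ρ b v) = ρ b (ρ g v)
  rw [← mul_apply, ← map_mul, mem_center_iff.1 b.2.2 g, map_mul, mul_apply]

/-- The semisimple part of the action of `N`. -/
def ssAct : N →* Endℂ V where
  toFun n := ρ n * hc.unip h n⁻¹
  map_one' := by simp
  map_mul' n n' := by
    ext v; simp only [mul_apply, coe_mul, map_mul, mul_inv_rev]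
    rw [hc.unip_rho h n⁻¹, hc.unip_comm h n'⁻¹ n⁻¹]

lemma ssAct_apply (n : N) (v : V) : hc.ssAct h n v = ρ n (hc.unip h n⁻¹ v) := rfl

lemma rho_eq_ssAct_unip (n : N) (v : V) : ρ n v = hc.ssAct h n (hc.unip h n v) := by
  rw [ssAct_apply, unip_inv_apply]

lemma ssAct_unip (n n' : N) (v : V) :
    hc.ssAct h n (hc.unip h n' v) = hc.unip h n' (hc.ssAct h n v) := by
  rw [ssAct_apply, ssAct_apply, unip_comm, unip_rho]

lemma ssAct_rho (n : N) (g : G) (v : V) :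
    hc.ssAct h n (ρ g v) = (hc.pair n g : ℂ) • ρ g (hc.ssAct h n v) := by
  have hC := hc.1.comm_mem n n.2 g
  have h1 : (n : G) * g = (n * g * (n : G)⁻¹ * g⁻¹) * (g * n) := by group
  have h2 := LinearMap.congr_fun (hc.1.apply_C h hC) (ρ (g * n) (hc.unip h n⁻¹ v))
  rw [ssAct_apply, unip_rho, ← mul_apply, ← map_mul, h1, map_mul, mul_apply]
  refine h2.trans ?_
  rw [map_mul, ssAct_apply]
  rfl

lemma ssAct_natural (f : V →ₗ[ℂ] V') (hf : ∀ g v, f (ρ g v) = ρ' g (f v)) (n : N) (v : V) :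
    f (hc.ssAct h n v) = hc.ssAct h' n (f v) := by
  rw [ssAct_apply, ssAct_apply, hf, hc.unip_natural h h' f fun b v => hf b v]

lemma ssAct_eq_smul {M : Subgroup G} (hM : M ≤ N) (hBM : base H N ≤ M) (α : M →* ℂˣ)
    (hα : ∀ b, α (inclusion hBM b) = φ b) (hu : IsUnipOver α (ρ.comp M°)) (m : M) (v : V) :
    hc.ssAct h (inclusion hM m) v = (α m : ℂ) • v := by
  rw [ssAct_apply]
  refine (hc.apply_eq_smul_unip h hM hBM (ρ.comp M°) α (fun b => rfl) hα hu m _).trans ?_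
  rw [unip_apply_inv]

/-- The eigenspace of `L ≤ N` for the semisimple action. -/
def eig (hL : L ≤ N) (θ : L →* ℂˣ) : Submodule ℂ V := charSpace ((hc.ssAct h).comp (inclusion hL)) θ

/-- The projection to the eigenspace. -/
def eigProj (hL : L ≤ N) (θ : L →* ℂˣ) : Endℂ V :=
  charProj (Z[N].subgroupOf L) ((hc.ssAct h).comp (inclusion hL)) θ

variable (hL : L ≤ N) {θ : L →* ℂˣ}

lemma mem_eig {v : V} : v ∈ hc.eig h hL θ ↔
    ∀ l : L, hc.ssAct h (inclusion hL l) v = (θ l : ℂ) • v := Iff.rfl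

include hc hL in
lemma finiteIndex_center : (Z[N].subgroupOf L).FiniteIndex := by
  have h1 := hc.1.relIndex_inf_center_ne_zero hc.genuine_inj
  exact ⟨fun h2 => h1 (relIndex_eq_zero_of_le_right hL h2)⟩

lemma normal_center_subgroupOf : (Z[N].subgroupOf L).Normal := ⟨fun n hn g => by
    have : g * n * g⁻¹ = n := by
      ext
      have := mem_center_iff.1 (mem_subgroupOf.1 hn).2 g
      simp only [coe_mul, this, InvMemClass.coe_inv, mul_inv_cancel_right]
    rwa [this]⟩

lemma rho_mem_eig {v : V} (hv : v ∈ hc.eig h hL θ) (g : G) :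
    ρ g v ∈ hc.eig h hL (θ * hc.pairChar hL g) := fun l => by
  show hc.ssAct h (inclusion hL l) (ρ g v) = _
  rw [ssAct_rho, hc.mem_eig h hL |>.1 hv l, map_smul, smul_smul, mmul_apply,
    Units.val_mul, mul_comm]
  rfl

lemma unip_mem_eig {v : V} (hv : v ∈ hc.eig h hL θ) (n : N) :
    hc.unip h n v ∈ hc.eig h hL θ := fun l => by
  show hc.ssAct h (inclusion hL l) (hc.unip h n v) = _
  rw [ssAct_unip, hc.mem_eig h hL |>.1 hv l, map_smul]

lemma rho_mem_eig_iff {v : V} (g : G) :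
    ρ g v ∈ hc.eig h hL (θ * hc.pairChar hL g) ↔ v ∈ hc.eig h hL θ := by
  refine ⟨fun hv => ?_, fun hv => hc.rho_mem_eig h hL hv g⟩
  have h1 := hc.rho_mem_eig h hL hv g⁻¹
  have h2 : θ * hc.pairChar hL g * hc.pairChar hL g⁻¹ = θ := mext fun l => by simp
  rwa [← mul_apply, ← map_mul, inv_mul_cancel, map_one, one_apply, h2] at h1

lemma rho_of_mem_eig {v : V} (hv : v ∈ hc.eig h hL θ) (l : L) :
    ρ l v = (θ l : ℂ) • hc.unip h (inclusion hL l) v := by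
  have := hc.rho_eq_ssAct_unip h (inclusion hL l) v
  rw [(hc.mem_eig h hL).1 (hc.unip_mem_eig h hL hv _) l] at this
  exact this

lemma map_mem_eig (f : V →ₗ[ℂ] V') (hf : ∀ g v, f (ρ g v) = ρ' g (f v)) {v : V}
    (hv : v ∈ hc.eig h hL θ) : f v ∈ hc.eig h' hL θ := fun l => by
  show hc.ssAct h' (inclusion hL l) (f v) = _
  rw [← hc.ssAct_natural h h' f hf, hc.mem_eig h hL |>.1 hv l, map_smul]

lemma map_eigProj (f : V →ₗ[ℂ] V') (hf : ∀ g v, f (ρ g v) = ρ' g (f v)) (v : V) :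
    f (hc.eigProj h hL θ v) = hc.eigProj h' hL θ (f v) := by
  have := hc.finiteIndex_center hL
  exact map_charProj_of_comm (s := (hc.ssAct h).comp (inclusion hL))
    (s' := (hc.ssAct h').comp (inclusion hL)) _ f
    (fun m v => hc.ssAct_natural h h' f hf (inclusion hL m) v) v

lemma eigProj_rho (g : G) (v : V) :
    hc.eigProj h hL (θ * hc.pairChar hL g) (ρ g v) = ρ g (hc.eigProj h hL θ v) := by
  have := hc.finiteIndex_center hL
  have := ofFinite (L ⧸ Z[N].subgroupOf L)
  rw [eigProj, eigProj, charProj_eq_sum, charProj_eq_sum, map_smul, map_sum]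
  congr 1
  refine sum_congr rfl fun q _ => ?_
  show _ • hc.ssAct h (inclusion hL q.out) (ρ g v) = _
  rw [ssAct_rho, smul_smul, map_smul, ← Units.val_mul, mmul_apply, mul_inv,
    pairChar_apply, inv_mul_cancel_right]
  rfl

lemma eigProj_unip (n : N) (v : V) :
    hc.eigProj h hL θ (hc.unip h n v) = hc.unip h n (hc.eigProj h hL θ v) := by
  have := hc.finiteIndex_center hL
  exact (map_charProj_of_comm (s := (hc.ssAct h).comp (inclusion hL))
    (s' := (hc.ssAct h).comp (inclusion hL)) _ (hc.unip h n)
    (fun m v => (hc.ssAct_unip h (inclusion hL m) _ v).symm) v).symm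

/-- The semisimple action of the center is given by `θ`. -/
def IsCentralChar (θ : L →* ℂˣ) : Prop :=
  ∀ l : L, (l : G) ∈ Z[N] → ∀ v, hc.ssAct h (inclusion hL l) v = (θ l : ℂ) • v

variable {h hL}

lemma IsCentralChar.mul (hθ : hc.IsCentralChar h hL θ) {ν : L →* ℂˣ}
    (hν : ∀ l : L, (l : G) ∈ Z[N] → ν l = 1) : hc.IsCentralChar h hL (θ * ν) := fun l hl v => by
  rw [hθ l hl, mmul_apply, hν l hl, mul_one]

lemma IsCentralChar.mul_pairChar (hθ : hc.IsCentralChar h hL θ) (g : G) :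
    hc.IsCentralChar h hL (θ * hc.pairChar hL g) :=
  hθ.mul _ fun _ hl => hc.pairChar_of_mem_center hL g hl.2

lemma IsCentralChar.eigProj_mem (hθ : hc.IsCentralChar h hL θ) (v : V) :
    hc.eigProj h hL θ v ∈ hc.eig h hL θ := by
  have := hc.finiteIndex_center hL
  exact charProj_mem _ (fun p hp v => hθ p hp v) v

lemma eigProj_of_mem {v : V} (hv : v ∈ hc.eig h hL θ) : hc.eigProj h hL θ v = v := by
  have := hc.finiteIndex_center hL
  exact charProj_of_mem _ hv

lemma eigProj_of_mem_of_ne {θ' : L →* ℂˣ} (hθ : ∀ l : L, (l : G) ∈ Z[N] → θ' l = θ l) (hne : θ' ≠ θ)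
    {v : V} (hv : v ∈ hc.eig h hL θ') : hc.eigProj h hL θ v = 0 := by
  have := hc.finiteIndex_center hL
  have := normal_center_subgroupOf (N := N) (L := L)
  exact charProj_of_mem_of_ne _ (fun p hp => hθ p hp) hne hv

lemma IsCentralChar.eq_zero_of_rho_eigProj (hθ : hc.IsCentralChar h hL θ)
    (hcomm : ∀ a ∈ L, ∀ b ∈ L, a * b = b * a) {ξ : V →ₗ[ℂ] V'} {v : V}
    (hξ : ∀ g : G, ξ (ρ g (hc.eigProj h hL θ (ρ g⁻¹ v))) = 0) : ξ v = 0 := by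
  have := hc.finiteIndex_center hL
  have hM : ∀ a b : L, a * b = b * a := fun a b => sext (hcomm a a.2 b b.2)
  have := (finite_card_chars hM (Z[N].subgroupOf L)).1
  have := ofFinite {ν : L →* ℂˣ // ∀ p ∈ Z[N].subgroupOf L, ν p = 1}
  rw [← sum_charProj (s := (hc.ssAct h).comp (inclusion hL)) (θ := θ) (Z[N].subgroupOf L) hM
    (fun p hp v => hθ p hp v) v, map_sum]
  refine sum_eq_zero fun ν _ => ?_
  obtain ⟨g, -, hg⟩ := hc.exists_pairChar hL ⊤ ν.1 fun m hm => ν.2 m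
    ⟨hL m.2, mem_center_iff.2 fun g => hm g trivial⟩
  have h2 := hc.eigProj_rho h hL (θ := θ) g (ρ g⁻¹ v)
  have h3 : ρ g (ρ g⁻¹ v) = v := by
    rw [← mul_apply, ← map_mul, mul_inv_cancel, map_one, one_apply]
  rw [← hg, h3] at h2
  refine (congrArg ξ h2).trans (hξ g)

lemma IsCentralChar.eq_zero_of_eigProj (hθ : hc.IsCentralChar h hL θ)
    (hcomm : ∀ a ∈ L, ∀ b ∈ L, a * b = b * a) {v : V}
    (hv : ∀ g : G, hc.eigProj h hL θ (ρ g v) = 0) : v = 0 :=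
  hθ.eq_zero_of_rho_eigProj hc hcomm (ξ := lid) fun g => by rw [hv, map_zero, map_zero]

/-- The projections of the translates of a vector to the eigenspace. -/
def projFun (hθ : hc.IsCentralChar h hL θ) : V →ₗ[ℂ] (G → hc.eig h hL θ) :=
  LinearMap.pi fun g => (hc.eigProj h hL θ ∘ₗ ρ g).codRestrict _ fun _ => hθ.eigProj_mem hc _

lemma projFun_coe (hθ : hc.IsCentralChar h hL θ) (v : V) (g : G) :
    (hc.projFun hθ v g : V) = hc.eigProj h hL θ (ρ g v) := rfl

lemma projFun_rho (hθ : hc.IsCentralChar h hL θ) (v : V) (g x : G) :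
    hc.projFun hθ (ρ g v) x = hc.projFun hθ v (x * g) := sext (by
  rw [projFun_coe, projFun_coe, map_mul, mul_apply])

lemma projFun_mul (hθ : hc.IsCentralChar h hL θ) (v : V) {k : G} (hk : ∀ l ∈ L, k * l = l * k)
    (g : G) : (hc.projFun hθ v (k * g) : V) = ρ k (hc.projFun hθ v g) := by
  have h1 := hc.eigProj_rho h hL (θ := θ) k (ρ g v)
  have h2 : θ * hc.pairChar hL k = θ := by
    rw [(hc.pairChar_eq_one_iff hL k).2 hk]; exact mul_one θ
  rw [h2] at h1
  rw [projFun_coe, projFun_coe, map_mul, mul_apply, h1]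

lemma map_projFun {h' : IsUnipOver φ (ρ'.comp (base H N)°)} (hθ : hc.IsCentralChar h hL θ)
    (hθ' : hc.IsCentralChar h' hL θ) (f : V →ₗ[ℂ] V') (hf : ∀ g v, f (ρ g v) = ρ' g (f v)) (v : V)
    (g : G) : f (hc.projFun hθ v g) = hc.projFun hθ' (f v) g := by
  rw [projFun_coe, projFun_coe, hc.map_eigProj h h' hL f hf, hf]

lemma projFun_injective (hθ : hc.IsCentralChar h hL θ)
    (hcomm : ∀ a ∈ L, ∀ b ∈ L, a * b = b * a) : Injective (hc.projFun hθ) :=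
  (injective_iff_map_eq_zero _).2 fun v hv => hθ.eq_zero_of_eigProj hc hcomm fun g => by
    rw [← projFun_coe hc hθ, hv]; rfl

lemma projFun_one (hθ : hc.IsCentralChar h hL θ) (v : hc.eig h hL θ) :
    hc.projFun hθ v.1 1 = v := sext (by
  rw [projFun_coe, map_one, one_apply, eigProj_of_mem hc v.2])

lemma projFun_surjective {hL : IsLagrangian N L} {h : IsUnipOver φ (ρ.comp (base H N)°)}
    (hθ : hc.IsCentralChar h hL.le θ) (F : G → hc.eig h hL.le θ)
    (hF : ∀ k ∈ L ⊔ H, ∀ g, (F (k * g) : V) = ρ k (F g)) : ∃ v, hc.projFun hθ v = F := by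
  have hfin := hc.1.finiteIndex_H
  have := ofFinite (G ⧸ (L ⊔ H))
  refine ⟨∑ q : G ⧸ (L ⊔ H), ρ q.out (F q.out⁻¹), funext fun g => sext ?_⟩
  rw [projFun_coe, map_sum, map_sum, Finset.sum_eq_single ((g⁻¹ : G) : G ⧸ (L ⊔ H))]
  · have h1 : g * ((g⁻¹ : G) : G ⧸ (L ⊔ H)).out ∈ L ⊔ H := by
      have := mk_out_eq_mul (L ⊔ H) g⁻¹; obtain ⟨y, hy⟩ := this
      rw [hy, mul_inv_cancel_left]; exact y.2
    rw [← rep_mul, ← hF _ h1, mul_inv_cancel_right]; exact eigProj_of_mem hc (F g).2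
  · intro q _ hq; rw [← rep_mul]
    have h1 : g * q.out ∉ L ⊔ H := fun h => hq (by
      rw [← q.out_eq']; refine QuotientGroup.eq.2 ?_
      have := inv_mem h; rwa [mul_inv_rev] at this)
    refine eigProj_of_mem_of_ne hc (fun l hl => ?_) (fun h => ?_)
      (hc.rho_mem_eig h hL.le (F _).2 (g * q.out))
    · rw [mmul_apply, hc.pairChar_of_mem_center hL.le _ hl.2, mul_one]
    · refine h1 ((hc.pairChar_eq_one_iff_mem hL _).1 (mext fun l => ?_))
      have := DFunLike.congr_fun h l
      rw [mmul_apply] at this; exact mul_eq_left.1 this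
  · simp

end

end CharData

variable {φ : base H N →* ℂˣ} (hc : CharData C H N φ) {χ : SmoothChar Z[N]}
  {ψ : SmoothChar ↥(N ⊓ H)} {B B' : Subgroup G} {κ : SmoothChar B}
  {κ' : SmoothChar B'} {F : RepLoc H° ψ ⥤ RepLoc idG χ}

lemma LagrangianDatum.le (D : LagrangianDatum H N ψ χ) : D.L ≤ N := D.2.le

section

variable {P : ObjectProperty (Rep.{u} ℂ K)}

/-- A morphism in a full subcategory of representations from an intertwining linear map. -/
def repHom {X Y : P.FullSubcategory} (f : X.obj →ₗ[ℂ] Y.obj)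
    (hf : ∀ k v, f (X.obj.ρ k v) = Y.obj.ρ k (f v)) : X ⟶ Y :=
  ObjectProperty.homMk (Rep.ofHom
    { toLinearMap := f
      isIntertwining' := fun k => lext fun v => hf k v })

/-- The linear map underlying a morphism. -/
def repLin {X Y : P.FullSubcategory} (f : X ⟶ Y) : X.obj →ₗ[ℂ] Y.obj := f.hom.hom.toLinearMap

lemma repLin_comm {X Y : P.FullSubcategory} (f : X ⟶ Y) (k : K) (v : X.obj) :
    repLin f (X.obj.ρ k v) = Y.obj.ρ k (repLin f v) :=
  Rep.hom_comm_apply f.hom k v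

lemma repHom_ext {X Y : P.FullSubcategory} {f g : X ⟶ Y} (h : ∀ v, repLin f v = repLin g v) :
    f = g := by
  apply ObjectProperty.hom_ext
  ext v
  exact h v

lemma repLin_comp {X Y Z : P.FullSubcategory} (f : X ⟶ Y) (g : Y ⟶ Z) (v : X.obj) :
    repLin (f ≫ g) v = repLin g (repLin f v) := rfl

lemma repLin_id {X : P.FullSubcategory} (v : X.obj) : repLin (𝟙 X) v = v := rfl

/-- A bijective intertwining map is an isomorphism. -/
def repIso {X Y : P.FullSubcategory} (f : X.obj →ₗ[ℂ] Y.obj)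
    (hf : ∀ k v, f (X.obj.ρ k v) = Y.obj.ρ k (f v)) (hb : Bijective f) : X ≅ Y where
  hom := repHom f hf
  inv := repHom (ofBijective f hb).symm.toLinearMap fun k v => by
    apply hb.1
    have h : ∀ w, f ((ofBijective f hb).symm w) = w := (ofBijective f hb).apply_symm_apply
    simp only [LinearEquiv.coe_coe]
    rw [h, hf, h]
  hom_inv_id := repHom_ext fun v => (ofBijective f hb).symm_apply_apply v
  inv_hom_id := repHom_ext fun v => (ofBijective f hb).apply_symm_apply v

lemma repLin_bijective {X Y : P.FullSubcategory} (e : X ≅ Y) : Bijective (repLin e.hom) := by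
  refine Function.bijective_iff_has_inverse.2 ⟨repLin e.inv, fun v => ?_, fun v => ?_⟩
  · rw [← repLin_comp, e.hom_inv_id, repLin_id]
  · rw [← repLin_comp, e.inv_hom_id, repLin_id]

/-- A natural transformation with bijective components is an isomorphism. -/
def repNatIso {D : Type*} [Category D] {F F' : D ⥤ P.FullSubcategory}
    (α : F ⟶ F') (h : ∀ X, Bijective (repLin (α.app X))) : F ≅ F' :=
  ofComponents (fun X => repIso (repLin (α.app X)) (repLin_comm _) (h X)) fun f => α.naturality f

lemma repLin_naturality {D : Type*} [Category D] {F F' : D ⥤ P.FullSubcategory}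
    (α : F ⟶ F') {X Y : D} (f : X ⟶ Y) (v : (F.obj X).obj) :
    repLin (α.app Y) (repLin (F.map f) v) = repLin (F'.map f) (repLin (α.app X) v) := by
  rw [← repLin_comp, ← repLin_comp, α.naturality]

lemma repLin_hom_inv {X Y : P.FullSubcategory} (e : X ≅ Y) (v : Y.obj) :
    repLin e.hom (repLin e.inv v) = v := by
  rw [← repLin_comp, e.inv_hom_id, repLin_id]

lemma repLin_inv_hom {X Y : P.FullSubcategory} (e : X ≅ Y) (v : X.obj) :
    repLin e.inv (repLin e.hom v) = v := by
  rw [← repLin_comp, e.hom_inv_id, repLin_id]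

end

lemma map_pow_of_comm {V V' : Type*} [AddCommGroup V] [Module ℂ V] [AddCommGroup V']
    [Module ℂ V'] (f : V →ₗ[ℂ] V') {a : Endℂ V} {b : Endℂ V'}
    (h : ∀ v, f (a v) = b (f v)) (m : ℕ) (v : V) : f ((a ^ m) v) = (b ^ m) (f v) := by
  induction m with
  | zero => rfl
  | succ m ih => rw [pow_succ', mul_apply, h, ih, pow_succ', mul_apply]

namespace SmoothChar

/-- The character `κ` of `B` extends the character `φ` of a subgroup of `B`. -/
def Extends {P : Subgroup G} (κ : SmoothChar B) (φ : P →* ℂˣ) : Prop :=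
  ∀ x (hx : x ∈ P), ∃ hB : x ∈ B, κ.1 ⟨x, hB⟩ = φ ⟨x, hx⟩

lemma Extends.le {P : Subgroup G} {φ : P →* ℂˣ} (h : κ.Extends φ) : P ≤ B := fun _ hx => (h _ hx).1

lemma Extends.apply {P : Subgroup G} {φ : P →* ℂˣ} (h : κ.Extends φ)
    {x : G} (hB : x ∈ B) (hx : x ∈ P) : κ.1 ⟨x, hB⟩ = φ ⟨x, hx⟩ := (h x hx).2

lemma Extends.trans {P : Subgroup G} {φ : P →* ℂˣ}
    (h : κ.Extends κ'.1) (h' : κ'.Extends φ) : κ.Extends φ := fun _ hx =>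
  ⟨h.le (h'.le hx), (h.apply _ (h'.le hx)).trans (h'.apply _ hx)⟩

lemma Consistent.extends (h : κ.Consistent κ') (hB : B' ≤ B) : κ.Extends κ'.1 := fun x hx =>
  ⟨hB hx, uext (h x (hB hx) hx)⟩

lemma Extends.consistent (h : κ.Extends κ'.1) : κ.Consistent κ' := fun _ hB hx =>
  congrArg uval (h.apply hB hx)

lemma Extends.restrict {P : Subgroup G}
    {φ : P →* ℂˣ} (h : κ.Extends φ) (h' : κ.Extends κ'.1) (hP : P ≤ B') : κ'.Extends φ :=
  fun _ hx => ⟨hP hx, (h'.apply (h.le hx) _).symm.trans (h.apply _ hx)⟩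

end SmoothChar

section

lemma isLocally_isUnipOver {f : K →* G} {V : Rep.{u} ℂ K} (h : isLocally f κ V) {M : Type*}
    [Group M] (j : M →* K) (hj : ∀ m, f (j m) ∈ B) (α : M →* ℂˣ)
    (hα : ∀ m, α m = κ.1 ⟨f (j m), hj m⟩) : IsUnipOver α (V.ρ.comp j) := fun v => by
  obtain ⟨m, hm⟩ := h v
  refine ⟨m, fun b => ?_⟩
  rw [hα]
  exact hm (j b) (hj b)

end

namespace CharData

lemma isUnipOver_base {f : K →* G} (hκ : κ.Extends φ) {V : Rep.{u} ℂ K} (h : isLocally f κ V)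
    (j : base H N →* K) (hj : ∀ b, f (j b) = b) : IsUnipOver φ (V.ρ.comp j) :=
  isLocally_isUnipOver h j (fun b => by rw [hj]; exact hκ.le b.2) φ fun b => by
    rw [← hκ.apply (hκ.le b.2) b.2]; congr 2
    exact (hj b).symm

lemma rep_base (hχ : χ.Extends φ) (π : RepLoc idG χ) : IsUnipOver φ (π.obj.ρ.comp (base H N)°) :=
  isUnipOver_base hχ π.property.2 _ fun _ => rfl

variable (hχ : χ.Extends φ) (hL : L ≤ N)

lemma isCentralChar {θ : SmoothChar L} (hθ : θ.Consistent χ) (π : RepLoc idG χ) :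
    hc.IsCentralChar (rep_base hχ π) hL θ.1 := fun l hl v => by
  have h1 := hc.ssAct_eq_smul (rep_base hχ π) (M := Z[N]) inf_le_left hχ.le χ.1
    (fun b => hχ.apply _ b.2)
    (isLocally_isUnipOver π.property.2 _ (fun m => m.2) _ fun m => rfl) ⟨l, hl⟩ v
  have h2 : ((θ.1 l : ℂˣ) : ℂ) = χ.1 ⟨l, hl⟩ := hθ l l.2 hl
  rw [h2]
  exact h1

/-- The eigenspace as a representation of a subgroup that centralizes `L`. -/
def eigRep (h : IsUnipOver φ (ρ.comp (base H N)°)) (θ : L →* ℂˣ) {K : Subgroup G}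
    (hK : ∀ k ∈ K, ∀ l ∈ L, k * l = l * k) : Repn K (hc.eig h hL θ) where
  toFun k := (ρ k).restrict fun v hv => by
    have h1 := hc.rho_mem_eig h hL hv k
    have h2 : θ * hc.pairChar hL (k : G) = θ := by
      rw [(hc.pairChar_eq_one_iff hL (k : G)).2 (hK k k.2)]; exact mul_one θ
    rwa [h2] at h1
  map_one' := by ext; simp
  map_mul' _ _ := by ext; simp

variable {K : Subgroup G} (hK : ∀ k ∈ K, ∀ l ∈ L, k * l = l * k) {θ : SmoothChar L}
  (hκ : θ.Extends κ.1)

include hκ in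
lemma isLocally_eigRep (π : RepLoc idG χ) :
    isLocally K° κ (Rep.of (hc.eigRep hL (rep_base hχ π) θ.1 hK)) := fun v => by
  obtain ⟨m, hm⟩ := rep_base hχ π v.1
  refine ⟨m, fun k hk => sext ?_⟩
  have hkL : (k : G) ∈ L := hκ.le hk
  have h1 := hc.1.unipAct_sub_one_pow hc.relIndex_ne_zero (rep_base hχ π) hm ⟨k, hL hkL⟩
  have h2 := map_pow_of_comm (hc.eig (rep_base hχ π) hL θ.1).subtype
    (a := hc.eigRep hL (rep_base hχ π) θ.1 hK k - κ.val ⟨k, hk⟩ • 1)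
    (b := (θ.val ⟨k, hkL⟩) • (hc.unip (rep_base hχ π) ⟨k, hL hkL⟩ - 1)) (fun w => by
      have h3 : κ.val ⟨k, hk⟩ = θ.val ⟨k, hkL⟩ := congrArg uval (hκ.apply hkL hk).symm
      have h4 := hc.rho_of_mem_eig (rep_base hχ π) hL w.2 ⟨k, hkL⟩
      rw [h3]; show π.obj.ρ k w.1 - θ.val ⟨k, hkL⟩ • w.1 = θ.val ⟨k, hkL⟩ • (_ - w.1)
      rw [smul_sub]; exact congrArg (· - _) h4) m v
  refine h2.trans ?_
  rw [smul_pow, lsmul_apply]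
  exact (congrArg _ h1).trans (smul_zero _)

/-- The functor sending `π` to the `θ`-eigenspace of `L`, as a representation of `K ≤ L H`. -/
def eigFunctor : RepLoc idG χ ⥤ RepLoc K° κ where
  obj π := ⟨Rep.of (hc.eigRep hL (rep_base hχ π) θ.1 hK), fun v => by
    have h := (π.property.1 v.1).preimage (csv : Continuous (sval : K → G))
    convert h using 1
    ext k; exact Subtype.ext_iff, hc.isLocally_eigRep hχ hL hK hκ π⟩
  map {π π'} f := repHom ((repLin f).restrict fun _ hv =>
    hc.map_mem_eig (rep_base hχ π) (rep_base hχ π') hL _ (repLin_comm f) hv)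
    fun k v => sext (repLin_comm f k v.1)
  map_id π := rfl
  map_comp f g := rfl

end CharData

section

variable {K M : Type u} [Group K] [TopologicalSpace K] [Group M] [TopologicalSpace M]
  [IsTopologicalGroup M] {f : K →* M}

/-- The function underlying an element of the induced representation. -/
def indFun {W : SmoothRep K} (x : ((smoothInd f).obj W).obj) : M → W.obj := x.1.1

lemma indFun_ext {W : SmoothRep K} {x y : ((smoothInd f).obj W).obj}
    (h : ∀ g, indFun x g = indFun y g) : x = y :=
  sext (sext (funext h))

lemma indFun_mul {W : SmoothRep K} (x : ((smoothInd f).obj W).obj) (k : K) (g : M) :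
    indFun x (f k * g) = W.obj.ρ k (indFun x g) := x.1.2 k g

lemma indFun_rho {W : SmoothRep K} (x : ((smoothInd f).obj W).obj) (g y : M) :
    indFun (((smoothInd f).obj W).obj.ρ g x) y = indFun x (y * g) := rfl

/-- Evaluation of induced functions, as a linear map. -/
def indEval (W : SmoothRep K) (g : M) : ((smoothInd f).obj W).obj →ₗ[ℂ] W.obj where
  toFun x := indFun x g
  map_add' _ _ := rfl
  map_smul' _ _ := rfl

/-- Constructor for elements of the induced representation. -/
def indMk {W : SmoothRep K} (F : M → W.obj) (hF : ∀ k g, F (f k * g) = W.obj.ρ k (F g))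
    (U : Subgroup M) (hU : IsOpen (U : Set M)) (hUF : ∀ u ∈ U, ∀ g, F (g * u) = F g) :
    ((smoothInd f).obj W).obj :=
  ⟨⟨F, hF⟩, by
    let S : Subgroup M :=
      { carrier := {m | Representation.coind f W.obj.ρ m ⟨F, hF⟩ = ⟨F, hF⟩}
        one_mem' := by
          show Representation.coind f W.obj.ρ 1 ⟨F, hF⟩ = ⟨F, hF⟩
          rw [map_one, one_apply]
        mul_mem' := fun {a b} ha hb => by
          simp only [Set.mem_ofPred_eq, map_mul, mul_apply] at *
          rw [hb, ha]
        inv_mem' := fun {a} ha => by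
          simp only [Set.mem_ofPred_eq] at *
          conv_lhs => rw [← ha]
          rw [← mul_apply, ← map_mul, inv_mul_cancel, map_one, one_apply] }
    exact isOpen_mono (H₁ := U) (H₂ := S) (fun u hu => sext (funext fun g => hUF u hu g)) hU⟩

/-- A map into the induced representation. -/
def toSmoothInd {V : SmoothRep M} {W : SmoothRep K} (F : V.obj →ₗ[ℂ] (M → W.obj))
    (h1 : ∀ v k g, F v (f k * g) = W.obj.ρ k (F v g))
    (h2 : ∀ v g x, F (V.obj.ρ g v) x = F v (x * g)) : V ⟶ (smoothInd f).obj W :=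
  let c : V.obj ⟶ Rep.of (Representation.coind f W.obj.ρ) := Rep.ofHom
    { toLinearMap := F.codRestrict (Representation.coindV f W.obj.ρ) h1
      isIntertwining' := fun g => lext fun v => sext (funext fun x => h2 v g x) }
  repHom (c.hom.toLinearMap.codRestrict (smoothVectors (Representation.coind f W.obj.ρ))
    fun v => map_mem_smoothVectors c (V.property v)) fun g v => sext (Rep.hom_comm_apply c g v)

end

namespace CharData

variable (hχ : χ.Extends φ) (hL : L ≤ N) {K : Subgroup G} (hK : ∀ k ∈ K, ∀ l ∈ L, k * l = l * k)
  {θ : SmoothChar L} (hθ : θ.Consistent χ) (hκ : θ.Extends κ.1)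

/-- The map from `π` to the representation induced from its `θ`-eigenspace. -/
def toIndEig : incl idG χ ⟶ hc.eigFunctor hχ hL hK hκ ⋙ incl K° κ ⋙ smoothInd K° where
  app π := toSmoothInd (V := (incl idG χ).obj π)
    (W := (incl K° κ).obj ((hc.eigFunctor hχ hL hK hκ).obj π))
    (hc.projFun (hc.isCentralChar hχ hL hθ π) : π.obj →ₗ[ℂ] (G → hc.eig (rep_base hχ π) hL θ.1))
    (fun v k g => sext (hc.projFun_mul (hc.isCentralChar hχ hL hθ π) v (hK k k.2) g))
    (hc.projFun_rho (hc.isCentralChar hχ hL hθ π))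
  naturality π π' f := repHom_ext fun v => indFun_ext fun g => sext
    (hc.map_projFun (hc.isCentralChar hχ hL hθ π) (hc.isCentralChar hχ hL hθ π') (repLin f)
      (repLin_comm f) v g).symm

lemma toIndEig_injective (hcomm : ∀ a ∈ L, ∀ b ∈ L, a * b = b * a) (π : RepLoc idG χ) :
    Injective (repLin ((hc.toIndEig hχ hL hK hθ hκ).app π)) := fun _ _ h =>
  hc.projFun_injective (hc.isCentralChar hχ hL hθ π) hcomm
    (funext fun g => congrArg (fun x => indFun x g) h)

end CharData

namespace CharData

variable (hχ : χ.Extends φ) (hL : IsLagrangian N L) {θ : SmoothChar L} (hθ : θ.Consistent χ)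

include hc hL in
lemma sup_comm_lagrangian : ∀ k ∈ L ⊔ H, ∀ l ∈ L, k * l = l * k := fun _ hk =>
  (hc.centralizer_lagrangian hL).1 hk

lemma _root_.SmoothChar.extends_self : θ.Extends θ.1 := fun _ hx => ⟨hx, rfl⟩

/-- The functor sending `π` to the `θ`-eigenspace of `L`, as a representation of `L H`. -/
def eigLH : RepLoc idG χ ⥤ RepLoc (L ⊔ H)° θ :=
  hc.eigFunctor hχ hL.le (hc.sup_comm_lagrangian hL) SmoothChar.extends_self

/-- The map from `π` to the representation induced from its `θ`-eigenspace. -/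
def toIndEigLH : incl idG χ ⟶ hc.eigLH hχ hL ⋙ incl (L ⊔ H)° θ ⋙ smoothInd (L ⊔ H)° :=
  hc.toIndEig hχ hL.le (hc.sup_comm_lagrangian hL) hθ SmoothChar.extends_self

lemma toIndEigLH_bijective (π : RepLoc idG χ) :
    Bijective (repLin ((hc.toIndEigLH hχ hL hθ).app π)) := by
  refine ⟨hc.toIndEig_injective hχ hL.le _ hθ _ (fun _ ha _ hb => hL.comm ha hb) π, fun x => ?_⟩
  obtain ⟨v, hv⟩ := hc.projFun_surjective (hL := hL) (hc.isCentralChar hχ hL.le hθ π) (fun g => indFun x g)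
    (fun k hk g => congrArg sval (indFun_mul x ⟨k, hk⟩ g))
  exact ⟨v, indFun_ext fun g => congrFun hv g⟩

/-- Every locally-`χ` representation is induced from its `θ`-eigenspace. -/
def indEigIso : incl idG χ ≅ hc.eigLH hχ hL ⋙ incl (L ⊔ H)° θ ⋙ smoothInd (L ⊔ H)° :=
  repNatIso (hc.toIndEigLH hχ hL hθ) (hc.toIndEigLH_bijective hχ hL hθ)

lemma projFun_map {π π' : RepLoc idG χ} (f : π ⟶ π') (v : π.obj) (g : G) :
    repLin ((hc.eigLH hχ hL).map f) (hc.projFun (hc.isCentralChar hχ hL.le hθ π) v g) =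
      hc.projFun (hc.isCentralChar hχ hL.le hθ π') (repLin f v) g :=
  sext (hc.map_projFun (hc.isCentralChar hχ hL.le hθ π) (hc.isCentralChar hχ hL.le hθ π')
    (repLin f) (repLin_comm f) v g)

include hθ in
lemma eigLH_faithful : (hc.eigLH hχ hL (θ := θ)).Faithful where
  map_injective {π π'} f g h := repHom_ext fun v => by
    refine hc.projFun_injective (hc.isCentralChar hχ hL.le hθ π')
      (fun _ ha _ hb => hL.comm ha hb) (funext fun x => ?_)
    have h1 := congrArg (fun k => repLin k (hc.projFun (hc.isCentralChar hχ hL.le hθ π) v x)) h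
    exact (hc.projFun_map hχ hL hθ f v x).symm.trans (h1.trans (hc.projFun_map hχ hL hθ g v x))

include hθ in
lemma eigLH_full : (hc.eigLH hχ hL (θ := θ)).Full where
  map_surjective {π π'} f := by
    let F : SmoothRep (L ⊔ H : Subgroup G) ⥤ SmoothRep G := smoothInd (L ⊔ H)°
    let T := (hc.indEigIso hχ hL hθ).hom.app π ≫
      F.map ((incl (L ⊔ H)° θ).map f) ≫ (hc.indEigIso hχ hL hθ).inv.app π'
    let T' : π ⟶ π' := ObjectProperty.homMk T.hom
    have key : ∀ v x, hc.projFun (hc.isCentralChar hχ hL.le hθ π') (repLin T' v) x =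
        repLin f (hc.projFun (hc.isCentralChar hχ hL.le hθ π) v x) := by
      intro v x; have h1 := repLin_hom_inv ((hc.indEigIso hχ hL hθ).app π')
        (repLin (F.map ((incl (L ⊔ H)° θ).map f)) (repLin ((hc.indEigIso hχ hL hθ).hom.app π) v))
      exact congrArg (fun y => indFun y x) h1
    refine ⟨T', repHom_ext fun v => ?_⟩
    have h1 := key v.1 1; have h2 := hc.projFun_one (hc.isCentralChar hχ hL.le hθ π) v
    have h3 := hc.projFun_one (hc.isCentralChar hχ hL.le hθ π') (repLin ((hc.eigLH hχ hL).map T') v)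
    exact h3.symm.trans (h1.trans (congrArg (repLin f) h2))

end CharData

lemma exists_sup_hom {G E : Type*} [Group G] [Monoid E] (L H : Subgroup G) [H.Normal]
    (hcomm : ∀ l ∈ L, ∀ h ∈ H, l * h = h * l) (a : L →* E) (b : H →* E)
    (hab : ∀ l h, Commute (a l) (b h)) (hint : ∀ x (hL : x ∈ L) (hH : x ∈ H), a ⟨x, hL⟩ = b ⟨x, hH⟩) :
    ∃ e : ↥(L ⊔ H) →* E, (∀ l : L, e (inclusion le_sup_left l) = a l) ∧
      ∀ h : H, e (inclusion le_sup_right h) = b h := by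
  have hwd : ∀ (l l' : L) (h h' : H), (l : G) * h = l' * h' → a l * b h = a l' * b h' := by
    intro l l' h h' heq
    have h1 : (l'⁻¹ * l : G) = h' * (h : G)⁻¹ := by
      rw [coe_inv, inv_mul_eq_iff_eq_mul, ← mul_assoc, ← heq, mul_inv_cancel_right]
    have h2 : a (l'⁻¹ * l) = b (h' * h⁻¹) :=
      (hint (l'⁻¹ * l : G) (l'⁻¹ * l).2 (h1 ▸ (h' * h⁻¹).2)).trans (congrArg b (sext h1))
    have h3 : a l = a l' * a (l'⁻¹ * l) := by rw [← map_mul, mul_inv_cancel_left]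
    rw [h3, h2, mul_assoc, ← map_mul, inv_mul_cancel_right]
  have hex : ∀ x : ↥(L ⊔ H), ∃ (l : L) (h : H), (l : G) * h = x := fun x => by
    obtain ⟨l, hl, h, hh, e⟩ := mem_sup_of_normal_right.1 x.2; exact ⟨⟨l, hl⟩, ⟨h, hh⟩, e⟩
  choose p q hpq using hex
  refine ⟨{ toFun := fun x => a (p x) * b (q x), map_one' := ?_, map_mul' := fun x y => ?_ },
    fun l => ?_, fun h => ?_⟩
  · rw [hwd _ 1 _ 1 (by simpa using hpq 1), map_one, map_one, one_mul]
  · have h1 : a (p x) * b (q x) * (a (p y) * b (q y)) = a (p x * p y) * b (q x * q y) := by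
      rw [map_mul, map_mul, mul_assoc, ← mul_assoc (b (q x)), ← (hab (p y) (q x)).eq]
      simp only [mul_assoc]
    rw [h1]; refine hwd _ _ _ _ ?_
    rw [hpq, coe_mul, ← hpq x, ← hpq y, coe_mul, coe_mul, mul_assoc,
      mul_assoc, ← mul_assoc (q x : G), ← hcomm (p y) (p y).2 (q x) (q x).2, mul_assoc]
  · exact (hwd _ l _ 1 (by rw [hpq]; simp)).trans (by rw [map_one, mul_one])
  · exact (hwd _ 1 _ h (by rw [hpq]; simp)).trans (by rw [map_one, one_mul])

lemma isOpen_stab_of_isOpenMap {K K' : Type*} [Group K] [TopologicalSpace K] [IsTopologicalGroup K]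
    [Group K'] [TopologicalSpace K'] (ρ : Repn K V) (i : K' →* K) (hi : IsOpenMap i) {v : V}
    (h : IsOpen {k : K' | ρ (i k) v = v}) : IsOpen {k : K | ρ k v = v} := by
  let S : Subgroup K :=
    { carrier := {k | ρ k v = v}
      one_mem' := by simp
      mul_mem' := fun {a b} (ha : ρ a v = v) (hb : ρ b v = v) => by
        show ρ (a * b) v = v
        rw [rep_mul, hb, ha]
      inv_mem' := fun {a} (ha : ρ a v = v) => by
        show ρ a⁻¹ v = v
        conv_lhs => rw [← ha]
        rw [← rep_mul, inv_mul_cancel, map_one, one_apply] }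
  have hS : IsOpen (S : Set K) := S.isOpen_of_mem_nhds (g := 1) (Filter.mem_of_superset
    ((hi _ h).mem_nhds ⟨1, by simp, map_one i⟩) (by rintro _ ⟨k, hk, rfl⟩; exact hk))
  exact hS

lemma isOpenMap_inclusion {H K : Subgroup G}
    (h : H ≤ K) (hH : IsOpen (H : Set G)) : IsOpenMap (inclusion h) := by
  have h1 : Topology.IsOpenEmbedding (sval : H → G) := hH.isOpenEmbedding_subtypeVal
  intro U hU
  refine isOpen_induced_iff.2 ⟨_, h1.isOpenMap U hU, ?_⟩
  ext x
  constructor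
  · rintro ⟨y, hy, hyx⟩
    exact ⟨y, hy, sext hyx⟩
  · rintro ⟨y, hy, rfl⟩
    exact ⟨y, hy, rfl⟩

namespace CharData

lemma sub_base {K : Subgroup G} (hκ : κ.Extends φ) (hb : base H N ≤ K) (W : RepLoc K° κ) :
    IsUnipOver φ (W.obj.ρ.comp (inclusion hb)) :=
  isUnipOver_base hκ W.property.2 _ fun _ => rfl

lemma base_le_H : base H N ≤ H := inf_le_left.trans inf_le_right

lemma sub_base_H (hψ : ψ.Extends φ) (τ : RepLoc H° ψ) :
    IsUnipOver φ (τ.obj.ρ.comp (inclusion base_le_H)) := sub_base hψ base_le_H τ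

lemma sub_apply {K : Subgroup G} (hκ : κ.Extends φ) (hb : base H N ≤ K) (hBN : B ≤ N) (hBK : B ≤ K)
    (W : RepLoc K° κ) (b : B) (w : W.obj) : W.obj.ρ (inclusion hBK b) w =
    (κ.1 b : ℂ) • hc.unip (sub_base hκ hb W) (inclusion hBN b) w :=
  hc.apply_eq_smul_unip (sub_base hκ hb W) hBN hκ.le
    (W.obj.ρ.comp (inclusion hBK)) κ.1 (fun _ => rfl) (fun b => hκ.apply _ b.2)
    (isLocally_isUnipOver W.property.2 _ (fun m => m.2) _ fun _ => rfl) b w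

lemma unip_sub {K : Subgroup G} (hb : base H N ≤ K) {σ : Repn K V}
    (h : IsUnipOver φ (σ.comp (inclusion hb))) (n : N) (k : K) (v : V) :
    hc.unip h n (σ k v) = σ k (hc.unip h n v) := by
  refine (hc.unip_natural h h (σ k) (fun b v => ?_) n v).symm
  show σ k (σ (inclusion hb b) v) = σ (inclusion hb b) (σ k v)
  rw [← rep_mul, ← rep_mul]
  congr 2
  exact sext (mem_center_iff.1 b.2.2 k)

variable {θ : SmoothChar L}

/-- Restriction of locally-`θ` representations of `L H` to locally-`ψ` representations of `H`. -/
def resLoc (hψ : θ.Extends ψ.1) : RepLoc (L ⊔ H)° θ ⥤ RepLoc H° ψ where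
  obj W := ⟨Rep.of (W.obj.ρ.comp (inclusion (le_sup_right : H ≤ L ⊔ H))),
    fun v => (W.property.1 v).preimage (continuous_inclusion (le_sup_right : H ≤ L ⊔ H)),
    fun v => by
      obtain ⟨m, hm⟩ := W.property.2 v; refine ⟨m, fun k hk => ?_⟩
      have h2 : θ.val ⟨k, hψ.le hk⟩ = ψ.val ⟨k, hk⟩ := congrArg uval (hψ.apply _ hk)
      have h1 : ((W.obj.ρ (inclusion le_sup_right k) - θ.val ⟨k, hψ.le hk⟩ • 1) ^ m) v = 0 :=
        hm (inclusion le_sup_right k) (hψ.le hk)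
      rw [h2] at h1; exact h1⟩
  map {W W'} f :=
    let f' : W.obj →ₗ[ℂ] W'.obj := repLin f
    repHom f' fun _ v => repLin_comm f _ v
  map_id _ := rfl
  map_comp _ _ := rfl

lemma resLoc_faithful (hψ : θ.Extends ψ.1) : (resLoc hψ).Faithful where
  map_injective {W W'} f g h := repHom_ext fun v => by
    have h1 : repLin ((resLoc hψ).map f) v = repLin ((resLoc hψ).map g) v := by rw [h]
    exact h1

include hc in
lemma resLoc_full (hψ : θ.Extends ψ.1) (hφ : ψ.Extends φ) (hL : L ≤ N) : (resLoc hψ).Full where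
  map_surjective {W W'} f := by
    have hb : base H N ≤ L ⊔ H := base_le_H.trans le_sup_right; have hn := hc.1.normal_H
    let f' : W.obj →ₗ[ℂ] W'.obj := repLin (X := (resLoc hψ).obj W) (Y := (resLoc hψ).obj W') f
    have hf : ∀ (k : ↥(L ⊔ H)) (hk : (k : G) ∈ H) v,
        f' (W.obj.ρ k v) = W'.obj.ρ k (f' v) := fun k hk v =>
      repLin_comm f ⟨k, hk⟩ v
    refine ⟨repHom f' fun k v => ?_, rfl⟩
    obtain ⟨l, hl, h, hh, e⟩ := mem_sup_of_normal_right.1 k.2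
    obtain rfl : inclusion le_sup_left ⟨l, hl⟩ * inclusion le_sup_right ⟨h, hh⟩ = k := sext e
    have hlin : ∀ w, f' (W.obj.ρ (inclusion le_sup_left ⟨l, hl⟩) w) =
        W'.obj.ρ (inclusion le_sup_left ⟨l, hl⟩) (f' w) := fun w => by
      rw [hc.sub_apply (hψ.trans hφ) hb hL, hc.sub_apply (hψ.trans hφ) hb hL, map_smul]; congr 1
      exact hc.unip_natural (sub_base (hψ.trans hφ) hb W) (sub_base (hψ.trans hφ) hb W') _
        (fun b v => hf _ b.2.1.2 v) _ _
    rw [rep_mul, hlin, hf _ hh, rep_mul]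

include hc in
lemma exists_extension (hψ : θ.Extends ψ.1) (hφ : ψ.Extends φ) (hL : L ≤ N)
    (τ : RepLoc H° ψ) : ∃ W : RepLoc (L ⊔ H)° θ, Nonempty ((resLoc hψ).obj W ≅ τ) := by
  have hn := hc.1.normal_H
  have hu := sub_base hφ base_le_H τ
  let a : L →* Endℂ τ.obj :=
    { toFun := fun l => (θ.1 l : ℂ) • hc.unip hu (inclusion hL l)
      map_one' := by simp
      map_mul' := fun l l' => by
        simp only [map_mul, Units.val_mul, smul_mul_smul_comm] }
  have ha : ∀ l v, a l v = (θ.1 l : ℂ) • hc.unip hu (inclusion hL l) v := fun _ _ => rfl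
  obtain ⟨e, he1, he2⟩ := exists_sup_hom L H (fun l hl h hh => (hc.1.comm_NH (hL hl) hh).symm)
    a τ.obj.ρ (fun l h => by
      ext v; rw [mul_apply, mul_apply, ha, ha, hc.unip_sub, map_smul])
    (fun x hxL hxH => by
      ext v; have h1 := hc.sub_apply hφ base_le_H inf_le_left inf_le_right τ ⟨x, hL hxL, hxH⟩ v
      rw [ha, hψ.apply hxL (⟨hL hxL, hxH⟩ : x ∈ N ⊓ H)]; exact h1.symm)
  have he2' : ∀ h v, e (inclusion le_sup_right h) v = τ.obj.ρ h v := fun h v => by rw [he2]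
  have he1' : ∀ l v, e (inclusion le_sup_left l) v =
    (θ.1 l : ℂ) • hc.unip hu (inclusion hL l) v := fun l v => by rw [he1]; rfl
  let W : RepLoc (L ⊔ H)° θ := ⟨Rep.of (X := τ.obj) e, fun v =>
      isOpen_stab_of_isOpenMap e (inclusion le_sup_right) (isOpenMap_inclusion _ hc.1.isOpen_H) (by
          have := τ.property.1 v; simp only [he2']
          exact this), fun v => by
    obtain ⟨m, hm⟩ := hc.isUnipOver_smul_unip hu (inclusion hL)
      (e.comp (inclusion le_sup_left)) θ.1 he1' v
    exact ⟨m, fun k hk => hm ⟨k, hk⟩⟩⟩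
  exact ⟨W, ⟨repIso (X := (resLoc hψ).obj W) (Y := τ) (lid : τ.obj →ₗ[ℂ] τ.obj) he2' bijective_id⟩⟩

end CharData

open CharData (rep_base sub_base sub_base_H base_le_H)

namespace CharData

variable {θ : SmoothChar L}

lemma exists_mul_out_inv (K : Subgroup G) (g : G) :
    ∃ k : K, g = k * (((g⁻¹ : G) : G ⧸ K).out)⁻¹ := by
  obtain ⟨y, hy⟩ := mk_out_eq_mul K g⁻¹
  exact ⟨y, by rw [hy, mul_inv_rev, inv_inv, mul_inv_cancel_left]⟩

include hc in
lemma isLocally_smoothInd (hL : IsLagrangian N L) (hθ : θ.Consistent χ) (W : SmoothRep ↥(L ⊔ H))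
    (hW : isLocally (L ⊔ H)° θ W.obj) : isLocally idG χ ((smoothInd (L ⊔ H)°).obj W).obj := by
  intro x
  have hfin := hc.1.finiteIndex_H
  have := ofFinite (G ⧸ (L ⊔ H))
  choose m hm using hW
  refine ⟨Finset.univ.sup fun q : G ⧸ (L ⊔ H) => m (indFun x q.out⁻¹),
    fun (z : G) (hz : z ∈ Z[N]) => indFun_ext fun g => ?_⟩
  have hzL : z ∈ L := hL.center_le hz
  let zz : ↥(L ⊔ H) := ⟨z, (le_sup_left : L ≤ L ⊔ H) hzL⟩
  let t : Endℂ W.obj := W.obj.ρ zz - θ.val ⟨z, hzL⟩ • 1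
  have ht : ∀ v, t v = W.obj.ρ zz v - θ.val ⟨z, hzL⟩ • v := fun _ => rfl
  have h1 := map_pow_of_comm (indEval (f := (L ⊔ H)°) W g)
    (a := ((smoothInd (L ⊔ H)°).obj W).obj.ρ z - χ.val ⟨z, hz⟩ • 1) (b := t) (fun y => by
        have h2 : indFun y (g * z) = W.obj.ρ zz (indFun y g) := by
          rw [mem_center_iff.1 hz.2 g]; exact indFun_mul y zz g
        show indFun y (g * z) - χ.val ⟨z, hz⟩ • indFun y g =
          W.obj.ρ zz (indFun y g) - θ.val ⟨z, hzL⟩ • indFun y g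
        rw [hθ z hzL hz, h2]) (Finset.univ.sup fun q : G ⧸ (L ⊔ H) => m (indFun x q.out⁻¹)) x
  refine h1.trans ?_
  obtain ⟨k, hk⟩ := exists_mul_out_inv (L ⊔ H) g
  have h3 : indFun x g = W.obj.ρ k (indFun x ((g⁻¹ : G) : G ⧸ (L ⊔ H)).out⁻¹) := by
    conv_lhs => rw [hk]
    exact indFun_mul x k _
  have h4 : ∀ v, W.obj.ρ k (t v) = t (W.obj.ρ k v) := fun v => by
    rw [ht, ht, map_sub, map_smul, ← rep_mul, ← rep_mul,
      show k * zz = zz * k from sext (mem_center_iff.1 hz.2 k)]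
  show (t ^ _) (indFun x g) = 0
  have h5 := pow_apply_eq_zero_of_le (t := t) (hm _ zz hzL)
    (Finset.le_sup (f := fun q : G ⧸ (L ⊔ H) => m (indFun x q.out⁻¹)) (mem_univ ((g⁻¹ : G) : G ⧸ (L ⊔ H))))
  rw [h3, ← map_pow_of_comm (W.obj.ρ k) h4, h5, map_zero]

/-- The representation induced from a locally-`θ` representation of `L H`. -/
def indLoc (hL : IsLagrangian N L) (hθ : θ.Consistent χ) (W : RepLoc (L ⊔ H)° θ) : RepLoc idG χ :=
  ⟨((smoothInd (L ⊔ H)°).obj ((incl (L ⊔ H)° θ).obj W)).obj,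
    ((smoothInd (L ⊔ H)°).obj ((incl (L ⊔ H)° θ).obj W)).property,
    hc.isLocally_smoothInd hL hθ ((incl (L ⊔ H)° θ).obj W) W.property.2⟩

/-- Evaluation on the induced representation. -/
def indLocEval (hL : IsLagrangian N L) (hθ : θ.Consistent χ)
    (W : RepLoc (L ⊔ H)° θ) (g : G) : (hc.indLoc hL hθ W).obj →ₗ[ℂ] W.obj :=
  indEval (f := (L ⊔ H)°) ((incl (L ⊔ H)° θ).obj W) g

variable (hχ : χ.Extends φ) (hL : IsLagrangian N L) (hθ : θ.Consistent χ) (W : RepLoc (L ⊔ H)° θ)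

lemma indLocEval_rho (g x : G) (f : (hc.indLoc hL hθ W).obj) :
    hc.indLocEval hL hθ W x ((hc.indLoc hL hθ W).obj.ρ g f) = hc.indLocEval hL hθ W (x * g) f := rfl

lemma indLocEval_mul (k : ↥(L ⊔ H)) (x : G) (f : (hc.indLoc hL hθ W).obj) :
    hc.indLocEval hL hθ W (k * x) f = W.obj.ρ k (hc.indLocEval hL hθ W x f) :=
  indFun_mul (f := (L ⊔ H)°) (W := (incl (L ⊔ H)° θ).obj W) f k x

lemma indLoc_ext {f f' : (hc.indLoc hL hθ W).obj}
    (h : ∀ x, hc.indLocEval hL hθ W x f = hc.indLocEval hL hθ W x f') : f = f' :=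
  indFun_ext (f := (L ⊔ H)°) (W := (incl (L ⊔ H)° θ).obj W) h

lemma indLocEval_ssAct (hθφ : θ.Extends φ) (l : L) (g : G) (f : (hc.indLoc hL hθ W).obj) :
    (θ.1 l : ℂ) • hc.indLocEval hL hθ W g f = (hc.pair (inclusion hL.le l) g : ℂ) •
      hc.indLocEval hL hθ W g (hc.ssAct (rep_base hχ (hc.indLoc hL hθ W))
        (inclusion hL.le l) f) := by
  have hb : base H N ≤ L ⊔ H := base_le_H.trans le_sup_right
  have h1 : ∀ f', hc.indLocEval hL hθ W 1 (hc.ssAct (rep_base hχ (hc.indLoc hL hθ W))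
      (inclusion hL.le l) f') = (θ.1 l : ℂ) • hc.indLocEval hL hθ W 1 f' := by
    intro f'
    rw [ssAct_apply, indLocEval_rho]
    have h2 := hc.indLocEval_mul hL hθ W (inclusion le_sup_left l) 1
      (hc.unip (rep_base hχ (hc.indLoc hL hθ W)) (inclusion hL.le l)⁻¹ f')
    have h3 : hc.indLocEval hL hθ W 1
        (hc.unip (rep_base hχ (hc.indLoc hL hθ W)) (inclusion hL.le l)⁻¹ f') =
        hc.unip (sub_base hθφ hb W) (inclusion hL.le l)⁻¹ (hc.indLocEval hL hθ W 1 f') := by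
      refine hc.unip_natural _ (sub_base hθφ hb W) _ (fun b v => ?_) _ _
      have h4 := hc.indLocEval_mul hL hθ W (inclusion hb b) 1 v
      rw [mul_one] at h4; refine Eq.trans ?_ h4
      show hc.indLocEval hL hθ W 1 ((hc.indLoc hL hθ W).obj.ρ b v) = _
      rw [indLocEval_rho, one_mul]; rfl
    rw [mul_one, h3, hc.sub_apply hθφ hb hL.le, unip_apply_inv] at h2; rw [one_mul]; exact h2
  have h2 := h1 ((hc.indLoc hL hθ W).obj.ρ g f)
  rw [ssAct_rho, map_smul, indLocEval_rho, indLocEval_rho, one_mul] at h2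
  exact h2.symm

lemma nonempty_eigLH_indLoc_iso (hθφ : θ.Extends φ) :
    Nonempty ((hc.eigLH hχ hL (θ := θ)).obj (hc.indLoc hL hθ W) ≅ W) := by
  have hHop : IsOpen ((L ⊔ H : Subgroup G) : Set G) := isOpen_mono le_sup_right hc.1.isOpen_H
  let e : hc.eig (rep_base hχ (hc.indLoc hL hθ W)) hL.le θ.1 →ₗ[ℂ] W.obj :=
    hc.indLocEval hL hθ W 1 ∘ₗ Submodule.subtype _
  refine ⟨repIso (X := (hc.eigLH hχ hL (θ := θ)).obj (hc.indLoc hL hθ W)) (Y := W) e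
    (fun k v => ?_) ⟨(injective_iff_map_eq_zero e).2 fun f hf => sext ?_, fun w => ?_⟩⟩
  · have h1 := hc.indLocEval_mul hL hθ W k 1 v.1; rw [mul_one] at h1; refine Eq.trans ?_ h1
    show hc.indLocEval hL hθ W 1 ((hc.indLoc hL hθ W).obj.ρ k v.1) = _
    rw [indLocEval_rho, one_mul]
  · refine hc.indLoc_ext hL hθ W fun g => ?_
    by_cases hg : g ∈ L ⊔ H
    · have h1 := hc.indLocEval_mul hL hθ W ⟨g, hg⟩ 1 f.1
      rw [mul_one] at h1; refine h1.trans ?_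
      have hf' : hc.indLocEval hL hθ W 1 f.1 = 0 := hf
      rw [hf', map_zero]; exact (map_zero _).symm
    · obtain ⟨l, hl⟩ : ∃ l : L, hc.pairChar hL.le g l ≠ 1 := by
        by_contra! h
        exact hg ((hc.pairChar_eq_one_iff_mem hL g).1 (mext h))
      have h1 := hc.indLocEval_ssAct hχ hL hθ W hθφ l g f.1
      rw [(hc.mem_eig _ hL.le).1 f.2 l, map_smul, smul_comm, ← sub_eq_zero, ← smul_sub,
        smul_eq_zero_iff_right (Units.ne_zero _)] at h1
      rw [Submodule.coe_zero, map_zero]; by_contra h0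
      refine hl (uext (sub_eq_zero.1 ?_)).symm
      rw [← one_smul ℂ (hc.indLocEval hL hθ W g f.1), ← smul_assoc, ← sub_smul] at h1
      refine Eq.trans ?_ ((smul_eq_zero_iff_left h0).1 h1)
      rw [smul_eq_mul, mul_one]; rfl
  · classical
    let F : G → W.obj := fun g => if hg : g ∈ L ⊔ H then W.obj.ρ ⟨g, hg⟩ w else 0
    have hF1 : ∀ (g : G) (hg : g ∈ L ⊔ H), F g = W.obj.ρ ⟨g, hg⟩ w := fun g hg => dif_pos hg
    have hF0 : ∀ (g : G) (hg : g ∉ L ⊔ H), F g = 0 := fun g hg => dif_neg hg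
    have hFk : ∀ (k : ↥(L ⊔ H)) g, F (k * g) = W.obj.ρ k (F g) := fun k g => by
      by_cases hg : g ∈ L ⊔ H
      · rw [hF1 _ (mul_mem k.2 hg), hF1 g hg, ← rep_mul]; rfl
      · rw [hF0 _ (fun h => hg ((Subgroup.mul_mem_cancel_left _ k.2).1 h)), hF0 g hg, map_zero]
    let S : Subgroup ↥(L ⊔ H) :=
      { carrier := {k | W.obj.ρ k w = w}
        one_mem' := by simp
        mul_mem' := fun {a b} (ha : W.obj.ρ a w = w) (hb : W.obj.ρ b w = w) => by
          show W.obj.ρ (a * b) w = w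
          rw [rep_mul, hb, ha]
        inv_mem' := fun {a} (ha : W.obj.ρ a w = w) => by
          show W.obj.ρ a⁻¹ w = w
          conv_lhs => rw [← ha]
          rw [← rep_mul, inv_mul_cancel, map_one, one_apply] }
    have hS : IsOpen (S : Set ↥(L ⊔ H)) := W.property.1 w
    let f : (hc.indLoc hL hθ W).obj := indMk (f := (L ⊔ H)°)
      (W := (incl (L ⊔ H)° θ).obj W) F hFk (S.map (L ⊔ H)°)
      (hHop.isOpenMap_subtype_val _ hS) (by
        rintro _ ⟨k, hk, rfl⟩ g
        have hk' : W.obj.ρ k w = w := hk; by_cases hg : g ∈ L ⊔ H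
        · have h1 : F (g * k) = F g := by
            rw [hF1 _ (mul_mem hg k.2), hF1 g hg]
            conv_rhs => rw [← hk', ← rep_mul]
            rfl
          exact h1
        · have h1 : F (g * k) = F g := by
            rw [hF0 _ (fun h => hg ((Subgroup.mul_mem_cancel_right _ k.2).1 h)), hF0 g hg]
          exact h1)
    have hf : ∀ g, hc.indLocEval hL hθ W g f = F g := fun g => rfl
    refine ⟨⟨f, fun l => hc.indLoc_ext hL hθ W fun g => ?_⟩, ?_⟩
    · have h1 := hc.indLocEval_ssAct hχ hL hθ W hθφ l g f
      show hc.indLocEval hL hθ W g (hc.ssAct (rep_base hχ (hc.indLoc hL hθ W))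
        (inclusion hL.le l) f) = _
      rw [map_smul, h1]; by_cases hg : g ∈ L ⊔ H
      · have h2 := DFunLike.congr_fun ((hc.pairChar_eq_one_iff_mem hL g).2 hg) l
        have h3 : hc.pair (inclusion hL.le l) g = 1 := h2
        rw [h3, val_one, one_smul]
      · rw [hf, hF0 g hg, smul_zero] at h1; rw [← h1]
        exact ((smul_eq_zero_iff_right (Units.ne_zero _)).1 h1.symm)
    · show F 1 = w
      rw [hF1 1 (one_mem _)]; exact LinearMap.congr_fun (map_one W.obj.ρ) w

include hc hχ hL hθ in
lemma eigLH_essSurj (hθφ : θ.Extends φ) : (hc.eigLH hχ hL (θ := θ)).EssSurj where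
  mem_essImage W := ⟨hc.indLoc hL hθ W, hc.nonempty_eigLH_indLoc_iso hχ hL hθ W hθφ⟩

include hθ in
lemma eigLH_isEquivalence (hθφ : θ.Extends φ) : (hc.eigLH hχ hL (θ := θ)).IsEquivalence where
  faithful := hc.eigLH_faithful hχ hL hθ
  full := hc.eigLH_full hχ hL hθ
  essSurj := hc.eigLH_essSurj hχ hL hθ hθφ

include hc in
lemma resLoc_isEquivalence (hψ : θ.Extends ψ.1) (hφ : ψ.Extends φ) (hL : L ≤ N) :
    (resLoc (H := H) hψ).IsEquivalence where
  faithful := resLoc_faithful hψ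
  full := hc.resLoc_full hψ hφ hL
  essSurj := ⟨fun τ => hc.exists_extension hψ hφ hL τ⟩

end CharData

namespace LagrangianDatum

variable (D : LagrangianDatum H N ψ χ)

include hc in
lemma extends_psi : D.θ.Extends ψ.1 :=
  D.extends_right.extends (hc.1.le_lagrangian D.2)

lemma extends_chi : D.θ.Extends χ.1 := D.extends_left.extends D.2.center_le

variable (hψ : ψ.Extends φ)

include hc hψ in
lemma extends_base : D.θ.Extends φ := (D.extends_psi hc).trans hψ

include hc hψ D in
lemma hχ : χ.Extends φ := (D.extends_base hc hψ).restrict D.extends_chi fun _ hx => ⟨hx.1.1, hx.2⟩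

include hc in
lemma comm_H : ∀ k ∈ H, ∀ l ∈ D.L, k * l = l * k := fun _ hk _ hl =>
  hc.1.comm_NH (D.le hl) hk

/-- The `θ`-eigenspace as a representation of `L H`. -/
def eigLH : RepLoc idG χ ⥤ RepLoc (D.L ⊔ H).subtype D.θ := hc.eigLH (D.hχ hc hψ) D.2

/-- The `θ`-eigenspace as a representation of `H`. -/
def eig : RepLoc idG χ ⥤ RepLoc H° ψ :=
  hc.eigFunctor (D.hχ hc hψ) D.le (D.comm_H hc) (D.extends_psi hc)

/-- The restriction of the eigenspace from `L H` to `H`. -/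
def eigIso : D.eigLH hc hψ ⋙ CharData.resLoc (D.extends_psi hc) ≅ D.eig hc hψ :=
  ofComponents (fun π => repIso (lid : hc.eig (rep_base (D.hχ hc hψ) π) D.le D.θ.1 →ₗ[ℂ]
      hc.eig (rep_base (D.hχ hc hψ) π) D.le D.θ.1)
    (fun _ _ => rfl) bijective_id) fun _ => rfl

lemma eigLH_isEquivalence : (D.eigLH hc hψ).IsEquivalence :=
  hc.eigLH_isEquivalence (D.hχ hc hψ) D.2 D.extends_left (D.extends_base hc hψ)

include hψ in
lemma resLoc_isEquivalence : (CharData.resLoc (D.extends_psi hc)).IsEquivalence :=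
  hc.resLoc_isEquivalence (D.extends_psi hc) hψ D.le

lemma eig_isEquivalence : (D.eig hc hψ).IsEquivalence := by
  have := D.eigLH_isEquivalence hc hψ
  have := D.resLoc_isEquivalence hc hψ
  exact Functor.isEquivalence_of_iso (D.eigIso hc hψ)

/-- `π` is induced from its eigenspace. -/
def indEigIso : incl idG χ ≅
    D.eigLH hc hψ ⋙ incl (D.L ⊔ H).subtype D.θ ⋙ smoothInd (D.L ⊔ H).subtype :=
  hc.indEigIso (D.hχ hc hψ) D.2 D.extends_left

include hc hψ in
lemma exists_isLInd : ∃ F, D.IsLInd F := by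
  have := D.eig_isEquivalence hc hψ
  let E := (D.eig hc hψ).asEquivalence
  refine ⟨E.inverse, E.inverse ⋙ D.eigLH hc hψ, ⟨?_⟩, ⟨?_⟩⟩
  · exact fassoc _ _ _ ≪≫ isoWhiskerLeft E.inverse (isoWhiskerRight (D.eigIso hc hψ) (incl H° ψ)) ≪≫
      (fassoc _ _ _).symm ≪≫
      isoWhiskerRight E.counitIso (incl H° ψ) ≪≫ leftUnitor _
  · exact isoWhiskerLeft E.inverse (D.indEigIso hc hψ)

lemma IsLInd.nonempty_iso {D : LagrangianDatum H N ψ χ} (hF : D.IsLInd F) :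
    Nonempty (F ⋙ D.eig hc hψ ≅ 𝟭 _) := by
  obtain ⟨E, ⟨e1⟩, ⟨e2⟩⟩ := hF
  have := D.eig_isEquivalence hc hψ
  have := D.eigLH_isEquivalence hc hψ
  have := D.resLoc_isEquivalence hc hψ
  have : (incl H° ψ).Full := full_ιOfLE _
  have : (incl H° ψ).Faithful := faithful_ιOfLE _
  have : (incl idG χ).Full := full_ιOfLE _
  have : (incl idG χ).Faithful := faithful_ιOfLE _
  let R := CharData.resLoc (H := H) (D.extends_psi hc)
  let Q := D.eigLH hc hψ
  have i1 : E ⋙ R ≅ 𝟭 _ := (ofFullyFaithful (incl H° ψ)).whiskeringRight _ |>.preimageIso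
      (e1 ≪≫ (leftUnitor _).symm)
  have i2 : F ⋙ Q ≅ E := by
    let P := Q.asEquivalence
    have i3 : F ≅ E ⋙ P.inverse := (ofFullyFaithful (incl idG χ)).whiskeringRight _ |>.preimageIso
        (e2 ≪≫ isoWhiskerRight (rightUnitor E).symm _ ≪≫
          isoWhiskerRight (isoWhiskerLeft E P.counitIso.symm) _ ≪≫
          isoWhiskerLeft (E ⋙ P.inverse) (D.indEigIso hc hψ).symm)
    exact isoWhiskerRight i3 Q ≪≫ fassoc _ _ _ ≪≫ isoWhiskerLeft E P.counitIso ≪≫ rightUnitor E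
  exact ⟨isoWhiskerLeft F (D.eigIso hc hψ).symm ≪≫ (fassoc _ _ _).symm ≪≫
    isoWhiskerRight i2 R ≪≫ i1⟩

end LagrangianDatum

namespace CharData

variable (h : IsUnipOver φ (ρ.comp (base H N)°))
  {ρ' : Repn G V'} (h' : IsUnipOver φ (ρ'.comp (base H N)°))

lemma ssAct_mem_eig (hL : L ≤ N) {θ : L →* ℂˣ} {v : V} (hv : v ∈ hc.eig h hL θ) (n : N) :
    hc.ssAct h n v ∈ hc.eig h hL (θ * hc.pairChar hL (n : G)) :=
  hc.rho_mem_eig h hL (hc.unip_mem_eig h hL hv _) n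

lemma ssAct_rho_of_mem (n : N) {g : G} (hg : g ∈ H) (v : V) :
    hc.ssAct h n (ρ g v) = ρ g (hc.ssAct h n v) := by
  rw [ssAct_rho, (hc.pair_eq_one_iff n g).2 (hc.1.comm_NH n.2 hg), val_one, one_smul]

lemma eigProj_rho_of_mem (hL : L ≤ N) {θ : L →* ℂˣ} {g : G} (hg : g ∈ H) (v : V) :
    hc.eigProj h hL θ (ρ g v) = ρ g (hc.eigProj h hL θ v) := by
  have h1 := hc.eigProj_rho h hL (θ := θ) g v
  have h2 : θ * hc.pairChar hL g = θ := by
    rw [(hc.pairChar_eq_one_iff hL g).2 fun l hl => hc.1.comm_NH (hL hl) hg]; exact mul_one θ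
  rwa [h2] at h1

variable {L L' : Subgroup G} (hL : IsLagrangian N L) (hL' : IsLagrangian N L') {θ : L →* ℂˣ}
  {θ' : L' →* ℂˣ}

lemma exists_eigProj_eigProj (hθθ' : ∀ x (hx : x ∈ L) (hx' : x ∈ L'), θ ⟨x, hx⟩ = θ' ⟨x, hx'⟩) :
    ∃ c : ℂ, c ≠ 0 ∧ ∀ w ∈ hc.eig h hL.le θ,
      hc.eigProj h hL.le θ (hc.eigProj h hL'.le θ' w) = c • w := by
  classical
  have := hc.finiteIndex_center hL'.le
  set P := Z[N].subgroupOf L'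
  have := ofFinite (L' ⧸ P)
  refine ⟨(P.index : ℂ)⁻¹ * (Finset.univ.filter fun q : L' ⧸ P => (q.out : G) ∈ L).card,
    mul_ne_zero (inv_ne_zero (Nat.cast_ne_zero.2 index_ne_zero))
      (Nat.cast_ne_zero.2 (Finset.card_ne_zero.2 ⟨((1 : L') : L' ⧸ P), ?_⟩)), fun w hw => ?_⟩
  · rw [Finset.mem_filter]; refine ⟨mem_univ _, hL.center_le ?_⟩
    obtain ⟨y, hy⟩ := mk_out_eq_mul P 1; rw [hy, one_mul]; exact y.2
  · have h1 : hc.eigProj h hL'.le θ' w = (P.index : ℂ)⁻¹ • ∑ q : L' ⧸ P,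
        ((θ' q.out)⁻¹ : ℂˣ).val • hc.ssAct h (inclusion hL'.le q.out) w :=
      charProj_eq_sum P w
    have h2 : ∀ q : L' ⧸ P, hc.eigProj h hL.le θ
        (((θ' q.out)⁻¹ : ℂˣ).val • hc.ssAct h (inclusion hL'.le q.out) w) =
        if (q.out : G) ∈ L then w else 0 := by
      intro q; split_ifs with hq
      · have h3 := (hc.mem_eig h hL.le).1 hw ⟨q.out, hq⟩
        have h4 : inclusion hL'.le q.out = inclusion hL.le ⟨q.out, hq⟩ := rfl
        rw [h4, h3, hθθ' _ hq q.out.2, smul_smul, ← Units.val_mul, inv_mul_cancel, val_one,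
          one_smul, eigProj_of_mem hc hw]
      · rw [map_smul, eigProj_of_mem_of_ne hc (fun l hl => ?_) (fun heq => hq ?_)
          (hc.ssAct_mem_eig h hL.le hw (inclusion hL'.le q.out)), smul_zero]
        · rw [mmul_apply, hc.pairChar_of_mem_center hL.le _ hl.2, mul_one]
        · refine hL.mem_of_comm (hL'.le q.out.2) fun l hl => ?_
          refine ((hc.pairChar_eq_one_iff hL.le _).1 (mext fun l => ?_) l hl).symm
          have := DFunLike.congr_fun heq l
          rw [mmul_apply] at this; exact mul_eq_left.1 this
    rw [h1, map_smul, map_sum]; simp only [h2]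
    rw [← Finset.sum_filter, sum_const, ← Nat.cast_smul_eq_nsmul ℂ, smul_smul]

variable {h}

lemma eigProj_bijective (hθ : hc.IsCentralChar h hL.le θ) (hθ' : hc.IsCentralChar h hL'.le θ')
    (hθθ' : ∀ x (hx : x ∈ L) (hx' : x ∈ L'), θ ⟨x, hx⟩ = θ' ⟨x, hx'⟩) :
    Bijective (((hc.eigProj h hL'.le θ').restrict
      fun v _ => hθ'.eigProj_mem hc v) : hc.eig h hL.le θ →ₗ[ℂ] hc.eig h hL'.le θ') := by
  obtain ⟨c, hc0, hcw⟩ := hc.exists_eigProj_eigProj h hL hL' hθθ'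
  obtain ⟨c', hc0', hcw'⟩ := hc.exists_eigProj_eigProj h hL' hL
    (fun x hx hx' => (hθθ' x hx' hx).symm)
  refine ⟨(injective_iff_map_eq_zero _).2 fun v hv => sext ?_, fun w => ?_⟩
  · have h1 := hcw v.1 v.2; have h2 : hc.eigProj h hL'.le θ' v.1 = 0 := congrArg sval hv
    rw [h2, map_zero] at h1; exact (smul_eq_zero_iff_right hc0).1 h1.symm
  · refine ⟨⟨c'⁻¹ • hc.eigProj h hL.le θ w.1, Submodule.smul_mem _ _ (hθ.eigProj_mem hc _)⟩,
      sext ?_⟩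
    show hc.eigProj h hL'.le θ' (c'⁻¹ • hc.eigProj h hL.le θ w.1) = w.1
    rw [map_smul, hcw' w.1 w.2, smul_smul, inv_mul_cancel₀ hc0', one_smul]

lemma ssAct_bijective (hL : L ≤ N) {θ : L →* ℂˣ} (n : N) : Bijective (((hc.ssAct h n).restrict
      fun _ hv => hc.ssAct_mem_eig h hL hv n) : hc.eig h hL θ →ₗ[ℂ]
        hc.eig h hL (θ * hc.pairChar hL (n : G))) := by
  have hinv : ∀ (m : N) v, hc.ssAct h m (hc.ssAct h m⁻¹ v) = v := fun m v => by
    rw [← mul_apply, ← map_mul, mul_inv_cancel, map_one, one_apply]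
  have hinv' : ∀ (m : N) v, hc.ssAct h m⁻¹ (hc.ssAct h m v) = v := fun m v => by
    rw [← mul_apply, ← map_mul, inv_mul_cancel, map_one, one_apply]
  refine ⟨fun v w hvw => sext ?_, fun w => ?_⟩
  · have h1 : hc.ssAct h n v.1 = hc.ssAct h n w.1 := congrArg sval hvw
    rw [← hinv' n v.1, h1, hinv']
  · have h1 := hc.ssAct_mem_eig h hL w.2 n⁻¹
    have h2 : θ * hc.pairChar hL (n : G) * hc.pairChar hL ((n⁻¹ : N) : G) = θ :=
      mext fun l => by simp
    rw [h2] at h1; exact ⟨⟨_, h1⟩, sext (hinv n w.1)⟩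

end CharData

namespace LagrangianDatum

variable (D D' : LagrangianDatum H N ψ χ) (hψ : ψ.Extends φ)

include hc in
lemma θ_eq_of_mem_center {x : G} (hx : x ∈ N ⊓ centralizer (N : Set G))
    (hD : x ∈ D.L) (hD' : x ∈ D'.L) : D.θ.1 ⟨x, hD⟩ = D'.θ.1 ⟨x, hD'⟩ := by
  have hn : Z[N].Normal := by
    have := hc.1.normal_N; infer_instance
  rw [hc.1.center_eq_sup hc.genuine_inj, mem_sup_of_normal_right] at hx
  obtain ⟨a, ha, b, hb, rfl⟩ := hx
  have key : ∀ (E : LagrangianDatum H N ψ χ) (hE : a * b ∈ E.L),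
      E.θ.1 ⟨a * b, hE⟩ = ψ.1 ⟨a, ha⟩ * χ.1 ⟨b, hb⟩ := fun E hE => by
    rw [← (E.extends_psi hc).apply (hc.1.le_lagrangian E.isLagrangian ha) ha,
      ← E.extends_chi.apply (E.isLagrangian.center_le hb) hb, ← map_mul]
    rfl
  rw [key, key]

include hc in
lemma exists_conj : ∃ n : N, ∀ x (hx : x ∈ D.L) (hx' : x ∈ D'.L),
    (D.θ.1 * hc.pairChar D.le (n : G)) ⟨x, hx⟩ = D'.θ.1 ⟨x, hx'⟩ := by
  obtain ⟨g, hg, hgμ⟩ := hc.exists_pairChar (L := D.L ⊓ D'.L) (inf_le_left.trans D.le) N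
    ((D.θ.1.comp (inclusion inf_le_left))⁻¹ * D'.θ.1.comp (inclusion inf_le_right))
    (fun m hm => by
      have h1 := θ_eq_of_mem_center hc D D' (x := m)
        ⟨D.le m.2.1, mem_centralizer_iff.2 hm⟩ m.2.1 m.2.2
      rw [mmul_apply, minv_apply, inv_mul_eq_one]; exact h1)
  refine ⟨⟨g, hg⟩, fun x hx hx' => ?_⟩
  have h1 := DFunLike.congr_fun hgμ ⟨x, hx, hx'⟩
  rw [mmul_apply, minv_apply, inv_mul_eq_iff_eq_mul] at h1
  exact h1.symm

lemma nonempty_eig_iso : Nonempty (D.eig hc hψ ≅ D'.eig hc hψ) := by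
  obtain ⟨n, hn⟩ := exists_conj hc D D'
  let h := fun π : RepLoc idG χ => rep_base (D.hχ hc hψ) π
  have hθ := fun π => hc.isCentralChar (D.hχ hc hψ) D.le D.extends_left π
  have hθ' := fun π => hc.isCentralChar (D.hχ hc hψ) D'.2.le D'.extends_left π
  let T : ∀ π : RepLoc idG χ, hc.eig (h π) D.le D.θ.1 →ₗ[ℂ]
      hc.eig (h π) D'.2.le D'.θ.1 := fun π =>
    ((hc.eigProj (h π) D'.2.le D'.θ.1).restrict fun v _ => (hθ' π).eigProj_mem hc v :
        hc.eig (h π) D.le (D.θ.1 * hc.pairChar D.le (n : G)) →ₗ[ℂ] _) ∘ₗ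
    (hc.ssAct (h π) n).restrict fun _ hv => hc.ssAct_mem_eig (h π) D.le hv n
  have hT : ∀ π v, (T π v : π.obj) = hc.eigProj (h π) D'.2.le D'.θ.1
    (hc.ssAct (h π) n v.1) := fun _ _ => rfl
  refine ⟨ofComponents (fun π => repIso (X := (D.eig hc hψ).obj π)
    (Y := (D'.eig hc hψ).obj π) (T π) (fun k v => sext ?_) ?_) fun {π π'} f =>
      repHom_ext fun v => sext ?_⟩
  · show hc.eigProj (h π) D'.2.le D'.θ.1 (hc.ssAct (h π) n (π.obj.ρ k v.1)) =
      π.obj.ρ k (hc.eigProj (h π) D'.2.le D'.θ.1 (hc.ssAct (h π) n v.1))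
    rw [hc.ssAct_rho_of_mem _ _ k.2, hc.eigProj_rho_of_mem _ _ k.2]
  · exact (hc.eigProj_bijective D.2 D'.2 ((hθ π).mul_pairChar hc n) (hθ' π)
      hn).comp (hc.ssAct_bijective D.le n)
  · show hc.eigProj (h π') D'.2.le D'.θ.1 (hc.ssAct (h π') n (repLin f v.1)) =
      repLin f (hc.eigProj (h π) D'.2.le D'.θ.1 (hc.ssAct (h π) n v.1))
    rw [hc.map_eigProj (h π) (h π') _ _ (repLin_comm f),
      hc.ssAct_natural (h π) (h π') _ (repLin_comm f)]

end LagrangianDatum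

namespace IsLInd

variable (D : LagrangianDatum H N ψ χ) (hψ : ψ.Extends φ) {F F' : RepLoc H° ψ ⥤ RepLoc idG χ}

lemma comp_eig (hF : IsLInd H N ψ χ F) : Nonempty (F ⋙ D.eig hc hψ ≅ 𝟭 _) := by
  obtain ⟨D', hD'⟩ := hF
  obtain ⟨e⟩ := hD'.nonempty_iso hc hψ
  obtain ⟨e'⟩ := D.nonempty_eig_iso hc D' hψ
  exact ⟨isoWhiskerLeft F e' ≪≫ e⟩

lemma nonempty_iso_inverse (hF : IsLInd H N ψ χ F) {F₁ : RepLoc idG χ ⥤ RepLoc H° ψ}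
    (hF₁ : Nonempty (F₁ ⋙ F ≅ 𝟭 _)) : Nonempty (F₁ ≅ D.eig hc hψ) := by
  obtain ⟨e⟩ := hF.comp_eig hc D hψ
  obtain ⟨e₁⟩ := hF₁
  exact ⟨(rightUnitor _).symm ≪≫ isoWhiskerLeft F₁ e.symm ≪≫
    (fassoc _ _ _).symm ≪≫ isoWhiskerRight e₁ _ ≪≫ leftUnitor _⟩

lemma nonempty_eig_comp (hF : IsLInd H N ψ χ F) : Nonempty (D.eig hc hψ ⋙ F ≅ 𝟭 _) := by
  obtain ⟨e⟩ := hF.comp_eig hc D hψ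
  have := D.eig_isEquivalence hc hψ
  let E := (D.eig hc hψ).asEquivalence
  have e1 : F ≅ E.inverse := (rightUnitor _).symm ≪≫
    isoWhiskerLeft F E.unitIso ≪≫ (fassoc _ _ _).symm ≪≫
    isoWhiskerRight e _ ≪≫ leftUnitor _
  exact ⟨isoWhiskerLeft _ e1 ≪≫ E.unitIso.symm⟩

include hc hψ in
lemma isEquivalence (hF : IsLInd H N ψ χ F) : F.IsEquivalence := by
  obtain ⟨D, -⟩ := id hF
  obtain ⟨e⟩ := hF.comp_eig hc D hψ
  obtain ⟨e'⟩ := hF.nonempty_eig_comp hc D hψ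
  exact (CategoryTheory.Equivalence.mk F (D.eig hc hψ) e.symm e').isEquivalence_functor

include hc hψ in
lemma iso_of_comp_eig (hF : IsLInd H N ψ χ F) {C' : Type*} [Category C']
    {A B : C' ⥤ RepLoc idG χ}
    (h : Nonempty (A ⋙ D.eig hc hψ ≅ B ⋙ D.eig hc hψ)) : Nonempty (A ≅ B) := by
  obtain ⟨e⟩ := h
  obtain ⟨e'⟩ := hF.nonempty_eig_comp hc D hψ
  exact ⟨(rightUnitor _).symm ≪≫ isoWhiskerLeft A e'.symm ≪≫
    (fassoc _ _ _).symm ≪≫ isoWhiskerRight e F ≪≫ fassoc _ _ _ ≪≫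
    isoWhiskerLeft B e' ≪≫ rightUnitor _⟩

include hc hψ in
lemma nonempty_iso (hF : IsLInd H N ψ χ F) (hF' : IsLInd H N ψ χ F') : Nonempty (F ≅ F') := by
  obtain ⟨D, -⟩ := id hF
  obtain ⟨e⟩ := hF.comp_eig hc D hψ
  obtain ⟨e'⟩ := hF'.comp_eig hc D hψ
  exact hF.iso_of_comp_eig hc D hψ ⟨e ≪≫ e'.symm⟩

end IsLInd

lemma bijective_toModule_of_charSpace {M : Type*} [Group M] (P : Subgroup M) [P.FiniteIndex] (hM : ∀ a b : M, a * b = b * a)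
    {s : M →* Endℂ V} {θ₀ : M →* ℂˣ} (hs : ∀ p ∈ P, ∀ v, s p v = (θ₀ p : ℂ) • v)
    {I : Type*} [DecidableEq I] {W : I → Type*} [∀ i, AddCommGroup (W i)] [∀ i, Module ℂ (W i)]
    {Θ : I → M →* ℂˣ} (hΘ : Injective Θ) (hP : ∀ i, ∀ p ∈ P, Θ i p = θ₀ p)
    (hsurj : ∀ μ : M →* ℂˣ, (∀ p ∈ P, μ p = θ₀ p) → ∃ i, Θ i = μ) (j : ∀ i, W i →ₗ[ℂ] V)
    (hj : ∀ i, Injective (j i)) (hmem : ∀ i w, j i w ∈ charSpace s (Θ i))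
    (hrange : ∀ i, ∀ v ∈ charSpace s (Θ i), ∃ w, j i w = v) :
    Bijective (DirectSum.toModule ℂ I V j) := by
  have hn : P.Normal := ⟨fun n hn g => by rwa [hM g, mul_inv_cancel_right]⟩
  have hsP : ∀ i, ∀ p ∈ P, ∀ v, s p v = (Θ i p : ℂ) • v := fun i p hp v => by rw [hP i p hp, hs p hp]
  constructor
  · refine (injective_iff_map_eq_zero _).2 fun x hx => DFinsupp.ext fun k => hj k ?_
    have key : ∀ x, charProj P s (Θ k) (DirectSum.toModule ℂ I V j x) = j k (x k) := by
      intro x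
      induction x using DirectSum.induction_on with
      | zero => simp
      | of i w =>
        rw [← DirectSum.lof_eq_of ℂ, DirectSum.toModule_lof]; by_cases hik : i = k
        · subst hik; rw [charProj_of_mem P (hmem i w), DirectSum.lof_apply]
        · rw [charProj_of_mem_of_ne P (fun p hp => (hP i p hp).trans (hP k p hp).symm)
            (fun h => hik (hΘ h)) (hmem i w), DirectSum.lof_eq_of, DirectSum.of_eq_of_ne _ _ _ (Ne.symm hik),
            map_zero]
      | add x y hx hy => rw [map_add, map_add, hx, hy, DirectSum.add_apply, map_add]
    have h1 := key x; rw [hx, map_zero] at h1; rw [← h1]; exact (map_zero _).symm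
  · intro v; have := (finite_card_chars hM P).1
    have := ofFinite {ν : M →* ℂˣ // ∀ p ∈ P, ν p = 1}
    rw [← LinearMap.mem_range, ← sum_charProj P hM hs v]; refine Submodule.sum_mem _ fun ν _ => ?_
    obtain ⟨i, hi⟩ := hsurj (θ₀ * ν.1) fun p hp => by rw [mmul_apply, ν.2 p hp, mul_one]
    rw [← hi]; obtain ⟨w, hw⟩ := hrange i _ (charProj_mem P (hsP i) v)
    exact ⟨DirectSum.lof ℂ I W i w, by rw [DirectSum.toModule_lof, hw]⟩

section

variable (hL : IsLagrangian N L)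

include hc hL in
lemma CharData.exists_fin_equiv {d : ℕ} (hd : (center N).index = d ^ 2)
    (ψ : SmoothChar ↥(N ⊓ H)) (χ : SmoothChar Z[N]) (h : ψ.Consistent χ) :
    Nonempty (Fin d ≃ {θ : SmoothChar L // θ.Consistent χ ∧ θ.Consistent ψ}) := by
  have hε := hc.genuine_inj
  obtain ⟨⟨L', hL', θ₀, h1, h2⟩, rfl⟩ := hc.1.exists_extension_char hL ψ χ h
  dsimp only at h1 h2 ⊢
  have hcard := hc.1.relIndex_Z_lagrangian_eq hε hL hd
  have hn : Z[N].Normal := by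
    have := hc.1.normal_N; infer_instance
  obtain ⟨hf, hk⟩ := PairData.finite_consistentChars L'
    (N ⊓ centralizer (N : Set G)) (fun a ha b hb => hL.comm ha hb) (θ₀.restrict hL.Z_le)
    (fun ν hν => hc.1.locConst_of_trivial hε hL.le ν fun m hm =>
      hν m (PairData.center_le_Z ⟨hL.le m.2, hm⟩)) (hc.1.relIndex_Z_lagrangian hL) θ₀ fun _ _ _ => rfl
  rw [hcard] at hk
  let e : ConsistentChars L' (θ₀.restrict hL.Z_le) ≃
      {θ : SmoothChar L' // θ.Consistent χ ∧ θ.Consistent ψ} :=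
    Equiv.subtypeEquivRight fun θ => by
      constructor
      · exact fun hθ => ⟨fun x hx hx' => (hθ x hx (PairData.center_le_Z hx')).trans (h1 x hx hx'),
          fun x hx hx' => (hθ x hx (hc.1.inf_le_Z hx')).trans (h2 x hx hx')⟩
      · rintro ⟨h3, h4⟩ x hx hx'
        rw [hc.1.center_eq_sup hε, mem_sup_of_normal_right] at hx'
        obtain ⟨a, ha, b, hb, rfl⟩ := hx'
        have key : ∀ κ : SmoothChar L', κ.Consistent χ → κ.Consistent ψ →
            κ.val ⟨a * b, hx⟩ = ψ.val ⟨a, ha⟩ * χ.val ⟨b, hb⟩ := fun κ h3 h4 => by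
          rw [← h3 b (hL.center_le hb) hb, ← h4 a (hc.1.le_lagrangian hL ha) ha]
          simp only [SmoothChar.val]
          rw [← Units.val_mul, ← map_mul]; rfl
        exact (key θ h3 h4).trans (key θ₀ h1 h2).symm
  exact ⟨(Finite.equivFinOfCardEq hk).symm.trans e⟩

include hc in
lemma CharData.finite_card_center (ψ : SmoothChar ↥(N ⊓ H)) (χ : SmoothChar Z[N])
    (h : ψ.Consistent χ) : Finite (ConsistentChars Z[N] ψ) ∧ Nat.card (ConsistentChars Z[N] ψ) =
    (N ⊓ H ⊓ center G).relIndex Z[N] := by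
  have hε := hc.genuine_inj
  have h0 := hc.1.relIndex_base_ne_zero hε
  have h1 : (N ⊓ H).relIndex Z[N] = (N ⊓ H ⊓ center G).relIndex Z[N] := by
    rw [← inf_relIndex_right (N ⊓ H)]; congr 1
    ext x; simp only [mem_inf]; tauto
  rw [← h1]
  refine PairData.finite_consistentChars (_ ⊓ _ : Subgroup G) _
    (fun a _ b hb => mem_center_iff.1 hb.2 a) ψ (fun ν hν => ?_)
    (fun h2 => h0 (relIndex_eq_zero_of_le_right inf_le_left (h1 ▸ h2))) χ
    fun x hx hx' => (h x hx' hx).symm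
  exact locConst_of_open (P := H.subgroupOf _) ν
    (hc.1.isOpen_H.preimage csv) fun p hp => hν p ⟨p.2.1, hp⟩

include hc in
lemma CharData.finite_card_inf (ψ : SmoothChar ↥(N ⊓ H)) (χ : SmoothChar Z[N]) (h : ψ.Consistent χ)
    : Finite (ConsistentChars (N ⊓ H) χ) ∧ Nat.card (ConsistentChars (N ⊓ H) χ) =
    (N ⊓ H ⊓ center G).relIndex (N ⊓ H) := by
  have hε := hc.genuine_inj
  have h0 := hc.1.relIndex_base_ne_zero hε
  have h1 : Z[N].relIndex (N ⊓ H) = (N ⊓ H ⊓ center G).relIndex (N ⊓ H) := by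
    rw [← inf_relIndex_right Z[N]]; congr 1
    ext x; simp only [mem_inf]; tauto
  rw [← h1]
  refine PairData.finite_consistentChars (_ ⊓ _ : Subgroup G) _
    (fun a ha b hb => hc.1.comm_inf a ha b hb.1) χ (fun ν hν => ?_)
    (fun h2 => h0 (relIndex_eq_zero_of_le_right inf_le_left (h1 ▸ h2))) ψ h
  exact hc.1.locConst_of_trivial hε inf_le_left ν fun m hm => hν m ⟨m.2.1, hm⟩

end

namespace CharData

variable (hL : IsLagrangian N L) {W : SmoothRep H}
  (hW : IsUnipOver φ (W.obj.ρ.comp (inclusion base_le_H)))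

/-- Left translation by `L`, corrected by the unipotent action, on a representation induced
from `H`. -/
def leftAct : L →* Endℂ ((smoothInd H°).obj W).obj where
  toFun l := repLin (toSmoothInd (V := (smoothInd H°).obj W) (f := H°)
    (LinearMap.pi fun g => hc.unip hW (inclusion hL.le l)⁻¹ ∘ₗ indEval W (l * g))
    (fun x k g => by
      show hc.unip hW _ (indFun x (l * (k * g))) = W.obj.ρ k (hc.unip hW _ (indFun x (l * g)))
      rw [← mul_assoc, ← hc.1.comm_NH (hL.le l.2) k.2, mul_assoc, ← hc.unip_sub base_le_H hW]
      congr 1; exact indFun_mul x k _)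
    fun x g y => by
      show hc.unip hW _ (indFun (((smoothInd H°).obj W).obj.ρ g x) (l * y)) =
        hc.unip hW _ (indFun x (l * (y * g)))
      rw [indFun_rho, mul_assoc])
  map_one' := lext fun x => indFun_ext fun g => by
    show hc.unip hW (inclusion hL.le 1)⁻¹ (indFun x (((1 : L) : G) * g)) = indFun x g
    rw [map_one, inv_one, map_one, Subgroup.coe_one, one_mul, one_apply]
  map_mul' a b := lext fun x => indFun_ext fun g => by
    show hc.unip hW (inclusion hL.le (a * b))⁻¹ (indFun x (((a * b : L) : G) * g)) =
      hc.unip hW (inclusion hL.le a)⁻¹ (hc.unip hW (inclusion hL.le b)⁻¹ (indFun x (b * (a * g))))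
    rw [← mul_assoc, ← hL.comm a.2 b.2, map_mul, mul_inv_rev, unip_mul_apply, hc.unip_comm]; rfl

lemma indFun_leftAct (l : L) (x : ((smoothInd H°).obj W).obj) (g : G) :
    indFun (hc.leftAct hL hW l x) g = hc.unip hW (inclusion hL.le l)⁻¹ (indFun x (l * g)) := rfl

lemma mem_charSpace_leftAct {θ : L →* ℂˣ} {x : ((smoothInd H°).obj W).obj} :
    x ∈ charSpace (hc.leftAct hL hW) θ ↔ ∀ (l : L) g,
      indFun x (l * g) = (θ l : ℂ) • hc.unip hW (inclusion hL.le l) (indFun x g) := by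
  rw [mem_charSpace]
  refine forall_congr' fun l => ⟨fun h g => ?_, fun h => indFun_ext fun g => ?_⟩
  · have h1 : indFun (hc.leftAct hL hW l x) g = (θ l : ℂ) • indFun x g :=
      congrArg (fun y => indFun y g) h
    rw [indFun_leftAct] at h1; rw [← map_smul, ← h1, unip_apply_inv]
  · show indFun (hc.leftAct hL hW l x) g = (θ l : ℂ) • indFun x g
    rw [indFun_leftAct, h, map_smul, unip_inv_apply]

lemma leftAct_of_mem (hψ : ∀ b w, W.obj.ρ (inclusion inf_le_right b) w =
      (ψ.1 b : ℂ) • hc.unip hW (inclusion inf_le_left b) w)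
    (p : L) (hp : (p : G) ∈ N ⊓ H) (x : ((smoothInd H°).obj W).obj) :
    hc.leftAct hL hW p x = (ψ.1 ⟨p, hp⟩ : ℂ) • x := indFun_ext fun g => by
  show hc.unip hW (inclusion hL.le p)⁻¹ (indFun x (p * g)) = (ψ.1 ⟨p, hp⟩ : ℂ) • indFun x g
  have h1 : indFun x (p * g) = W.obj.ρ (inclusion inf_le_right ⟨p, hp⟩) (indFun x g) :=
    indFun_mul x ⟨p, hp.2⟩ g
  rw [h1, hψ, map_smul]
  congr 1
  exact hc.unip_inv_apply hW _ _

end CharData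

namespace LagrangianDatum

variable (D : LagrangianDatum H N ψ χ) (hψ : ψ.Extends φ) (e : F ⋙ D.eig hc hψ ≅ 𝟭 _)

/-- The map from Lagrangian induction to induction. -/
def toInd : F ⋙ incl idG χ ⟶ incl H° ψ ⋙ smoothInd H° :=
  Functor.whiskerLeft F (hc.toIndEig (D.hχ hc hψ) D.le (D.comm_H hc)
    D.extends_left (D.extends_psi hc)) ≫
    Functor.whiskerRight e.hom (incl H° ψ ⋙ smoothInd H°)

/-- The isomorphism of the eigenspace of the induced representation. -/
def eigTo (τ : RepLoc H° ψ) : hc.eig (rep_base (D.hχ hc hψ) (F.obj τ)) D.le D.θ.1 →ₗ[ℂ] τ.obj :=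
  repLin (e.hom.app τ)

/-- The inverse of the isomorphism `eigTo`. -/
def eigInv (τ : RepLoc H° ψ) : τ.obj →ₗ[ℂ] hc.eig (rep_base (D.hχ hc hψ) (F.obj τ)) D.le D.θ.1 :=
  repLin (e.inv.app τ)

lemma eigTo_eigInv (τ : RepLoc H° ψ) (w : τ.obj) :
    D.eigTo hc hψ e τ (D.eigInv hc hψ e τ w) = w := repLin_hom_inv (e.app τ) w

lemma eigInv_eigTo (τ : RepLoc H° ψ) (v : hc.eig (rep_base (D.hχ hc hψ) (F.obj τ)) D.le D.θ.1) :
    D.eigInv hc hψ e τ (D.eigTo hc hψ e τ v) = v := repLin_inv_hom (e.app τ) v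

lemma eigInv_comm (τ : RepLoc H° ψ) (h : H) (w : τ.obj) :
    (D.eigInv hc hψ e τ (τ.obj.ρ h w) : (F.obj τ).obj) = (F.obj τ).obj.ρ h (D.eigInv hc hψ e τ w) :=
  congrArg sval (repLin_comm (e.inv.app τ) h w)

/-- The function on `G` attached to a vector of the Lagrangian induction. -/
def toIndFun (τ : RepLoc H° ψ) (v : (F.obj τ).obj) (g : G) : τ.obj := D.eigTo hc hψ e τ (hc.projFun
    (hc.isCentralChar (D.hχ hc hψ) D.le D.extends_left (F.obj τ)) v g)

lemma toIndFun_injective (τ : RepLoc H° ψ) : Injective (D.toIndFun hc hψ e τ) := by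
  intro v v' h
  refine hc.projFun_injective (hc.isCentralChar (D.hχ hc hψ) D.le
    D.extends_left (F.obj τ)) (fun _ ha _ hb => D.2.comm ha hb) (funext fun g => ?_)
  have h1 := congrFun h g
  rw [toIndFun, toIndFun] at h1
  rw [← D.eigInv_eigTo hc hψ e τ (hc.projFun _ v g), h1, eigInv_eigTo]

lemma eigInv_unip (τ : RepLoc H° ψ) (n : N) (w : τ.obj) :
    (D.eigInv hc hψ e τ (hc.unip (sub_base_H hψ τ) n w) : (F.obj τ).obj) =
      hc.unip (rep_base (D.hχ hc hψ) (F.obj τ)) n (D.eigInv hc hψ e τ w) :=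
  hc.unip_natural (sub_base_H hψ τ) (rep_base (D.hχ hc hψ) (F.obj τ))
    (Submodule.subtype _ ∘ₗ D.eigInv hc hψ e τ)
    (fun b v => D.eigInv_comm hc hψ e τ (inclusion base_le_H b) v) n w

lemma toIndFun_mul (τ : RepLoc H° ψ) (v : (F.obj τ).obj) (l : D.L) (g : G) :
    D.toIndFun hc hψ e τ v (l * g) = (D.θ.1 l : ℂ) •
      hc.unip (sub_base_H hψ τ) (inclusion D.le l) (D.toIndFun hc hψ e τ v g) := by
  have h1 : D.eigInv hc hψ e τ (D.toIndFun hc hψ e τ v (l * g)) =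
      D.eigInv hc hψ e τ ((D.θ.1 l : ℂ) • hc.unip (sub_base_H hψ τ)
        (inclusion D.le l) (D.toIndFun hc hψ e τ v g)) := by
    refine sext ?_
    rw [map_smul, Submodule.coe_smul, eigInv_unip, toIndFun, toIndFun, eigInv_eigTo,
      eigInv_eigTo, CharData.projFun_mul _ _ _ (fun l' hl' => D.2.comm l.2 hl')]
    exact hc.rho_of_mem_eig _ _ (Subtype.prop _) l
  have h2 := congrArg (D.eigTo hc hψ e τ) h1
  rwa [eigTo_eigInv, eigTo_eigInv] at h2

lemma exists_toIndFun_eq (τ : RepLoc H° ψ) (x : G → τ.obj)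
    (hx : ∀ (l : D.L) g, x (l * g) = (D.θ.1 l : ℂ) •
      hc.unip (sub_base_H hψ τ) (inclusion D.le l) (x g))
    (hx' : ∀ (h : H) g, x (h * g) = τ.obj.ρ h (x g)) :
    ∃ v, D.toIndFun hc hψ e τ v = x := by
  have hn := hc.1.normal_H
  obtain ⟨v, hv⟩ := hc.projFun_surjective (hL := D.2)
    (hc.isCentralChar (D.hχ hc hψ) D.le D.extends_left (F.obj τ))
    (fun g => D.eigInv hc hψ e τ (x g)) (fun k hk g => by
      obtain ⟨l, hl, h, hh, rfl⟩ := mem_sup_of_normal_right.1 hk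
      have h1 : x (l * h * g) = _ := (congrArg x (mul_assoc l h g)).trans (hx ⟨l, hl⟩ (h * g))
      simp only [h1]
      rw [hx' ⟨h, hh⟩, map_smul, Submodule.coe_smul, eigInv_unip, eigInv_comm, rep_mul]
      refine (hc.rho_of_mem_eig (rep_base (D.hχ hc hψ) (F.obj τ)) D.le (θ := D.θ.1) ?_ ⟨l, hl⟩).symm
      have h5 := D.eigInv_comm hc hψ e τ ⟨h, hh⟩ (x g); rw [← h5]; exact Subtype.prop _)
  exact ⟨v, funext fun g => (congrArg (D.eigTo hc hψ e τ) (congrFun hv g)).trans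
    (D.eigTo_eigInv hc hψ e τ (x g))⟩

lemma toInd_injective (τ : RepLoc H° ψ) :
    Injective (repLin ((D.toInd hc hψ e).app τ)) := fun _ _ h =>
  D.toIndFun_injective hc hψ e τ (funext fun g => congrArg (fun y => indFun y g) h)

lemma toInd_mem (τ : RepLoc H° ψ) (v : (F.obj τ).obj) :
    repLin ((D.toInd hc hψ e).app τ) v ∈ charSpace (hc.leftAct D.2
      (W := (incl H° ψ).obj τ) (sub_base_H hψ τ)) D.θ.1 :=
  (hc.mem_charSpace_leftAct D.2 (W := (incl H° ψ).obj τ)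
    (sub_base_H hψ τ)).2 (D.toIndFun_mul hc hψ e τ v)

lemma exists_toInd_eq (τ : RepLoc H° ψ) (x : ((incl H° ψ ⋙ smoothInd H°).obj τ).obj)
    (hx : x ∈ charSpace (hc.leftAct D.2 (W := (incl H° ψ).obj τ)
      (sub_base_H hψ τ)) D.θ.1) :
    ∃ v, repLin ((D.toInd hc hψ e).app τ) v = x := by
  obtain ⟨v, hv⟩ := D.exists_toIndFun_eq hc hψ e τ (fun g => indFun x g)
    ((hc.mem_charSpace_leftAct D.2 (W := (incl H° ψ).obj τ)
      (sub_base_H hψ τ)).1 hx) (fun h g => indFun_mul x h g)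
  exact ⟨v, indFun_ext fun g => congrFun hv g⟩

end LagrangianDatum

section

include hc in
lemma CharData.isNatDirectSum_ind {d : ℕ} (hd : (center N).index = d ^ 2) (hψ : ψ.Extends φ)
    (hψχ : ψ.Consistent χ) (F : ∀ χ' : ConsistentChars Z[N] ψ, RepLoc H° ψ ⥤ RepLoc idG χ'.1)
    (hF : ∀ χ' : ConsistentChars Z[N] ψ, IsLInd H N ψ χ'.1 (F χ')) :
    IsNatDirectSum (incl H° ψ ⋙ smoothInd H°) (fun i : Fin d × ConsistentChars Z[N] ψ =>
        F i.2 ⋙ incl idG i.2.1) := by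
  obtain ⟨L, hL⟩ := hc.1.exists_lagrangian
  obtain ⟨D₀, rfl⟩ := hc.1.exists_extension_char hL ψ χ hψχ
  have he := fun χ' : ConsistentChars Z[N] ψ =>
    hc.exists_fin_equiv hL hd ψ χ'.1 fun x hx hx' => (χ'.2 x hx' hx).symm
  replace he := fun χ' => Classical.choice (he χ')
  let D : ∀ i : Fin d × ConsistentChars Z[N] ψ, LagrangianDatum H N ψ i.2.1 :=
    fun i => ⟨D₀.L, hL, (he i.2 i.1).1, (he i.2 i.1).2.1, (he i.2 i.1).2.2⟩
  have hE := fun i => Classical.choice ((hF i.2).comp_eig hc (D i) hψ)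
  have hfin : ((N ⊓ H).subgroupOf D₀.L).FiniteIndex := ⟨hc.1.relIndex_H_lagrangian hL⟩
  refine ⟨fun i => (D i).toInd hc hψ (hE i), fun τ => ?_⟩
  have hψ' : ∀ i p, p ∈ (N ⊓ H).subgroupOf D₀.L → (D i).θ.1 p = D₀.θ.1 p := fun i p hp =>
    uext (((D i).extends_right p p.2 hp).trans (D₀.extends_right p p.2 hp).symm)
  let _ : DecidableEq (Fin d × ConsistentChars Z[N] ψ) := fun a b => Classical.propDecidable (a = b)
  refine bijective_toModule_of_charSpace ((N ⊓ H).subgroupOf D₀.L)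
    (fun a b => sext (hL.comm a.2 b.2)) (θ₀ := D₀.θ.1)
    (s := hc.leftAct hL (W := (incl H° ψ).obj τ) (sub_base_H hψ τ))
    (fun p hp x => ?_) (Θ := fun i => (D i).θ.1) (fun i i' hii => ?_) hψ' (fun μ hμ => ?_) _
    (fun i => (D i).toInd_injective hc hψ (hE i) τ) (fun i => (D i).toInd_mem hc hψ (hE i) τ)
    (fun i => (D i).exists_toInd_eq hc hψ (hE i) τ)
  · have h1 : ((D₀.θ.1 p : ℂˣ) : ℂ) = ψ.1 ⟨p, hp⟩ := D₀.extends_right p p.2 hp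
    rw [h1]; exact hc.leftAct_of_mem hL (W := (incl H° ψ).obj τ) (sub_base_H hψ τ)
      (hc.sub_apply hψ base_le_H inf_le_left inf_le_right τ) p hp x
  · obtain ⟨k, χ'⟩ := i; obtain ⟨k', χ''⟩ := i'
    have h1 : (he χ' k).1 = (he χ'' k').1 := sext hii
    obtain rfl : χ' = χ'' := sext (SmoothChar.ext_val fun b => by
      rw [← (he χ' k).2.1 b (hL.center_le b.2) b.2, ← (he χ'' k').2.1 b (hL.center_le b.2) b.2, h1])
    rw [(he χ').injective (sext h1)]
  · have hμψ : ∀ m : ↥(N ⊓ H), μ (inclusion (hc.1.le_lagrangian hL) m) = ψ.1 m :=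
      fun m => (hμ (inclusion (hc.1.le_lagrangian hL) m) m.2).trans
        ((D₀.extends_psi hc).apply _ m.2)
    have hsm : IsLocallyConstant μ := locConst_of_restrict hc.1.isOpen_H
      (hc.1.le_lagrangian hL) (fun x hx => ⟨hL.le hx.1, hx.2⟩) ψ μ hμψ
    let θ : SmoothChar D₀.L := ⟨μ, hsm⟩
    let χ' : ConsistentChars Z[N] ψ := ⟨θ.restrict hL.center_le,
      fun x hx hx' => congrArg uval (hμψ ⟨x, hx'⟩)⟩
    refine ⟨⟨(he χ').symm ⟨θ, fun _ _ _ => rfl, fun x hx hx' =>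
      congrArg uval (hμψ ⟨x, hx'⟩)⟩, χ'⟩, ?_⟩
    show (he χ' ((he χ').symm _)).1.1 = μ
    rw [Equiv.apply_symm_apply]

/-- The inclusion of the eigenspace, for an inverse of Lagrangian induction. -/
def LagrangianDatum.toRes (D : LagrangianDatum H N ψ χ) (hψ : ψ.Extends φ)
    {R : RepLoc idG χ ⥤ RepLoc H° ψ} (e : R ≅ D.eig hc hψ) :
    R ⋙ incl H° ψ ⟶ incl idG χ ⋙ smoothRes H° csv :=
  Functor.whiskerRight e.hom (incl H° ψ) ≫
    { app := fun π => repHom (X := (incl H° ψ).obj ((D.eig hc hψ).obj π))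
        (Y := (incl idG χ ⋙ smoothRes H° csv).obj π)
        ((hc.eig (rep_base (D.hχ hc hψ) π) D.le D.θ.1).subtype)
        fun _ _ => rfl
      naturality := fun _ _ _ => rfl }

include hc in
lemma CharData.isNatDirectSum_res {d : ℕ} (hd : (center N).index = d ^ 2) (hχ : χ.Extends φ)
    (hψχ : ψ.Consistent χ)
    (R : ∀ ψ' : ConsistentChars (N ⊓ H) χ, RepLoc idG χ ⥤ RepLoc H° ψ'.1)
    (hR : ∀ (ψ' : ConsistentChars (N ⊓ H) χ) (D : LagrangianDatum H N ψ'.1 χ) (hψ' : ψ'.1.Extends φ),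
      Nonempty (R ψ' ≅ D.eig hc hψ')) :
    IsNatDirectSum (incl idG χ ⋙ smoothRes H° csv)
      (fun i : Fin d × ConsistentChars (N ⊓ H) χ => R i.2 ⋙ incl H° i.2.1) := by
  obtain ⟨L, hL⟩ := hc.1.exists_lagrangian
  obtain ⟨D₀, rfl⟩ := hc.1.exists_extension_char hL ψ χ hψχ
  have hψφ : ∀ ψ' : ConsistentChars (N ⊓ H) χ, ψ'.1.Extends φ := fun ψ' x hx =>
    ⟨hx.1, uext ((ψ'.2 x hx.1 (hχ.le hx)).trans (congrArg uval (hχ.apply _ hx)))⟩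
  have he := fun ψ' : ConsistentChars (N ⊓ H) χ => hc.exists_fin_equiv hL hd ψ'.1 χ ψ'.2
  replace he := fun χ' => Classical.choice (he χ')
  let D : ∀ i : Fin d × ConsistentChars (N ⊓ H) χ, LagrangianDatum H N i.2.1 χ :=
    fun i => ⟨D₀.L, hL, (he i.2 i.1).1, (he i.2 i.1).2.1, (he i.2 i.1).2.2⟩
  have hE := fun i => Classical.choice (hR i.2 (D i) (hψφ i.2))
  have hfin := hc.finiteIndex_center hL.le
  refine ⟨fun i => (D i).toRes hc (hψφ i.2) (hE i), fun π => ?_⟩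
  have hP : ∀ i p, p ∈ Z[N].subgroupOf D₀.L → (D i).θ.1 p = D₀.θ.1 p :=
    fun i p hp => uext (((D i).extends_left p p.2 hp).trans (D₀.extends_left p p.2 hp).symm)
  let E := fun i => (repLin ((hE i).hom.app π) : ((R i.2).obj π).obj →ₗ[ℂ]
    hc.eig (rep_base ((D i).hχ hc (hψφ i.2)) π) (D i).isLagrangian.le (D i).θ.1)
  have hEb : ∀ i, Bijective (E i) := fun i => repLin_bijective ((hE i).app π)
  let _ : DecidableEq (Fin d × ConsistentChars (N ⊓ H) χ) :=
    fun a b => Classical.propDecidable (a = b)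
  refine bijective_toModule_of_charSpace (Z[N].subgroupOf D₀.L)
    (fun a b => sext (hL.comm a.2 b.2)) (θ₀ := D₀.θ.1)
    (s := (hc.ssAct (rep_base hχ π)).comp (inclusion hL.le))
    (hc.isCentralChar hχ hL.le D₀.extends_left π) (Θ := fun i => (D i).θ.1)
    (fun i i' hii => ?_) hP (fun μ hμ => ?_) (fun i => (Submodule.subtype _) ∘ₗ E i)
    (fun i => Subtype.val_injective.comp (hEb i).1) (fun i w => (E i w).2)
    (fun i v hv => ?_)
  · obtain ⟨k, χ'⟩ := i; obtain ⟨k', χ''⟩ := i'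
    have h1 : (he χ' k).1 = (he χ'' k').1 := sext hii
    obtain rfl : χ' = χ'' := sext (SmoothChar.ext_val fun b => by
      rw [← (he χ' k).2.2 b (hc.1.le_lagrangian hL b.2) b.2,
        ← (he χ'' k').2.2 b (hc.1.le_lagrangian hL b.2) b.2, h1])
    rw [(he χ').injective (sext h1)]
  · have h1 : IsLocallyConstant (D₀.θ.1⁻¹ * μ) := hc.1.locConst_of_trivial
      hc.genuine_inj hL.le _ fun m hm => by
        rw [mmul_apply, minv_apply, hμ m ⟨hL.le m.2, hm⟩, inv_mul_cancel]
    let θ : SmoothChar D₀.L := D₀.θ * ⟨_, h1⟩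
    have hθ : θ.1 = μ := mul_inv_cancel_left D₀.θ.1 μ
    have hθχ : θ.Consistent χ := fun x hx hx' => by
      have h2 := hμ ⟨x, hx⟩ hx'
      rw [← hθ] at h2; exact (congrArg uval h2).trans (D₀.extends_left x hx hx')
    let ψ' : ConsistentChars (N ⊓ H) χ := ⟨θ.restrict (hc.1.le_lagrangian hL),
      fun x hx hx' => hθχ x (hc.1.le_lagrangian hL hx) hx'⟩
    refine ⟨⟨(he ψ').symm ⟨θ, hθχ, fun _ _ _ => rfl⟩, ψ'⟩, ?_⟩
    show (he ψ' ((he ψ').symm _)).1.1 = μ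
    rw [Equiv.apply_symm_apply]; exact hθ
  · obtain ⟨w, hw⟩ := (hEb i).2 ⟨v, hv⟩; exact ⟨w, congrArg sval hw⟩

end

section

lemma Representation.irr_iff_submodule {K V : Type*} [Group K] [AddCommGroup V]
    [Module ℂ V] (ρ : Repn K V) : ρ.IsIrreducible ↔ Nontrivial V ∧
      ∀ U : Submodule ℂ V, (∀ k, ∀ v ∈ U, ρ k v ∈ U) → U = ⊥ ∨ U = ⊤ := by
  constructor
  · intro h; refine ⟨?_, fun U hU => ?_⟩
    · by_contra hV
      rw [not_nontrivial_iff_subsingleton] at hV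
      exact bot_ne_top (α := Subrepresentation ρ) (toSubmodule_injective (Subsingleton.elim _ _))
    · exact (h.eq_bot_or_eq_top ⟨U, fun k v hv => hU k v hv⟩).imp
        (congrArg toSubmodule) (congrArg toSubmodule)
  · rintro ⟨hV, h⟩
    have : Nontrivial (Subrepresentation ρ) := ⟨⊥, ⊤, fun heq => by
      have h1 : (⊥ : Submodule ℂ V) = ⊤ := congrArg toSubmodule heq
      exact bot_ne_top h1⟩
    exact ⟨fun U => (h U.toSubmodule fun k v hv => U.apply_mem_toSubmodule k hv).imp
      (fun h => toSubmodule_injective h)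
      (fun h => toSubmodule_injective h)⟩

/-- An object without proper nonzero subobjects, expressed through morphisms. -/
def IsCatIrreducible {D : Type*} [Category D] (V : D) : Prop :=
  (∃ g h : V ⟶ V, g ≠ h) ∧ ∀ (X : D) (p : V ⟶ X), Mono p ∨ ∀ g h : V ⟶ V, g ≫ p = h ≫ p

lemma isCatIrreducible_map_iff {D D' : Type*} [Category D] [Category D'] (F : D ⥤ D')
    [F.IsEquivalence] (V : D) : IsCatIrreducible (F.obj V) ↔ IsCatIrreducible V := by
  constructor
  · rintro ⟨⟨g, h, hgh⟩, H⟩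
    refine ⟨⟨F.preimage g, F.preimage h, fun heq => hgh ?_⟩, fun X p => ?_⟩
    · rw [← F.map_preimage g, heq, F.map_preimage]
    · refine (H _ (F.map p)).imp (fun hm => F.mono_of_mono_map hm) fun h1 g h => F.map_injective ?_
      rw [F.map_comp, F.map_comp, h1]
  · rintro ⟨⟨g, h, hgh⟩, H⟩
    refine ⟨⟨F.map g, F.map h, fun heq => hgh (F.map_injective heq)⟩, fun X p => ?_⟩
    let e := F.objObjPreimageIso X
    have hp : p = F.map (F.preimage (p ≫ e.inv)) ≫ e.hom := by simp
    refine (H _ (F.preimage (p ≫ e.inv))).imp (fun hm => ?_) fun h1 g h => ?_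
    · have hm' : Mono (F.preimage (p ≫ e.inv)) := hm
      have : Mono (F.map (F.preimage (p ≫ e.inv))) := F.map_mono _
      rw [hp]; exact mono_comp _ _
    · rw [hp, ← F.map_preimage g, ← F.map_preimage h, ← F.map_comp_assoc, ← F.map_comp_assoc, h1]

variable {f : K →* G} {χ : SmoothChar B}

/-- A subrepresentation of a locally-`χ` representation. -/
def RepLoc.sub (V : RepLoc f χ) (U : Submodule ℂ V.obj)
    (hU : ∀ k, ∀ v ∈ U, V.obj.ρ k v ∈ U) : RepLoc f χ :=
  let r : Repn K U :=
    { toFun := fun k => (V.obj.ρ k).restrict (hU k)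
      map_one' := by ext; simp
      map_mul' := fun _ _ => by ext; simp }
  ⟨Rep.of r, fun v => by
    have h := V.property.1 v.1
    convert h using 1
    ext k
    exact Subtype.ext_iff, fun v => by
    obtain ⟨m, hm⟩ := V.property.2 v.1
    exact ⟨m, fun k hk => sext ((map_pow_of_comm U.subtype
      (a := r k - χ.val ⟨f k, hk⟩ • 1) (b := V.obj.ρ k - χ.val ⟨f k, hk⟩ • 1)
      (fun _ => rfl) m v).trans (hm k hk))⟩⟩

/-- A quotient of a locally-`χ` representation. -/
def RepLoc.quot (V : RepLoc f χ) (U : Submodule ℂ V.obj)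
    (hU : ∀ k, ∀ v ∈ U, V.obj.ρ k v ∈ U) : RepLoc f χ :=
  let r : Repn K (V.obj ⧸ U) :=
    { toFun := fun k => U.mapQ U (V.obj.ρ k) (hU k)
      map_one' := by ext; simp
      map_mul' := fun _ _ => by ext; simp }
  ⟨Rep.of r, fun v => by
    obtain ⟨w, rfl⟩ := U.mkQ_surjective v
    have h := isOpen_stab_of_le (Representation.prod V.obj.ρ r) (v := (w, 0)) (w := (0, U.mkQ w))
      (by simpa [Prod.ext_iff] using V.property.1 w) (fun k hk => by
        have hk' : V.obj.ρ k w = w := by simpa [Prod.ext_iff] using hk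
        have h1 : r k (U.mkQ w) = U.mkQ w := by
          show U.mkQ (V.obj.ρ k w) = U.mkQ w
          rw [hk']
        rw [Representation.prod_apply_apply, h1, map_zero])
    show IsOpen {k : K | r k (U.mkQ w) = U.mkQ w}
    simpa only [Representation.prod_apply_apply, Prod.ext_iff, map_zero, true_and] using h, fun v => by
    obtain ⟨w, rfl⟩ := U.mkQ_surjective v; obtain ⟨m, hm⟩ := V.property.2 w
    refine ⟨m, fun k hk => ?_⟩
    refine (map_pow_of_comm U.mkQ (a := V.obj.ρ k - χ.val ⟨f k, hk⟩ • 1)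
      (b := r k - χ.val ⟨f k, hk⟩ • 1) (fun _ => rfl) m w).symm.trans ?_
    rw [hm, map_zero]⟩

lemma RepLoc.isIrreducible_iff (V : RepLoc f χ) : V.obj.ρ.IsIrreducible ↔ IsCatIrreducible V := by
  rw [Representation.irr_iff_submodule]
  let z : V ⟶ V := repHom (0 : V.obj →ₗ[ℂ] V.obj) (by simp)
  have hz : ∀ v, repLin z v = 0 := fun _ => rfl
  constructor
  · rintro ⟨hV, H⟩
    refine ⟨⟨𝟙 V, z, fun heq => ?_⟩, fun X p => ?_⟩
    · obtain ⟨v, hv⟩ := exists_ne (0 : V.obj)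
      exact hv ((repLin_id v).symm.trans (congrArg (fun q => repLin q v) heq))
    · rcases H (LinearMap.ker (repLin p)) (fun k v hv => by
        rw [mem_ker] at hv ⊢
        rw [repLin_comm, hv, map_zero]) with h | h
      · refine Or.inl ⟨fun g h' heq => repHom_ext fun v => ?_⟩
        refine LinearMap.ker_eq_bot.1 h ?_
        exact congrArg (fun q => repLin q v) heq
      · refine Or.inr fun g h' => repHom_ext fun v => ?_
        have hp : ∀ w, repLin p w = 0 := fun w => mem_ker.1 (h ▸ Submodule.mem_top)
        rw [repLin_comp, repLin_comp, hp, hp]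
  · rintro ⟨⟨g, h, hgh⟩, H⟩
    refine ⟨?_, fun U hU => ?_⟩
    · by_contra hV
      rw [not_nontrivial_iff_subsingleton] at hV
      exact hgh (repHom_ext fun v => Subsingleton.elim _ _)
    · let p : V ⟶ V.quot U hU := repHom (Y := V.quot U hU) U.mkQ fun _ _ => rfl
      rcases H _ p with hp | hp
      · left
        let i : V.sub U hU ⟶ V := repHom (X := V.sub U hU) U.subtype fun _ _ => rfl
        let i' : V.sub U hU ⟶ V := repHom (X := V.sub U hU) (0 : U →ₗ[ℂ] V.obj) fun _ _ => (map_zero _).symm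
        have h1 : i = i' := by
          rw [← cancel_mono p]; refine repHom_ext fun v => ?_
          have h2 : U.mkQ v.1 = 0 := (Submodule.Quotient.mk_eq_zero _).2 v.2; exact h2
        refine (Submodule.eq_bot_iff _).2 fun v hv => ?_
        exact congrArg (fun q => repLin (X := V.sub U hU) (Y := V) q ⟨v, hv⟩) h1
      · right
        refine Submodule.eq_top_iff'.2 fun v => ?_
        have h1 := congrArg (fun q => repLin q v) (hp (𝟙 V) z)
        have h2 : U.mkQ v = U.mkQ 0 := h1
        rw [map_zero] at h2; exact (Submodule.Quotient.mk_eq_zero _).1 h2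

lemma RepLoc.isIrreducible_map_iff [IsTopologicalGroup K] {K' : Type u} [Group K']
    [TopologicalSpace K'] [IsTopologicalGroup K'] {f' : K' →* G}
    {χ' : SmoothChar B'} (F : RepLoc f χ ⥤ RepLoc f' χ') [F.IsEquivalence] (V : RepLoc f χ) :
    (F.obj V).obj.ρ.IsIrreducible ↔ V.obj.ρ.IsIrreducible := by
  rw [RepLoc.isIrreducible_iff, RepLoc.isIrreducible_iff, isCatIrreducible_map_iff]

end

namespace CharData

variable {s : base H N →* Endℂ V} (h : IsUnipOver φ s)

lemma unip_isLocUnip (n : N) : IsLocUnip (hc.unip h n) :=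
  hc.1.unipAct_isLocUnip _ h n

lemma unip_pow (n : N) : hc.unip h n ^ (base H N).relIndex N =
    ((φ (hc.1.basePow n))⁻¹ : ℂˣ).val • s (hc.1.basePow n) :=
  unipRoot_pow _ hc.relIndex_ne_zero

lemma eq_unip {n : N} {t : Endℂ V} (ht : IsLocUnip t) (h' : t ^ (base H N).relIndex N =
      ((φ (hc.1.basePow n))⁻¹ : ℂˣ).val • s (hc.1.basePow n)) : t = hc.unip h n :=
  eq_unipRoot _ hc.relIndex_ne_zero ht h'

lemma unip_twist {c φ' : base H N →* ℂˣ} (hc' : CharData C H N φ') (hφ' : φ' = φ * c)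
    {s' : base H N →* Endℂ V} (h' : IsUnipOver φ' s')
    (hs' : ∀ b, s' b = (c b : ℂ) • s b) (n : N) : hc'.unip h' n = hc.unip h n := by
  subst hφ'
  refine hc.eq_unip h (hc'.unip_isLocUnip h' n) ?_
  rw [hc'.unip_pow h', hs', smul_smul, ← Units.val_mul, mmul_apply, mul_inv, inv_mul_cancel_right]

lemma psEval_dual {V V' : Type*} [AddCommGroup V] [Module ℂ V] [AddCommGroup V'] [Module ℂ V']
    {x : Endℂ V} (hx : IsLocUnip x) {x' : Endℂ V'} (hx' : IsLocUnip x')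
    (ev : V' →ₗ[ℂ] Dual ℂ V) (hxx' : ∀ ξ v, ev (x' ξ) v = ev ξ (x v)) (p : PowerSeries ℂ)
    (ξ : V') (v : V) : ev (psEval x' hx' p ξ) v = ev ξ (psEval x hx p v) := by
  obtain ⟨m, hm⟩ := hx' ξ
  obtain ⟨m', hm'⟩ := hx v
  rw [psEval_apply hx' p (pow_apply_eq_zero_of_le hm (le_max_left m m')),
    psEval_apply hx p (pow_apply_eq_zero_of_le hm' (le_max_right m m'))]
  have hpow : ∀ (i : ℕ) ξ v, ev (((x' - 1) ^ i) ξ) v = ev ξ (((x - 1) ^ i) v) := by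
    intro i
    induction i with
    | zero => intro ξ v; rfl
    | succ i ih =>
      intro ξ v; rw [pow_succ', pow_succ, mul_apply, mul_apply, ← ih, lsub_apply,
        lsub_apply, map_sub, lsub_apply, hxx', map_sub]
      rfl
  generalize p.trunc (max m m') = q
  rw [Polynomial.aeval_eq_sum_range, Polynomial.aeval_eq_sum_range]
  simp only [LinearMap.sum_apply, map_sum, lsmul_apply, map_smul, hpow]

lemma unip_dual (hc' : CharData C H N φ⁻¹) {s' : base H N →* Endℂ V'} (h' : IsUnipOver φ⁻¹ s')
    (ev : V' →ₗ[ℂ] Dual ℂ V) (hs' : ∀ b ξ v, ev (s' b ξ) v = ev ξ (s b⁻¹ v)) (n : N) (ξ : V')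
    (v : V) : ev (hc'.unip h' n ξ) v = ev ξ (hc.unip h n⁻¹ v) := by
  refine psEval_dual (h.isLocUnip (hc.1.basePow n⁻¹))
    (h'.isLocUnip (hc'.data.basePow n)) ev (fun ξ v => ?_) _ ξ v
  have h1 : hc.1.basePow n⁻¹ = (hc'.data.basePow n)⁻¹ := sext (inv_pow (n : G) _)
  rw [h1, lsmul_apply, lsmul_apply, map_smul, map_smul, lsmul_apply, hs', map_inv φ, minv_apply]

end CharData

lemma rep_inv_apply (ρ : Repn K V) (k : K) (v : V) : ρ k⁻¹ (ρ k v) = v := by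
  rw [← rep_mul, inv_mul_cancel, map_one, one_apply]

lemma rep_apply_inv (ρ : Repn K V) (k : K) (v : V) : ρ k (ρ k⁻¹ v) = v := by
  rw [← rep_mul, mul_inv_cancel, map_one, one_apply]

namespace LagrangianDatum

variable (D : LagrangianDatum H N ψ χ) (hψ : ψ.Extends φ) (hB : (N ⊓ H).Normal) (g : G)

lemma _root_.SmoothChar.conj_val (hB : B.Normal) (κ : SmoothChar B) (g : G)
    (b : B) : (κ.conj hB g).1 b = κ.1 ⟨g * b * g⁻¹, hB.conj_mem b b.2 g⟩ := rfl

lemma conj_of_mem_center {x : G} (hx : x ∈ center G) (g : G) : g * x * g⁻¹ = x := by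
  rw [mem_center_iff.1 hx g, mul_inv_cancel_right]

/-- The conjugate datum. -/
def conj : LagrangianDatum H N (ψ.conj hB g) χ where
  L := D.L
  isLagrangian := D.2
  θ := D.θ.conj (hc.1.lagrangian_normal D.2) g
  extends_left x hx hx' := by
    refine (congrArg uval ?_).trans (D.extends_left x hx hx')
    rw [SmoothChar.conj_val]; exact congrArg D.θ.1 (sext (conj_of_mem_center hx'.2 g))
  extends_right x hx hx' := D.extends_right _ _ _

include hψ in
omit hc D in
lemma conj_extends : (ψ.conj hB g).Extends φ := fun x hx => ⟨hx.1, by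
  rw [← hψ.apply hx.1 hx, SmoothChar.conj_val]
  exact congrArg ψ.1 (sext (conj_of_mem_center hx.2 g))⟩

include hψ in
lemma conj_mul_pairChar :
    (D.θ.conj (hc.1.lagrangian_normal D.2) g).1 * hc.pairChar D.le g =
      D.θ.1 := mext fun l => by
  rw [mmul_apply]
  have h1 : hc.pairChar D.le g l = D.θ.1 ⟨l * g * (l : G)⁻¹ * g⁻¹,
      hc.1.C_le_lagrangian D.2 (hc.1.comm_mem l (D.le l.2) g)⟩ :=
    ((D.extends_base hc hψ).apply _ (hc.1.C_le_base (hc.1.comm_mem l (D.le l.2) g))).symm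
  have h2 : (D.θ.conj (hc.1.lagrangian_normal D.2) g).1 l = D.θ.1 ⟨g * l * g⁻¹,
    (hc.1.lagrangian_normal D.2).conj_mem l l.2 g⟩ := rfl
  rw [h1, h2, mul_comm, ← map_mul]
  refine congrArg D.θ.1 (sext ?_)
  show l * g * (l : G)⁻¹ * g⁻¹ * (g * l * g⁻¹) = (l : G)
  group

lemma nonempty_conj_eig_iso (hH : H.Normal) (hψ' : (ψ.conj hB g).Extends φ) :
    Nonempty ((D.conj hc hB g).eig hc hψ' ≅ D.eig hc hψ ⋙ RepLoc.conj hH hB ψ g) := by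
  let h := fun π : RepLoc idG χ => rep_base (D.hχ hc hψ) π
  have hmem : ∀ π v, v ∈ hc.eig (h π) D.le (D.θ.conj (hc.1.lagrangian_normal D.2) g).1 ↔
      π.obj.ρ g v ∈ hc.eig (h π) D.le D.θ.1 := fun π v => by
    rw [← hc.rho_mem_eig_iff (h π) D.le g, D.conj_mul_pairChar hc hψ g]
  let T : ∀ π : RepLoc idG χ, hc.eig (h π) D.le
        (D.θ.conj (hc.1.lagrangian_normal D.2) g).1 →ₗ[ℂ]
      hc.eig (h π) D.le D.θ.1 := fun π =>
    (π.obj.ρ g).restrict fun v hv => (hmem π v).1 hv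
  have hT : ∀ π v, (T π v : π.obj) = π.obj.ρ g v.1 := fun _ _ => rfl
  refine ⟨ofComponents (fun π => repIso (X := ((D.conj hc hB g).eig hc hψ').obj π)
    (Y := (D.eig hc hψ ⋙ RepLoc.conj hH hB ψ g).obj π) (T π) (fun k v => sext ?_)
    ⟨fun v w hvw => sext ?_, fun w => ?_⟩) fun {π π'} f =>
      repHom_ext fun v => sext ?_⟩
  · show π.obj.ρ g (π.obj.ρ k v.1) = π.obj.ρ (g * k * g⁻¹) (π.obj.ρ g v.1)
    rw [← rep_mul, ← rep_mul, inv_mul_cancel_right]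
  · have h1 : π.obj.ρ g v.1 = π.obj.ρ g w.1 := congrArg sval hvw
    have h2 := congrArg (π.obj.ρ g⁻¹) h1
    rwa [← rep_mul, ← rep_mul, inv_mul_cancel, map_one] at h2
  · have h1 : π.obj.ρ g (π.obj.ρ g⁻¹ w.1) = w.1 := by
      rw [← rep_mul, mul_inv_cancel, map_one, one_apply]
    exact ⟨⟨π.obj.ρ g⁻¹ w.1, (hmem π _).2 (h1.symm ▸ w.2)⟩, sext h1⟩
  · exact (repLin_comm f g v.1).symm

end LagrangianDatum

section

variable (hψ : ψ.Extends φ)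

include hc hψ in
lemma IsLInd.nonempty_conj_iso (hH : H.Normal) (hB : (N ⊓ H).Normal) (g : G)
    {F' : RepLoc H° (ψ.conj hB g) ⥤ RepLoc idG χ} (hF : IsLInd H N ψ χ F)
    (hF' : IsLInd H N (ψ.conj hB g) χ F') : Nonempty (RepLoc.conj hH hB ψ g ⋙ F' ≅ F) := by
  obtain ⟨D, -⟩ := id hF
  have hψ' := LagrangianDatum.conj_extends hψ hB g
  obtain ⟨e⟩ := hF.comp_eig hc D hψ
  obtain ⟨e'⟩ := hF'.comp_eig hc (D.conj hc hB g) hψ'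
  obtain ⟨i⟩ := D.nonempty_conj_eig_iso hc hψ hB g hH hψ'
  exact hF'.iso_of_comp_eig hc (D.conj hc hB g) hψ' ⟨fassoc _ _ _ ≪≫
    isoWhiskerLeft _ e' ≪≫ rightUnitor _ ≪≫ (leftUnitor _).symm ≪≫
    isoWhiskerRight e.symm _ ≪≫ fassoc _ _ _ ≪≫ isoWhiskerLeft F i.symm⟩

include hc in
lemma CharData.map_conj_of_mem (hH : H.Normal) {g : G} (hg : g ∈ N ⊔ H) (c : SmoothCls H) :
    SmoothCls.map (smoothConj hH g) c = c := by
  induction c using inductionOn with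
  | _ V =>
  obtain ⟨n, hn, h, hh, rfl⟩ := mem_sup_of_normal_right.1 hg
  refine sound ⟨Iso.symm (repIso (X := V) (Y := (smoothConj hH (n * h)).obj V)
    (V.obj.ρ ⟨h, hh⟩) (fun k v => ?_) ⟨fun v w hvw => ?_, fun w => ?_⟩)⟩
  · show V.obj.ρ ⟨h, hh⟩ (V.obj.ρ k v) = V.obj.ρ ⟨n * h * k * (n * h)⁻¹, _⟩ (V.obj.ρ ⟨h, hh⟩ v)
    rw [← rep_mul, ← rep_mul]; refine congrArg (fun x => V.obj.ρ x v) (sext ?_)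
    show h * k = n * h * k * (n * h)⁻¹ * h
    have h1 := hc.1.comm_NH hn (mul_mem (mul_mem hh k.2) (inv_mem hh))
    have h2 : n * h * k * (n * h)⁻¹ * h = n * (h * k * h⁻¹) * n⁻¹ * h := by group
    rw [h2, ← h1]; group
  · exact (rep_inv_apply V.obj.ρ ⟨h, hh⟩ v).symm.trans
      ((congrArg (V.obj.ρ (⟨h, hh⟩ : H)⁻¹) hvw).trans (rep_inv_apply V.obj.ρ ⟨h, hh⟩ w))
  · exact ⟨V.obj.ρ (⟨h, hh⟩ : H)⁻¹ w, rep_apply_inv V.obj.ρ ⟨h, hh⟩ w⟩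

/-- A locally-`ψ` representation is locally-`φ` for a character `φ` that `ψ` extends. -/
def RepLoc.weaken {f : K →* G} (h : κ.Extends κ'.1) (V : RepLoc f κ) : RepLoc f κ' :=
  ⟨V.obj, V.property.1, fun v => by
    obtain ⟨m, hm⟩ := V.property.2 v; refine ⟨m, fun k hk => ?_⟩
    have h1 : κ'.val ⟨f k, hk⟩ = κ.val ⟨f k, h.le hk⟩ := congrArg uval (h.apply _ hk).symm
    rw [h1]; exact hm k _⟩

lemma RepLoc.mem_irrLoc {f : K →* G} (h : κ.Extends κ'.1)
    (V : RepLoc f κ) (hV : V.obj.ρ.IsIrreducible) : ((incl f κ).obj V).cls ∈ IrrLoc f κ' :=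
  ⟨V.weaken h, hV, rfl⟩

include hc in
lemma CharData.exists_conj_eq (hB : (N ⊓ H).Normal) (hψ : ψ.Extends φ)
    {ψ' : SmoothChar ↥(N ⊓ H)} (hψ' : ψ'.Extends φ) : ∃ g : G, ψ' = ψ.conj hB g := by
  obtain ⟨g, -, hg⟩ := hc.exists_pairChar (L := N ⊓ H) inf_le_left ⊤ (ψ'.1⁻¹ * ψ.1) (fun m hm => by
    have hm' : (m : G) ∈ base H N := ⟨m.2, mem_center_iff.2 fun g => hm g trivial⟩
    rw [mmul_apply, minv_apply, hψ.apply m.2 hm', hψ'.apply m.2 hm', inv_mul_cancel])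
  refine ⟨g, sext (mext fun b => ?_)⟩
  have hb := hc.1.comm_mem b b.2.1 g
  have h1 : (ψ'.1 b)⁻¹ * ψ.1 b = φ ⟨_, hc.1.C_le_base hb⟩ := DFunLike.congr_fun hg b
  rw [← hψ.apply (hc.1.C_le_base hb).1 (hc.1.C_le_base hb), inv_mul_eq_iff_eq_mul,
    mul_comm, ← inv_mul_eq_iff_eq_mul, ← map_inv, ← map_mul] at h1
  rw [← h1]
  refine congrArg ψ.1 (sext ?_)
  show (b * g * (b : G)⁻¹ * g⁻¹)⁻¹ * (b : G) = g * b * g⁻¹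
  group

include hc in
lemma CharData.range_mem_conjOrbits (hχ : χ.Extends φ) (hψχ : ψ.Consistent χ) (hH : H.Normal)
    (hB : (N ⊓ H).Normal) (κ : SmoothChar (base H N)) (hκ : κ.1 = φ)
    (R : ∀ ψ' : ConsistentChars (N ⊓ H) χ, RepLoc idG χ ⥤ RepLoc H° ψ'.1)
    (hR : ∀ (ψ' : ConsistentChars (N ⊓ H) χ) (D : LagrangianDatum H N ψ'.1 χ)
      (hψ' : ψ'.1.Extends φ), Nonempty (R ψ' ≅ D.eig hc hψ'))
    (π : RepLoc idG χ) (hπ : π.obj.ρ.IsIrreducible) :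
    Set.range (fun ψ' : ConsistentChars (N ⊓ H) χ =>
      ((incl H° ψ'.1).obj ((R ψ').obj π)).cls) ∈ conjOrbits hH κ := by
  have hψφ : ∀ ψ' : SmoothChar ↥(N ⊓ H), ψ'.Consistent χ → ψ'.Extends φ := fun ψ' h x hx =>
    ⟨hx.1, uext ((h x hx.1 (hχ.le hx)).trans (congrArg uval (hχ.apply _ hx)))⟩
  have hψ := hψφ ψ hψχ
  obtain ⟨L, hL⟩ := hc.1.exists_lagrangian
  obtain ⟨D, -⟩ := hc.1.exists_extension_char hL ψ χ hψχ
  have := D.eig_isEquivalence hc hψ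
  have key : ∀ (g : G) (h : (ψ.conj hB g).Consistent χ),
      ((incl H° _).obj ((R ⟨ψ.conj hB g, h⟩).obj π)).cls =
      SmoothCls.map (smoothConj hH g) ((incl H° ψ).obj ((D.eig hc hψ).obj π)).cls := fun g h => by
    obtain ⟨i⟩ := hR ⟨ψ.conj hB g, h⟩ (D.conj hc hB g) (hψφ _ h)
    obtain ⟨i'⟩ := D.nonempty_conj_eig_iso hc hψ hB g hH (hψφ _ h)
    exact sound ⟨(incl H° _).mapIso ((i ≪≫ i').app π)⟩
  refine ⟨((incl H° ψ).obj ((D.eig hc hψ).obj π)).cls, ?_, Set.ext fun c => ?_⟩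
  · refine RepLoc.mem_irrLoc (κ' := κ) (hκ ▸ hψ) _ ?_
    exact (RepLoc.isIrreducible_map_iff (D.eig hc hψ) π).2 hπ
  · constructor
    · rintro ⟨g, rfl⟩
      have h : (ψ.conj hB g).Consistent χ := fun x hx hx' => by
        have hx2 : x ∈ base H N := ⟨hx, hx'.2⟩
        exact congrArg uval (((LagrangianDatum.conj_extends hψ hB g).apply hx hx2).trans
          (hχ.apply hx' hx2).symm)
      exact ⟨⟨_, h⟩, key g h⟩
    · rintro ⟨⟨ψ', h⟩, rfl⟩
      obtain ⟨g, rfl⟩ := hc.exists_conj_eq hB hψ (hψφ ψ' h); exact ⟨g, (key g h).symm⟩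

end

namespace CharData

variable (ω : SmoothChar G)

include hc in
lemma twist (hω : ∀ c ∈ C, ω.1 c = 1) : CharData C H N (φ * ω.1.comp (base H N)°) where
  data := hc.data
  injective c hC h := hc.injective c hC (by
    rw [mmul_apply, mcomp_apply] at h
    have h1 : ω.1 ((base H N)° ⟨c, hc.1.C_le_base hC⟩) = 1 := hω c hC
    rwa [h1, mul_one] at h)

variable (h : IsUnipOver φ (ρ.comp (base H N)°)) {ρ' : Repn G V}
  (hρ' : ∀ g v, ρ' g v = ω.val g • ρ g v) (hc' : CharData C H N (φ * ω.1.comp (base H N)°))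
  (h' : IsUnipOver (φ * ω.1.comp (base H N)°) (ρ'.comp (base H N)°))

include hρ' in
lemma ssAct_twist (n : N) (v : V) : hc'.ssAct h' n v = ω.val n • hc.ssAct h n v := by
  rw [ssAct_apply, ssAct_apply, hρ', hc.unip_twist h (c := ω.1.comp (base H N)°) hc' rfl h'
    (fun b => lext fun v => hρ' b v)]

include hρ' in
lemma mem_eig_twist (hL : L ≤ N) (θ : SmoothChar L) {v : V} :
    v ∈ hc'.eig h' hL (θ * ω.res L).1 ↔ v ∈ hc.eig h hL θ.1 := by
  rw [mem_eig, mem_eig]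
  refine forall_congr' fun l => ?_
  rw [hc.ssAct_twist ω h hρ' hc' h']
  have h1 : (((θ * ω.res L).1 l : ℂˣ) : ℂ) = ω.val (l : G) * θ.1 l := by
    rw [mul_comm]; rfl
  rw [h1, mul_smul]
  exact (smul_right_injective V (Units.ne_zero (ω.1 (l : G)))).eq_iff

end CharData

section

variable (D : LagrangianDatum H N ψ χ) (hψ : ψ.Extends φ) (ω : SmoothChar G)

lemma SmoothChar.Extends.twist {P : Subgroup G} {α : P →* ℂˣ}
    (h : κ.Extends α) : (κ * ω.res B).Extends (α * ω.1.comp P°) := fun x hx =>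
  ⟨h.le hx, congrArg (· * ω.1 x) (h.apply _ hx)⟩

lemma SmoothChar.Consistent.twist
    (h : κ.Consistent κ') : (κ * ω.res B).Consistent (κ' * ω.res B') := fun x hx hx' => by
  have h1 : κ.val ⟨x, hx⟩ * ω.val x = κ'.val ⟨x, hx'⟩ * ω.val x := by rw [h]
  exact h1

/-- The twisted datum. -/
def LagrangianDatum.twist : LagrangianDatum H N (ψ * ω.res (N ⊓ H)) (χ * ω.res Z[N]) where
  L := D.L
  isLagrangian := D.2
  θ := D.θ * ω.res D.L
  extends_left := D.extends_left.twist ω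
  extends_right := D.extends_right.twist ω

variable (hc' : CharData C H N (φ * ω.1.comp (base H N)°))

lemma LagrangianDatum.nonempty_twist_eig_iso : Nonempty (RepLoc.twist (hid G) continuous_id χ ω ⋙
        (D.twist ω).eig hc' (hψ.twist ω) ≅
      D.eig hc hψ ⋙ RepLoc.twist H° csv ψ ω) := by
  let h := fun π : RepLoc idG χ => rep_base (D.hχ hc hψ) π
  let h' := fun π : RepLoc idG χ => rep_base ((D.twist ω).hχ hc' (hψ.twist ω))
    ((RepLoc.twist (hid G) continuous_id χ ω).obj π)
  have hmem : ∀ (π : RepLoc idG χ) (v : π.obj), v ∈ hc'.eig (h' π) D.le (D.θ * ω.res D.L).1 ↔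
        v ∈ hc.eig (h π) D.le D.θ.1 :=
    fun π v => hc.mem_eig_twist ω (h π) (fun _ _ => rfl) hc' (h' π) D.le D.θ
  let T : ∀ π : RepLoc idG χ, hc'.eig (h' π) D.le (D.θ * ω.res D.L).1 →ₗ[ℂ]
      hc.eig (h π) D.le D.θ.1 := fun π =>
    (lid : π.obj →ₗ[ℂ] π.obj).restrict fun v hv => (hmem π v).1 hv
  exact ⟨ofComponents (fun π => repIso (X := (RepLoc.twist (hid G) continuous_id χ ω ⋙
        (D.twist ω).eig hc' (hψ.twist ω)).obj π)
    (Y := (D.eig hc hψ ⋙ RepLoc.twist H° csv ψ ω).obj π) (T π)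
    (fun k v => sext rfl)
    ⟨fun v w hvw => by
      have h1 : (T π v : π.obj) = T π w := congrArg sval hvw
      exact sext h1, fun w => ⟨⟨w.1, (hmem π _).2 w.2⟩, rfl⟩⟩)
    fun {π π'} f => rfl⟩

include hc hψ hc' in
lemma IsLInd.nonempty_twist_iso {F' : RepLoc H° (ψ * ω.res (N ⊓ H)) ⥤ RepLoc idG (χ * ω.res Z[N])}
    (hF : IsLInd H N ψ χ F) (hF' : IsLInd H N (ψ * ω.res (N ⊓ H)) (χ * ω.res Z[N]) F') :
    Nonempty (RepLoc.twist H° csv ψ ω ⋙ F' ≅ F ⋙ RepLoc.twist (hid G) continuous_id χ ω) := by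
  obtain ⟨D, -⟩ := id hF
  obtain ⟨e⟩ := hF.comp_eig hc D hψ
  obtain ⟨e'⟩ := hF'.comp_eig hc' (D.twist ω) (hψ.twist ω)
  obtain ⟨i⟩ := D.nonempty_twist_eig_iso hc hψ ω hc'
  exact hF'.iso_of_comp_eig hc' (D.twist ω) (hψ.twist ω) ⟨fassoc _ _ _ ≪≫
    isoWhiskerLeft _ e' ≪≫ rightUnitor _ ≪≫ (leftUnitor _).symm ≪≫
    isoWhiskerRight e.symm _ ≪≫ fassoc _ _ _ ≪≫
    isoWhiskerLeft F i.symm ≪≫ (fassoc _ _ _).symm⟩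

include hc hψ hc' in
lemma IsLInd.nonempty_twist_iso_of_eq {ψ' : SmoothChar ↥(N ⊓ H)} {χ' : SmoothChar Z[N]}
    (hψ' : ψ' = ψ * ω.res (N ⊓ H)) (hχ' : χ' = χ * ω.res Z[N]) {F' : RepLoc H° ψ' ⥤ RepLoc idG χ'}
    (hF : IsLInd H N ψ χ F) (hF' : IsLInd H N ψ' χ' F') (T : RepLoc H° ψ ⥤ RepLoc H° ψ')
    (hT : Nonempty (T ⋙ incl H° ψ' ≅ incl H° ψ ⋙ smoothTwist (ω.comap H° csv))) :
    Nonempty (T ⋙ F' ⋙ incl idG χ' ≅ F ⋙ incl idG χ ⋙ smoothTwist ω) := by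
  subst hψ' hχ'
  obtain ⟨i⟩ := hF.nonempty_twist_iso hc hψ ω hc' hF'
  obtain ⟨t⟩ := hT
  have : (incl H° (ψ * ω.res (N ⊓ H))).Full := full_ιOfLE _
  have : (incl H° (ψ * ω.res (N ⊓ H))).Faithful := faithful_ιOfLE _
  have i1 : T ≅ RepLoc.twist H° csv ψ ω := (ofFullyFaithful
      (incl H° (ψ * ω.res (N ⊓ H)))).whiskeringRight _ |>.preimageIso t
  have i2 : RepLoc.twist (hid G) continuous_id χ ω ⋙ incl idG
      (χ * ω.res Z[N]) ≅ incl idG χ ⋙ smoothTwist ω :=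
    Iso.refl _
  exact ⟨(fassoc _ _ _).symm ≪≫ isoWhiskerRight (isoWhiskerRight i1 F') _ ≪≫
    isoWhiskerRight i _ ≪≫ fassoc _ _ _ ≪≫ isoWhiskerLeft F i2⟩

lemma SmoothChar.eq_mul_res (κ : SmoothChar B) (h : ∀ b ∈ B, ω.1 b = 1) :
    κ = κ * ω.res B := sext (mext fun b => by
  show κ.1 b = κ.1 b * ω.1 b
  rw [h b b.2, mul_one])

include hc hψ in
lemma IsLInd.nonempty_comp_smoothTwist_iso {χ' : SmoothChar Z[N]} {F' : RepLoc H° ψ ⥤ RepLoc idG χ'}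
    (hF : IsLInd H N ψ χ F) (hF' : IsLInd H N ψ χ' F') (h1 : ∀ x ∈ H, ω.1 x = 1)
    (hχ' : χ' = χ * ω.res Z[N]) : Nonempty (F' ⋙ incl idG χ' ≅ F ⋙ incl idG χ ⋙ smoothTwist ω) := by
  obtain ⟨e⟩ := hF.nonempty_twist_iso_of_eq hc hψ ω (hc.twist ω fun c h => h1 c (hc.1.C_le_H h))
    (SmoothChar.eq_mul_res ω ψ fun b hb => h1 b hb.2) hχ' hF' (𝟭 _)
    ⟨leftUnitor _ ≪≫ ofComponents (fun τ => repIso (X := (incl H° ψ).obj τ)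
      (Y := (incl H° ψ ⋙ smoothTwist (ω.comap H° csv)).obj τ)
      (lid : τ.obj →ₗ[ℂ] τ.obj) (fun k v => by
        have h3 : (ω.comap H° csv).val k = 1 := congrArg uval (h1 k k.2)
        show τ.obj.ρ k v = (ω.comap H° csv).val k • τ.obj.ρ k v
        rw [h3, one_smul]) bijective_id) fun _ => rfl⟩
  exact ⟨(leftUnitor _).symm ≪≫ e⟩

/-- Twisting twice. -/
def smoothTwistTwist (V : SmoothRep K) (ω ω' ω'' : SmoothChar K) (h : ω'' = ω * ω') :
    (smoothTwist ω).obj ((smoothTwist ω').obj V) ≅ (smoothTwist ω'').obj V :=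
  repIso (X := (smoothTwist ω).obj ((smoothTwist ω').obj V)) (Y := (smoothTwist ω'').obj V)
    (lid : V.obj →ₗ[ℂ] V.obj) (fun k v => by
      show ω.val k • ω'.val k • V.obj.ρ k v = ω''.val k • V.obj.ρ k v
      rw [smul_smul, h]; rfl) bijective_id

include hc hψ in
lemma IsLInd.nonempty_smoothTwist_iso (hψχ : ψ.Consistent χ) {ω ω' : SmoothChar G}
    (h1 : ∀ x ∈ H, ω.1 x = ω'.1 x)
    (h2 : ∀ x ∈ Z[N], ω.1 x = ω'.1 x) (π : RepLoc idG χ) :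
    Nonempty ((smoothTwist ω).obj ((incl idG χ).obj π) ≅
      (smoothTwist ω').obj ((incl idG χ).obj π)) := by
  obtain ⟨L, hL⟩ := hc.1.exists_lagrangian
  obtain ⟨D, -⟩ := hc.1.exists_extension_char hL ψ χ hψχ
  obtain ⟨F, hF⟩ := D.exists_isLInd hc hψ
  have hF' : IsLInd H N ψ χ F := ⟨D, hF⟩
  have := hF'.isEquivalence hc hψ
  have h3 : ∀ {x}, ω.1 x = ω'.1 x → (ω⁻¹ * ω').1 x = 1 := fun {x} h => by
    show (ω.1 x)⁻¹ * ω'.1 x = 1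
    rw [h, inv_mul_cancel]
  obtain ⟨e⟩ := hF'.nonempty_comp_smoothTwist_iso hc hψ (ω⁻¹ * ω') hF'
    (fun x hx => h3 (h1 x hx)) (SmoothChar.eq_mul_res _ χ fun x hx => h3 (h2 x hx))
  let i := (incl idG χ).mapIso (F.objObjPreimageIso π)
  have j : (smoothTwist (ω⁻¹ * ω')).obj ((incl idG χ).obj π) ≅ (incl idG χ).obj π :=
    (smoothTwist (ω⁻¹ * ω')).mapIso i.symm ≪≫ e.symm.app (F.objPreimage π) ≪≫ i
  exact ⟨(smoothTwist ω).mapIso j.symm ≪≫ smoothTwistTwist _ ω (ω⁻¹ * ω') ω'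
    (mul_inv_cancel_left ω ω').symm⟩

end

namespace CharData

section

include hc in
lemma inverse : CharData C H N φ⁻¹ where
  data := hc.data
  injective c hC h := hc.injective c hC (inv_eq_one.1 h)

variable (h : IsUnipOver φ (ρ.comp (base H N)°)) {hL : L ≤ N} {θ : L →* ℂˣ} (hθ : hc.IsCentralChar h hL θ)

variable {h} in
include hθ in
lemma IsCentralChar.eq_zero_of_rho (hcomm : ∀ a ∈ L, ∀ b ∈ L, a * b = b * a) {ξ : V →ₗ[ℂ] V'}
    (hξ : ∀ g : G, ∀ v ∈ hc.eig h hL θ, ξ (ρ g v) = 0) (v : V) : ξ v = 0 :=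
  hθ.eq_zero_of_rho_eigProj hc hcomm fun g => hξ g _ (hθ.eigProj_mem hc _)

lemma eigProj_ssAct (hcomm : ∀ a ∈ L, ∀ b ∈ L, a * b = b * a) (l : L) (v : V) :
    hc.eigProj h hL θ (hc.ssAct h (inclusion hL l) v) =
      hc.ssAct h (inclusion hL l) (hc.eigProj h hL θ v) := by
  have := hc.finiteIndex_center hL
  refine (map_charProj_of_comm (s := (hc.ssAct h).comp (inclusion hL))
    (s' := (hc.ssAct h).comp (inclusion hL)) _ (hc.ssAct h (inclusion hL l))
    (fun m v => ?_) v).symm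
  show hc.ssAct h _ (hc.ssAct h _ v) = hc.ssAct h _ (hc.ssAct h _ v)
  rw [← mul_apply, ← mul_apply, ← map_mul (hc.ssAct h), ← map_mul (hc.ssAct h)]
  have h1 : inclusion hL l * inclusion hL m =
      inclusion hL m * inclusion hL l := sext (hcomm l l.2 m m.2)
  rw [h1]

lemma apply_eigProj {ξ : V →ₗ[ℂ] V'}
    (hξ : ∀ (l : L) v, ξ (hc.ssAct h (inclusion hL l) v) = (θ l : ℂ) • ξ v) (v : V) :
    ξ (hc.eigProj h hL θ v) = ξ v := by
  have := hc.finiteIndex_center hL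
  have := ofFinite (L ⧸ Z[N].subgroupOf L)
  rw [eigProj, charProj_eq_sum, map_smul, map_sum]
  have h1 : ∀ q : L ⧸ Z[N].subgroupOf L,
      ξ (((θ q.out)⁻¹ : ℂˣ).val • ((hc.ssAct h).comp (inclusion hL)) q.out v) = ξ v :=
    fun q => by
      rw [map_smul]; refine (congrArg _ (hξ _ v)).trans ?_
      rw [smul_smul, ← Units.val_mul, inv_mul_cancel, val_one, one_smul]
  simp only [h1, sum_const, card_univ, ← Nat.card_eq_fintype_card]
  rw [← Nat.cast_smul_eq_nsmul ℂ, smul_smul]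
  have h2 : ((Z[N].subgroupOf L).index : ℂ) ≠ 0 := Nat.cast_ne_zero.2 index_ne_zero
  rw [Subgroup.index] at h2 ⊢
  rw [inv_mul_cancel₀ h2, one_smul]

variable {h} in
include hθ in
lemma IsCentralChar.exists_unip_pow (hcomm : ∀ a ∈ L, ∀ b ∈ L, a * b = b * a)
    (hHL : ∀ k ∈ H, ∀ l ∈ L, k * l = l * k) {ξ : V →ₗ[ℂ] V'}
    (hξ : ∀ g : G, ∃ m : ℕ, ∀ b : base H N, ∀ v ∈ hc.eig h hL θ,
      ξ (ρ g (((ρ b - (φ b : ℂ) • (1 : Endℂ V)) ^ m) v)) = 0) :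
    ∃ m : ℕ, ∀ (n : N) v, ξ (((hc.unip h n - 1) ^ m) v) = 0 := by
  choose m hm using hξ
  have hfin := hc.1.finiteIndex_H
  have := ofFinite (G ⧸ H)
  refine ⟨Finset.univ.sup fun q : G ⧸ H => m q.out, fun n v => ?_⟩
  set M := Finset.univ.sup fun q : G ⧸ H => m q.out with hM
  have hcommu : ∀ (g : G) (i : ℕ) v, ((hc.unip h n - 1) ^ i) (ρ g v) =
      ρ g (((hc.unip h n - 1) ^ i) v) := fun g i v =>
    (map_pow_of_comm (ρ g) (fun v => by
      rw [lsub_apply, lsub_apply, map_sub, unip_rho]; rfl) i v).symm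
  refine IsCentralChar.eq_zero_of_rho hc hθ hcomm (ξ := ξ ∘ₗ ((hc.unip h n - 1) ^ M))
    (fun g v hv => ?_) v
  obtain ⟨k, hk⟩ := mk_out_eq_mul H g
  obtain ⟨q, hq⟩ : ∃ q : G ⧸ H, q = (g : G ⧸ H) := ⟨_, rfl⟩
  rw [← hq] at hk
  have hg : g = q.out * (k : G)⁻¹ := by rw [hk, mul_inv_cancel_right]
  have hkv : ρ (k : G)⁻¹ v ∈ hc.eig h hL θ := by
    have h1 := hc.rho_mem_eig h hL hv (k : G)⁻¹
    rw [(hc.pairChar_eq_one_iff hL _).2 (hHL _ (H.inv_mem k.2))] at h1; rwa [mul_one θ] at h1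
  rw [hg, map_mul, mul_apply]
  generalize ρ (k : G)⁻¹ v = w at hkv
  show ξ (((hc.unip h n - 1) ^ M) (ρ q.out w)) = 0
  rw [hcommu]
  have hpow : ∀ v, (ξ ∘ₗ ρ q.out ∘ₗ hc.eigProj h hL θ)
      (((hc.unip h n ^ (base H N).relIndex N - 1) ^ m q.out) v) = 0 := fun v => by
    have h1 : hc.unip h n ^ (base H N).relIndex N - 1 =
        ((φ (hc.1.basePow n))⁻¹ : ℂˣ).val • (ρ (hc.1.basePow n) -
          (φ (hc.1.basePow n) : ℂ) • (1 : Endℂ V)) := by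
      rw [unip_pow, smul_sub, smul_smul, ← Units.val_mul, inv_mul_cancel, val_one, one_smul]; rfl
    have h2 := map_pow_of_comm (hc.eigProj h hL θ)
      (a := hc.unip h n ^ (base H N).relIndex N - 1)
      (b := hc.unip h n ^ (base H N).relIndex N - 1) (fun v => by
        rw [lsub_apply, lsub_apply, map_sub, ← map_pow, eigProj_unip]; rfl) (m q.out) v
    rw [lcomp_apply, lcomp_apply, h2, h1, smul_pow, lsmul_apply, map_smul,
      map_smul, hm q.out _ _ (hθ.eigProj_mem hc v), smul_zero]
  obtain ⟨j, hj⟩ := Nat.exists_eq_add_of_le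
    (Finset.le_sup (f := fun q : G ⧸ H => m q.out) (mem_univ q))
  have h5 : (hc.unip h n - 1) ^ M = (hc.unip h n - 1) ^ m q.out * (hc.unip h n - 1) ^ j := by
    rw [← pow_add]; exact congrArg _ hj
  have hj' : ((hc.unip h n - 1) ^ j) w ∈ hc.eig h hL θ := by
    have : ∀ w ∈ hc.eig h hL θ, (hc.unip h n - 1) w ∈ hc.eig h hL θ := fun w hw =>
      sub_mem (hc.unip_mem_eig h hL hw n) hw
    clear h5 hj
    induction j with
    | zero => exact hkv
    | succ j ih => rw [pow_succ', mul_apply]; exact this _ ih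
  rw [h5, mul_apply]
  have h6 := comp_sub_one_pow_eq_zero hc.relIndex_ne_zero (hc.unip_isLocUnip h n)
    ((hc.unip_isLocUnip h n).pow _) _ hpow (((hc.unip h n - 1) ^ j) w)
  have h7 := map_pow_of_comm (hc.eigProj h hL θ) (a := hc.unip h n - 1)
    (b := hc.unip h n - 1) (fun v => by
      rw [lsub_apply, lsub_apply, map_sub, eigProj_unip]; rfl) (m q.out)
      (((hc.unip h n - 1) ^ j) w)
  rwa [lcomp_apply, lcomp_apply, h7, eigProj_of_mem hc hj'] at h6

end

end CharData

lemma dual_sub_smul_pow {K V : Type*} [Group K] [AddCommGroup V] [Module ℂ V] (ρ : Repn K V) (k : K)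
    (c : ℂ) (m : ℕ) (ξ : Dual ℂ V) (v : V) : (((ρ.dual k - c • (1 : Endℂ (Dual ℂ V))) ^ m) ξ) v =
    ξ (((ρ k⁻¹ - c • (1 : Endℂ V)) ^ m) v) := by
  induction m generalizing v with
  | zero => rfl
  | succ m ih =>
    rw [pow_succ', pow_succ, mul_apply, mul_apply, ← ih, lsub_apply,
      lsub_apply, lsub_apply, map_sub]
    exact congrArg (_ - ·) (map_smul (((ρ.dual k - c • 1) ^ m) ξ) c v).symm

lemma smoothSubrep_sub_smul_pow {K V : Type*} [Group K] [TopologicalSpace K] [IsTopologicalGroup K]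
    [AddCommGroup V] [Module ℂ V] (ρ : Repn K V) (k : K) (c : ℂ) (m : ℕ) (ξ : smoothVectors ρ) :
    ((((smoothSubrep ρ k - c • (1 : Endℂ (smoothVectors ρ))) ^ m) ξ : smoothVectors ρ) : V) =
    ((ρ k - c • (1 : Endℂ V)) ^ m) ξ :=
  map_pow_of_comm (smoothVectors ρ).subtype (fun _ => rfl) m ξ

namespace CharData

section

variable (D : LagrangianDatum H N ψ χ) (hψ : ψ.Extends φ)

/-- The contragredient of a smooth representation. -/
abbrev _root_.SmoothRep.dual (V : SmoothRep K) : SmoothRep K :=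
  (contragredient K).obj (Opposite.op V)

lemma _root_.SmoothChar.Extends.inv {P : Subgroup G} {α : P →* ℂˣ}
    (h : κ.Extends α) : (κ⁻¹).Extends α⁻¹ := fun _ hx => ⟨h.le hx, congrArg Inv.inv (h.apply _ hx)⟩

lemma _root_.SmoothChar.Consistent.inv (h : κ.Consistent κ') : (κ⁻¹).Consistent κ'⁻¹ := fun x hx hx' =>
  congrArg uval (congrArg Inv.inv (uext (h x hx hx') : κ.1 ⟨x, hx⟩ = κ'.1 ⟨x, hx'⟩))

/-- The inverse datum. -/
def _root_.LagrangianDatum.inverse : LagrangianDatum H N ψ⁻¹ χ⁻¹ where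
  L := D.L
  isLagrangian := D.2
  θ := D.θ⁻¹
  extends_left := D.extends_left.inv
  extends_right := D.extends_right.inv

variable {τ : SmoothRep H} {π : RepLoc idG χ} (j : τ.obj →ₗ[ℂ] π.obj)
  (hj : ∀ k v, j (τ.obj.ρ k v) = π.obj.ρ k (j v))

include hj in
lemma comp_mem_smoothVectors {ξ : Dual ℂ π.obj} (hξ : ξ ∈ smoothVectors π.obj.ρ.dual) :
    ξ ∘ₗ j ∈ smoothVectors τ.obj.ρ.dual := by
  have h1 : IsOpen {k : H | π.obj.ρ.dual k ξ = ξ} :=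
    IsOpen.preimage csv (show IsOpen {g : G | π.obj.ρ.dual g ξ = ξ} from hξ)
  have h2 := isOpen_stab_of_le (Representation.prod (π.obj.ρ.dual.comp H°) τ.obj.ρ.dual)
    (v := (ξ, 0)) (w := (0, ξ ∘ₗ j)) (by simpa [Prod.ext_iff] using h1) (fun k hk => by
      have hk' : π.obj.ρ.dual k ξ = ξ := by simpa [Prod.ext_iff] using hk
      refine Prod.ext (map_zero (π.obj.ρ.dual k)) (lext fun v => ?_)
      show ξ (j (τ.obj.ρ k⁻¹ v)) = ξ (j v)
      rw [hj]; exact congrArg (fun η : Dual ℂ π.obj => η (j v)) hk')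
  show IsOpen {k : H | τ.obj.ρ.dual k (ξ ∘ₗ j) = ξ ∘ₗ j}
  simpa [Prod.ext_iff] using h2

include hj D hψ in
lemma isLocally_contragredient
    (hjr : ∀ w ∈ hc.eig (rep_base (D.hχ hc hψ) π) D.le D.θ.1, ∃ v, j v = w)
    (hτ : isLocally H° ψ⁻¹ τ.dual.obj) :
    isLocally idG χ⁻¹ ((incl idG χ).obj π).dual.obj := fun ξ => by
  let ξ' : smoothVectors π.obj.ρ.dual := ξ
  have hbase := rep_base (D.hχ hc hψ) π
  have hθ := hc.isCentralChar (D.hχ hc hψ) D.le D.extends_left π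
  obtain ⟨m, hm⟩ := IsCentralChar.exists_unip_pow hc hθ (fun a ha b hb => D.2.comm ha hb)
    (D.comm_H hc) (ξ := ξ'.1) (fun g => by
      have h1 := comp_mem_smoothVectors j hj (smoothVectors_stable π.obj.ρ.dual g⁻¹ ξ'.2)
      obtain ⟨m, hm⟩ := hτ ⟨_, h1⟩; refine ⟨m, fun b w hw => ?_⟩
      obtain ⟨v, rfl⟩ := hjr w hw; have hb : (b : G) ∈ H := base_le_H b.2
      have h2 := hm (⟨b, hb⟩⁻¹ : H) (hψ.le ((base H N).inv_mem b.2))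
      have h3 : (ψ⁻¹).val ⟨H° (⟨b, hb⟩⁻¹ : H), hψ.le ((base H N).inv_mem b.2)⟩ =
          (φ b : ℂ) := congrArg uval ((hψ.inv.apply _ ((base H N).inv_mem b.2)).trans
            (show (φ b⁻¹)⁻¹ = φ b by rw [map_inv, inv_inv]))
      rw [h3] at h2; have h4 := (smoothSubrep_sub_smul_pow τ.obj.ρ.dual (⟨b, hb⟩⁻¹ : H) (φ b : ℂ) m
        ⟨_, h1⟩).symm.trans (congrArg sval h2)
      have h5 := congrArg (fun η : Dual ℂ τ.obj => η v) h4
      have h6 := (dual_sub_smul_pow τ.obj.ρ (⟨b, hb⟩⁻¹ : H) (φ b : ℂ) m _ v).symm.trans h5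
      rw [inv_inv] at h6; have h7 := map_pow_of_comm j (a := τ.obj.ρ ⟨b, hb⟩ - (φ b : ℂ) • 1)
        (b := π.obj.ρ b - (φ b : ℂ) • 1) (fun v => by
          rw [lsub_apply, lsub_apply, map_sub, hj, lsmul_apply, lsmul_apply, map_smul]; rfl) m v
      have h8 : π.obj.ρ.dual g⁻¹ ξ'.1 (j (((τ.obj.ρ ⟨b, hb⟩ - (φ b : ℂ) • 1) ^ m) v)) = 0 := h6
      rw [h7] at h8
      have h9 : ξ'.1 (π.obj.ρ g⁻¹⁻¹ (((π.obj.ρ b - (φ b : ℂ) • 1) ^ m) (j v))) = 0 := h8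
      rwa [inv_inv] at h9)
  refine ⟨m, fun z hz => sext (lext fun v => ?_)⟩
  refine (congrArg (fun η : Dual ℂ π.obj => η v)
    (smoothSubrep_sub_smul_pow π.obj.ρ.dual z ((χ⁻¹).val ⟨z, hz⟩) m ξ')).trans ?_
  refine (dual_sub_smul_pow π.obj.ρ z _ m ξ'.1 v).trans ?_
  have hz' : z⁻¹ ∈ Z[N] := inv_mem hz
  have h1 : ∀ v, π.obj.ρ z⁻¹ v = (χ.1 ⟨z⁻¹, hz'⟩ : ℂ) • hc.unip hbase ⟨z⁻¹, hz'.1⟩ v := fun v =>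
    hc.apply_eq_smul_unip hbase (M := Z[N]) inf_le_left
      (D.hχ hc hψ).le (π.obj.ρ.comp Z[N].subtype) χ.1
      (fun b => rfl) (fun b => (D.hχ hc hψ).apply _ b.2)
      (isLocally_isUnipOver π.property.2 _ (fun m => m.2) _ fun m => rfl) ⟨z⁻¹, hz'⟩ v
  have h2 : π.obj.ρ z⁻¹ - (χ⁻¹).val ⟨z, hz⟩ • (1 : Endℂ π.obj) =
      (χ.1 ⟨z⁻¹, hz'⟩ : ℂ) • (hc.unip hbase ⟨z⁻¹, hz'.1⟩ - 1) := by
    have h3 : (χ⁻¹).val ⟨z, hz⟩ = (χ.1 ⟨z⁻¹, hz'⟩ : ℂ) := congrArg uval (map_inv χ.1 ⟨z, hz⟩).symm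
    ext v; rw [lsub_apply, h1, h3, smul_sub]
    rfl
  have h3 := hm ⟨z⁻¹, hz'.1⟩ v
  have h4 : ξ'.1 (((π.obj.ρ z⁻¹ - (χ⁻¹).val ⟨z, hz⟩ • (1 : Endℂ π.obj)) ^ m) v) = 0 := by
    rw [h2, smul_pow]; exact (map_smul ξ'.1 _ _).trans ((congrArg _ h3).trans (smul_zero _))
  exact h4

lemma dual_ssAct (h' : IsUnipOver φ⁻¹ (((smoothSubrep π.obj.ρ.dual)).comp (base H N)°))
    (h : IsUnipOver φ (π.obj.ρ.comp (base H N)°)) (n : N) (ξ : smoothVectors π.obj.ρ.dual)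
    (v : π.obj) : (hc.inverse.ssAct h' n ξ).1 v = ξ.1 (hc.ssAct h n⁻¹ v) := by
  rw [ssAct_apply, ssAct_apply]
  have h1 := hc.unip_dual h hc.inverse h' (smoothVectors π.obj.ρ.dual).subtype (fun _ _ _ => rfl) n⁻¹ ξ
    (π.obj.ρ (n : G)⁻¹ v)
  rw [inv_inv] at h1 ⊢
  rw [unip_rho] at h1
  exact h1

variable (h' : IsUnipOver φ⁻¹ (((smoothSubrep π.obj.ρ.dual)).comp (base H N)°))

lemma eq_zero_of_mem_dual_eig (hL : L ≤ N) (θ : SmoothChar L)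
    (h : IsUnipOver φ (π.obj.ρ.comp (base H N)°)) (hθ : hc.IsCentralChar h hL θ.1)
    (hjr : ∀ w ∈ hc.eig h hL θ.1, ∃ v, j v = w) {ξ : smoothVectors π.obj.ρ.dual}
    (hξ : ξ ∈ hc.inverse.eig h' hL (θ⁻¹).1) (h0 : ξ.1 ∘ₗ j = 0) : ξ = 0 := by
  refine sext (lext fun v => ?_)
  have h1 := hc.apply_eigProj (V' := ℂ) h (hL := hL) (θ := θ.1) (ξ := ξ.1) (fun l v => by
    have h2 := (hc.inverse.mem_eig h' hL).1 hξ l⁻¹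
    have h3 := congrArg (fun η : smoothVectors π.obj.ρ.dual => η.1 v) h2
    have h4 := (hc.dual_ssAct h' h _ ξ v).symm.trans h3
    rw [← map_inv, inv_inv] at h4; refine h4.trans ?_
    have h5 : (θ⁻¹).1 l⁻¹ = θ.1 l := (congrArg Inv.inv (map_inv θ.1 l)).trans (inv_inv _)
    show ((θ⁻¹).1 l⁻¹ : ℂ) • ξ.1 v = _
    rw [h5]) v
  obtain ⟨w, hw⟩ := hjr _ (hθ.eigProj_mem hc v)
  rw [← h1, ← hw]
  exact congrArg (fun η : Dual ℂ τ.obj => η w) h0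

include hj in
lemma exists_mem_dual_eig (hL : L ≤ N) (θ : SmoothChar L) (hcomm : ∀ a ∈ L, ∀ b ∈ L, a * b = b * a)
    (hHL : ∀ k ∈ H, ∀ l ∈ L, k * l = l * k) (h : IsUnipOver φ (π.obj.ρ.comp (base H N)°))
    (hθ : hc.IsCentralChar h hL θ.1) (hji : Injective j) (hjm : ∀ v, j v ∈ hc.eig h hL θ.1)
    (hjr : ∀ w ∈ hc.eig h hL θ.1, ∃ v, j v = w) (η : smoothVectors τ.obj.ρ.dual) :
    ∃ ξ ∈ hc.inverse.eig h' hL (θ⁻¹).1, ξ.1 ∘ₗ j = η.1 := by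
  let e : τ.obj ≃ₗ[ℂ] hc.eig h hL θ.1 := ofBijective (j.codRestrict _ hjm)
    ⟨fun v w hvw => hji (congrArg sval hvw), fun w => by
      obtain ⟨v, hv⟩ := hjr w.1 w.2; exact ⟨v, sext hv⟩⟩
  have he : ∀ v, (e v : π.obj) = j v := fun _ => rfl
  let p : π.obj →ₗ[ℂ] τ.obj := e.symm.toLinearMap ∘ₗ
    (hc.eigProj h hL θ.1).codRestrict _ fun v => hθ.eigProj_mem hc v
  have hp : ∀ v, j (p v) = hc.eigProj h hL θ.1 v := fun v => by
    rw [← he]; exact congrArg sval (e.apply_symm_apply _)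
  have hpj : ∀ v, p (j v) = v := fun v => hji (by rw [hp, eigProj_of_mem hc (hjm v)])
  have hpH : ∀ (k : H) v, p (π.obj.ρ k v) = τ.obj.ρ k (p v) := fun k v => hji (by
    rw [hp, hj, hp]; have h1 := hc.eigProj_rho h hL (θ := θ.1) (k : G) v
    rw [(hc.pairChar_eq_one_iff hL _).2 (hHL _ k.2)] at h1; rwa [mul_one θ.1] at h1)
  have hsm : η.1 ∘ₗ p ∈ smoothVectors π.obj.ρ.dual := by
    refine isOpen_stab_of_isOpenMap π.obj.ρ.dual H° hc.1.isOpen_H.isOpenMap_subtype_val ?_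
    have h1 : IsOpen {k : H | τ.obj.ρ.dual k η.1 = η.1} := η.2
    have h2 := isOpen_stab_of_le (Representation.prod τ.obj.ρ.dual (π.obj.ρ.dual.comp H°))
      (v := (η.1, 0)) (w := (0, η.1 ∘ₗ p)) (by simpa [Prod.ext_iff] using h1) (fun k hk => by
        have hk' : τ.obj.ρ.dual k η.1 = η.1 := by simpa [Prod.ext_iff] using hk
        refine Prod.ext (map_zero (τ.obj.ρ.dual k)) (lext fun v => ?_)
        show η.1 (p (π.obj.ρ ((k⁻¹ : H) : G) v)) = η.1 (p v)
        rw [hpH]; exact congrArg (fun η : Dual ℂ τ.obj => η (p v)) hk')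
    simpa [Prod.ext_iff] using h2
  refine ⟨⟨_, hsm⟩, (hc.inverse.mem_eig h' hL).2 fun l => sext (lext fun v => ?_),
    lext fun v => congrArg η.1 (hpj v)⟩
  refine (hc.dual_ssAct h' h _ ⟨_, hsm⟩ v).trans ?_
  rw [← map_inv]
  have h1 : p (hc.ssAct h (inclusion hL l⁻¹) v) = (θ.1 l⁻¹ : ℂ) • p v := hji (by
    rw [hp, map_smul, hp, hc.eigProj_ssAct h hcomm]
    exact (hc.mem_eig h hL).1 (hθ.eigProj_mem hc v) l⁻¹)
  have h2 : ((θ⁻¹).1 l) = θ.1 l⁻¹ := (map_inv θ.1 l).symm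
  rw [h2]
  show η.1 (p _) = (θ.1 l⁻¹ : ℂ) • η.1 (p v)
  rw [h1, map_smul]

end

end CharData

section

variable (hψ : ψ.Extends φ) {F' : RepLoc H° ψ⁻¹ ⥤ RepLoc idG χ⁻¹}

include hc hψ in
lemma IsLInd.nonempty_contragredient_iso (hF : IsLInd H N ψ χ F) (hF' : IsLInd H N ψ⁻¹ χ⁻¹ F') :
    Nonempty (((RepLoc.hasLocalDual H° ψ).ι ⋙ F ⋙ incl idG χ).op ⋙ contragredient G ≅
      RepLoc.contragredient H° ψ ⋙ F' ⋙ incl idG χ⁻¹) := by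
  obtain ⟨D, -⟩ := id hF
  obtain ⟨e⟩ := hF.comp_eig hc D hψ
  obtain ⟨e'⟩ := hF'.comp_eig hc.inverse D.inverse hψ.inv
  let hb := fun π : RepLoc idG χ => rep_base (D.hχ hc hψ) π
  let j : ∀ τ : RepLoc H° ψ, τ.obj →ₗ[ℂ] (F.obj τ).obj := fun τ =>
    (hc.eig (hb (F.obj τ)) D.le D.θ.1).subtype ∘ₗ repLin (e.inv.app τ)
  have hj : ∀ τ k v, j τ (τ.obj.ρ k v) = (F.obj τ).obj.ρ k (j τ v) := fun τ k v =>
    congrArg sval (repLin_comm (e.inv.app τ) k v)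
  have hje : ∀ τ v, repLin (e.hom.app τ) (repLin (e.inv.app τ) v) = v := fun τ v =>
    repLin_hom_inv (e.app τ) v
  have hji : ∀ τ, Injective (j τ) := fun τ v w hvw => by
    have h1 : repLin (e.inv.app τ) v = repLin (e.inv.app τ) w := sext hvw
    rw [← hje τ v, h1, hje]
  have hjm : ∀ τ v, j τ v ∈ hc.eig (hb (F.obj τ)) D.le D.θ.1 := fun τ v =>
    (repLin (e.inv.app τ) v : hc.eig (hb (F.obj τ)) D.le D.θ.1).2
  have hjr : ∀ τ, ∀ w ∈ hc.eig (hb (F.obj τ)) D.le D.θ.1, ∃ v, j τ v = w :=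
    fun τ w hw => ⟨repLin (e.hom.app τ) (⟨w, hw⟩ : hc.eig (hb (F.obj τ)) D.le D.θ.1), congrArg sval
        (repLin_inv_hom (e.app τ) (⟨w, hw⟩ : hc.eig (hb (F.obj τ)) D.le D.θ.1))⟩
  have hjn : ∀ {τ τ' : RepLoc H° ψ} (f : τ ⟶ τ') v,
      j τ' (repLin f v) = repLin (F.map f) (j τ v) := fun {τ τ'} f v =>
    congrArg sval (repLin_naturality e.inv f v)
  let A : (RepLoc.hasLocalDual H° ψ).FullSubcategoryᵒᵖ ⥤ RepLoc idG χ⁻¹ :=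
    (isSmoothLocally (hid G) χ⁻¹).lift (((RepLoc.hasLocalDual H° ψ).ι ⋙ F ⋙ incl idG χ).op ⋙
        contragredient G ⋙ (isSmooth G).ι) fun τ =>
      ⟨((contragredient G).obj (Opposite.op ((incl idG χ).obj (F.obj τ.unop.obj)))).property,
        hc.isLocally_contragredient (τ := (incl H° ψ).obj τ.unop.obj) D hψ
          (j τ.unop.obj) (hj _) (hjr _) τ.unop.property⟩
  let hb' := fun τ : (RepLoc.hasLocalDual H° ψ).FullSubcategoryᵒᵖ =>
    rep_base (D.inverse.hχ hc.inverse hψ.inv) (A.obj τ)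
  let T : ∀ τ : (RepLoc.hasLocalDual H° ψ).FullSubcategoryᵒᵖ,
      hc.inverse.eig (hb' τ) D.le (D.θ⁻¹).1 →ₗ[ℂ] smoothVectors τ.unop.obj.obj.ρ.dual := fun τ =>
    { toFun := fun ξ => ⟨(show smoothVectors (F.obj τ.unop.obj).obj.ρ.dual from ξ.1).1 ∘ₗ
        j τ.unop.obj, CharData.comp_mem_smoothVectors (τ := (incl H° ψ).obj τ.unop.obj)
          (j τ.unop.obj) (hj _) (show smoothVectors (F.obj τ.unop.obj).obj.ρ.dual from ξ.1).2⟩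
      map_add' := fun _ _ => rfl
      map_smul' := fun _ _ => rfl }
  have hθ := fun π => hc.isCentralChar (D.hχ hc hψ) D.le D.extends_left π
  have i : A ⋙ D.inverse.eig hc.inverse hψ.inv ≅ RepLoc.contragredient H° ψ :=
    ofComponents (fun τ => repIso (X := (A ⋙ D.inverse.eig hc.inverse hψ.inv).obj τ)
      (Y := (RepLoc.contragredient H° ψ).obj τ) (T τ) (fun k ξ => by
        refine sext (lext fun v => ?_)
        exact congrArg (show smoothVectors (F.obj τ.unop.obj).obj.ρ.dual from ξ.1).1
          (hj τ.unop.obj k⁻¹ v).symm) ⟨(injective_iff_map_eq_zero (T τ)).2 fun ξ hξ => sext ?_,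
        fun η => ?_⟩) fun {τ τ'} f => ?_
  · obtain ⟨t⟩ := hF'.iso_of_comp_eig hc.inverse D.inverse hψ.inv (A := A)
      (B := RepLoc.contragredient H° ψ ⋙ F') ⟨i ≪≫ (rightUnitor _).symm ≪≫
        isoWhiskerLeft _ e'.symm ≪≫ (fassoc _ _ _).symm⟩
    exact ⟨isoWhiskerRight t (incl idG χ⁻¹) ≪≫ fassoc _ _ _⟩
  · exact hc.eq_zero_of_mem_dual_eig (τ := (incl H° ψ).obj τ.unop.obj) (j τ.unop.obj)
      (hb' τ) D.le D.θ (hb _) (hθ _) (hjr _) ξ.2 (congrArg sval hξ)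
  · obtain ⟨ξ, hξ, h1⟩ := hc.exists_mem_dual_eig (τ := (incl H° ψ).obj τ.unop.obj)
      (j τ.unop.obj) (hj _) (hb' τ) D.le D.θ (fun a ha b hb => D.2.comm ha hb)
      (D.comm_H hc) (hb _) (hθ _) (hji _) (hjm _) (hjr _) η
    exact ⟨⟨ξ, hξ⟩, sext h1⟩
  · refine repHom_ext fun ξ => sext (lext fun v => ?_)
    exact congrArg (show smoothVectors (F.obj τ.unop.obj).obj.ρ.dual from ξ.1).1 (hjn f.unop.hom v).symm

end

section

variable {ρ : Repn K V} (hρ : ρ.IsIrreducible)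

include hρ in
lemma Representation.IsIrreducible.eq_zero_of_comm {T : Endℂ V}
    (hT : ∀ k v, T (ρ k v) = ρ k (T v)) {v : V} (hv : v ≠ 0) (hTv : T v = 0) : T = 0 := by
  have h := (Representation.irr_iff_submodule ρ).1 hρ
  rcases h.2 (LinearMap.ker T) (fun k v hv => by
    rw [mem_ker] at hv ⊢
    rw [hT, hv, map_zero]) with h1 | h1
  · exact absurd (h1 ▸ mem_ker.2 hTv : v ∈ (⊥ : Submodule ℂ V)) (by simpa using hv)
  · exact LinearMap.ker_eq_top.1 h1

include hρ in
lemma Representation.IsIrreducible.eq_zero_of_pow {T : Endℂ V} (hT : ∀ k v, T (ρ k v) = ρ k (T v))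
    {v : V} (hv : v ≠ 0) {m : ℕ} (hTv : (T ^ m) v = 0) : T = 0 := by
  induction m with
  | zero => exact absurd hTv hv
  | succ m ih =>
    by_cases h : (T ^ m) v = 0
    · exact ih h
    · rw [pow_succ', mul_apply] at hTv; exact hρ.eq_zero_of_comm hT h hTv

include hρ in
lemma Representation.IsIrreducible.exists_ne_zero : ∃ v : V, v ≠ 0 := by
  have := ((Representation.irr_iff_submodule ρ).1 hρ).1
  exact exists_ne 0

include hρ in
lemma Representation.IsIrreducible.exists_eq_smul {T : Endℂ V}
    (hT : ∀ k v, T (ρ k v) = ρ k (T v)) {n : ℕ} (hn : n ≠ 0) {c : ℂ}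
    (hTn : T ^ n = c • (1 : Endℂ V)) : ∃ ζ : ℂ, T = ζ • (1 : Endℂ V) := by
  obtain ⟨v, hv⟩ := hρ.exists_ne_zero
  let p : Polynomial ℂ := Polynomial.X ^ n - Polynomial.C c
  have hp : p.Monic := Polynomial.monic_X_pow_sub_C c hn
  have hpT : aeval T p = 0 := by
    simp [p, hTn, Algebra.algebraMap_eq_smul_one]
  have hprod : p = (p.roots.map fun x => Polynomial.X - Polynomial.C x).prod := by
    have h1 := (IsAlgClosed.splits p).eq_prod_roots
    rwa [hp.leadingCoeff, map_one, one_mul] at h1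
  by_contra! hne
  have hinj : ∀ (s : Multiset ℂ) (w : V), w ≠ 0 →
      aeval T (s.map fun x => Polynomial.X - Polynomial.C x).prod w ≠ 0 := by
    intro s
    induction s using Multiset.induction with
    | empty => intro w hw; simpa using hw
    | cons a s ih =>
      intro w hw h0; rw [Multiset.map_cons, Multiset.prod_cons, mul_comm, map_mul, mul_apply] at h0
      refine ih _ (fun h1 => hne a ?_) h0
      have h2 := hρ.eq_zero_of_comm (T := T - a • 1) (fun k v => by
        simp [hT]) hw (by
          simpa [Algebra.algebraMap_eq_smul_one] using h1)
      exact sub_eq_zero.1 h2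
  rw [hprod] at hpT
  exact hinj _ v hv (by rw [hpT]; rfl)

end

section

lemma RepLoc.rho_eq_smul {f : K →* G} (V : RepLoc f κ)
    (hV : V.obj.ρ.IsIrreducible) {k : K} (hk : f k ∈ B) (hc : ∀ k', k' * k = k * k') (v : V.obj) :
    V.obj.ρ k v = κ.val ⟨f k, hk⟩ • v := by
  obtain ⟨w, hw⟩ := hV.exists_ne_zero
  obtain ⟨m, hm⟩ := V.property.2 w
  have h1 := hV.eq_zero_of_pow (T := V.obj.ρ k - κ.val ⟨f k, hk⟩ • 1) (fun k' v => by
    rw [lsub_apply, lsub_apply, map_sub, ← rep_mul, ← hc, rep_mul]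
    exact congrArg _ (map_smul (V.obj.ρ k') _ _).symm) hw (hm k hk)
  exact congrArg (fun T : Endℂ V.obj => T v) (sub_eq_zero.1 h1)

lemma SmoothRep.exists_char (V : SmoothRep K) (hV : V.obj.ρ.IsIrreducible) (B : Subgroup G)
    (f : K →* G) (i : B →* K) (hi : Continuous i) (hfi : ∀ b, f (i b) = b) (hf : Injective f)
    (hc : ∀ k (b : B), k * i b = i b * k) {n : ℕ} (hn : n ≠ 0)
    (hs : ∀ b : B, ∃ c : ℂ, V.obj.ρ (i b ^ n) = c • (1 : Endℂ V.obj)) :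
    ∃ κ : SmoothChar B, (∀ b v, V.obj.ρ (i b) v = κ.val b • v) ∧ isLocally f κ V.obj := by
  have h1 : ∀ b : B, ∃ ζ : ℂ, V.obj.ρ (i b) = ζ • (1 : Endℂ V.obj) := fun b => by
    obtain ⟨c, hc'⟩ := hs b
    exact hV.exists_eq_smul (fun k v => by rw [← rep_mul, ← hc, rep_mul]) hn
      (by rw [← map_pow, hc'])
  choose ζ hζ using h1
  obtain ⟨w, hw⟩ := hV.exists_ne_zero
  have hζw : ∀ b v, V.obj.ρ (i b) v = ζ b • v := fun b v => by rw [hζ]; rfl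
  have hmul : ∀ a b, ζ (a * b) = ζ a * ζ b := fun a b => by
    refine smul_left_injective ℂ hw ?_
    show ζ (a * b) • w = (ζ a * ζ b) • w
    rw [← hζw, map_mul, rep_mul, hζw, hζw, smul_smul, mul_comm]
  have hone : ζ 1 = 1 := by
    refine smul_left_injective ℂ hw ?_
    show ζ 1 • w = (1 : ℂ) • w
    rw [← hζw, map_one, map_one, one_smul, one_apply]
  let ζ' : B →* ℂ := { toFun := ζ, map_one' := hone, map_mul' := hmul }
  have hval : ∀ b, (ζ'.toHomUnits b : ℂ) = ζ b := fun b => rfl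
  have hlc : IsLocallyConstant ζ'.toHomUnits := by
    have ho : IsOpen {b : B | V.obj.ρ (i b) w = w} := (V.property w).preimage hi
    let P : Subgroup B := ζ'.toHomUnits.ker
    have hP : (P : Set B) = {b : B | V.obj.ρ (i b) w = w} := by
      ext b; show ζ'.toHomUnits b = 1 ↔ V.obj.ρ (i b) w = w
      rw [hζw, Units.ext_iff, hval, val_one]; constructor
      · intro h; rw [h, one_smul]
      · intro h; exact smul_left_injective ℂ hw (h.trans (one_smul ℂ w).symm)
    exact locConst_of_open _ (P := P) (hP ▸ ho) fun p hp => hp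
  refine ⟨⟨ζ'.toHomUnits, hlc⟩, hζw, fun v => ⟨1, fun k hk => ?_⟩⟩
  have h2 : k = i ⟨f k, hk⟩ := hf (hfi ⟨f k, hk⟩).symm
  rw [pow_one, lsub_apply]
  have h3 := hζw ⟨f k, hk⟩ v
  rw [← h2] at h3
  exact sub_eq_zero.2 h3

end

section

include hc in
lemma CharData.exists_twist_eq (hG : commutator G ≤ H) {χ χ' : SmoothChar Z[N]} (hχ : χ.Extends φ)
    (hχ' : χ'.Extends φ) : ∃ ω : SmoothChar G, (∀ h ∈ H, ω.1 h = 1) ∧ χ' = χ * ω.res Z[N] := by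
  have := hc.1.normal_H
  have hM : ∀ a b : G ⧸ H, a * b = b * a := fun a b => by
    obtain ⟨a, rfl⟩ := mk_surjective a; obtain ⟨b, rfl⟩ := mk_surjective b
    refine QuotientGroup.eq.2 (hG ?_)
    have h1 := Subgroup.commutator_mem_commutator (Subgroup.mem_top b⁻¹) (Subgroup.mem_top a⁻¹)
    rw [commutatorElement_def] at h1; simpa [mul_assoc, commutator_def] using h1
  let f : Z[N] →* G ⧸ H := (mk' H).comp (Subgroup.subtype _)
  let μ : Z[N] →* ℂˣ := χ.1⁻¹ * χ'.1
  have hker : f.rangeRestrict.ker ≤ μ.ker := fun z hz => by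
    rw [MonoidHom.ker_rangeRestrict] at hz; have h1 : (z : G) ∈ H := (eq_one_iff _).1 hz
    have h2 : (z : G) ∈ base H N := ⟨⟨z.2.1, h1⟩, z.2.2⟩
    show (χ.1 z)⁻¹ * χ'.1 z = 1
    rw [hχ.apply z.2 h2, hχ'.apply z.2 h2, inv_mul_cancel]
  let μ' := f.rangeRestrict.liftOfSurjective f.rangeRestrict_surjective ⟨μ, hker⟩
  have hμ' : ∀ z, μ' (f.rangeRestrict z) = μ z := fun z =>
    MonoidHom.liftOfRightInverse_comp_apply _ _ _ ⟨μ, hker⟩ z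
  obtain ⟨ν, hν⟩ := exists_extend_char hM f.range μ'
  have hω : ∀ h ∈ H, (ν.comp (mk' H)) h = 1 := fun h hh => by
    rw [mcomp_apply, QuotientGroup.mk'_apply, (eq_one_iff h).2 hh, map_one]
  refine ⟨⟨_, locConst_of_open (ν.comp (mk' H)) hc.1.isOpen_H
    hω⟩, hω, sext (mext fun z => ?_)⟩
  have h1 : ν (f z) = (χ.1 z)⁻¹ * χ'.1 z := (hν (f.rangeRestrict z)).trans (hμ' z)
  show χ'.1 z = χ.1 z * ν (f z)
  rw [h1, mul_inv_cancel_left]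

variable {χ' : SmoothChar Z[N]}

include hc in
lemma IsLInd.cls_twist (hψ : ψ.Extends φ) {F' : RepLoc H° ψ ⥤ RepLoc idG χ'} (hF : IsLInd H N ψ χ F)
    (hF' : IsLInd H N ψ χ' F') {ω : SmoothChar G} (hω : ∀ h ∈ H, ω.1 h = 1)
    (hχ' : χ' = χ * ω.res Z[N]) (τ : RepLoc H° ψ) : ((incl idG χ').obj (F'.obj τ)).cls =
    SmoothCls.map (smoothTwist ω) ((incl idG χ).obj (F.obj τ)).cls := by
  obtain ⟨e⟩ := hF.nonempty_comp_smoothTwist_iso hc hψ ω hF' hω hχ'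
  exact sound ⟨e.app τ⟩

include hc in
lemma CharData.range_mem_twistOrbits (hG : commutator G ≤ H) (hψ : ψ.Extends φ)
    (hψχ : ψ.Consistent χ) (κ : SmoothChar (base H N)) (hκ : κ.1 = φ)
    (F : ∀ χ' : ConsistentChars Z[N] ψ, RepLoc H° ψ ⥤ RepLoc idG χ'.1)
    (hF : ∀ χ' : ConsistentChars Z[N] ψ, IsLInd H N ψ χ'.1 (F χ')) (τ : RepLoc H° ψ)
    (hτ : τ.obj.ρ.IsIrreducible) : Set.range (fun χ' : ConsistentChars Z[N] ψ =>
      ((incl idG χ'.1).obj ((F χ').obj τ)).cls) ∈ twistOrbits H κ := by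
  have hχφ : ∀ χ' : SmoothChar Z[N], χ'.Consistent ψ → χ'.Extends φ :=
    fun χ' h x hx => ⟨⟨hx.1.1, hx.2⟩, uext ((h x ⟨hx.1.1, hx.2⟩ hx.1).trans
      (congrArg uval (hψ.apply _ hx)))⟩
  let χ₀ : ConsistentChars Z[N] ψ := ⟨χ, fun x h h' => (hψχ x h' h).symm⟩
  have := (hF χ₀).isEquivalence hc hψ
  refine ⟨((incl idG χ).obj ((F χ₀).obj τ)).cls,
    RepLoc.mem_irrLoc (κ' := κ) (hκ ▸ hχφ χ χ₀.2) _ ((RepLoc.isIrreducible_map_iff (F χ₀) τ).2 hτ),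
    Set.ext fun c => ⟨?_, ?_⟩⟩
  · rintro ⟨ω, rfl⟩
    have hω : ∀ h ∈ H, ω.1.1 h = 1 := fun h hh => uext (ω.2 h hh)
    have h1 : (χ * ω.1.res Z[N]).Consistent ψ := fun x hx hx' => by
      refine Eq.trans ?_ (χ₀.2 x hx hx')
      show (χ.1 ⟨x, hx⟩ : ℂ) * ω.1.1 x = χ.1 ⟨x, hx⟩
      rw [hω x hx'.2, val_one, mul_one]
    exact ⟨⟨_, h1⟩, IsLInd.cls_twist hc hψ (hF χ₀) (hF ⟨_, h1⟩) hω rfl τ⟩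
  · rintro ⟨χ', rfl⟩
    obtain ⟨ω, hω, h1⟩ := hc.exists_twist_eq hG (hχφ χ χ₀.2) (hχφ χ'.1 χ'.2)
    exact ⟨⟨ω, fun h hh => congrArg uval (hω h hh)⟩,
      (IsLInd.cls_twist hc hψ (hF χ₀) (hF χ') hω h1 τ).symm⟩

end

section

lemma RepLoc.nonempty_iso_of_cls {f : K →* G} {V W : RepLoc f κ}
    (h : ((incl f κ).obj V).cls = ((incl f κ).obj W).cls) : Nonempty (V ≅ W) := by
  obtain ⟨e⟩ := Quotient.exact h
  have : (incl f κ).Full := full_ιOfLE _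
  have : (incl f κ).Faithful := faithful_ιOfLE _
  exact ⟨(incl f κ).preimageIso e⟩

lemma SmoothChar.eq_of_smul {κ κ' : SmoothChar B} {v : V} (hv : v ≠ 0) {r : B → V} (h : ∀ b, r b = κ.val b • v)
    (h' : ∀ b, r b = κ'.val b • v) : κ = κ' :=
  SmoothChar.ext_val fun b => smul_left_injective ℂ hv ((h b).symm.trans (h' b))

end

section

lemma SmoothCls.map_twist_twist (ω ω' : SmoothChar G) (c : SmoothCls G) :
    SmoothCls.map (smoothTwist ω) (SmoothCls.map (smoothTwist ω') c) =
      SmoothCls.map (smoothTwist (ω * ω')) c := by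
  induction c using inductionOn with
  | _ V => exact sound ⟨smoothTwistTwist V ω ω' _ rfl⟩

lemma SmoothCls.map_twist_one (c : SmoothCls G) : SmoothCls.map (smoothTwist 1) c = c := by
  induction c using inductionOn with
  | _ V => exact sound ⟨repIso (X := (smoothTwist 1).obj V) (Y := V)
      (lid : V.obj →ₗ[ℂ] V.obj) (fun k v => one_smul ℂ (V.obj.ρ k v)) bijective_id⟩

lemma SmoothCls.map_conj_conj {H : Subgroup G} (hH : H.Normal) (g g' : G) (c : SmoothCls H) :
    SmoothCls.map (smoothConj hH g) (SmoothCls.map (smoothConj hH g') c) =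
      SmoothCls.map (smoothConj hH (g' * g)) c := by
  induction c using inductionOn with
  | _ V => exact sound ⟨repIso (X := (smoothConj hH g).obj ((smoothConj hH g').obj V))
      (Y := (smoothConj hH (g' * g)).obj V) (lid : V.obj →ₗ[ℂ] V.obj) (fun k v => by
        refine congrArg (fun k => V.obj.ρ k v) (sext ?_)
        show g' * (g * k * g⁻¹) * g'⁻¹ = g' * g * k * (g' * g)⁻¹
        group) bijective_id⟩

lemma SmoothCls.map_conj_one {H : Subgroup G} (hH : H.Normal) (c : SmoothCls H) :
    SmoothCls.map (smoothConj hH 1) c = c := by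
  induction c using inductionOn with
  | _ V => exact sound ⟨repIso (X := (smoothConj hH 1).obj V) (Y := V)
      (lid : V.obj →ₗ[ℂ] V.obj) (fun k v => by
        refine congrArg (fun k => V.obj.ρ k v) (sext ?_)
        show (1 : G) * k * (1 : G)⁻¹ = k
        group) bijective_id⟩

lemma conjOrbit_eq {H : Subgroup G} (hH : H.Normal) {c c' : SmoothCls H} (h : c' ∈ conjOrbit hH c) :
    conjOrbit hH c' = conjOrbit hH c := by
  obtain ⟨g, rfl⟩ := h
  ext x
  constructor
  · rintro ⟨g', rfl⟩
    exact ⟨g * g', (SmoothCls.map_conj_conj hH _ _ _).symm⟩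
  · rintro ⟨g', rfl⟩
    exact ⟨g⁻¹ * g', (SmoothCls.map_conj_conj hH _ _ _).trans (by rw [mul_inv_cancel_left])⟩

lemma mem_conjOrbit_self {H : Subgroup G} (hH : H.Normal) (c : SmoothCls H) : c ∈ conjOrbit hH c :=
  ⟨1, SmoothCls.map_conj_one hH c⟩

lemma twistOrbit_eq (H : Subgroup G) {c c' : SmoothCls G} (h : c' ∈ twistOrbit H c) :
    twistOrbit H c' = twistOrbit H c := by
  obtain ⟨ω, rfl⟩ := h
  have hval : ∀ (a b : SmoothChar G) x, (a * b).val x = a.val x * b.val x := fun _ _ _ => rfl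
  ext x
  constructor
  · rintro ⟨ω', rfl⟩
    exact ⟨⟨ω'.1 * ω.1, fun h hh => by rw [hval, ω'.2 h hh, ω.2 h hh, one_mul]⟩,
      (SmoothCls.map_twist_twist _ _ _).symm⟩
  · rintro ⟨ω', rfl⟩
    refine ⟨⟨ω'.1 * ω.1⁻¹, fun h hh => ?_⟩,
      (SmoothCls.map_twist_twist _ _ _).trans (by rw [inv_mul_cancel_right])⟩
    have h1 : (ω.1⁻¹).val h = (ω.1.val h)⁻¹ := Units.val_inv_eq_inv_val (ω.1.1 h)
    rw [hval, h1, ω'.2 h hh, ω.2 h hh, inv_one, one_mul]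

lemma mem_twistOrbit_self (H : Subgroup G) (c : SmoothCls G) : c ∈ twistOrbit H c :=
  ⟨⟨1, fun _ _ => rfl⟩, SmoothCls.map_twist_one c⟩

end

section

lemma SmoothChar.Extends.consistent_of_base
    (hψ : ψ.Extends φ) (hχ : χ.Extends φ) : ψ.Consistent χ := fun _ hx hx' =>
  congrArg uval ((hψ.apply hx ⟨hx, hx'.2⟩).trans (hχ.apply hx' ⟨hx, hx'.2⟩).symm)

include hc in
lemma CharData.exists_isLInd (hψ : ψ.Extends φ) (hχ : χ.Extends φ) : ∃ F, IsLInd H N ψ χ F := by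
  obtain ⟨L, hL⟩ := hc.1.exists_lagrangian
  obtain ⟨D, -⟩ := hc.1.exists_extension_char hL ψ χ (hψ.consistent_of_base hχ)
  obtain ⟨F, hF⟩ := D.exists_isLInd hc hψ
  exact ⟨F, D, hF⟩

include hc in
lemma CharData.exists_irr_H (κ : SmoothChar (base H N)) (hκ : κ.1 = φ)
    (V : RepLoc H° κ) (hV : V.obj.ρ.IsIrreducible) :
    ∃ ψ : SmoothChar ↥(N ⊓ H), ψ.Extends φ ∧ ∃ τ : RepLoc H° ψ, τ.obj.ρ.IsIrreducible ∧
      ((incl H° ψ).obj τ).cls = ((incl H° κ).obj V).cls := by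
  have hbase : ∀ b : base H N, ∀ v, V.obj.ρ ⟨b, base_le_H b.2⟩ v = κ.val b • v := fun b v =>
    V.rho_eq_smul hV (k := ⟨b, base_le_H b.2⟩) b.2 (fun k => sext (mem_center_iff.1 b.2.2 k)) v
  obtain ⟨ψ, h1, h2⟩ := ((incl H° κ).obj V).exists_char hV (N ⊓ H) H°
    (inclusion inf_le_right) (continuous_inclusion inf_le_right) (fun _ => rfl)
    Subtype.val_injective (fun k b => sext (hc.1.comm_NH b.2.1 k.2))
    hc.relIndex_ne_zero (fun b => by
      have hb : (b : G) ^ (base H N).relIndex N ∈ base H N := (hc.1.basePow ⟨b, b.2.1⟩).2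
      exact ⟨κ.val ⟨_, hb⟩, lext fun v => hbase ⟨_, hb⟩ v⟩)
  obtain ⟨w, hw⟩ := hV.exists_ne_zero
  refine ⟨ψ, fun x hx => ⟨hx.1, uext (smul_left_injective ℂ hw ?_)⟩,
    ⟨V.obj, V.property.1, h2⟩, hV, rfl⟩
  have h3 : V.obj.ρ ⟨x, base_le_H hx⟩ w = ψ.val ⟨x, hx.1⟩ • w := h1 ⟨x, hx.1⟩ w
  have h4 := hbase ⟨x, hx⟩ w
  rw [← hκ]
  exact h3.symm.trans h4

include hc in
lemma CharData.exists_irr_G (κ : SmoothChar (base H N)) (hκ : κ.1 = φ)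
    (V : RepLoc idG κ) (hV : V.obj.ρ.IsIrreducible) :
    ∃ χ : SmoothChar Z[N], χ.Extends φ ∧ ∃ π : RepLoc idG χ,
      π.obj.ρ.IsIrreducible ∧ ((incl idG χ).obj π).cls = ((incl idG κ).obj V).cls := by
  have hbase : ∀ b : base H N, ∀ v, V.obj.ρ b v = κ.val b • v := fun b v =>
    V.rho_eq_smul hV (k := b) b.2 (fun k => mem_center_iff.1 b.2.2 k) v
  obtain ⟨χ, h1, h2⟩ := ((incl idG κ).obj V).exists_char hV Z[N] (hid G) (Subgroup.subtype _) csv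
    (fun _ => rfl) Function.injective_id (fun k b => mem_center_iff.1 b.2.2 k)
    hc.relIndex_ne_zero (fun b => by
      have hb : (b : G) ^ (base H N).relIndex N ∈ base H N := (hc.1.basePow ⟨b, b.2.1⟩).2
      exact ⟨κ.val ⟨_, hb⟩, lext fun v => hbase ⟨_, hb⟩ v⟩)
  obtain ⟨w, hw⟩ := hV.exists_ne_zero
  refine ⟨χ, fun x hx => ⟨⟨hx.1.1, hx.2⟩, uext (smul_left_injective ℂ hw ?_)⟩,
    ⟨V.obj, V.property.1, h2⟩, hV, rfl⟩
  have h3 : V.obj.ρ x w = χ.val ⟨x, hx.1.1, hx.2⟩ • w := h1 ⟨x, hx.1.1, hx.2⟩ w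
  have h4 := hbase ⟨x, hx⟩ w
  rw [← hκ]
  exact h3.symm.trans h4

variable {χ₁ χ₂ : SmoothChar Z[N]} {ψ₁ ψ₂ : SmoothChar ↥(N ⊓ H)} (hψ₁ : ψ₁.Extends φ)
  (hψ₂ : ψ₂.Extends φ) (hχ₁ : χ₁.Extends φ) (hχ₂ : χ₂.Extends φ) {F₁ : RepLoc H° ψ₁ ⥤ RepLoc idG χ₁}
  (hF₁ : IsLInd H N ψ₁ χ₁ F₁) {F₂ : RepLoc H° ψ₂ ⥤ RepLoc idG χ₂} (hF₂ : IsLInd H N ψ₂ χ₂ F₂)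
  {τ₁ : RepLoc H° ψ₁} (hτ₁ : τ₁.obj.ρ.IsIrreducible) {τ₂ : RepLoc H° ψ₂}
  (hτ₂ : τ₂.obj.ρ.IsIrreducible)

include hc hψ₁ hχ₁ hχ₂ hF₁ hF₂ hτ₁ hτ₂ in
lemma IsLInd.mem_twistOrbit (hG : commutator G ≤ H) (hH : H.Normal) (hB : (N ⊓ H).Normal)
    (h : ((incl H° ψ₂).obj τ₂).cls ∈ conjOrbit hH ((incl H° ψ₁).obj τ₁).cls) :
    ((incl idG χ₂).obj (F₂.obj τ₂)).cls ∈ twistOrbit H ((incl idG χ₁).obj (F₁.obj τ₁)).cls := by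
  obtain ⟨g, hg⟩ := h
  obtain rfl : ψ₂ = ψ₁.conj hB g := by
    obtain ⟨i⟩ := Quotient.exact hg; obtain ⟨w, hw⟩ := hτ₂.exists_ne_zero
    refine SmoothChar.eq_of_smul hw (r := fun b => τ₂.obj.ρ ⟨b, b.2.2⟩ w)
      (fun b => τ₂.rho_eq_smul hτ₂ (k := ⟨b, b.2.2⟩) b.2
        (fun k => sext (hc.1.comm_NH b.2.1 k.2)) w) fun b => ?_
    have h1 : ∀ v : τ₁.obj, ((smoothConj hH g).obj ((incl H° ψ₁).obj τ₁)).obj.ρ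
        ⟨b, b.2.2⟩ v = (ψ₁.conj hB g).val b • v := fun v => by
      have hb := hB.conj_mem b b.2 g; exact τ₁.rho_eq_smul hτ₁ (k := ⟨g * b * g⁻¹, hb.2⟩) hb
        (fun k => sext (hc.1.comm_NH hb.1 k.2)) v
    let i' : τ₁.obj →ₗ[ℂ] τ₂.obj := repLin i.hom
    have h2 : ∀ v, i' (((smoothConj hH g).obj ((incl H° ψ₁).obj τ₁)).obj.ρ
        ⟨b, b.2.2⟩ v) = τ₂.obj.ρ ⟨b, b.2.2⟩ (i' v) := fun v => repLin_comm i.hom ⟨b, b.2.2⟩ v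
    have h3 : i' (repLin i.inv w) = w := repLin_hom_inv i w
    have h4 := h2 (repLin i.inv w)
    rw [h3] at h4; refine h4.symm.trans ((congrArg i' (h1 _)).trans ?_)
    exact (map_smul i' _ _).trans (congrArg _ h3)
  obtain ⟨ω, hω, h2⟩ := hc.exists_twist_eq hG hχ₁ hχ₂
  obtain ⟨F, hF⟩ := hc.exists_isLInd hψ₁ hχ₂
  obtain ⟨e⟩ := hF.nonempty_conj_iso hc hψ₁ hH hB g hF₂
  obtain ⟨i⟩ := RepLoc.nonempty_iso_of_cls (V := (RepLoc.conj hH hB ψ₁ g).obj τ₁) (W := τ₂) hg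
  refine ⟨⟨ω, fun h hh => congrArg uval (hω h hh)⟩,
    (IsLInd.cls_twist hc hψ₁ hF₁ hF hω h2 τ₁).symm.trans ?_⟩
  exact sound ⟨(incl idG χ₂).mapIso ((e.app τ₁).symm ≪≫ F₂.mapIso i)⟩

include hc hψ₁ hψ₂ hχ₂ hF₁ hF₂ hτ₁ hτ₂ in
lemma IsLInd.mem_conjOrbit (hH : H.Normal) (hB : (N ⊓ H).Normal)
    (h : ((incl idG χ₂).obj (F₂.obj τ₂)).cls ∈ twistOrbit H ((incl idG χ₁).obj (F₁.obj τ₁)).cls) :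
    ((incl H° ψ₂).obj τ₂).cls ∈ conjOrbit hH ((incl H° ψ₁).obj τ₁).cls := by
  obtain ⟨⟨ω, hω'⟩, hg⟩ := h
  have hω : ∀ h ∈ H, ω.1 h = 1 := fun h hh => uext (hω' h hh)
  have := hF₁.isEquivalence hc hψ₁
  have := hF₂.isEquivalence hc hψ₂
  have hχ : χ₂ = χ₁ * ω.res Z[N] := by
    obtain ⟨i⟩ := Quotient.exact hg; have hI₁ := (RepLoc.isIrreducible_map_iff F₁ τ₁).2 hτ₁
    have hI₂ := (RepLoc.isIrreducible_map_iff F₂ τ₂).2 hτ₂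
    obtain ⟨w, hw⟩ := hI₂.exists_ne_zero
    refine SmoothChar.eq_of_smul hw (r := fun b => (F₂.obj τ₂).obj.ρ b w)
      (fun b => (F₂.obj τ₂).rho_eq_smul hI₂ (k := b) b.2
        (fun k => mem_center_iff.1 b.2.2 k) w) fun b => ?_
    have h1 : ∀ v : (F₁.obj τ₁).obj, ω.val b • (F₁.obj τ₁).obj.ρ b v =
        (χ₁ * ω.res Z[N]).val b • v := fun v => by
      rw [(F₁.obj τ₁).rho_eq_smul hI₁ (k := b) b.2 (fun k => mem_center_iff.1 b.2.2 k),
        smul_smul, mul_comm]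
      rfl
    let i' : (F₁.obj τ₁).obj →ₗ[ℂ] (F₂.obj τ₂).obj := repLin i.hom
    have h2 : ∀ v, i' (ω.val b • (F₁.obj τ₁).obj.ρ b v) = (F₂.obj τ₂).obj.ρ b (i' v) :=
      fun v => repLin_comm i.hom (b : G) v
    have h3 : i' (repLin i.inv w) = w := repLin_hom_inv i w
    have h4 := h2 (repLin i.inv w)
    rw [h3] at h4; refine h4.symm.trans ((congrArg i' (h1 _)).trans ?_)
    exact (map_smul i' _ _).trans (congrArg _ h3)
  obtain ⟨g, rfl⟩ := hc.exists_conj_eq hB hψ₁ hψ₂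
  obtain ⟨F, hF⟩ := hc.exists_isLInd hψ₁ hχ₂
  obtain ⟨e⟩ := hF.nonempty_conj_iso hc hψ₁ hH hB g hF₂
  have h2 := (IsLInd.cls_twist hc hψ₁ hF₁ hF hω hχ τ₁).trans hg
  obtain ⟨i⟩ := RepLoc.nonempty_iso_of_cls h2
  exact ⟨g, sound ⟨(incl H° (ψ₁.conj hB g)).mapIso (F₂.preimageIso (e.app τ₁ ≪≫ i))⟩⟩

include hc in
lemma CharData.existsUnique_orbit_equiv (hG : commutator G ≤ H) (hH : H.Normal)
    (hB : (N ⊓ H).Normal) (κ : SmoothChar (base H N)) (hκ : κ.1 = φ)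
    (hψ₁ : ψ₁.Extends φ) (hχ₁ : χ₁.Extends φ) :
    ∃! Φ : ↥(conjOrbits hH κ) ≃ ↥(twistOrbits H κ),
      ∀ (ψ' : SmoothChar ↥(N ⊓ H)) (χ' : SmoothChar Z[N]),
        ψ'.Consistent κ → χ'.Consistent κ → ∀ F, IsLInd H N ψ' χ' F →
        ∀ τ : RepLoc H° ψ', τ.obj.ρ.IsIrreducible →
        ∀ O : ↥(conjOrbits hH κ), ((incl H° ψ').obj τ).cls ∈ O.1 →
          ((incl idG χ').obj (F.obj τ)).cls ∈ (Φ O).1 := by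
  have hex : ∀ {B : Subgroup G} {α : SmoothChar B}, α.Consistent κ → base H N ≤ B →
      α.Extends φ := fun h hB => hκ ▸ h.extends hB
  have hle : base H N ≤ Z[N] := hχ₁.le
  have hle' : base H N ≤ N ⊓ H := hψ₁.le
  have hrep : ∀ O : ↥(conjOrbits hH κ), ∃ (ψ' : SmoothChar ↥(N ⊓ H)) (_ : ψ'.Extends φ)
      (τ : RepLoc H° ψ'), τ.obj.ρ.IsIrreducible ∧
        O.1 = conjOrbit hH ((incl H° ψ').obj τ).cls := fun O => by
    obtain ⟨c, ⟨V, hV, rfl⟩, hO⟩ := O.2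
    obtain ⟨ψ', hψ', τ, hτ, h⟩ := hc.exists_irr_H κ hκ V hV
    exact ⟨ψ', hψ', τ, hτ, by rw [h, hO]⟩
  choose ψ' hψ' τ hτ hO using hrep
  choose F hF using fun O => hc.exists_isLInd (hψ' O) hχ₁
  have hirr : ∀ O, ((F O).obj (τ O)).obj.ρ.IsIrreducible := fun O => by
    have := (hF O).isEquivalence hc (hψ' O)
    exact (RepLoc.isIrreducible_map_iff (F O) (τ O)).2 (hτ O)
  let Φ : ↥(conjOrbits hH κ) → ↥(twistOrbits H κ) := fun O =>
    ⟨twistOrbit H ((incl idG χ₁).obj ((F O).obj (τ O))).cls,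
      Set.mem_image_of_mem _ (RepLoc.mem_irrLoc (hκ.symm ▸ hχ₁) _ (hirr O))⟩
  have hΦ : ∀ (ψ' : SmoothChar ↥(N ⊓ H)) (χ' : SmoothChar Z[N]),
      χ'.Extends φ → ∀ F, IsLInd H N ψ' χ' F →
      ∀ τ : RepLoc H° ψ', τ.obj.ρ.IsIrreducible →
      ∀ O : ↥(conjOrbits hH κ), ((incl H° ψ').obj τ).cls ∈ O.1 →
        ((incl idG χ').obj (F.obj τ)).cls ∈ (Φ O).1 :=
    fun ψ'' χ'' hχ'' F'' hF'' τ'' hτ'' O hτO =>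
      IsLInd.mem_twistOrbit hc (hψ' O) hχ₁ hχ'' (hF O) hF'' (hτ O) hτ'' hG hH hB (hO O ▸ hτO)
  have hbij : Bijective Φ := by
    constructor
    · intro O O' h
      have h1 : twistOrbit H _ = twistOrbit H _ := congrArg sval h
      have h2 := IsLInd.mem_conjOrbit hc (hψ' O') (hψ' O) hχ₁ (hF O') (hF O) (hτ O') (hτ O) hH hB
        (h1 ▸ mem_twistOrbit_self H _)
      have h3 := conjOrbit_eq hH h2; rw [← hO, ← hO] at h3; exact sext h3
    · intro P; obtain ⟨c, ⟨V, hV, rfl⟩, hP⟩ := P.2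
      obtain ⟨χ', hχ', π, hπ, h⟩ := hc.exists_irr_G κ hκ V hV
      obtain ⟨F', hF'⟩ := hc.exists_isLInd hψ₁ hχ'
      have := hF'.isEquivalence hc hψ₁; let σ := F'.asEquivalence.inverse.obj π
      have e : F'.obj σ ≅ π := F'.asEquivalence.counitIso.app π
      have hσ : σ.obj.ρ.IsIrreducible :=
        (RepLoc.isIrreducible_map_iff F'.asEquivalence.inverse π).2 hπ
      let O : ↥(conjOrbits hH κ) := ⟨conjOrbit hH ((incl H° ψ₁).obj σ).cls,
        Set.mem_image_of_mem _ (RepLoc.mem_irrLoc (hκ.symm ▸ hψ₁) _ hσ)⟩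
      refine ⟨O, sext ?_⟩
      have h1 := hΦ ψ₁ χ' hχ' F' hF' σ hσ O (mem_conjOrbit_self hH _)
      have h2 := twistOrbit_eq H h1; refine h2.symm.trans ?_
      have h3 : ((incl idG χ').obj (F'.obj σ)).cls = ((incl idG χ').obj π).cls :=
        sound ⟨(incl idG χ').mapIso e⟩
      rw [h3, h, hP]
  refine ⟨Equiv.ofBijective Φ hbij, fun ψ'' χ'' _ hχ'' F'' hF'' τ'' hτ'' O hO' =>
    hΦ ψ'' χ'' (hex hχ'' hle) F'' hF'' τ'' hτ'' O hO', fun Ψ hΨ => Equiv.ext fun O => ?_⟩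
  have h1 := hΨ (ψ' O) χ₁ ((hκ.symm ▸ hψ' O : (ψ' O).Extends κ.1).consistent)
    ((hκ.symm ▸ hχ₁ : χ₁.Extends κ.1).consistent) (F O) (hF O) (τ O) (hτ O) O
    (hO O ▸ mem_conjOrbit_self hH _)
  obtain ⟨c, -, hc'⟩ := (Ψ O).2
  refine sext ?_
  rw [← hc'] at h1 ⊢
  exact (twistOrbit_eq H h1).symm

end

/-! ### Compact open subgroups -/

open scoped Pointwise in
lemma exists_isCompact_isOpen_subgroup (K : Type*) [Group K] [TopologicalSpace K]
    [IsTopologicalGroup K] [T2Space K] [LocallyCompactSpace K] [TotallyDisconnectedSpace K] :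
    HasCompactOpen K := by
  obtain ⟨C₀, hC₀, hC₀'⟩ := exists_compact_mem_nhds (1 : K)
  obtain ⟨C, ⟨hC, hCo⟩, hC1, hC'⟩ :=
    (loc_compact_Haus_tot_disc_of_zero_dim (H := K)).mem_nhds_iff.1 hC₀'
  have hCc : IsCompact C := hC₀.of_isClosed_subset hC hC'
  obtain ⟨T, hT, hTC⟩ := compact_open_separated_mul_right hCc hCo subset_rfl
  obtain ⟨S, hS, hST⟩ : ∃ S ∈ nhds (1 : K), ∀ x ∈ S, x ∈ T ∧ x⁻¹ ∈ T :=
    ⟨T ∩ T⁻¹, Filter.inter_mem hT (inv_mem_nhds_one K hT), fun x hx => ⟨hx.1, hx.2⟩⟩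
  have h : ∀ x ∈ Subgroup.closure S, x ∈ C := by
    intro x hx
    induction hx using Subgroup.closure_induction_right with
    | one => exact hC1
    | mul_right x hx y hy ih => exact hTC (Set.mul_mem_mul ih (hST y hy).1)
    | mul_inv_cancel x hx y hy ih => exact hTC (Set.mul_mem_mul ih (hST y hy).2)
  have ho : IsOpen (Subgroup.closure S : Set K) :=
    Subgroup.isOpen_of_mem_nhds _ (g := 1) (Filter.mem_of_superset hS Subgroup.subset_closure)
  exact ⟨_, ho, hCc.of_isClosed_subset (isClosed_of_isOpen _ ho) h⟩

open scoped Pointwise in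
lemma IsCentralCovering.isProperMap {A Gbar G : Type*} [CommGroup A] [Finite A] [TopologicalSpace A]
    [Group Gbar] [TopologicalSpace Gbar] [Group G] [TopologicalSpace G] [IsTopologicalGroup G]
    {ι : A →* G} {pr : G →* Gbar} (h : IsCentralCovering ι pr) : IsProperMap pr := by
  have hq := h.isSES.isOpenQuotientMap
  have hker : ∀ x, pr x = 1 ↔ x ∈ Set.range ι := h.isSES.mulExact
  have hfin : (Set.range ι).Finite := Set.finite_range ι
  rw [isProperMap_iff_isClosedMap_and_compact_fibers]
  refine ⟨hq.continuous, fun C hC => ?_, fun y => ?_⟩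
  · rw [← hq.isQuotientMap.isClosed_preimage]
    have : pr ⁻¹' (pr '' C) = C * Set.range ι := by
      ext x; simp only [Set.mem_preimage, Set.mem_image, Set.mem_mul]
      constructor
      · rintro ⟨c, hc, hcx⟩
        exact ⟨c, hc, c⁻¹ * x, (hker _).1 (by rw [map_mul, map_inv, hcx, inv_mul_cancel]),
          mul_inv_cancel_left _ _⟩
      · rintro ⟨c, hc, a, ha, rfl⟩
        exact ⟨c, hc, by rw [map_mul, (hker a).2 ha, mul_one]⟩
    rw [this]; exact hC.mul_right_of_isCompact hfin.isCompact
  · obtain ⟨x, rfl⟩ := hq.surjective y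
    have : pr ⁻¹' {pr x} = (x * ·) '' Set.range ι := by
      ext z; constructor
      · intro hz; exact ⟨x⁻¹ * z, (hker _).1 (by
          rw [map_mul, map_inv, show pr z = pr x from hz, inv_mul_cancel]),
          mul_inv_cancel_left _ _⟩
      · rintro ⟨a, ha, rfl⟩
        show pr (x * a) = pr x
        rw [map_mul, (hker a).2 ha, mul_one]
    rw [this]; exact (hfin.image _).isCompact

lemma IsProperMap.locallyCompactSpace_group {G M : Type*} [Group G] [TopologicalSpace G]
    [IsTopologicalGroup G] [TopologicalSpace M] [LocallyCompactSpace M] {f : G → M}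
    (hf : IsProperMap f) : LocallyCompactSpace G := by
  obtain ⟨C, hC, hC'⟩ := exists_compact_mem_nhds (f 1)
  exact (hf.isCompact_preimage hC).locallyCompactSpace_of_mem_nhds_of_group
    (hf.continuous.continuousAt.preimage_mem_nhds hC')

lemma IsProperMap.sigmaCompactSpace {G M : Type*} [TopologicalSpace G] [TopologicalSpace M]
    [SigmaCompactSpace M] {f : G → M} (hf : IsProperMap f) : SigmaCompactSpace G :=
  SigmaCompactSpace.of_countable (Set.range fun n => f ⁻¹' compactCovering M n)
    (Set.countable_range _) (by
      rintro _ ⟨n, rfl⟩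
      exact hf.isCompact_preimage (isCompact_compactCovering M n)) (by
      rw [Set.sUnion_range, ← Set.preimage_iUnion, iUnion_compactCovering, Set.preimage_univ])

/-! ### Subgroups that are finite over open subgroups -/

/-- `W` is commensurable to a subgroup of every open subgroup that contains `B`. -/
def FinOver (B W : Subgroup K) : Prop :=
  ∀ O : Subgroup K, IsOpen (O : Set K) → B ≤ O → O.relIndex W ≠ 0

namespace FinOver

variable {B C W W' : Subgroup K}

lemma of_isCompact (hW : IsCompact (W : Set K)) : FinOver B W := by
  intro O hO _
  obtain ⟨t, ht⟩ := hW.elim_finite_subcover (fun w : K => (w * ·) '' (O : Set K))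
    (fun w => (Homeomorph.mulLeft w).isOpenMap _ hO)
    (fun w _ => Set.mem_iUnion.2 ⟨w, 1, O.one_mem, mul_one w⟩)
  have : Finite (W ⧸ O.subgroupOf W) := by
    have hex : ∀ q : W ⧸ O.subgroupOf W, ∃ w ∈ t, w⁻¹ * (q.out : K) ∈ O := fun q => by
      obtain ⟨w, hw⟩ := Set.mem_iUnion.1 (ht q.out.2)
      obtain ⟨hwt, o, ho, hwo⟩ := Set.mem_iUnion.1 hw
      exact ⟨w, hwt, by rw [← hwo]; simpa using ho⟩
    choose f hf hf' using hex
    refine Finite.of_injective (fun q => (⟨f q, hf q⟩ : t)) fun q q' h => ?_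
    have h' : f q = f q' := congrArg sval h
    rw [← q.out_eq', ← q'.out_eq']; refine Quotient.sound' (leftRel_apply.2 ?_)
    have := O.mul_mem (O.inv_mem (hf' q)) (h' ▸ hf' q')
    rw [mem_subgroupOf]; simpa [mul_assoc] using this
  exact Subgroup.index_ne_zero_of_finite

lemma mono (h : FinOver B W) (hW : W' ≤ W) : FinOver B W' := fun O hO hB h0 =>
  h O hO hB (relIndex_eq_zero_of_le_right hW h0)

lemma mono_left (h : FinOver B W) (hB : B ≤ C) : FinOver C W := fun O hO hC =>
  h O hO (hB.trans hC)

lemma of_relIndex (h : B.relIndex W ≠ 0) : FinOver B W := fun _ _ hB h0 =>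
  h (relIndex_eq_zero_of_le_left hB h0)

lemma refl (B : Subgroup K) : FinOver B B :=
  of_relIndex (by rw [relIndex_self]; exact one_ne_zero)

end FinOver

lemma Subgroup.relIndex_eq_of_forall {O C W : Subgroup K} (hCW : C ≤ W)
    (h : ∀ w ∈ W, ∃ c ∈ C, c⁻¹ * w ∈ O) : O.relIndex W = O.relIndex C := by
  let f := Subgroup.quotientSubgroupOfEmbeddingOfLE O hCW
  refine (Nat.card_congr (Equiv.ofBijective f ⟨f.injective, fun q => ?_⟩)).symm
  induction q using QuotientGroup.induction_on with
  | H w =>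
    obtain ⟨c, hc, hcw⟩ := h w w.2
    exact ⟨((⟨c, hc⟩ : C) : C ⧸ O.subgroupOf C), Quotient.sound' (leftRel_apply.2 hcw)⟩

lemma normal_of_le_center {C : Subgroup K} (hC : C ≤ center K) : C.Normal := ⟨fun n hn g => by
  rwa [mem_center_iff.1 (hC hn) g, mul_inv_cancel_right]⟩

lemma Subgroup.relIndex_sup_of_le_center {O C : Subgroup K}
    (hC : C ≤ center K) : O.relIndex (C ⊔ O) = O.relIndex C :=
  Subgroup.relIndex_eq_of_forall le_sup_left fun w hw => by
    have := normal_of_le_center hC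
    obtain ⟨c, hc, o, ho, rfl⟩ := mem_sup_of_normal_left.1 hw
    exact ⟨c, hc, by simpa using ho⟩

namespace FinOver

variable {B C W W' : Subgroup K}

lemma trans (h : FinOver C W) (h' : FinOver B C)
    (hC : C ≤ center K) : FinOver B W := fun O hO hB => by
  refine Subgroup.relIndex_ne_zero_trans (K := C ⊔ O) ?_
    (h _ (isOpen_mono le_sup_right hO) le_sup_left)
  rw [Subgroup.relIndex_sup_of_le_center hC]
  exact h' O hO hB

lemma sup (h : FinOver B C) (hC : C ≤ center K)
    (hW : IsCompact (W : Set K)) : FinOver B (C ⊔ W) := by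
  refine FinOver.trans (C := C) (fun O hO hCO => ?_) h hC
  rw [Subgroup.relIndex_eq_of_forall (C := W) le_sup_right fun w hw => by
    have := normal_of_le_center hC
    obtain ⟨c, hc, u, hu, rfl⟩ := mem_sup_of_normal_left.1 hw; refine ⟨u, hu, hCO ?_⟩
    rw [← mul_assoc, mem_center_iff.1 (hC hc) u⁻¹, inv_mul_cancel_right]; exact hc]
  exact FinOver.of_isCompact hW O hO hCO

end FinOver

/-! ### Sums over coset spaces -/

section

variable {E : Type*} {𝕜 : Type*} [RCLike 𝕜]

/-- Invariance of a function under right translation by `W`. -/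
def RightInv (W : Subgroup K) (F : K → E) : Prop := ∀ x, ∀ w ∈ W, F (x * w) = F x

namespace RightInv

variable {W W' : Subgroup K} {F : K → E} {f : K → 𝕜}

lemma mono (h : RightInv W F) (hW : W' ≤ W) : RightInv W' F := fun x w hw => h x w (hW hw)

lemma out (h : RightInv W F) (x : K) : F (x : K ⧸ W).out = F x := by
  obtain ⟨w, hw⟩ := mk_out_eq_mul W x
  rw [hw, h x w w.2]

lemma comp {E' : Type*} (h : RightInv W F) (g : E → E') : RightInv W fun x => g (F x) :=
  fun x w hw => congrArg g (h x w hw)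

lemma mul_left (h : RightInv W F) (g : K) : RightInv W fun x => F (g * x) := fun x w hw =>
  (congrArg F (mul_assoc g x w).symm).trans (h _ w hw)

lemma mul_right (h : RightInv W F) (g : K) :
    RightInv (W.map (MulAut.conj g).toMonoidHom) fun x => F (x * g) := by
  rintro x _ ⟨w, hw, rfl⟩
  refine Eq.trans (congrArg F ?_) (h (x * g) w hw)
  simp [mul_assoc]

lemma subgroupOf (h : RightInv W F) (H : Subgroup K) :
    RightInv (W.subgroupOf H) fun x : H => F x := fun x w hw => h x w hw

lemma summable_mul_right (h : RightInv W f) (g : K) (hs : Summable fun q : K ⧸ W => f q.out) :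
    Summable fun q : K ⧸ W.map (MulAut.conj g).toMonoidHom => f (q.out * g) := by
  have hinj : Injective
      fun q : K ⧸ W.map (MulAut.conj g).toMonoidHom => ((q.out * g : K) : K ⧸ W) := by
    intro q q' hq
    rw [← q.out_eq', ← q'.out_eq']
    refine Quotient.sound' (leftRel_apply.2 ⟨_, QuotientGroup.eq.1 hq, ?_⟩)
    simp [mul_assoc]
  exact (hs.comp_injective hinj).congr fun q => h.out _

lemma summable_subgroupOf (h : RightInv W f) (H : Subgroup K)
    (hs : Summable fun q : K ⧸ W => f q.out) : Summable fun q : H ⧸ W.subgroupOf H => f q.out := by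
  have hinj : Injective fun q : H ⧸ W.subgroupOf H => ((q.out : K) : K ⧸ W) := by
    intro q q' hq
    rw [← q.out_eq', ← q'.out_eq']; have hq' : ((q.out : K) : K ⧸ W) = ((q'.out : K) : K ⧸ W) := hq
    exact Quotient.sound' (leftRel_apply.2 (mem_subgroupOf.2 (QuotientGroup.eq.1 hq')))
  exact (hs.comp_injective hinj).congr fun q => h.out _

lemma summable_mul_left (h : RightInv W f) (g : K) :
    (Summable fun q : K ⧸ W => f (g * q.out)) ↔ Summable fun q : K ⧸ W => f q.out := by
  rw [← (toPerm g : Equiv.Perm (K ⧸ W)).summable_iff (f := fun q => f q.out)]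
  refine summable_congr fun q => ?_
  obtain ⟨x, rfl⟩ := mk_surjective q
  exact ((h.mul_left g).out x).trans (h.out (g * x)).symm

lemma tsum_mul_left (h : RightInv W f) (g : K) :
    ∑' q : K ⧸ W, f (g * q.out) = ∑' q : K ⧸ W, f q.out := by
  rw [← (toPerm g : Equiv.Perm (K ⧸ W)).tsum_eq fun q => f q.out]
  refine tsum_congr fun q => ?_
  obtain ⟨x, rfl⟩ := mk_surjective q
  exact ((h.mul_left g).out x).trans (h.out (g * x)).symm

lemma summable_iff_of_le (h : RightInv W f) (hle : W' ≤ W) (h0 : W'.relIndex W ≠ 0) :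
    ((Summable fun q : K ⧸ W' => f q.out) ↔ Summable fun q : K ⧸ W => f q.out) ∧
      ((Summable fun q : K ⧸ W => f q.out) →
        ∑' q : K ⧸ W', f q.out = W'.relIndex W * ∑' q : K ⧸ W, f q.out) := by
  have : (W'.subgroupOf W).FiniteIndex := ⟨h0⟩
  have := ofFinite (W ⧸ W'.subgroupOf W)
  let e := Subgroup.quotientEquivProdOfLE hle
  have he : ∀ q : K ⧸ W', f q.out = f (e q).1.out * (1 : 𝕜) := by
    intro q; obtain ⟨x, rfl⟩ := mk_surjective q
    exact ((h.mono hle).out x).trans ((h.out x).symm.trans (mul_one _).symm)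
  have h1 : Summable fun _ : W ⧸ W'.subgroupOf W => ‖(1 : 𝕜)‖ := Summable.of_finite
  refine ⟨⟨fun hs => ?_, fun hs => ?_⟩, fun hs => ?_⟩
  · have h2 := ((e.symm.summable_iff.2 hs).comp_injective
      (fun a b hab => congrArg Prod.fst hab : Injective
        fun q : K ⧸ W => (q, ((1 : W) : W ⧸ W'.subgroupOf W))))
    refine h2.congr fun q => ?_
    simp only [Function.comp_apply, he, Equiv.apply_symm_apply, mul_one]
  · rw [← e.symm.summable_iff]; refine (summable_mul_of_summable_norm hs.norm h1).congr fun p => ?_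
    simp only [Function.comp_apply, he, Equiv.apply_symm_apply]
  · rw [← e.symm.tsum_eq, mul_comm]; have h2 := tsum_mul_tsum_of_summable_norm hs.norm h1
    rw [tsum_fintype (fun _ : W ⧸ W'.subgroupOf W => (1 : 𝕜)), sum_const, card_univ,
      ← Nat.card_eq_fintype_card, nsmul_one] at h2
    refine Eq.trans (tsum_congr fun p => ?_) h2.symm
    simp only [he, Equiv.apply_symm_apply]

lemma summable_iff_split (h : RightInv W f) {H : Subgroup K} [H.FiniteIndex] (hle : W ≤ H) :
    ((Summable fun q : K ⧸ W => f q.out) ↔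
      ∀ c : K ⧸ H, Summable fun q : H ⧸ W.subgroupOf H => f (c.out * q.out)) ∧
      ((Summable fun q : K ⧸ W => f q.out) →
        ∑' q : K ⧸ W, f q.out = ∑ᶠ c : K ⧸ H, ∑' q : H ⧸ W.subgroupOf H, f (c.out * q.out)) := by
  let e := Subgroup.quotientEquivProdOfLE hle
  have := ofFinite (K ⧸ H)
  have he : ∀ p, f (e.symm p).out = f (p.1.out * p.2.out) := by
    rintro ⟨c, q⟩
    obtain ⟨x, rfl⟩ := mk_surjective q; refine (h.out (c.out * x)).trans ?_
    exact (((h.mul_left c.out).subgroupOf H).out x).symm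
  have hsum : (Summable fun q : K ⧸ W => f q.out) ↔
      Summable fun p : (K ⧸ H) × (H ⧸ W.subgroupOf H) => f (p.1.out * p.2.out) := by
    rw [← e.symm.summable_iff]; exact summable_congr he
  refine ⟨hsum.trans ⟨fun hs c => hs.prod_factor c, fun hs => ?_⟩, fun hs => ?_⟩
  · rw [← summable_norm_iff, summable_prod_of_nonneg fun _ => norm_nonneg _]
    exact ⟨fun c => (hs c).norm, Summable.of_finite⟩
  · rw [← e.symm.tsum_eq, finsum_eq_sum_of_fintype, ← tsum_fintype (L := .unconditional _),
      ← Summable.tsum_prod (f := fun p : (K ⧸ H) × (H ⧸ W.subgroupOf H) => f (p.1.out * p.2.out))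
        (hsum.1 hs)]
    exact tsum_congr he

end RightInv

/-- `W` is an open subgroup containing `B` that is finite over the open subgroups
containing `B`. -/
structure IsLevel (B W : Subgroup K) : Prop where
  le : B ≤ W
  isOpen : IsOpen (W : Set K)
  finOver : FinOver B W

namespace IsLevel

variable {B C W W' : Subgroup K} {f : K → 𝕜}

lemma inf (h : IsLevel B W) (hO : IsOpen (W' : Set K)) (hB : B ≤ W') : IsLevel B (W ⊓ W') :=
  ⟨le_inf h.le hB, h.isOpen.inter hO, h.finOver.mono inf_le_left⟩

lemma summable_inf_iff (hW : IsLevel B W) (hW' : IsLevel B W') (hf : RightInv W f) :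
    (Summable fun q : K ⧸ (W ⊓ W' : Subgroup K) => f q.out) ↔ Summable fun q : K ⧸ W => f q.out :=
  (hf.summable_iff_of_le inf_le_left (by
    rw [inf_relIndex_left]; exact hW.finOver W' hW'.isOpen hW'.le)).1

lemma summable_iff (hW : IsLevel B W) (hW' : IsLevel B W') (hf : RightInv W f) (hf' : RightInv W' f)
    : (Summable fun q : K ⧸ W => f q.out) ↔ Summable fun q : K ⧸ W' => f q.out := by
  rw [← hW.summable_inf_iff hW' hf, inf_comm, hW'.summable_inf_iff hW hf']

lemma conj (h : IsLevel B W) (hB : B ≤ center K) (g : K) :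
    IsLevel B (W.map (MulAut.conj g).toMonoidHom) := by
  have hle : ∀ (O : Subgroup K) (g : K), B ≤ O → B ≤ O.map (MulAut.conj g).toMonoidHom :=
    fun O g hO b hb => ⟨b, hO hb, by
      simp [mem_center_iff.1 (hB hb) g]⟩
  have hop : ∀ (O : Subgroup K) (g : K), IsOpen (O : Set K) →
      IsOpen (O.map (MulAut.conj g).toMonoidHom : Set K) := fun O g hO => by
    have : (O.map (MulAut.conj g).toMonoidHom : Set K) = (fun x => g⁻¹ * x * g) ⁻¹' O := by
      ext x; constructor
      · rintro ⟨y, hy, rfl⟩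
        simpa [mul_assoc] using hy
      · exact fun hx => ⟨g⁻¹ * x * g, hx, by simp [mul_assoc]⟩
    rw [this]; exact hO.preimage (by fun_prop)
  refine ⟨hle W g h.le, hop W g h.isOpen, fun O hO hBO => ?_⟩
  have h1 := h.finOver _ (hop O g⁻¹ hO) (hle O g⁻¹ hBO)
  rw [← Subgroup.relIndex_map_map_of_injective (f := (MulAut.conj g).toMonoidHom) _ _
    (MulAut.conj g).injective, Subgroup.map_map]
    at h1
  convert h1 using 2
  ext x
  simp [Subgroup.mem_map, mul_assoc]

end IsLevel

end

/-! ### Haar measures on quotients by central subgroups -/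

instance cosetBorelSpace (K : Type*) [Group K] [TopologicalSpace K] (B : Subgroup K) :
    BorelSpace (K ⧸ B) := ⟨rfl⟩

lemma cosetMap_injective (H B : Subgroup K) : Injective (cosetRes H B) := by
  intro a b
  obtain ⟨a, rfl⟩ := mk_surjective a
  obtain ⟨b, rfl⟩ := mk_surjective b
  intro hab
  have hab' : ((a : K) : K ⧸ B) = ((b : K) : K ⧸ B) := hab
  exact QuotientGroup.eq.2 (mem_subgroupOf.2 (QuotientGroup.eq.1 hab'))

namespace IsHaarOnQuotient

variable {B W W' : Subgroup K} {μ μ' : Measure (K ⧸ B)} {𝕜 : Type*} [RCLike 𝕜] {f : K → 𝕜}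

lemma isHaarMeasure [B.Normal] (h : IsHaarOnQuotient B μ) : μ.IsHaarMeasure := by
  have := h.regular
  have := h.invariant
  have : μ.IsMulLeftInvariant := ⟨fun x => by
    obtain ⟨g, rfl⟩ := mk_surjective x; ext s hs; rw [map_apply (measurable_const_mul _) hs]
    exact measure_preimage_smul μ g s⟩
  have : NeZero μ := ⟨h.ne_zero⟩
  have := isOpenPosMeasure_of_mulLeftInvariant_of_regular (μ := μ)
  exact { }

lemma of_isHaarMeasure [B.Normal] [μ.IsHaarMeasure] [hr : μ.Regular] : IsHaarOnQuotient B μ where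
  invariant := ⟨fun g s hs => by
    have := measure_preimage_mul μ (g : K ⧸ B) s; exact this⟩
  regular := hr
  ne_zero := NeZero.ne μ

lemma exists_haar (B : Subgroup K) [B.Normal] [LocallyCompactSpace K] :
    ∃ μ : Measure (K ⧸ B), IsHaarOnQuotient B μ :=
  ⟨Measure.haar, of_isHaarMeasure⟩

lemma smul (h : IsHaarOnQuotient B μ) {c : ENNReal} (h0 : c ≠ 0) (hc : c ≠ ⊤) :
    IsHaarOnQuotient B (c • μ) where
  invariant := by
    have := h.invariant; infer_instance
  regular := by
    have := h.regular; exact Measure.Regular.smul hc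
  ne_zero h1 := h.ne_zero (by
    rw [← one_smul ENNReal μ, ← ENNReal.inv_mul_cancel h0 hc, mul_smul, h1, smul_zero])

lemma exists_eq_smul [B.Normal] [LocallyCompactSpace K] (h : IsHaarOnQuotient B μ)
    (h' : IsHaarOnQuotient B μ') : ∃ c : ENNReal, c ≠ 0 ∧ c ≠ ⊤ ∧ μ' = c • μ := by
  have := h.isHaarMeasure
  have := h'.isHaarMeasure
  have := h.regular
  have := h'.regular
  refine ⟨Measure.haarScalarFactor μ' μ, fun h0 => h'.ne_zero ?_, ENNReal.coe_ne_top,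
    Measure.isMulLeftInvariant_eq_smul_of_regular μ' μ⟩
  rw [Measure.isMulLeftInvariant_eq_smul_of_regular μ' μ]
  show ((Measure.haarScalarFactor μ' μ : NNReal) : ENNReal) • μ = 0
  rw [h0, zero_smul]

/-- The measure of the image of `W`. -/
def _root_.levelVol (μ : Measure (K ⧸ B)) (W : Subgroup K) : ENNReal := μ (((↑) : K → K ⧸ B) '' W)

lemma _root_.Subgroup.countable_quot_of_isOpen [SigmaCompactSpace K]
    (hW : IsOpen (W : Set K)) : Countable (K ⧸ W) := by
  have := discreteTopology hW
  have : SigmaCompactSpace (K ⧸ W) := isSigmaCompact_univ_iff.1 (by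
    rw [← Set.range_eq_univ.2 (mk_surjective (s := W)), ← Set.image_univ]
    exact isSigmaCompact_univ.image continuous_mk)
  exact countable_of_Lindelof_of_discrete

lemma map_eq [SigmaCompactSpace K] (h : IsHaarOnQuotient B μ) (hB : B ≤ W) (hW : IsOpen (W : Set K))
    : μ.map (quotientMapOfLE hB) = levelVol μ W • Measure.count := by
  have := Subgroup.countable_quot_of_isOpen hW
  have := discreteTopology hW
  have := h.invariant
  have hc : Continuous (quotientMapOfLE hB) := continuous_quot_lift _ continuous_mk
  refine Measure.ext_of_singleton fun q => ?_
  obtain ⟨g, rfl⟩ := mk_surjective q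
  rw [map_apply hc.measurable (measurableSet_singleton _), Measure.smul_apply,
    Measure.count_singleton, smul_eq_mul, mul_one, levelVol]
  refine Eq.trans (congrArg μ ?_) (measure_smul μ g _)
  ext x
  obtain ⟨x, rfl⟩ := mk_surjective x
  rw [Set.mem_smul_set_iff_inv_smul_mem]
  constructor
  · intro hx; have hx' : (x : K ⧸ W) = (g : K ⧸ W) := hx
    exact ⟨g⁻¹ * x, QuotientGroup.eq.1 hx'.symm, rfl⟩
  · rintro ⟨w, hw, hwx⟩
    show (x : K ⧸ W) = (g : K ⧸ W)
    refine (QuotientGroup.eq.2 ?_).symm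
    have hwx' : (w : K ⧸ B) = ((g⁻¹ * x : K) : K ⧸ B) := hwx
    have h1 : w⁻¹ * (g⁻¹ * x) ∈ B := QuotientGroup.eq.1 hwx'
    exact (W.mul_mem_cancel_left (W.inv_mem hw)).1 (hB h1)

lemma levelVol_eq_mul [SigmaCompactSpace K] (h : IsHaarOnQuotient B μ) (hB : B ≤ W')
    (hle : W' ≤ W) (hW' : IsOpen (W' : Set K)) (h0 : W'.relIndex W ≠ 0) :
    levelVol μ W = W'.relIndex W * levelVol μ W' := by
  have := Subgroup.countable_quot_of_isOpen hW'
  have := discreteTopology hW'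
  have : (W'.subgroupOf W).FiniteIndex := ⟨h0⟩
  have hc : Continuous (quotientMapOfLE hB) := continuous_quot_lift _ continuous_mk
  let j : W ⧸ W'.subgroupOf W → K ⧸ W' := cosetMap W° _ W' le_rfl
  have hj : Injective j := cosetMap_injective W W'
  have h1 : (((↑) : K → K ⧸ B) '' W) = quotientMapOfLE hB ⁻¹' Set.range j := by
    ext x; obtain ⟨x, rfl⟩ := mk_surjective x
    constructor
    · rintro ⟨w, hw, hwx⟩
      exact ⟨((⟨w, hw⟩ : W) : W ⧸ W'.subgroupOf W), congrArg (quotientMapOfLE hB) hwx⟩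
    · rintro ⟨w, hwx⟩
      obtain ⟨w, rfl⟩ := mk_surjective w
      have hwx' : ((w : K) : K ⧸ W') = (x : K ⧸ W') := hwx
      exact ⟨x, by simpa using W.mul_mem w.2 (hle (QuotientGroup.eq.1 hwx')), rfl⟩
  rw [levelVol, h1, ← map_apply hc.measurable (Set.to_countable _).measurableSet,
    h.map_eq hB hW', Measure.smul_apply, Measure.count_apply (Set.to_countable _).measurableSet,
    ← Set.image_univ, hj.encard_image, Set.encard_univ, ENat.card_eq_coe_natCard, smul_eq_mul,
    mul_comm]
  rfl

lemma levelVol_ne_zero [SigmaCompactSpace K] (h : IsHaarOnQuotient B μ) (hB : B ≤ W)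
    (hW : IsOpen (W : Set K)) : levelVol μ W ≠ 0 := fun h0 => h.ne_zero (by
  have h1 := h.map_eq hB hW
  have hc : Continuous (quotientMapOfLE hB) := continuous_quot_lift _ continuous_mk
  rwa [h0, zero_smul, Measure.map_eq_zero_iff hc.aemeasurable] at h1)

lemma levelVol_ne_top [SigmaCompactSpace K] (h : IsHaarOnQuotient B μ) (hB : B ≤ center K)
    (hU : HasCompactOpen K) (hW : IsLevel B W) : levelVol μ W ≠ ⊤ := by
  obtain ⟨U, hUo, hUc⟩ := hU
  have := h.regular
  have hBU : IsOpen ((B ⊔ U : Subgroup K) : Set K) := isOpen_mono le_sup_right hUo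
  have h1 : levelVol μ (B ⊔ U) ≠ ⊤ := by
    have : (((↑) : K → K ⧸ B) '' (B ⊔ U : Subgroup K)) = (((↑) : K → K ⧸ B) '' U) := by
      ext x; constructor
      · rintro ⟨w, hw, rfl⟩
        have := normal_of_le_center hB
        obtain ⟨b, hb, v, hv, rfl⟩ := mem_sup_of_normal_left.1 hw
        refine ⟨v, hv, QuotientGroup.eq.2 ?_⟩
        rwa [← mem_center_iff.1 (hB hb) v, inv_mul_cancel_left]
      · rintro ⟨w, hw, rfl⟩
        exact ⟨w, (le_sup_right : U ≤ B ⊔ U) hw, rfl⟩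
    rw [levelVol, this]; exact (hUc.image continuous_mk).measure_lt_top.ne
  have h2 := hW.inf hBU le_sup_left
  have h3 : (W ⊓ (B ⊔ U)).relIndex W ≠ 0 := by
    rw [inf_relIndex_left]; exact hW.finOver _ hBU le_sup_left
  rw [h.levelVol_eq_mul h2.le inf_le_left h2.isOpen h3]
  exact ENNReal.mul_ne_top (ENNReal.natCast_ne_top _)
    (ne_top_of_le_ne_top h1 (measure_mono (Set.image_mono inf_le_right)))

lemma integrable_iff [SigmaCompactSpace K] (h : IsHaarOnQuotient B μ) (hB : B ≤ center K)
    (hU : HasCompactOpen K) (hW : IsLevel B W) (hf : RightInv W f) :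
    (Integrable (fun x : K ⧸ B => f x.out) μ ↔ Summable fun q : K ⧸ W => f q.out) ∧
    ∫ x : K ⧸ B, f x.out ∂μ = (levelVol μ W).toReal • ∑' q : K ⧸ W, f q.out := by
  have := Subgroup.countable_quot_of_isOpen hW.isOpen
  have := discreteTopology hW.isOpen
  have hc : Continuous (quotientMapOfLE hW.le) := continuous_quot_lift _ continuous_mk
  have h1 : (fun x : K ⧸ B => f x.out) = (fun q : K ⧸ W => f q.out) ∘ quotientMapOfLE hW.le := by
    funext x
    obtain ⟨x, rfl⟩ := mk_surjective x; exact ((hf.mono hW.le).out x).trans (hf.out x).symm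
  have hm : Measurable fun q : K ⧸ W => f q.out := measurable_of_countable _
  constructor
  · rw [h1, ← integrable_map_measure hm.aestronglyMeasurable hc.aemeasurable, h.map_eq hW.le hW.isOpen,
      integrable_smul_measure (h.levelVol_ne_zero hW.le hW.isOpen) (h.levelVol_ne_top hB hU hW),
      integrable_count_iff, summable_norm_iff]
  · rw [h1, Function.comp_def]
    rw [← integral_map (φ := quotientMapOfLE hW.le) (f := fun q : K ⧸ W => f q.out) hc.aemeasurable hm.aestronglyMeasurable, h.map_eq hW.le hW.isOpen,
      integral_smul_measure]
    congr 1; by_cases hs : Summable fun q : K ⧸ W => f q.out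
    · rw [integral_countable' (integrable_count_iff.2 hs.norm)]; simp [Measure.real]
    · rw [tsum_eq_zero_of_not_summable hs, integral_undef]
      rwa [integrable_count_iff, summable_norm_iff]

end IsHaarOnQuotient

namespace IsHaarOnQuotient

variable {B C W : Subgroup K} {μ μ' : Measure (K ⧸ B)} {𝕜 : Type*} [RCLike 𝕜] {f : K → 𝕜}

lemma continuous_quotMap (h : B ≤ C) : Continuous (quotientMapOfLE h) :=
  continuous_quot_lift _ continuous_mk

lemma levelVol_map (hBC : B ≤ C) (hCW : C ≤ W) (hW : IsOpen (W : Set K)) :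
    levelVol (μ.map (quotientMapOfLE hBC)) W = levelVol μ W := by
  rw [levelVol, map_apply (continuous_quotMap hBC).measurable
    (isOpenMap_coe _ hW).measurableSet, levelVol]
  congr 1
  ext x
  obtain ⟨x, rfl⟩ := mk_surjective x
  constructor
  · rintro ⟨w, hw, hwx⟩
    have hwx' : (w : K ⧸ C) = (x : K ⧸ C) := hwx
    exact ⟨x, (W.mul_mem_cancel_left (W.inv_mem hw)).1 (hCW (QuotientGroup.eq.1 hwx')), rfl⟩
  · rintro ⟨w, hw, hwx⟩
    exact ⟨w, hw, congrArg (quotientMapOfLE hBC) hwx⟩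

section

variable [LocallyCompactSpace K] [SigmaCompactSpace K]

lemma map_quotientMapOfLE (h : IsHaarOnQuotient B μ) (hBC : B ≤ C) (hC : C ≤ center K)
    (hfin : FinOver B C) (hU : HasCompactOpen K) :
    IsHaarOnQuotient C (μ.map (quotientMapOfLE hBC)) := by
  have := normal_of_le_center (hBC.trans hC)
  have := normal_of_le_center hC
  have := h.isHaarMeasure
  have := h.regular
  have hσ : ∀ D : Subgroup K, SigmaCompactSpace (K ⧸ D) := fun D => isSigmaCompact_univ_iff.1 (by
    rw [← Set.range_eq_univ.2 (mk_surjective (s := D)), ← Set.image_univ]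
    exact isSigmaCompact_univ.image continuous_mk)
  have := hσ B
  have := hσ C
  let φ : K ⧸ B →* K ⧸ C := QuotientGroup.map B C (hid K) hBC
  have hc : Continuous φ := continuous_quotMap hBC
  have hsurj : Function.Surjective φ := fun x => by
    obtain ⟨x, rfl⟩ := mk_surjective x; exact ⟨(x : K ⧸ B), rfl⟩
  show IsHaarOnQuotient C (μ.map φ)
  have := _root_.MeasureTheory.isMulLeftInvariant_map (μ := μ) φ.toMulHom hc.measurable hsurj
  have : (μ.map φ).IsMulLeftInvariant := this
  have : (μ.map φ).InnerRegular := Measure.InnerRegular.map_of_continuous hc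
  obtain ⟨U, hUo, hUc⟩ := id hU
  have hlev : IsLevel B (C ⊔ U) :=
    ⟨hBC.trans le_sup_left, isOpen_mono le_sup_right hUo, hfin.sup hC hUc⟩
  have hv : μ.map φ (((↑) : K → K ⧸ C) '' (C ⊔ U : Subgroup K)) = levelVol μ (C ⊔ U) :=
    levelVol_map hBC le_sup_left hlev.isOpen
  have himg : (((↑) : K → K ⧸ C) '' (C ⊔ U : Subgroup K)) = (((↑) : K → K ⧸ C) '' U) := by
    ext x; constructor
    · rintro ⟨w, hw, rfl⟩
      obtain ⟨b, hb, v, hv, rfl⟩ := mem_sup_of_normal_left.1 hw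
      refine ⟨v, hv, QuotientGroup.eq.2 ?_⟩
      rwa [← mem_center_iff.1 (hC hb) v, inv_mul_cancel_left]
    · rintro ⟨w, hw, rfl⟩
      exact ⟨w, (le_sup_right : U ≤ C ⊔ U) hw, rfl⟩
  rw [himg] at hv
  have hopen : IsOpen (((↑) : K → K ⧸ C) '' (U : Set K)) := isOpenMap_coe _ hUo
  have : (μ.map φ).IsHaarMeasure := Measure.isHaarMeasure_of_isCompact_nonempty_interior _
    (((↑) : K → K ⧸ C) '' (U : Set K)) (hUc.image continuous_mk)
    (by rw [hopen.interior_eq]; exact ⟨_, 1, U.one_mem, rfl⟩)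
    (hv ▸ h.levelVol_ne_zero hlev.le hlev.isOpen)
    (hv ▸ h.levelVol_ne_top (hBC.trans hC) hU hlev)
  have heq := Measure.isMulLeftInvariant_eq_smul_of_innerRegular (μ.map φ)
    (Measure.haar : Measure (K ⧸ C))
  have : (μ.map φ).Regular := by
    rw [heq]; exact Measure.Regular.smul (μ := (Measure.haar : Measure (K ⧸ C))) ENNReal.coe_ne_top
  exact of_isHaarMeasure

lemma exists_map_eq {μ' : Measure (K ⧸ C)} (h : IsHaarOnQuotient C μ') (hBC : B ≤ C)
    (hC : C ≤ center K) (hfin : FinOver B C) (hU : HasCompactOpen K) :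
    ∃ μ : Measure (K ⧸ B), IsHaarOnQuotient B μ ∧ μ.map (quotientMapOfLE hBC) = μ' := by
  have := normal_of_le_center (hBC.trans hC)
  have := normal_of_le_center hC
  obtain ⟨μ, hμ⟩ := exists_haar B
  obtain ⟨c, hc, hc', rfl⟩ := (hμ.map_quotientMapOfLE hBC hC hfin hU).exists_eq_smul h
  exact ⟨c • μ, hμ.smul hc hc', Measure.map_smul ..⟩

end

lemma isOpenEmb_cosetMap {H : Subgroup K} (hH : IsOpen (H : Set K)) :
    Topology.IsOpenEmbedding (cosetRes H B) := by
  have hc : Continuous (cosetRes H B) :=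
    continuous_quot_lift _ (QuotientGroup.continuous_mk.comp csv)
  refine .of_continuous_injective_isOpenMap hc (cosetMap_injective H B) fun s hs => ?_
  · have h1 := isOpenMap_coe (N := B) _ (hH.isOpenMap_subtype_val _
      (hs.preimage (continuous_mk (N := B.subgroupOf H))))
    convert h1 using 1
    ext x; constructor
    · rintro ⟨a, ha, rfl⟩
      obtain ⟨a, rfl⟩ := mk_surjective a; exact ⟨a, ⟨a, ha, rfl⟩, rfl⟩
    · rintro ⟨_, ⟨a, ha, rfl⟩, rfl⟩
      exact ⟨_, ha, rfl⟩

lemma comap_cosetMap (h : IsHaarOnQuotient B μ) (hB : B ≤ center K) {H : Subgroup K}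
    (hH : IsOpen (H : Set K)) : IsHaarOnQuotient (B.subgroupOf H) (μ.comap (cosetRes H B)) := by
  have := normal_of_le_center hB
  have := h.isHaarMeasure
  have := h.regular
  have he := isOpenEmb_cosetMap (B := B) hH
  let φ : H ⧸ B.subgroupOf H →* K ⧸ B := QuotientGroup.map (B.subgroupOf H) B H° le_rfl
  have : (μ.comap φ).IsHaarMeasure := Measure.IsHaarMeasure.comap (mH := inferInstance) μ (f := φ) he
  have : (μ.comap φ).Regular := Measure.Regular.comap' μ he
  exact of_isHaarMeasure (μ := μ.comap φ)

lemma levelVol_comap {H : Subgroup K} (hH : IsOpen (H : Set K)) (hW : W ≤ H) :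
    levelVol (μ.comap (cosetRes H B)) (W.subgroupOf H) = levelVol μ W := by
  have he := (isOpenEmb_cosetMap (B := B) hH).measurableEmbedding
  rw [levelVol, he.comap_apply, levelVol]
  congr 1
  ext x
  constructor
  · rintro ⟨_, ⟨a, ha, rfl⟩, rfl⟩
    exact ⟨a, ha, rfl⟩
  · rintro ⟨w, hw, rfl⟩
    exact ⟨_, ⟨⟨w, hW hw⟩, hw, rfl⟩, rfl⟩

section

lemma integral_mul_left (h : IsHaarOnQuotient B μ) (hf : RightInv B f) (g : K) :
    ∫ x : K ⧸ B, f (g * x.out) ∂μ = ∫ x : K ⧸ B, f x.out ∂μ := by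
  have := h.invariant
  rw [← integral_smul_eq_self (fun x : K ⧸ B => f x.out) (g := g)]
  refine integral_congr_ae (.of_forall fun x => ?_)
  obtain ⟨x, rfl⟩ := mk_surjective x
  exact ((hf.mul_left g).out x).trans (hf.out (g * x)).symm

lemma out_mul (hB : B ≤ center K) [B.Normal] (hf : RightInv B f) (g : K) (x : K ⧸ B) :
    f (x * (g : K ⧸ B)).out = f (x.out * g) := by
  obtain ⟨x, rfl⟩ := mk_surjective x
  have h1 : RightInv B fun x => f (x * g) := fun x b hb => by
    show f (x * b * g) = f (x * g)
    rw [mul_assoc, ← mem_center_iff.1 (hB hb) g, ← mul_assoc, hf _ b hb]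
  exact (hf.out (x * g)).trans (h1.out x).symm

lemma isMulRightInvariant [LocallyCompactSpace K] [B.Normal] (h : IsHaarOnQuotient B μ) (hB : B ≤ center K)
    (H : Subgroup K) [H.FiniteIndex] [H.Normal]
    (hex : ∀ g ∈ H, ∃ f : K → ℂ, RightInv B f ∧ ∫ x : K ⧸ B, f x.out ∂μ ≠ 0 ∧
      ∫ x : K ⧸ B, f (x.out * g) ∂μ = ∫ x : K ⧸ B, f x.out ∂μ) : μ.IsMulRightInvariant := by
  have := h.isHaarMeasure
  have := h.regular
  have hc : ∀ y : K ⧸ B, ∃ c : ENNReal, c ≠ ⊤ ∧ μ.map (· * y) = c • μ := fun y => by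
    have : (μ.map (· * y)).Regular := Measure.Regular.map (Homeomorph.mulRight y)
    exact ⟨_, ENNReal.coe_ne_top, Measure.isMulLeftInvariant_eq_smul_of_regular (μ.map (· * y)) μ⟩
  choose c hct hc using hc
  have hone : ∀ a : ENNReal, a • μ = μ → a = 1 := fun a ha => by
    obtain ⟨S, hS, hS'⟩ := exists_compact_mem_nhds (1 : K ⧸ B)
    have h1 : a * μ S = 1 * μ S := by
      rw [one_mul]; exact congrArg (fun m : Measure (K ⧸ B) => m S) ha
    exact (ENNReal.mul_left_inj (Measure.measure_pos_of_mem_nhds μ hS').ne' hS.measure_lt_top.ne).1 h1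
  have hpow : ∀ (y : K ⧸ B) (n : ℕ), μ.map (· * y ^ n) = c y ^ n • μ := fun y n => by
    induction n with
    | zero => simp
    | succ n ih =>
      have : (· * y ^ (n + 1) : K ⧸ B → K ⧸ B) = (· * y) ∘ (· * y ^ n) := by
        funext x
        simp [pow_succ, mul_assoc]
      rw [this, ← Measure.map_map (measurable_mul_const _) (measurable_mul_const _), ih,
        Measure.map_smul, hc, smul_smul, pow_succ]
  have hH : ∀ g ∈ H, c (g : K ⧸ B) = 1 := fun g hg => by
    obtain ⟨f, hf, hf0, hfg⟩ := hex g hg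
    have h1 : ∫ x : K ⧸ B, f (x.out * g) ∂μ = (c (g : K ⧸ B)).toReal • ∫ x : K ⧸ B, f x.out ∂μ := by
      rw [← integral_smul_measure, ← hc]; refine Eq.trans ?_ (integral_map_equiv
        (MeasurableEquiv.mulRight (g : K ⧸ B)) fun x : K ⧸ B => f x.out).symm
      exact integral_congr_ae (.of_forall fun x => (out_mul hB hf g x).symm)
    rw [hfg] at h1
    have h2 : ((c (g : K ⧸ B)).toReal : ℂ) = 1 := by
      have : ((c (g : K ⧸ B)).toReal : ℂ) * ∫ x : K ⧸ B, f x.out ∂μ = ∫ x : K ⧸ B, f x.out ∂μ := by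
        rw [← Complex.real_smul]; exact h1.symm
      exact mul_right_cancel₀ hf0 (this.trans (one_mul _).symm)
    exact (ENNReal.toReal_eq_one_iff _).1 (by exact_mod_cast h2)
  refine ⟨fun y => ?_⟩
  obtain ⟨g, rfl⟩ := mk_surjective y
  have h1 : c (g : K ⧸ B) ^ H.index = 1 := hone _ (by
    rw [← hpow, ← mk_pow, hc, hH _ (Subgroup.pow_index_mem H g), one_smul])
  have h2 := (ENNReal.pow_right_strictMono (index_ne_zero (H := H))).injective (h1.trans (one_pow _).symm)
  rw [hc, h2, one_smul]

lemma integrable_inv [LocallyCompactSpace K] [B.Normal] [μ.IsMulRightInvariant]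
    (h : IsHaarOnQuotient B μ) (hB : B ≤ center K) (hf : RightInv B f)
    (hi : Integrable (fun x : K ⧸ B => f x.out) μ) : Integrable (fun x : K ⧸ B => f x.out⁻¹) μ := by
  have := h.isHaarMeasure
  have := h.regular
  have : (μ.map Inv.inv).Regular := Measure.Regular.map (Homeomorph.inv (K ⧸ B))
  have : (μ.map Inv.inv).IsMulLeftInvariant := inferInstanceAs μ.inv.IsMulLeftInvariant
  have h1 := Measure.isMulLeftInvariant_eq_smul_of_regular (μ.map Inv.inv) μ
  have h2 : Integrable (fun x : K ⧸ B => f x.out) (μ.map Inv.inv) := by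
    rw [h1]; exact hi.smul_measure ENNReal.coe_ne_top
  refine (((MeasurableEquiv.inv (K ⧸ B)).measurableEmbedding.integrable_map_iff).1 h2).congr
    (.of_forall fun x => ?_)
  obtain ⟨x, rfl⟩ := mk_surjective x
  have h3 : RightInv B fun x => f x⁻¹ := fun x b hb => by
    show f (x * b)⁻¹ = f x⁻¹
    rw [mul_inv_rev, ← mem_center_iff.1 (hB (B.inv_mem hb)) x⁻¹, hf _ _ (B.inv_mem hb)]
  exact (hf.out x⁻¹).trans (h3.out x).symm

end

end IsHaarOnQuotient

variable {X : Type*} [AddCommGroup X] [Module ℂ X]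

/-! ### Matrix coefficients and formal degrees -/

lemma exists_isLevel {B C : Subgroup K} (hU : HasCompactOpen K) (hBC : B ≤ C) (hC : C ≤ center K)
    (hfin : FinOver B C) {O : Subgroup K} (hO : IsOpen (O : Set K)) :
    ∃ W : Subgroup K, IsLevel B W ∧ C ≤ W ∧ ∀ w ∈ W, ∃ c ∈ C, ∃ o ∈ O, w = o * c := by
  obtain ⟨U, hUo, hUc⟩ := hU
  have hUO : IsOpen ((U ⊓ O : Subgroup K) : Set K) := hUo.inter hO
  refine ⟨C ⊔ (U ⊓ O), ⟨hBC.trans le_sup_left, isOpen_mono le_sup_right hUO,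
    hfin.sup hC (hUc.of_isClosed_subset (isClosed_of_isOpen _ hUO) Set.inter_subset_left)⟩,
    le_sup_left, fun w hw => ?_⟩
  have := normal_of_le_center hC
  obtain ⟨c, hc, o, ho, rfl⟩ := mem_sup_of_normal_left.1 hw
  exact ⟨c, hc, o, ho.2, (mem_center_iff.1 (hC hc) o).symm⟩

namespace Representation

variable (ρ : Repn K X)

/-- The stabilizer of a vector. -/
def stab (v : X) : Subgroup K where
  carrier := {k | ρ k v = v}
  one_mem' := by simp
  mul_mem' {a b} ha hb := by
    show ρ (a * b) v = v
    rw [rep_mul, show ρ b v = v from hb]; exact ha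
  inv_mem' {a} ha := by
    show ρ a⁻¹ v = v
    conv_lhs => rw [← show ρ a v = v from ha]
    exact rep_inv_apply ρ a v

/-- The product of two matrix coefficients that occurs in the Schur orthogonality relations. -/
def schur (v u : X) (ξ η : Dual ℂ X) (g : K) : ℂ := ξ (ρ g v) * η (ρ g⁻¹ u)

variable {ρ} {v u : X} {ξ η : Dual ℂ X} {B C W : Subgroup K}

/-- The elements of `B` act by scalars. -/
def IsScalarOn (ρ : Repn K X) (B : Subgroup K) : Prop := ∀ b ∈ B, ∃ c : ℂ, ∀ v, ρ b v = c • v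

lemma IsScalarOn.schur_mul (h : IsScalarOn ρ C) {o c : K} (hv : ρ o v = v) (hη : ρ.dual o η = η)
    (hc : c ∈ C) (g : K) : schur ρ v u ξ η (g * (o * c)) = schur ρ v u ξ η g := by
  obtain ⟨a, ha⟩ := h c hc
  have h1 : ρ (g * (o * c)) v = a • ρ g v := by
    rw [rep_mul, rep_mul, ha, map_smul, map_smul, hv]
  have h2 : ∀ x, η (ρ o⁻¹ x) = η x := fun x => congrArg (fun f : Dual ℂ X => f x) hη
  have h3 : ∀ x, a • ρ c⁻¹ x = x := fun x => by
    rw [← map_smul, ← ha]; exact rep_inv_apply ρ c x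
  have h4 : a • ρ (g * (o * c))⁻¹ u = ρ o⁻¹ (ρ g⁻¹ u) := by
    rw [mul_inv_rev, mul_inv_rev, rep_mul, rep_mul, h3]
  rw [schur, h1, map_smul, smul_eq_mul, mul_comm a, mul_assoc, ← smul_eq_mul (a := a), ← map_smul, h4,
    h2]
  rfl

lemma exists_isLevel_schur (hU : HasCompactOpen K)
    (hBC : B ≤ C) (hC : C ≤ center K) (hfin : FinOver B C) (h : IsScalarOn ρ C)
    (hv : IsOpen (ρ.stab v : Set K)) (hη : η ∈ smoothVectors ρ.dual) :
    ∃ W : Subgroup K, IsLevel B W ∧ C ≤ W ∧ ∀ u ξ, RightInv W (schur ρ v u ξ η) := by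
  obtain ⟨W, hW, hCW, hdec⟩ := exists_isLevel hU hBC hC hfin (O := ρ.stab v ⊓ ρ.dual.stab η)
    (hv.inter hη)
  refine ⟨W, hW, hCW, fun u ξ g w hw => ?_⟩
  obtain ⟨c, hc, o, ho, rfl⟩ := hdec w hw
  exact h.schur_mul ho.1 ho.2 hc g

end Representation

namespace IsHaarOnQuotient

variable [LocallyCompactSpace K] [SigmaCompactSpace K] {B C W : Subgroup K} {μ : Measure (K ⧸ B)}
  {f : K → ℂ}

lemma integrable_map_iff (h : IsHaarOnQuotient B μ) (hBC : B ≤ C) (hC : C ≤ center K)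
    (hfin : FinOver B C) (hU : HasCompactOpen K)
    (hW : IsLevel B W) (hCW : C ≤ W) (hf : RightInv W f) :
    (Integrable (fun x : K ⧸ C => f x.out) (μ.map (quotientMapOfLE hBC)) ↔
      Integrable (fun x : K ⧸ B => f x.out) μ) ∧
      ∫ x : K ⧸ C, f x.out ∂(μ.map (quotientMapOfLE hBC)) = ∫ x : K ⧸ B, f x.out ∂μ := by
  have h' := h.map_quotientMapOfLE hBC hC hfin hU
  have h1 := h.integrable_iff (hBC.trans hC) hU hW hf
  have h2 := h'.integrable_iff hC hU ⟨hCW, hW.isOpen, hW.finOver.mono_left hBC⟩ hf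
  rw [levelVol_map hBC hCW hW.isOpen] at h2
  exact ⟨h2.1.trans h1.1.symm, h2.2.trans h1.2.symm⟩

end IsHaarOnQuotient

section

open Representation

variable [LocallyCompactSpace K] [SigmaCompactSpace K] {B C : Subgroup K} {V : Rep.{u} ℂ K}

lemma isFormalDegree_map_iff (hV : isSmooth K V) (h : IsScalarOn V.ρ C) {μ : Measure (K ⧸ B)}
    (hμ : IsHaarOnQuotient B μ) (hBC : B ≤ C) (hC : C ≤ center K)
    (hfin : FinOver B C) (hU : HasCompactOpen K) :
    IsFormalDegree V C (μ.map (quotientMapOfLE hBC)) ↔ IsFormalDegree V B μ := by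
  refine (and_iff_right (hμ.map_quotientMapOfLE hBC hC hfin hU)).trans
    (Iff.trans ?_ (and_iff_right hμ).symm)
  refine forall₄_congr fun v u ξ η => ?_
  obtain ⟨W, hW, hCW, hinv⟩ := exists_isLevel_schur hU hBC hC hfin h (hV v) η.2
  have h1 := hμ.integrable_map_iff hBC hC hfin hU hW hCW (hinv u ξ.1)
  exact and_congr h1.1 ⟨h1.2.symm.trans, h1.2.trans⟩

lemma exists_isFormalDegree_iff (hV : isSmooth K V) (h : IsScalarOn V.ρ C) (hBC : B ≤ C)
    (hC : C ≤ center K) (hfin : FinOver B C) (hU : HasCompactOpen K) : (∃ μ, IsFormalDegree V C μ) ↔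
    ∃ μ, IsFormalDegree V B μ := by
  constructor
  · rintro ⟨μ', hμ'⟩
    obtain ⟨μ, hμ, rfl⟩ := hμ'.1.exists_map_eq hBC hC hfin hU
    exact ⟨μ, (isFormalDegree_map_iff hV h hμ hBC hC hfin hU).1 hμ'⟩
  · rintro ⟨μ, hμ⟩
    exact ⟨_, (isFormalDegree_map_iff hV h hμ.1 hBC hC hfin hU).2 hμ⟩

omit [LocallyCompactSpace K] [SigmaCompactSpace K] in
lemma exists_smooth_functional {ρ : Repn K X}
    (hρ : ∀ v, IsOpen (ρ.stab v : Set K)) (hU : HasCompactOpen K) {w : X} (hw : w ≠ 0) :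
    ∃ ξ ∈ smoothVectors ρ.dual, ξ w ≠ 0 := by
  obtain ⟨U, hUo, hUc⟩ := hU
  set U₀ := U ⊓ ρ.stab w with hU₀
  have hU₀o : IsOpen (U₀ : Set K) := hUo.inter (hρ w)
  have hU₀c : IsCompact (U₀ : Set K) :=
    hUc.of_isClosed_subset (isClosed_of_isOpen _ hU₀o) Set.inter_subset_left
  let P : Submodule ℂ X := span ℂ {x | ∃ k ∈ U₀, ∃ v, x = ρ k v - v}
  -- a finite average over `U₀` kills any given element of `P` and fixes `w`
  have key : ∀ x ∈ P, ∃ O : Subgroup K, IsOpen (O : Set K) ∧ O ≤ U₀ ∧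
      ∀ O' : Subgroup U₀, O'.FiniteIndex → O'.Normal → (∀ k ∈ O', (k : K) ∈ O) →
        ∑ᶠ q : U₀ ⧸ O', ρ (q.out : U₀) x = 0 := by
    intro x hx
    induction hx using Submodule.span_induction with
    | mem x hx =>
      obtain ⟨k, hk, v, rfl⟩ := hx
      refine ⟨U₀ ⊓ ρ.stab v, hU₀o.inter (hρ v), inf_le_left, fun O' hO' hn hle => ?_⟩
      have hf : ∀ a b : U₀, (a : U₀ ⧸ O') = b → ρ (a : K) v = ρ (b : K) v := fun a b hab => by
        have := (hle _ (QuotientGroup.eq.1 hab)).2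
        have h1 : ρ ((a⁻¹ * b : U₀) : K) v = v := this
        rw [coe_mul, coe_inv, rep_mul] at h1
        conv_lhs => rw [← h1]
        exact rep_apply_inv ρ _ _
      have := ofFinite (U₀ ⧸ O')
      rw [finsum_eq_sum_of_fintype]; simp only [map_sub, Finset.sum_sub_distrib]
      rw [sub_eq_zero, ← Equiv.sum_comp (Equiv.mulRight ((⟨k, hk⟩ : U₀) : U₀ ⧸ O'))
        fun q : U₀ ⧸ O' => ρ (q.out : U₀) v]
      refine sum_congr rfl fun q _ => ?_
      rw [← rep_mul]; refine hf (q.out * ⟨k, hk⟩) _ ?_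
      rw [QuotientGroup.out_eq', mk_mul, QuotientGroup.out_eq']; rfl
    | zero => exact ⟨U₀, hU₀o, le_rfl, fun _ _ _ _ => by simp⟩
    | add x y _ _ hx hy =>
      obtain ⟨O₁, h₁, h₁', hx⟩ := hx; obtain ⟨O₂, h₂, -, hy⟩ := hy
      refine ⟨O₁ ⊓ O₂, h₁.inter h₂, inf_le_left.trans h₁', fun O' hO' hn hle => ?_⟩
      simp only [map_add]
      rw [finsum_add_distrib (Set.toFinite _) (Set.toFinite _),
        hx O' hO' hn fun k hk => (hle k hk).1, hy O' hO' hn fun k hk => (hle k hk).2, add_zero]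
    | smul c x _ hx =>
      obtain ⟨O₁, h₁, h₁', hx⟩ := hx; refine ⟨O₁, h₁, h₁', fun O' hO' hn hle => ?_⟩
      simp only [map_smul]
      rw [← smul_finsum, hx O' hO' hn hle, smul_zero]
  have hwP : w ∉ P := fun hwP => by
    obtain ⟨O, hO, hOU, h⟩ := key w hwP
    have h0 : (O.subgroupOf U₀).FiniteIndex := ⟨FinOver.of_isCompact hU₀c O hO bot_le⟩
    have h1 := h (O.subgroupOf U₀).normalCore inferInstance inferInstance
      fun k hk => show k ∈ O.subgroupOf U₀ from Subgroup.normalCore_le _ hk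
    have := ofFinite (U₀ ⧸ (O.subgroupOf U₀).normalCore)
    rw [finsum_eq_sum_of_fintype, sum_congr rfl fun (q : U₀ ⧸ (O.subgroupOf U₀).normalCore) _ =>
      show ρ ((q.out : U₀) : K) w = w from (q.out : U₀).2.2,
      sum_const, ← Nat.cast_smul_eq_nsmul ℂ, smul_eq_zero] at h1
    exact h1.elim (by simp [card_univ]) hw
  obtain ⟨ξ, hξ, hξP⟩ := Submodule.exists_le_ker_of_notMem hwP
  refine ⟨ξ, ?_, hξ⟩
  refine isOpen_mono (H₂ := ρ.dual.stab ξ) (fun k hk => ?_) hU₀o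
  show ρ.dual k ξ = ξ
  ext v
  have : ξ (ρ k⁻¹ v - v) = 0 := hξP (subset_span ⟨k⁻¹, U₀.inv_mem hk, v, rfl⟩)
  rw [map_sub, sub_eq_zero] at this
  exact this

omit [SigmaCompactSpace K] in
lemma IsFormalDegree.eq (hV : isSmooth K V) [Nontrivial V] (hB : B ≤ center K)
    (hU : HasCompactOpen K)
    {μ μ' : Measure (K ⧸ B)} (h : IsFormalDegree V B μ) (h' : IsFormalDegree V B μ') : μ = μ' := by
  have := normal_of_le_center hB
  obtain ⟨w, hw⟩ := exists_ne (0 : V)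
  obtain ⟨ξ, hξ, hξw⟩ := exists_smooth_functional (ρ := V.ρ) hV hU hw
  obtain ⟨c, -, hc, rfl⟩ := h.1.exists_eq_smul h'.1
  have h1 := (h.2 w w ⟨ξ, hξ⟩ ⟨ξ, hξ⟩).2
  have h2 := (h'.2 w w ⟨ξ, hξ⟩ ⟨ξ, hξ⟩).2
  rw [integral_smul_measure, h1] at h2
  have h3 : (c.toReal : ℂ) = 1 := by
    refine mul_right_cancel₀ (mul_ne_zero hξw hξw) (Eq.trans ?_ (one_mul _).symm)
    rw [← Complex.real_smul]; exact h2
  have h4 : c = 1 := (ENNReal.toReal_eq_one_iff _).1 (by exact_mod_cast h3)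
  rw [h4, one_smul]

end

/-! ### Representations that are determined by an eigenspace -/

/-- `τ` is the `θ`-eigenspace of `L` in `ρ`, with inclusion `j` and projection `p`. -/
structure Compression {H L : Subgroup G} (θ : L →* ℂˣ)
    {X Y : Type*} [AddCommGroup X] [Module ℂ X] [AddCommGroup Y] [Module ℂ Y]
    (ρ : Repn G X) (τ : Repn H Y) where
  j : Y →ₗ[ℂ] X
  p : X →ₗ[ℂ] Y
  p_j : ∀ w, p (j w) = w
  rho_j : ∀ (h : H) w, ρ h (j w) = j (τ h w)
  p_rho : ∀ (h : H) v, p (ρ h v) = τ h (p v)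
  rho_j_L : ∀ (l : L) w, ρ l (j w) = (θ l : ℂ) • j w
  p_rho_L : ∀ (l : L) v, p (ρ l v) = (θ l : ℂ) • p v
  zero_off : ∀ g ∉ L ⊔ H, ∀ w, p (ρ g (j w)) = 0
  eq_zero : ∀ v, (∀ g, p (ρ g v) = 0) → v = 0
  exists_ne : ∀ t ∉ L ⊔ H, ∃ (l : L) (c : ℂ), c * θ l ≠ 1 ∧
    ∀ w, ρ (l : G)⁻¹ (ρ t (j w)) = c • ρ t (j w)

namespace Compression

variable {θ : L →* ℂˣ} {X Y : Type*} [AddCommGroup X] [Module ℂ X] [AddCommGroup Y]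
  [Module ℂ Y] {ρ : Repn G X} {τ : Repn H Y} (c : Compression θ ρ τ)

lemma rho_mul_j (l : L) (h : H) (w : Y) : ρ (l * h) (c.j w) = (θ l : ℂ) • c.j (τ h w) := by
  rw [rep_mul, c.rho_j, c.rho_j_L]

lemma p_rho_mul (l : L) (h : H) (v : X) : c.p (ρ (l * h) v) = (θ l : ℂ) • τ h (c.p v) := by
  rw [rep_mul, c.p_rho_L, c.p_rho]

variable [H.Normal]

lemma exists_mul {g : G} (hg : g ∈ L ⊔ H) : ∃ (l : L) (h : H), g = l * h := by
  obtain ⟨l, hl, h, hh, rfl⟩ := mem_sup_of_normal_right.1 hg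
  exact ⟨⟨l, hl⟩, ⟨h, hh⟩, rfl⟩

lemma sum_eq [H.FiniteIndex] (v : X) :
    ∑ᶠ q : G ⧸ (L ⊔ H), ρ q.out (c.j (c.p (ρ q.out⁻¹ v))) = v := by
  have := ofFinite (G ⧸ (L ⊔ H))
  rw [finsum_eq_sum_of_fintype, ← sub_eq_zero]
  refine c.eq_zero _ fun g => ?_
  rw [map_sub, map_sub, map_sum, map_sum, sub_eq_zero,
    Finset.sum_eq_single ((g⁻¹ : G) : G ⧸ (L ⊔ H))]
  · set q := (((g⁻¹ : G) : G ⧸ (L ⊔ H)).out : G)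
    have hq : g * q ∈ L ⊔ H := by
      have := QuotientGroup.eq.1 (QuotientGroup.out_eq' ((g⁻¹ : G) : G ⧸ (L ⊔ H))).symm
      rwa [inv_inv] at this
    obtain ⟨l, h, hlh⟩ := exists_mul hq
    rw [← rep_mul, hlh, c.rho_mul_j, map_smul, c.p_j, ← c.p_rho_mul, ← hlh, ← rep_mul,
      mul_inv_cancel_right]
  · intro q _ hq; rw [← rep_mul]
    refine c.zero_off _ (fun h => hq ?_) _
    rw [← q.out_eq']; exact (QuotientGroup.eq.2 (by rwa [inv_inv])).symm
  · exact fun h => (h (mem_univ _)).elim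

lemma induction_vec [H.FiniteIndex] {P : X → Prop} (h0 : P 0)
    (hadd : ∀ v w, P v → P w → P (v + w)) (h : ∀ g w, P (ρ g (c.j w))) (v : X) : P v := by
  have := ofFinite (G ⧸ (L ⊔ H))
  rw [← c.sum_eq v, finsum_eq_sum_of_fintype]
  exact Finset.sum_induction _ P hadd h0 fun q _ => h _ _

open Representation

omit [H.Normal] in
lemma schur_mul (v u : Y) (ξ η : Dual ℂ Y) (l : L) (h : H) :
    schur ρ (c.j v) (c.j u) (ξ ∘ₗ c.p) (η ∘ₗ c.p) (l * h) = schur τ v u ξ η h := by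
  have h1 : c.p (ρ (l * h : G)⁻¹ (c.j u)) = (θ l : ℂ)⁻¹ • τ h⁻¹ u := by
    rw [mul_inv_rev, rep_mul, ← coe_inv, ← coe_inv, c.p_rho, c.rho_j_L,
      map_smul, map_smul, c.p_j, map_inv, Units.val_inv_eq_inv_val]
  rw [schur, schur, lcomp_apply, lcomp_apply, c.p_rho_mul, c.p_j, h1, map_smul,
    map_smul, smul_eq_mul, smul_eq_mul, mul_mul_mul_comm, mul_inv_cancel₀ (θ l).ne_zero, one_mul]

omit [H.Normal] in
lemma schur_of_notMem (v u : Y) (ξ η : Dual ℂ Y) {g : G} (hg : g ∉ L ⊔ H) :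
    schur ρ (c.j v) (c.j u) (ξ ∘ₗ c.p) (η ∘ₗ c.p) g = 0 := by
  rw [schur, lcomp_apply, c.zero_off g hg, map_zero, zero_mul]

lemma tsum_eq_mul [H.FiniteIndex] {W : Subgroup G} (hW : W ≤ H) {f : G → ℂ} {f' : H → ℂ}
    (hf : RightInv W f) (h0 : ∀ g ∉ L ⊔ H, f g = 0) (hff : ∀ (l : L) (h : H), f (l * h) = f' h) :
    ((Summable fun q : G ⧸ W => f q.out) ↔ Summable fun q : H ⧸ W.subgroupOf H => f' q.out) ∧
      ((Summable fun q : G ⧸ W => f q.out) → ∑' q : G ⧸ W, f q.out =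
        H.relIndex (L ⊔ H) * ∑' q : H ⧸ W.subgroupOf H, f' q.out) := by
  classical
  have hf' : RightInv (W.subgroupOf H) f' := fun x w hw => by
    have := hf x w hw; have h1 := hff 1 x; have h2 := hff 1 (x * w)
    rw [OneMemClass.coe_one, one_mul] at h1 h2; rw [← h1, ← h2]; exact this
  have hs := hf.summable_iff_split hW
  have hz : ∀ c : G ⧸ H, c.out ∉ L ⊔ H → ∀ q : H ⧸ W.subgroupOf H, f (c.out * q.out) = 0 :=
    fun c hc q => h0 _ fun h => hc ((Subgroup.mul_mem_cancel_right _
      ((le_sup_right : H ≤ L ⊔ H) q.out.2)).1 h)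
  have hm : ∀ c : G ⧸ H, c.out ∈ L ⊔ H → ∃ h : H, ∀ q : H ⧸ W.subgroupOf H,
      f (c.out * q.out) = f' (h * q.out) := fun c hc => by
    obtain ⟨l, h, hlh⟩ := exists_mul hc
    exact ⟨h, fun q => by rw [hlh, mul_assoc, ← coe_mul, hff]⟩
  refine ⟨hs.1.trans ⟨fun h => ?_, fun h c => ?_⟩, fun h => ?_⟩
  · obtain ⟨h', hh'⟩ := hm ((1 : G) : G ⧸ H) (by
      obtain ⟨h, hh⟩ := mk_out_eq_mul H 1
      rw [hh, one_mul]; exact (le_sup_right : H ≤ L ⊔ H) h.2)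
    exact (hf'.summable_mul_left h').1 ((h _).congr fun q => hh' q)
  · by_cases hc : c.out ∈ L ⊔ H
    · obtain ⟨h', hh'⟩ := hm c hc
      exact ((hf'.summable_mul_left h').2 h).congr fun q => (hh' q).symm
    · exact summable_zero.congr fun q => (hz c hc q).symm
  · rw [hs.2 h]; have hfin : (H.subgroupOf (L ⊔ H)).FiniteIndex := inferInstance
    have := ofFinite ((L ⊔ H : Subgroup G) ⧸ H.subgroupOf (L ⊔ H))
    let i : (L ⊔ H : Subgroup G) ⧸ H.subgroupOf (L ⊔ H) → G ⧸ H := cosetMap (L ⊔ H)° _ H le_rfl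
    have hr : ∀ c : G ⧸ H, c ∈ Set.range i ↔ c.out ∈ L ⊔ H := fun c => by
      constructor
      · rintro ⟨m, rfl⟩
        obtain ⟨m, rfl⟩ := mk_surjective m; obtain ⟨h, hh⟩ := mk_out_eq_mul H (m : G)
        exact hh ▸ Subgroup.mul_mem _ m.2 ((le_sup_right : H ≤ L ⊔ H) h.2)
      · exact fun hc => ⟨((⟨c.out, hc⟩ : (L ⊔ H : Subgroup G)) :
          (L ⊔ H : Subgroup G) ⧸ H.subgroupOf (L ⊔ H)), c.out_eq'⟩
    have h1 : ∀ c : G ⧸ H, ∑' q : H ⧸ W.subgroupOf H, f (c.out * q.out) =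
        ∑ᶠ (_ : c ∈ Set.range i), ∑' q : H ⧸ W.subgroupOf H, f' q.out := fun c => by
      by_cases hc : c.out ∈ L ⊔ H
      · obtain ⟨h', hh'⟩ := hm c hc
        rw [finsum_eq_if, if_pos ((hr c).2 hc), tsum_congr hh', hf'.tsum_mul_left]
      · rw [finsum_eq_if, if_neg (mt (hr c).1 hc), tsum_congr (hz c hc), tsum_zero]
    rw [finsum_congr h1, finsum_mem_range (cosetMap_injective (L ⊔ H) H), finsum_eq_sum_of_fintype,
      sum_const, nsmul_eq_mul, card_univ, ← Nat.card_eq_fintype_card]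
    rfl

end Compression

variable {θ : L →* ℂˣ} {V : Rep.{u} ℂ G} {T : Rep.{u} ℂ H}
  (c : Compression θ V.ρ T.ρ)

/-! ### Formal degrees and eigenspaces -/

open Representation

lemma RightInv.measurable {B W : Subgroup K} {f : K → ℂ} (h : RightInv W f) (hB : B ≤ W)
    (hW : IsOpen (W : Set K)) : Measurable fun x : K ⧸ B => f x.out := by
  have := discreteTopology hW
  have h1 : (fun x : K ⧸ B => f x.out) = (fun q : K ⧸ W => f q.out) ∘ quotientMapOfLE hB := by
    funext x
    obtain ⟨x, rfl⟩ := mk_surjective x; exact ((h.mono hB).out x).trans (h.out x).symm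
  rw [h1]
  exact (continuous_of_discreteTopology.comp
    (IsHaarOnQuotient.continuous_quotMap hB)).measurable

lemma IsLevel.subgroupOf {B W H : Subgroup K} (h : IsLevel B W) (hB : B ≤ H)
    (hH : IsOpen (H : Set K)) : IsLevel (B.subgroupOf H) (W.subgroupOf H) where
  le := fun _ hb => h.le hb
  isOpen := h.isOpen.preimage csv
  finOver := fun O hO hBO => by
    have h1 := (h.finOver.mono (inf_le_left (b := H))) (O.map H°)
      (by have := hH.isOpenMap_subtype_val (O : Set H) hO; exact this) fun b hb => ⟨⟨b, hB hb⟩, hBO hb, rfl⟩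
    rw [← Subgroup.subgroupOf_map_subtype,
      Subgroup.relIndex_map_map_of_injective _ _ H.subtype_injective] at h1
    exact h1

/-- All matrix coefficients of `ρ` are, after twisting by `ω`, square-integrable modulo `B`. -/
def IsL2 (B : Subgroup K)
    (ρ : Repn K X) (ω : SmoothChar K) : Prop :=
  ∀ v, ∀ ξ ∈ smoothVectors ρ.dual, ∃ W, IsLevel B W ∧
    RightInv W (fun g => ‖ω.val g * ξ (ρ g v)‖ ^ 2) ∧
    Summable fun q : K ⧸ W => ‖ω.val q.out * ξ (ρ q.out v)‖ ^ 2

namespace Compression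

lemma comp_p_mem (hH : IsOpen (H : Set G)) {ω : Dual ℂ T}
    (hω : ω ∈ smoothVectors T.ρ.dual) : ω ∘ₗ c.p ∈ smoothVectors V.ρ.dual := by
  refine isOpen_stab_of_isOpenMap V.ρ.dual H° hH.isOpenMap_subtype_val
    (isOpen_mono (H₁ := T.ρ.dual.stab ω)
      (H₂ := (V.ρ.dual.stab (ω ∘ₗ c.p)).comap H°) (fun h hh => lext fun v => ?_) hω)
  exact (congrArg ω (c.p_rho h⁻¹ v)).trans (congrArg (fun f : Dual ℂ T => f (c.p v)) hh)

lemma comp_j_mem {ξ : Dual ℂ V} (hξ : ξ ∈ smoothVectors V.ρ.dual) :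
    ξ ∘ₗ c.j ∈ smoothVectors T.ρ.dual :=
  isOpen_mono (H₁ := (V.ρ.dual.stab ξ).comap H°)
    (H₂ := T.ρ.dual.stab (ξ ∘ₗ c.j)) (fun h hh => lext fun w =>
      (congrArg ξ (c.rho_j h⁻¹ w)).symm.trans (congrArg (fun f : Dual ℂ V => f (c.j w)) hh))
    (IsOpen.preimage csv hξ)

lemma induction_dual [H.Normal] [H.FiniteIndex] (hH : IsOpen (H : Set G))
    {P : Dual ℂ V → Prop} (h0 : P 0)
    (hadd : ∀ ξ ∈ smoothVectors V.ρ.dual, ∀ η ∈ smoothVectors V.ρ.dual, P ξ → P η → P (ξ + η))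
    (h : ∀ g, ∀ ω ∈ smoothVectors T.ρ.dual, P (V.ρ.dual g (ω ∘ₗ c.p)))
    (ξ : Dual ℂ V) (hξ : ξ ∈ smoothVectors V.ρ.dual) : P ξ := by
  have := ofFinite (G ⧸ (L ⊔ H))
  let ω : G → Dual ℂ T := fun g => (V.ρ.dual g⁻¹ ξ) ∘ₗ c.j
  have hω : ∀ g, ω g ∈ smoothVectors T.ρ.dual := fun g =>
    c.comp_j_mem (smoothVectors_stable V.ρ.dual g⁻¹ hξ)
  have h1 : ξ = ∑ q : G ⧸ (L ⊔ H), V.ρ.dual q.out (ω q.out ∘ₗ c.p) := by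
    ext v
    conv_lhs => rw [← c.sum_eq v]
    rw [finsum_eq_sum_of_fintype, map_sum, LinearMap.sum_apply]; refine sum_congr rfl fun q _ => ?_
    show _ = ξ (V.ρ q.out⁻¹⁻¹ (c.j (c.p (V.ρ q.out⁻¹ v))))
    rw [inv_inv]
  rw [h1]
  exact (Finset.sum_induction _ (fun η => η ∈ smoothVectors V.ρ.dual ∧ P η)
    (fun η η' hη hη' => ⟨Submodule.add_mem _ hη.1 hη'.1, hadd _ hη.1 _ hη'.1 hη.2 hη'.2⟩)
    ⟨Submodule.zero_mem _, h0⟩ fun q _ => ⟨smoothVectors_stable V.ρ.dual _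
      (c.comp_p_mem hH (hω _)), h _ _ (hω _)⟩).2

variable [LocallyCompactSpace G] [SigmaCompactSpace G] [H.Normal] [H.FiniteIndex]
  {μ : Measure (G ⧸ B)}

omit [LocallyCompactSpace G] in
lemma integrable_schur_iff (hHo : IsOpen (H : Set G)) (hV : isSmooth G V)
    (hBH : B ≤ H) (hB : B ≤ center G) (hs : IsScalarOn V.ρ B)
    (hU : HasCompactOpen G)
    (hμ : IsHaarOnQuotient B μ) (v u : T) (ξ : Dual ℂ T) {η : Dual ℂ T}
    (hη : η ∈ smoothVectors T.ρ.dual) {r : ENNReal} (hr : r = H.relIndex (L ⊔ H)) :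
    (Integrable (fun x : G ⧸ B => schur V.ρ (c.j v) (c.j u) (ξ ∘ₗ c.p) (η ∘ₗ c.p) x.out) μ ↔
      Integrable (fun x : H ⧸ B.subgroupOf H => schur T.ρ v u ξ η x.out)
        (r • μ.comap (cosetRes H B))) ∧
    ∫ x : G ⧸ B, schur V.ρ (c.j v) (c.j u) (ξ ∘ₗ c.p) (η ∘ₗ c.p) x.out ∂μ =
      ∫ x : H ⧸ B.subgroupOf H, schur T.ρ v u ξ η x.out ∂(r • μ.comap (cosetRes H B)) := by
  have hcl := isClosed_of_isOpen H hHo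
  have : SigmaCompactSpace H := hcl.isClosedEmbedding_subtypeVal.sigmaCompactSpace
  have hBH' : B.subgroupOf H ≤ center H := fun b hb =>
    mem_center_iff.2 fun h => sext (mem_center_iff.1 (hB hb) h)
  have hUH := HasCompactOpen.subgroup hU hHo
  have hr0 : (r : ENNReal) ≠ 0 := by
    rw [hr, Nat.cast_ne_zero]; exact mt (relIndex_eq_zero_of_le_right le_top) (by
      rw [Subgroup.relIndex_top_right]; exact index_ne_zero)
  obtain ⟨W, hW, -, hinv⟩ := exists_isLevel_schur hU le_rfl hB
    (FinOver.refl _) hs (hV (c.j v))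
    (c.comp_p_mem hHo hη)
  have hW' := hW.inf hHo hBH
  have hinv' := (hinv (c.j u) (ξ ∘ₗ c.p)).mono (inf_le_left (b := H))
  have hff := c.schur_mul v u ξ η
  have hinvT : RightInv ((W ⊓ H).subgroupOf H) (schur T.ρ v u ξ η) := fun x w hw => by
    rw [← hff 1, ← hff 1, OneMemClass.coe_one, one_mul, one_mul]; exact hinv' x w hw
  have h1 := hμ.integrable_iff hB hU hW' hinv'
  have h2 := (hμ.comap_cosetMap hB hHo).integrable_iff hBH' hUH (hW'.subgroupOf hBH hHo) hinvT
  have h3 := Compression.tsum_eq_mul (L := L) inf_le_right hinv' (fun g hg => c.schur_of_notMem v u ξ η hg) hff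
  rw [integrable_smul_measure hr0 (hr ▸ ENNReal.natCast_ne_top _)]
  refine ⟨h1.1.trans (h3.1.trans h2.1.symm), ?_⟩
  rw [integral_smul_measure, h1.2, h2.2, IsHaarOnQuotient.levelVol_comap hHo inf_le_right]
  by_cases hsum : Summable fun q : G ⧸ (W ⊓ H : Subgroup G) =>
      schur V.ρ (c.j v) (c.j u) (ξ ∘ₗ c.p) (η ∘ₗ c.p) q.out
  · rw [h3.2 hsum, hr, ENNReal.toReal_natCast, smul_comm, Complex.real_smul (x := (H.relIndex _ : ℝ))]
    push_cast
    rfl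
  · rw [tsum_eq_zero_of_not_summable hsum, tsum_eq_zero_of_not_summable (mt h3.1.2 hsum), smul_zero,
      smul_zero]

end Compression

namespace Compression

open Representation

variable [LocallyCompactSpace G] [SigmaCompactSpace G] [H.Normal] [H.FiniteIndex]
  {μ : Measure (G ⧸ B)}

include c in
omit [LocallyCompactSpace G] in
lemma isFormalDegree (hHo : IsOpen (H : Set G)) (hV : isSmooth G V) (hBH : B ≤ H)
    (hB : B ≤ center G) (hs : IsScalarOn V.ρ B) (hU : HasCompactOpen G) {r : ENNReal}
    (hr : r = H.relIndex (L ⊔ H)) (h0 : r ≠ 0) (h : IsFormalDegree V B μ) :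
    IsFormalDegree T (B.subgroupOf H) (r • μ.comap (cosetRes H B)) := by
  refine ⟨(h.1.comap_cosetMap hB hHo).smul h0 (hr ▸ ENNReal.natCast_ne_top _), fun v u ξ η => ?_⟩
  have h1 := c.integrable_schur_iff hHo hV hBH hB hs hU h.1 v u ξ.1 η.2 hr
  have h2 := h.2 (c.j v) (c.j u) ⟨ξ.1 ∘ₗ c.p, c.comp_p_mem hHo ξ.2⟩
    ⟨η.1 ∘ₗ c.p, c.comp_p_mem hHo η.2⟩
  refine ⟨h1.1.1 h2.1, h1.2.symm.trans (h2.2.trans ?_)⟩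
  show η.1 (c.p (c.j v)) * ξ.1 (c.p (c.j u)) = _
  rw [c.p_j, c.p_j]

include c in
lemma isFormalDegree_of (hHo : IsOpen (H : Set G)) (hV : isSmooth G V) (hT : isSmooth H T)
    [Nontrivial T] (hBH : B ≤ H) (hB : B ≤ center G) (hs : IsScalarOn V.ρ B) (hU : HasCompactOpen G)
    {r : ENNReal} (hr : r = H.relIndex (L ⊔ H)) (hμ : IsHaarOnQuotient B μ) {ω₀ : SmoothChar G}
    (hL2 : IsL2 B V.ρ ω₀) (h : IsFormalDegree T (B.subgroupOf H) (r • μ.comap (cosetRes H B))) :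
    IsFormalDegree V B μ := by
  have := normal_of_le_center hB
  have hinv : ∀ v u ξ η, RightInv B (schur V.ρ v u ξ η) := fun v u ξ η g b hb => by
    have h1 := hs.schur_mul (v := v) (u := u) (ξ := ξ) (η := η) (o := 1) (by simp) (by rw [map_one]; rfl) hb g
    rwa [one_mul] at h1
  have hbase : ∀ (v u : T) (ξ : smoothVectors T.ρ.dual) (η : smoothVectors T.ρ.dual),
      ∫ x : G ⧸ B, schur V.ρ (c.j v) (c.j u) (ξ.1 ∘ₗ c.p) (η.1 ∘ₗ c.p) x.out ∂μ = η.1 v * ξ.1 u :=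
    fun v u ξ η => (c.integrable_schur_iff hHo hV hBH hB hs hU hμ v u ξ.1 η.2 hr).2.trans
      (h.2 v u ξ η).2
  have hright : ∀ v u ξ η g x, schur V.ρ v u ξ η (x * g) = schur V.ρ (V.ρ g v) u ξ (V.ρ.dual g η) x :=
    fun v u ξ η g x => by
      rw [schur, schur, mul_inv_rev, rep_mul, rep_mul]; rfl
  have hleft : ∀ v u ξ η g x, schur V.ρ v u ξ η (g * x) =
      schur V.ρ v (V.ρ g⁻¹ u) (V.ρ.dual g⁻¹ ξ) η x := fun v u ξ η g x => by
    rw [schur, schur, mul_inv_rev, rep_mul, rep_mul]; show _ = ξ (V.ρ g⁻¹⁻¹ _) * _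
    rw [inv_inv]
  -- right invariance of the measure
  have hμr : μ.IsMulRightInvariant := by
    obtain ⟨w, hw⟩ := _root_.exists_ne (0 : T)
    obtain ⟨ω, hω, hωw⟩ := exists_smooth_functional (ρ := T.ρ) hT
      (HasCompactOpen.subgroup hU hHo) hw
    refine hμ.isMulRightInvariant hB H fun g hg =>
      ⟨schur V.ρ (c.j w) (c.j w) (ω ∘ₗ c.p) (ω ∘ₗ c.p), hinv _ _ _ _, ?_, ?_⟩
    · rw [hbase w w ⟨ω, hω⟩ ⟨ω, hω⟩]; exact mul_ne_zero hωw hωw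
    · have h1 : V.ρ.dual g (ω ∘ₗ c.p) = (T.ρ.dual ⟨g, hg⟩ ω) ∘ₗ c.p := lext fun v =>
        congrArg ω (c.p_rho (⟨g, hg⟩ : H)⁻¹ v)
      rw [hbase w w ⟨ω, hω⟩ ⟨ω, hω⟩]; simp_rw [hright]; rw [c.rho_j ⟨g, hg⟩, h1]
      refine (hbase (T.ρ ⟨g, hg⟩ w) w ⟨ω, hω⟩ ⟨T.ρ.dual ⟨g, hg⟩ ω,
        smoothVectors_stable T.ρ.dual _ hω⟩).trans ?_
      congr 1; exact congrArg ω (rep_inv_apply T.ρ _ w)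
  -- integrability
  have hsq : ∀ v, ∀ ξ ∈ smoothVectors V.ρ.dual, RightInv B (fun g => ‖ω₀.val g * ξ (V.ρ g v)‖ ^ 2) ∧
      Integrable (fun x : G ⧸ B => ‖ω₀.val x.out * ξ (V.ρ x.out v)‖ ^ 2) μ := fun v ξ hξ => by
    obtain ⟨W, hW, h1, h2⟩ := hL2 v ξ hξ
    exact ⟨h1.mono hW.le, (hμ.integrable_iff hB hU hW h1).1.2 h2⟩
  have hint : ∀ v u, ∀ ξ ∈ smoothVectors V.ρ.dual, ∀ η ∈ smoothVectors V.ρ.dual,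
      Integrable (fun x : G ⧸ B => schur V.ρ v u ξ η x.out) μ := fun v u ξ hξ η hη => by
    obtain ⟨W, hW, -, hWi⟩ := exists_isLevel_schur hU le_rfl hB
      (FinOver.refl _) hs (hV v) hη
    refine ((hsq v ξ hξ).2.add (hμ.integrable_inv hB (hsq u η hη).1 (hsq u η hη).2)).mono'
      ((hWi u ξ).measurable hW.le hW.isOpen).aestronglyMeasurable (.of_forall fun x => ?_)
    have h1 : ω₀.val x.out * ω₀.val x.out⁻¹ = 1 := by
      rw [SmoothChar.val, SmoothChar.val, ← Units.val_mul, ← map_mul, mul_inv_cancel, map_one,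
        val_one]
    have h2 : schur V.ρ v u ξ η x.out =
        (ω₀.val x.out * ξ (V.ρ x.out v)) * (ω₀.val x.out⁻¹ * η (V.ρ x.out⁻¹ u)) := by
      rw [mul_mul_mul_comm, h1, one_mul, schur]
    rw [h2, norm_mul]; show _ ≤ ‖_‖ ^ 2 + ‖_‖ ^ 2
    nlinarith [sq_nonneg (‖ω₀.val x.out * ξ (V.ρ x.out v)‖ -
      ‖ω₀.val x.out⁻¹ * η (V.ρ x.out⁻¹ u)‖), sq_nonneg (‖ω₀.val x.out * ξ (V.ρ x.out v)‖ +
      ‖ω₀.val x.out⁻¹ * η (V.ρ x.out⁻¹ u)‖)]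
  let I : V → V → Dual ℂ V → Dual ℂ V → ℂ := fun v u ξ η =>
    ∫ x : G ⧸ B, schur V.ρ v u ξ η x.out ∂μ
  have hIr : ∀ v u ξ η g, I (V.ρ g v) u ξ (V.ρ.dual g η) = I v u ξ η := fun v u ξ η g => by
    refine Eq.trans ?_ (integral_mul_right_eq_self (fun x : G ⧸ B => schur V.ρ v u ξ η x.out)
      (g : G ⧸ B))
    refine integral_congr_ae (.of_forall fun x => ?_)
    exact ((IsHaarOnQuotient.out_mul hB (hinv v u ξ η) g x).trans (hright v u ξ η g _)).symm
  have hIl : ∀ v u ξ η g, I v (V.ρ g u) (V.ρ.dual g ξ) η = I v u ξ η := fun v u ξ η g => by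
    have h1 := hμ.integral_mul_left (hinv v u ξ η) g⁻¹; simp_rw [hleft, inv_inv] at h1
    exact h1
  refine ⟨hμ, fun v u ξ η => ⟨hint v u ξ.1 ξ.2 η.1 η.2, ?_⟩⟩
  show I v u ξ.1 η.1 = η.1 v * ξ.1 u
  -- reduction to vectors in the eigenspace
  have key : ∀ w, ∀ ω ∈ smoothVectors T.ρ.dual, ∀ u, ∀ η ∈ smoothVectors V.ρ.dual,
      I (c.j w) u (ω ∘ₗ c.p) η = η (c.j w) * ω (c.p u) := by
    intro w ω hω u η hη; have hωp := c.comp_p_mem hHo hω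
    induction u using c.induction_vec with
    | h0 =>
      rw [map_zero, map_zero, mul_zero]
      refine (integral_congr_ae (.of_forall fun x => ?_)).trans (integral_zero _ _)
      show _ * η (V.ρ _ 0) = 0
      rw [map_zero, map_zero, mul_zero]
    | hadd u u' h1 h2 =>
      rw [map_add, map_add, mul_add, ← h1, ← h2]
      refine Eq.trans (integral_congr_ae (.of_forall fun x => ?_))
        (integral_add (hint _ u _ hωp η hη) (hint _ u' _ hωp η hη))
      show _ * η (V.ρ _ (u + u')) = _ * _ + _ * _
      rw [map_add, map_add, mul_add]
    | h t w' =>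
      by_cases ht : t ∈ L ⊔ H
      · obtain ⟨l, k, rfl⟩ := exists_mul ht
        rw [c.rho_mul_j, ← map_smul]; generalize (θ l : ℂ) • T.ρ k w' = u
        rw [c.p_j]
        refine c.induction_dual hHo (P := fun η =>
          I (c.j w) (c.j u) (ω ∘ₗ c.p) η = η (c.j w) * ω u) ?_ ?_ ?_ η hη
        · refine (integral_congr_ae (.of_forall fun x => mul_zero _)).trans
            ((integral_zero _ _).trans (zero_mul _).symm)
        · intro η hη η' hη' h1 h2
          rw [ladd_apply, add_mul, ← h1, ← h2]
          exact Eq.trans (integral_congr_ae (.of_forall fun x => mul_add _ _ _))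
            (integral_add (hint _ _ _ hωp η hη) (hint _ _ _ hωp η' hη'))
        · intro s ω' hω'
          by_cases hs' : s ∈ L ⊔ H
          · obtain ⟨l', k', hlk⟩ := exists_mul (inv_mem hs')
            have h1 : V.ρ.dual s (ω' ∘ₗ c.p) = ((θ l' : ℂ) • T.ρ.dual k'⁻¹ ω') ∘ₗ c.p := by
              ext v; show ω' (c.p (V.ρ s⁻¹ v)) = (θ l' : ℂ) • ω' (T.ρ k'⁻¹⁻¹ (c.p v))
              rw [hlk, c.p_rho_mul, map_smul, inv_inv]
            rw [h1]; refine (hbase w u ⟨ω, hω⟩ ⟨_, Submodule.smul_mem _ _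
              (smoothVectors_stable T.ρ.dual k'⁻¹ hω')⟩).trans ?_
            show _ = ((θ l' : ℂ) • T.ρ.dual k'⁻¹ ω') (c.p (c.j w)) * _
            rw [c.p_j]
          · have h1 : (V.ρ.dual s (ω' ∘ₗ c.p)) (c.j w) = 0 := by
              show ω' (c.p (V.ρ s⁻¹ (c.j w))) = 0
              rw [c.zero_off _ (mt inv_mem_iff.1 hs'), map_zero]
            rw [h1, zero_mul]
            refine (integral_congr_ae (.of_forall fun x => ?_)).trans (integral_zero _ _)
            show ω (c.p (V.ρ x.out (c.j w))) * ω' (c.p (V.ρ s⁻¹ (V.ρ x.out⁻¹ (c.j u)))) = 0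
            by_cases hx : x.out ∈ L ⊔ H
            · rw [← rep_mul, c.zero_off (s⁻¹ * x.out⁻¹) (fun h' => hs' (inv_mem_iff.1
                ((Subgroup.mul_mem_cancel_right _ (inv_mem hx)).1 h'))), map_zero, mul_zero]
            · rw [c.zero_off _ hx, map_zero, zero_mul]
      · obtain ⟨l, a, ha, hl⟩ := c.exists_ne t ht; rw [c.zero_off t ht, map_zero, mul_zero]
        have h1 : V.ρ.dual (l : G)⁻¹ (ω ∘ₗ c.p) = (θ l : ℂ) • (ω ∘ₗ c.p) := by
          ext v; show ω (c.p (V.ρ (l : G)⁻¹⁻¹ v)) = (θ l : ℂ) • ω (c.p v)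
          rw [inv_inv, c.p_rho_L, map_smul]
        have h2 := hIl (c.j w) (V.ρ t (c.j w')) (ω ∘ₗ c.p) η (l : G)⁻¹
        rw [hl, h1] at h2; have h3 : I (c.j w) (a • V.ρ t (c.j w')) ((θ l : ℂ) • (ω ∘ₗ c.p)) η =
            (a * θ l) * I (c.j w) (V.ρ t (c.j w')) (ω ∘ₗ c.p) η := by
          rw [← integral_const_mul]; refine integral_congr_ae (.of_forall fun x => ?_)
          show ((θ l : ℂ) • ω _) * η (V.ρ _ (a • _)) = _ * (ω _ * η _)
          rw [map_smul, map_smul, smul_eq_mul, smul_eq_mul]; ring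
        rw [h3] at h2
        have h4 : (a * θ l - 1) * I (c.j w) (V.ρ t (c.j w')) (ω ∘ₗ c.p) η = 0 := by
          rw [sub_mul, h2, one_mul, sub_self]
        exact (mul_eq_zero.1 h4).resolve_left (sub_ne_zero.2 ha)
  obtain ⟨ξ, hξ⟩ := ξ
  obtain ⟨η, hη⟩ := η
  show I v u ξ η = η v * ξ u
  induction v using c.induction_vec generalizing η with
  | h0 =>
    rw [map_zero, zero_mul]
    refine (integral_congr_ae (.of_forall fun x => ?_)).trans (integral_zero _ _)
    show ξ (V.ρ _ 0) * _ = 0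
    rw [map_zero, map_zero, zero_mul]
  | hadd v v' h1 h2 =>
    rw [map_add, add_mul, ← h1 η hη, ← h2 η hη]
    refine Eq.trans (integral_congr_ae (.of_forall fun x => ?_))
      (integral_add (hint v u ξ hξ η hη) (hint v' u ξ hξ η hη))
    show ξ (V.ρ _ (v + v')) * _ = _ * _ + _ * _
    rw [map_add, map_add, add_mul]
  | h g w =>
    have h1 := hIr (c.j w) u ξ (V.ρ.dual g⁻¹ η) g; rw [rep_apply_inv V.ρ.dual g η] at h1
    rw [h1, show η (V.ρ g (c.j w)) = (V.ρ.dual g⁻¹ η) (c.j w) by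
      show _ = η (V.ρ g⁻¹⁻¹ (c.j w))
      rw [inv_inv]]
    have hη' := smoothVectors_stable V.ρ.dual g⁻¹ hη; generalize V.ρ.dual g⁻¹ η = η' at hη'
    refine c.induction_dual hHo (P := fun ξ => ∀ u, I (c.j w) u ξ η' = η' (c.j w) * ξ u)
      (fun u => ?_) (fun ξ hξ ξ' hξ' h1 h2 u => ?_) (fun s ω hω u => ?_) ξ hξ u
    · exact (integral_congr_ae (.of_forall fun x => zero_mul _)).trans
        ((integral_zero _ _).trans (mul_zero _).symm)
    · rw [ladd_apply, mul_add, ← h1, ← h2]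
      exact Eq.trans (integral_congr_ae (.of_forall fun x => add_mul _ _ _))
        (integral_add (hint _ _ _ hξ η' hη') (hint _ _ _ hξ' η' hη'))
    · have h2 := hIl (c.j w) (V.ρ s⁻¹ u) (ω ∘ₗ c.p) η' s
      rw [rep_apply_inv V.ρ s u] at h2; exact h2.trans (key w ω hω (V.ρ s⁻¹ u) η' hη')

end Compression

/-! ### Supports of square-integrable matrix coefficients -/

namespace Representation

section

variable (ρ : Repn K X)

/-- The functionals that are fixed by `U`. -/
def fixedDual (U : Subgroup K) : Submodule ℂ (Dual ℂ X) where
  carrier := {ζ | ∀ u ∈ U, ∀ x, ζ (ρ u x) = ζ x}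
  zero_mem' := fun _ _ _ => rfl
  add_mem' h h' u hu x := congrArg₂ (· + ·) (h u hu x) (h' u hu x)
  smul_mem' c _ h u hu x := congrArg (c • ·) (h u hu x)

variable {ρ} (hρ : ρ.IsIrreducible) {U W : Subgroup K} {v₀ : X} (hv₀ : v₀ ≠ 0) (ω : SmoothChar K)
  (hW : ∀ w ∈ W, ∃ κ : ℂ, ‖κ‖ = 1 ∧ ω.val w • ρ w v₀ = κ • v₀)

lemma val_mul (ω : SmoothChar K) (a b : K) : ω.val (a * b) = ω.val a * ω.val b := by
  rw [SmoothChar.val, map_mul, Units.val_mul]; rfl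

include hW in
lemma coef_mul {w : K} (hw : w ∈ W) : ∃ κ : ℂ, ‖κ‖ = 1 ∧ ∀ (ζ : Dual ℂ X) x,
    ω.val (x * w) * ζ (ρ (x * w) v₀) = κ * (ω.val x * ζ (ρ x v₀)) := by
  obtain ⟨κ, hκ, h⟩ := hW w hw
  refine ⟨κ, hκ, fun ζ x => ?_⟩
  rw [val_mul, rep_mul, mul_assoc, ← smul_eq_mul (ω.val w), ← map_smul, ← map_smul, h, map_smul,
    map_smul, smul_eq_mul, mul_left_comm]

include hρ hv₀ hW in
lemma finiteDimensional_fixedDual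
    (hsum : ∀ ζ ∈ ρ.fixedDual U, Summable fun q : K ⧸ W => ‖ω.val q.out * ζ (ρ q.out v₀)‖ ^ 2) :
    FiniteDimensional ℂ (ρ.fixedDual U) := by
  let P : Submodule ℂ X := span ℂ {x | ∃ u ∈ U, ∃ y, x = ρ u y - y}
  have hP : ∀ φ : Dual ℂ (X ⧸ P), φ ∘ₗ P.mkQ ∈ ρ.fixedDual U := fun φ u hu x => by
    have h1 : P.mkQ (ρ u x) = P.mkQ x := (Submodule.Quotient.eq P).2 (subset_span ⟨u, hu, x, rfl⟩)
    rw [lcomp_apply, h1]; rfl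
  let s : Set (X ⧸ P) := Set.range fun h => P.mkQ (ρ h v₀)
  have hspan : span ℂ s = ⊤ := by
    have h1 : span ℂ (Set.range fun h => ρ h v₀) = ⊤ := by
      refine ((irr_iff_submodule ρ).1 hρ).2 _ (fun g x hx => ?_) |>.resolve_left fun h => hv₀ ?_
      · induction hx using Submodule.span_induction with
        | mem x hx =>
          obtain ⟨h, rfl⟩ := hx; exact subset_span ⟨g * h, rep_mul ρ g h v₀⟩
        | zero => rw [map_zero]; exact Submodule.zero_mem _
        | add x y _ _ hx hy => rw [map_add]; exact Submodule.add_mem _ hx hy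
        | smul c x _ hx => rw [map_smul]; exact Submodule.smul_mem _ c hx
      · rw [← Submodule.mem_bot ℂ, ← h]; exact subset_span ⟨1, by simp⟩
    rw [show s = P.mkQ '' Set.range fun h => ρ h v₀ from Set.range_comp _ _, Submodule.span_image, h1,
      Submodule.map_top, Submodule.range_mkQ]
  obtain ⟨b, hbs, hb, hli⟩ := exists_linearIndependent ℂ s
  let β : Module.Basis b ℂ (X ⧸ P) := Module.Basis.mk hli (by
    rw [Subtype.range_coe, hb, hspan])
  have hβ : ∀ i, β i = i := fun i => Module.Basis.mk_apply _ _ i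
  choose t ht using fun i : b => hbs i.2
  replace ht : ∀ i, P.mkQ (ρ (t i) v₀) = i := ht
  have hfin : Finite b := by
    by_contra hinf
    rw [not_finite_iff_infinite] at hinf; let φ := β.constr ℂ fun i => (ω.val (t i))⁻¹
    have hφ : ∀ i, φ (P.mkQ (ρ (t i) v₀)) = (ω.val (t i))⁻¹ := fun i => by
      rw [ht, ← hβ]; exact β.constr_basis ℂ _ i
    have hinj : Injective fun i : b => (t i : K ⧸ W) := fun i i' h => by
      obtain ⟨κ, hκ, h1⟩ := coef_mul ω hW (QuotientGroup.eq.1 h); by_contra hne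
      have h2 := h1 ((β.coord i') ∘ₗ P.mkQ) (t i)
      rw [mul_inv_cancel_left, lcomp_apply, lcomp_apply, ht, ht, ← hβ i, ← hβ i',
        Module.Basis.coord_apply, Module.Basis.coord_apply, Module.Basis.repr_self, Module.Basis.repr_self,
        Finsupp.single_eq_same, Finsupp.single_eq_of_ne (Ne.symm hne), mul_one, mul_zero, mul_zero] at h2
      exact (ω.1 (t i')).ne_zero h2
    have h1 := (hsum _ (hP φ)).comp_injective hinj
    refine absurd ((summable_congr fun i => ?_).1 h1) (mt (summable_const_iff (1 : ℝ)).1 one_ne_zero)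
    obtain ⟨w, hw⟩ := mk_out_eq_mul W (t i); obtain ⟨κ, hκ, h1⟩ := coef_mul ω hW w.2
    show ‖ω.val ((t i : K ⧸ W)).out * (φ ∘ₗ P.mkQ) (ρ ((t i : K ⧸ W)).out v₀)‖ ^ 2 = 1
    rw [hw, h1, norm_mul, hκ, lcomp_apply, hφ,
      show ω.val (t i) * (ω.val (t i))⁻¹ = 1 from mul_inv_cancel₀ (ω.1 (t i)).ne_zero, norm_one,
      one_mul, one_pow]
  have := Module.Finite.of_basis β
  let f : ρ.fixedDual U →ₗ[ℂ] Dual ℂ (X ⧸ P) :=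
    { toFun := fun ζ => P.liftQ ζ.1 (Submodule.span_le.2 (by
        rintro _ ⟨u, hu, y, rfl⟩
        exact (map_sub ζ.1 _ _).trans (sub_eq_zero.2 (ζ.2 u hu y))))
      map_add' := fun _ _ => Submodule.linearMap_qext _ rfl
      map_smul' := fun _ _ => Submodule.linearMap_qext _ rfl }
  refine FiniteDimensional.of_injective f fun ζ ζ' h => sext (lext fun x => ?_)
  exact congrArg (fun g : Dual ℂ (X ⧸ P) => g (P.mkQ x)) h

end

end Representation

section

variable {ι : Type*}

/-- The restriction of a square-summable function to a set. -/
def lpCut (S : Set ι) (v : lp (fun _ : ι => ℂ) 2) : lp (fun _ : ι => ℂ) 2 :=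
  ⟨S.indicator v, memℓp_gen (Summable.of_nonneg_of_le (fun _ => by positivity)
    (fun i => Real.rpow_le_rpow (norm_nonneg _) (norm_indicator_le_norm_self _ _) (by simp))
    ((lp.memℓp v).summable (by simp)))⟩

lemma lpCut_add_compl (S : Set ι) (v : lp (fun _ : ι => ℂ) 2) : lpCut S v + lpCut Sᶜ v = v :=
  lp.ext (Set.indicator_self_add_compl S v)

lemma lpCut_univ (v : lp (fun _ : ι => ℂ) 2) : lpCut Set.univ v = v := lp.ext (Set.indicator_univ _)

lemma exists_norm_lpCut_le {n : ℕ} (b : Fin n → lp (fun _ : ι => ℂ) 2) {ε : ℝ} (hε : 0 < ε) :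
    ∃ F : Finset ι, ∀ S : Set ι, Disjoint S F → ∀ i, ‖lpCut S (b i)‖ ≤ ε := by
  classical
  have h1 : ∀ i, ∃ F : Finset ι, ∀ S : Set ι, Disjoint S F → ‖lpCut S (b i)‖ ≤ ε := fun i => by
    obtain ⟨F, hF⟩ := ((lp.memℓp (b i)).summable (by simp)).tsum_vanishing
      (Iio_mem_nhds (show (0 : ℝ) < ε ^ 2 by positivity))
    refine ⟨F, fun S hS => le_of_lt ?_⟩
    have h2 := hF S hS; rw [tsum_subtype S (fun j => ‖b i j‖ ^ (2 : ENNReal).toReal)] at h2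
    have h3 := lp.norm_rpow_eq_tsum (p := 2) (by simp) (lpCut S (b i))
    refine lt_of_pow_lt_pow_left₀ 2 hε.le ?_
    rw [← Real.rpow_natCast ‖_‖]
    refine Eq.trans_lt (Eq.trans (by simp) (h3.trans (tsum_congr fun j => ?_))) h2
    show ‖S.indicator (b i) j‖ ^ _ = _
    by_cases hj : j ∈ S
    · rw [Set.indicator_of_mem hj, Set.indicator_of_mem hj]
    · rw [Set.indicator_of_notMem hj, Set.indicator_of_notMem hj]; simp
  choose F hF using h1
  exact ⟨Finset.univ.biUnion F, fun S hS i => hF i S (hS.mono_right (by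
    exact_mod_cast Finset.subset_biUnion_of_mem F (mem_univ i)))⟩

lemma inner_lpCut (S : Set ι) (v w : lp (fun _ : ι => ℂ) 2) :
    inner ℂ (lpCut S v) w = inner ℂ v (lpCut S w) := by
  rw [lp.inner_eq_tsum, lp.inner_eq_tsum]
  refine tsum_congr fun i => ?_
  show inner ℂ (S.indicator v i) (w i) = inner ℂ (v i) (S.indicator w i)
  by_cases hj : i ∈ S
  · rw [Set.indicator_of_mem hj, Set.indicator_of_mem hj]
  · rw [Set.indicator_of_notMem hj, Set.indicator_of_notMem hj]; simp

end

namespace Representation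

variable {B : Subgroup K} {ρ : Repn K X}

lemma IsIrreducible.exists_support_bound (hρ : ρ.IsIrreducible) (hB : B ≤ center K)
    (hU : HasCompactOpen K) (hsm : ∀ v, IsOpen (ρ.stab v : Set K)) {ω : SmoothChar K}
    (hun : ∀ b ∈ B, ∃ c : ℂ, ‖c‖ = 1 ∧ ∀ v, ω.val b • ρ b v = c • v) (hL2 : IsL2 B ρ ω) {ℓ : K → ℝ}
    (hℓ : ∀ a b, ℓ (a * b) = ℓ a + ℓ b) (hℓB : ∀ b ∈ B, ℓ b = 0) {O : Subgroup K}
    (hO : IsOpen (O : Set K)) (hℓO : ∀ o ∈ O, ℓ o = 0) (v : X) {ξ : Dual ℂ X}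
    (hξ : ξ ∈ smoothVectors ρ.dual) : ∃ C, ∀ g, C < |ℓ g| → ξ (ρ g v) = 0 := by
  by_cases hv : v = 0
  · exact ⟨0, fun g _ => by rw [hv, map_zero, map_zero]⟩
  obtain ⟨U, hUo, hUc, hUv, hUξ, hUω, hUO⟩ : ∃ U : Subgroup K, IsOpen (U : Set K) ∧
      IsCompact (U : Set K) ∧ U ≤ ρ.stab v ∧ U ≤ ρ.dual.stab ξ ∧ (∀ u ∈ U, ω.val u = 1) ∧ U ≤ O := by
    obtain ⟨U, h1, h2⟩ := hU
    have h3 : IsOpen ((U ⊓ (ρ.stab v ⊓ (ρ.dual.stab ξ ⊓ (ω.1.ker ⊓ O))) : Subgroup K) : Set K) :=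
      h1.inter ((hsm v).inter (IsOpen.inter hξ ((isOpen_fiber ω.2 1).inter hO)))
    exact ⟨_, h3, h2.of_isClosed_subset (isClosed_of_isOpen _ h3) Set.inter_subset_left,
      fun _ h => h.2.1, fun _ h => h.2.2.1, fun u h => congrArg uval (h.2.2.2.1 : ω.1 u = 1),
      fun _ h => h.2.2.2.2⟩
  obtain ⟨W, hlev, -, hdec⟩ := exists_isLevel hU le_rfl hB
    (FinOver.refl B) hUo
  have hW : ∀ w ∈ W, ∃ κ : ℂ, ‖κ‖ = 1 ∧ ω.val w • ρ w v = κ • v := fun w hw => by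
    obtain ⟨b, hb, o, ho, rfl⟩ := hdec w hw; obtain ⟨κ, hκ, h⟩ := hun b hb
    refine ⟨κ, hκ, ?_⟩
    rw [val_mul, hUω o ho, one_mul, rep_mul, ← map_smul, h, map_smul]
    exact congrArg (κ • ·) (hUv ho)
  have hℓW : ∀ w ∈ W, ℓ w = 0 := fun w hw => by
    obtain ⟨b, hb, o, ho, rfl⟩ := hdec w hw; rw [hℓ, hℓO o (hUO ho), hℓB b hb, add_zero]
  let f : Dual ℂ X → K → ℂ := fun ζ x => ω.val x * ζ (ρ x v)
  have hfW : ∀ w ∈ W, ∃ κ : ℂ, ‖κ‖ = 1 ∧ ∀ ζ x, f ζ (x * w) = κ * f ζ x := fun w hw =>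
    coef_mul ω hW hw
  have hsum : ∀ ζ ∈ smoothVectors ρ.dual, Summable fun q : K ⧸ W => ‖f ζ q.out‖ ^ 2 := fun ζ hζ => by
    obtain ⟨W', h1, h2, h3⟩ := hL2 v ζ hζ
    refine (h1.summable_iff hlev h2 fun x w hw => ?_).1 h3
    obtain ⟨κ, hκ, h⟩ := hfW w hw; show ‖f ζ (x * w)‖ ^ 2 = ‖f ζ x‖ ^ 2
    rw [h, norm_mul, hκ, one_mul]
  have hM : ρ.fixedDual U ≤ smoothVectors ρ.dual := fun ζ hζ =>
    isOpen_mono (H₂ := ρ.dual.stab ζ) (fun u hu => lext fun x =>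
      hζ u⁻¹ (U.inv_mem hu) x) hUo
  have := finiteDimensional_fixedDual hρ hv ω hW (U := U) fun ζ hζ => hsum ζ (hM hζ)
  let J : smoothVectors ρ.dual →ₗ[ℂ] lp (fun _ : K ⧸ W => ℂ) 2 :=
    { toFun := fun ζ => ⟨fun q => f ζ.1 q.out, memℓp_gen (by simpa using hsum ζ.1 ζ.2)⟩
      map_add' := fun ζ ζ' => lp.ext (funext fun q => mul_add _ _ _)
      map_smul' := fun c ζ => lp.ext (funext fun q => mul_left_comm _ _ _) }
  let tr : K → smoothVectors ρ.dual → smoothVectors ρ.dual := fun h ζ =>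
    ω.val h • ⟨ρ.dual h⁻¹ ζ.1, smoothVectors_stable ρ.dual _ ζ.2⟩
  have htr' : ∀ h (ζ : smoothVectors ρ.dual) x, (tr h ζ).1 x = ω.val h * ζ.1 (ρ h x) := fun h ζ x => by
    show ω.val h * ζ.1 (ρ h⁻¹⁻¹ x) = _
    rw [inv_inv]
  have htr : ∀ h (ζ : smoothVectors ρ.dual) x, f (tr h ζ).1 x = f ζ.1 (h * x) := fun h ζ x => by
    show ω.val x * (tr h ζ).1 _ = ω.val (h * x) * ζ.1 (ρ (h * x) v)
    rw [htr', val_mul, rep_mul, mul_left_comm, mul_assoc]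
  let cut : Set ℝ → lp (fun _ : K ⧸ W => ℂ) 2 → lp (fun _ : K ⧸ W => ℂ) 2 := fun D =>
    lpCut {q | ℓ q.out ∈ D}
  have hT : ∀ (ξ ζ : smoothVectors ρ.dual) h D, inner ℂ (J (tr h ξ)) (cut D (J ζ)) =
      inner ℂ (J ξ) (cut ((fun t => t - ℓ h) ⁻¹' D) (J (tr h⁻¹ ζ))) := fun ξ ζ h D => by
    classical
    rw [lp.inner_eq_tsum, lp.inner_eq_tsum]
    let Φ : K → ℂ := fun x => if ℓ x - ℓ h ∈ D then inner ℂ (f ξ.1 x) (f ζ.1 (h⁻¹ * x)) else 0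
    have hΦ : RightInv W Φ := fun x w hw => by
      obtain ⟨κ, hκ, h1⟩ := hfW w hw; show (if _ then _ else _) = if _ then _ else _
      rw [hℓ, hℓW w hw, add_zero, ← mul_assoc, h1, h1, ← smul_eq_mul, ← smul_eq_mul,
        inner_smul_left, inner_smul_right, ← mul_assoc, Complex.conj_mul', hκ]
      simp
    refine Eq.trans (tsum_congr fun q => ?_) ((hΦ.tsum_mul_left h).trans (tsum_congr fun q => ?_))
    · show inner ℂ (f (tr h ξ).1 q.out) (Set.indicator _ (fun q => f ζ.1 q.out) q) =
        if ℓ (h * q.out) - ℓ h ∈ D then inner ℂ (f ξ.1 (h * q.out)) (f ζ.1 (h⁻¹ * (h * q.out))) else 0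
      rw [htr, hℓ, add_sub_cancel_left, inv_mul_cancel_left, Set.indicator_apply]
      split_ifs with h1 h2 h2
      · rfl
      · exact (h2 h1).elim
      · exact (h1 h2).elim
      · exact inner_zero_right _
    · show (if _ then _ else _) = inner ℂ (f ξ.1 q.out) (Set.indicator _ (fun q => f (tr h⁻¹ ζ).1 q.out) q)
      rw [Set.indicator_apply, htr]; split_ifs with h1 h2 h2
      · rfl
      · exact (h2 h1).elim
      · exact (h1 h2).elim
      · exact (inner_zero_right _).symm
  have hcu : ∀ v, cut Set.univ v = v := lpCut_univ
  have hT' : ∀ (ξ ζ : smoothVectors ρ.dual) h, inner ℂ (J (tr h ξ)) (J ζ) =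
      inner ℂ (J ξ) (J (tr h⁻¹ ζ)) := fun ξ ζ h => by
    have := hT ξ ζ h Set.univ; rwa [Set.preimage_univ, hcu, hcu] at this
  have hfixed : ∀ ζ : smoothVectors ρ.dual, ζ.1 ∈ ρ.fixedDual U → ∀ u ∈ U, tr u ζ = ζ :=
    fun ζ hζ u hu => sext (lext fun x => by
      rw [htr', hUω u hu, one_mul, hζ u hu])
  -- averaging over `U`
  have havg : ∀ ξ : smoothVectors ρ.dual, ∃ ξ' : smoothVectors ρ.dual, ξ'.1 ∈ ρ.fixedDual U ∧
      ξ'.1 v = ξ.1 v ∧ ∀ ζ : smoothVectors ρ.dual, ζ.1 ∈ ρ.fixedDual U → ∀ D,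
        inner ℂ (J ξ) (cut D (J ζ)) = inner ℂ (J ξ') (cut D (J ζ)) := fun ξ => by
    let O' := (ρ.dual.stab ξ.1).subgroupOf U
    have : O'.FiniteIndex := ⟨FinOver.of_isCompact hUc _ ξ.2 bot_le⟩
    have := ofFinite (U ⧸ O'); have hn : (Fintype.card (U ⧸ O') : ℂ) ≠ 0 := by simp
    have hS : ∀ x, (∑ q : U ⧸ O', tr (q.out : K)⁻¹ ξ).1 x = ∑ q : U ⧸ O', ξ.1 (ρ (q.out : K)⁻¹ x) :=
      fun x => by
        rw [Submodule.coe_sum, LinearMap.sum_apply]; refine sum_congr rfl fun q _ => ?_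
        rw [htr', hUω _ (U.inv_mem q.out.2), one_mul]
    refine ⟨(Fintype.card (U ⧸ O') : ℂ)⁻¹ • ∑ q : U ⧸ O', tr (q.out : K)⁻¹ ξ, fun u hu x => ?_, ?_, ?_⟩
    · refine congrArg ((Fintype.card (U ⧸ O') : ℂ)⁻¹ * ·) ?_
      rw [hS, hS]
      have h1 : RightInv O' fun a : U => ξ.1 (ρ (a : K)⁻¹ x) := fun a o ho => by
        show ξ.1 (ρ (a * o : K)⁻¹ x) = _
        rw [mul_inv_rev, rep_mul]
        exact congrArg (fun g : Dual ℂ X => g _) (ho : ρ.dual o ξ.1 = ξ.1)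
      have h2 := h1.tsum_mul_left (⟨u, hu⟩⁻¹ : U)
      rw [tsum_fintype, tsum_fintype] at h2; refine Eq.trans (sum_congr rfl fun q _ => ?_) h2
      show _ = ξ.1 (ρ (u⁻¹ * (q.out : K))⁻¹ x)
      rw [mul_inv_rev, inv_inv, rep_mul]
    · refine (congrArg ((Fintype.card (U ⧸ O') : ℂ)⁻¹ * ·) (hS v)).trans ?_
      rw [sum_congr rfl fun (q : U ⧸ O') _ => congrArg ξ.1
        (show ρ (q.out : K)⁻¹ v = v from hUv (U.inv_mem q.out.2)), sum_const, nsmul_eq_mul,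
        card_univ, inv_mul_cancel_left₀ hn]
    · intro ζ hζ D
      rw [map_smul, map_sum, inner_smul_left, sum_inner, sum_congr rfl fun q _ =>
        show inner ℂ (J (tr (q.out : K)⁻¹ ξ)) (cut D (J ζ)) = inner ℂ (J ξ) (cut D (J ζ)) by
          rw [hT, inv_inv, hfixed ζ hζ _ q.out.2, hℓO _ (hUO (U.inv_mem q.out.2))]; simp,
        sum_const, nsmul_eq_mul, card_univ, map_inv₀, Complex.conj_natCast,
        inv_mul_cancel_left₀ hn]
  -- an orthonormal basis of the coefficients that are invariant under `U`
  let JM := J ∘ₗ Submodule.inclusion hM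
  let E := LinearMap.range JM
  obtain ⟨n, ⟨b⟩⟩ : ∃ n, Nonempty (OrthonormalBasis (Fin n) ℂ E) := ⟨_, ⟨stdOrthonormalBasis ℂ E⟩⟩
  choose z hz using fun i => (b i).2
  let ζ : Fin n → smoothVectors ρ.dual := fun i => Submodule.inclusion hM (z i)
  have hζM : ∀ i, (ζ i).1 ∈ ρ.fixedDual U := fun i => (z i).2
  have hζ : ∀ i, J (ζ i) = b i := hz
  have hrepr : ∀ ξ : smoothVectors ρ.dual, ξ.1 ∈ ρ.fixedDual U →
      J ξ = ∑ k, inner ℂ (J (ζ k)) (J ξ) • J (ζ k) := fun ξ hξ => by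
    have h1 := congrArg sval (b.sum_repr' ⟨J ξ, ⟨⟨ξ.1, hξ⟩, rfl⟩⟩)
    rw [Submodule.coe_sum] at h1; refine h1.symm.trans (sum_congr rfl fun k _ => ?_)
    rw [hζ]; rfl
  have hexp : ∀ ξ D j, inner ℂ (J ξ) (cut D (J (ζ j))) =
      ∑ k, inner ℂ (J ξ) (J (ζ k)) * inner ℂ (J (ζ k)) (cut D (J (ζ j))) := fun ξ D j => by
    obtain ⟨ξ', h1, -, h2⟩ := havg ξ
    have h3 : ∀ k, inner ℂ (J ξ) (J (ζ k)) = inner ℂ (J ξ') (J (ζ k)) := fun k => by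
      have := h2 (ζ k) (hζM k) Set.univ; rwa [hcu] at this
    rw [h2 _ (hζM j)]
    conv_lhs => rw [hrepr ξ' h1]
    rw [sum_inner]; refine sum_congr rfl fun k _ => ?_
    rw [inner_smul_left, h3, inner_conj_symm]
  have hnorm : ∀ i, ‖J (ζ i)‖ = 1 := fun i => by
    rw [hζ]; exact b.orthonormal.1 i
  let ε : ℝ := (2 * n + 1)⁻¹
  have hε : 0 < ε := by positivity
  obtain ⟨F, hF⟩ := exists_norm_lpCut_le (fun i => J (ζ i)) hε
  let R : ℝ := ∑ q ∈ F, |ℓ q.out|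
  have hR : ∀ q ∈ F, |ℓ q.out| ≤ R := fun q hq =>
    Finset.single_le_sum (f := fun q : K ⧸ W => |ℓ q.out|) (fun _ _ => abs_nonneg _) hq
  have hsmall : ∀ D : Set ℝ, (∀ t ∈ D, R < |t|) → ∀ k j,
      ‖inner ℂ (J (ζ k)) (cut D (J (ζ j)))‖ ≤ ε := fun D hD k j => by
    refine (norm_inner_le_norm _ _).trans ?_
    rw [hnorm, one_mul]
    exact hF _ (Set.disjoint_left.2 fun q hq hqF => (hD _ hq).not_ge (hR q hqF)) j
  have hzero : ∀ h, 2 * R < |ℓ h| → ∀ i k, inner ℂ (J (tr h (ζ i))) (J (ζ k)) = 0 := by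
    intro h hh; let A : Fin n → Fin n → ℂ := fun i k => inner ℂ (J (tr h (ζ i))) (J (ζ k))
    have hA : ∀ j k, ‖inner ℂ (J (tr h⁻¹ (ζ j))) (J (ζ k))‖ = ‖A k j‖ := fun j k => by
      rw [norm_inner_symm, ← hT' (ζ k) (ζ j) h]
    by_contra! hne
    obtain ⟨i, k, hik⟩ := hne; have : Nonempty (Fin n) := ⟨i⟩
    obtain ⟨⟨i₀, j₀⟩, hmax⟩ := Finite.exists_max fun p : Fin n × Fin n => ‖A p.1 p.2‖
    have hpos : 0 < ‖A i₀ j₀‖ := (norm_pos_iff.2 hik).trans_le (hmax (i, k))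
    let D : Set ℝ := {t | |t| ≤ R}
    have h1 : A i₀ j₀ = inner ℂ (J (tr h (ζ i₀))) (cut D (J (ζ j₀))) +
        inner ℂ (J (tr h (ζ i₀))) (cut Dᶜ (J (ζ j₀))) := by
      rw [← inner_add_right]; exact congrArg (inner ℂ _) (lpCut_add_compl _ _).symm
    have hb : ∀ (ξ : smoothVectors ρ.dual) D j, (∀ t ∈ D, R < |t|) →
        (∀ k, ‖inner ℂ (J ξ) (J (ζ k))‖ ≤ ‖A i₀ j₀‖) →
        ‖inner ℂ (J ξ) (cut D (J (ζ j)))‖ ≤ n * (‖A i₀ j₀‖ * ε) := fun ξ D j hD hξ => by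
      rw [hexp]
      refine (norm_sum_le _ _).trans ((Finset.sum_le_card_nsmul _ _ (‖A i₀ j₀‖ * ε) fun k _ => ?_).trans
        (by simp))
      rw [norm_mul]; exact mul_le_mul (hξ k) (hsmall D hD k j) (norm_nonneg _) (norm_nonneg _)
    have h2 : ‖inner ℂ (J (tr h (ζ i₀))) (cut D (J (ζ j₀)))‖ ≤ n * (‖A i₀ j₀‖ * ε) := by
      rw [hT, ← inner_lpCut, norm_inner_symm]
      refine hb _ _ _ (fun t ht => ?_) fun k => (hA j₀ k).trans_le (hmax (k, j₀))
      have h3 : |t - ℓ h| ≤ R := ht; have h4 := abs_sub_abs_le_abs_sub (ℓ h) t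
      rw [abs_sub_comm] at h4; linarith
    have h3 := hb (tr h (ζ i₀)) Dᶜ j₀ (fun t ht => not_le.1 ht) fun k => hmax (i₀, k)
    have h4 := norm_add_le (inner ℂ (J (tr h (ζ i₀))) (cut D (J (ζ j₀))))
      (inner ℂ (J (tr h (ζ i₀))) (cut Dᶜ (J (ζ j₀))))
    rw [← h1] at h4; have h5 : ε * (2 * n + 1) = 1 := inv_mul_cancel₀ (by positivity)
    nlinarith [mul_pos hpos hε]
  refine ⟨2 * R, fun g hg => ?_⟩
  let ξ₀ : smoothVectors ρ.dual := ⟨ξ, hξ⟩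
  have hξ₀ : ξ₀.1 ∈ ρ.fixedDual U := fun u hu x => by
    have := congrArg (fun g : Dual ℂ X => g x) (hUξ (U.inv_mem hu) : ρ.dual u⁻¹ ξ = ξ)
    change ξ (ρ u⁻¹⁻¹ x) = ξ x at this
    rwa [inv_inv] at this
  obtain ⟨ξ', h1, h2, h3⟩ := havg (tr g ξ₀)
  have h4 : J ξ' = 0 := by
    rw [hrepr ξ' h1]; refine sum_eq_zero fun k _ => ?_
    have h5 := h3 (ζ k) (hζM k) Set.univ
    rw [hcu, hT', hrepr ξ₀ hξ₀, sum_inner, sum_eq_zero fun i _ => by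
      rw [inner_smul_left, ← hT', hzero g hg, mul_zero]] at h5
    rw [← inner_conj_symm, ← h5, map_zero, zero_smul]
  obtain ⟨w, hw⟩ := mk_out_eq_mul W 1
  obtain ⟨κ, hκ, h⟩ := hfW w w.2
  have h6 : f ξ'.1 ((1 : K) : K ⧸ W).out = 0 := congrArg (fun v : lp (fun _ : K ⧸ W => ℂ) 2 => v _) h4
  rw [hw, h, mul_eq_zero] at h6
  have h7 := h6.resolve_left fun h0 => by simp [h0] at hκ
  have h8 : ξ'.1 v = 0 := by
    have h9 : ω.val 1 * ξ'.1 (ρ 1 v) = 0 := h7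
    rw [map_one] at h9; exact (mul_eq_zero.1 h9).resolve_left (ω.1 1).ne_zero
  rw [h2, htr'] at h8
  exact (mul_eq_zero.1 h8).resolve_left (ω.1 g).ne_zero

end Representation

section

variable (hψ : ψ.Extends φ) (hF : IsLInd H N ψ χ F)

include hc hψ hF in
lemma IsLInd.exists_compression {τ : RepLoc H° ψ} (hτ : τ.obj.ρ.IsIrreducible) :
    (F.obj τ).obj.ρ.IsIrreducible ∧ ∃ D : LagrangianDatum H N ψ χ,
      Nonempty (Compression D.θ.1 (F.obj τ).obj.ρ τ.obj.ρ) := by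
  have := hF.isEquivalence hc hψ
  have hV := (RepLoc.isIrreducible_map_iff F τ).2 hτ
  obtain ⟨D, -⟩ := id hF
  obtain ⟨e⟩ := hF.comp_eig hc D hψ
  refine ⟨hV, D, ⟨?_⟩⟩
  let V := F.obj τ
  let hb := rep_base (D.hχ hc hψ) V
  have hL := D.2
  let E := hc.eig hb hL.le D.θ.1
  have hcen := hc.isCentralChar (D.hχ hc hψ) hL.le D.extends_left V
  have hun : ∀ n v, hc.unip hb n v = v := fun n v => by
    have h1 := hc.1.unipAct_sub_one_pow hc.relIndex_ne_zero hb (v := v) (m := 1) (fun b => by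
      rw [pow_one]; refine sub_eq_zero.2 ((V.rho_eq_smul hV (k := (b : G)) ⟨b.2.1.1, b.2.2⟩
        (mem_center_iff.1 b.2.2) v).trans ?_)
      exact congrArg (fun z : ℂˣ => (z : ℂ) • v)
        ((D.hχ hc hψ).apply (x := (b : G)) ⟨b.2.1.1, b.2.2⟩ b.2)) n
    rw [pow_one] at h1; exact sub_eq_zero.1 h1
  have hEL : ∀ {α : D.L →* ℂˣ} {v}, v ∈ hc.eig hb hL.le α → ∀ l : D.L, V.obj.ρ l v = (α l : ℂ) • v :=
    fun hv l => (hc.rho_of_mem_eig hb hL.le hv l).trans (congrArg _ (hun _ _))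
  let j₀ : τ.obj →ₗ[ℂ] E := repLin (e.inv.app τ)
  let p₀ : E →ₗ[ℂ] τ.obj := repLin (e.hom.app τ)
  let pr : V.obj →ₗ[ℂ] E := (hc.eigProj hb hL.le D.θ.1).codRestrict E (hcen.eigProj_mem hc)
  have hpr : ∀ v (w : E), hc.eigProj hb hL.le D.θ.1 v = w → p₀ (pr v) = p₀ w := fun v w h =>
    congrArg p₀ (sext h)
  have hne : ∀ t ∉ D.L ⊔ H, hc.pairChar hL.le t ≠ 1 := fun t ht =>
    mt (hc.pairChar_eq_one_iff_mem hL t).1 ht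
  exact
    { j := E.subtype ∘ₗ j₀
      p := p₀ ∘ₗ pr
      p_j := fun w => (hpr _ _ (hc.eigProj_of_mem (j₀ w).2)).trans (repLin_hom_inv (e.app τ) w)
      rho_j := fun h w => (congrArg sval (repLin_comm (e.inv.app τ) h w)).symm
      p_rho := fun h v => (congrArg p₀ (sext (hc.eigProj_rho_of_mem hb hL.le h.2 v))).trans
        (repLin_comm (e.hom.app τ) h (pr v))
      rho_j_L := fun l w => hEL (j₀ w).2 l
      p_rho_L := fun l v => by
        have h1 := hc.eigProj_rho hb hL.le (θ := D.θ.1) l v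
        rw [(hc.pairChar_eq_one_iff_mem hL l).2 (Subgroup.mem_sup_left l.2),
          show D.θ.1 * 1 = D.θ.1 from mul_one D.θ.1] at h1
        exact (hpr _ ((D.θ.1 l : ℂ) • pr v) (h1.trans (hEL (pr v).2 l))).trans (map_smul p₀ _ _)
      zero_off := fun g hg w => (hpr _ 0 (hc.eigProj_of_mem_of_ne
        (θ := D.θ.1) (θ' := D.θ.1 * hc.pairChar hL.le g) (fun l hl => by
          rw [mmul_apply, hc.pairChar_of_mem_center hL.le g hl.2, mul_one])
        (fun h => hne g hg (mul_left_cancel (h.trans (mul_one D.θ.1).symm)))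
        (hc.rho_mem_eig hb hL.le (j₀ w).2 g))).trans (map_zero p₀)
      eq_zero := fun v hv => hcen.eq_zero_of_eigProj hc (fun a ha b hb => hL.comm ha hb) fun g =>
        congrArg sval ((repLin_bijective (e.app τ)).1 ((hv g).trans (map_zero p₀).symm))
      exists_ne := fun t ht => by
        obtain ⟨l, hl⟩ := not_forall.1 (mt MonoidHom.ext_iff.2 (hne t ht))
        refine ⟨l, _, fun h => hl ?_, fun w => hEL (hc.rho_mem_eig hb hL.le (j₀ w).2 t) l⁻¹⟩
        rw [← Units.val_mul, Units.val_eq_one, mmul_apply, map_inv, map_inv, mul_comm,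
          mul_inv_cancel_left, inv_eq_one] at h
        exact h }

end

/-! ### Essential square-integrability -/

lemma FinOver.of_compactSpace {Z K : Type*} [Group Z] [TopologicalSpace Z] [IsTopologicalGroup Z]
    [Group K] [TopologicalSpace K] {B : Subgroup K} {f : Z →* K} (hf : Continuous f) {D : Subgroup Z}
    [CompactSpace (Z ⧸ D)] (hD : ∀ z ∈ D, f z ∈ B) :
    FinOver B f.range := fun O hO hB => by
  rw [← Subgroup.index_comap]
  have hle : D ≤ O.comap f := fun z hz => hB (hD z hz)
  have := discreteTopology (N := O.comap f) (hO.preimage hf)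
  have hs : Function.Surjective (quotientMapOfLE hle) :=
    QuotientGroup.mk_surjective.forall.2 fun z => ⟨(z : Z ⧸ D), rfl⟩
  have : CompactSpace (Z ⧸ O.comap f) := ⟨hs.range_eq ▸ isCompact_range
    (IsHaarOnQuotient.continuous_quotMap hle)⟩
  have : Finite (Z ⧸ O.comap f) := finite_of_compact_of_discrete
  exact Subgroup.index_ne_zero_of_finite

/-- The elements of `B` act by scalars of absolute value one, after twisting by `ω`. -/
def IsUnitaryOn (ρ : Repn K X) (ω : SmoothChar K) (B : Subgroup K) : Prop :=
  ∀ b ∈ B, ∃ c : ℂ, ‖c‖ = 1 ∧ ∀ v, ω.val b • ρ b v = c • v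

section

open Representation

variable {B Z : Subgroup K} {ρ : Repn K X}
  {ω : SmoothChar K}

lemma IsUnitaryOn.exists_isLevel (h : IsUnitaryOn ρ ω Z) (hBZ : B ≤ Z) (hZ : Z ≤ center K)
    (hfin : FinOver B Z) (hU : HasCompactOpen K) {O : Subgroup K} (hO : IsOpen (O : Set K)) :
    ∃ W, IsLevel B W ∧ Z ≤ W ∧ ∀ v, O ≤ ρ.stab v →
    ∀ ξ : Dual ℂ X, RightInv W fun g => ‖ω.val g * ξ (ρ g v)‖ ^ 2 := by
  obtain ⟨W, h1, h2, h3⟩ := _root_.exists_isLevel hU hBZ hZ hfin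
    (O := O ⊓ ω.1.ker) (hO.inter (isOpen_fiber ω.2 1))
  refine ⟨W, h1, h2, fun v hv ξ x w hw => ?_⟩
  obtain ⟨z, hz, o, ho, rfl⟩ := h3 w hw
  obtain ⟨c, hc, hcv⟩ := h z hz
  have h4 : ω.val o = 1 := congrArg uval (ho.2 : ω.1 o = 1)
  have h5 : ω.val (x * (o * z)) * ξ (ρ (x * (o * z)) v) = c * (ω.val x * ξ (ρ x v)) := by
    rw [val_mul, val_mul, h4, one_mul, mul_assoc, ← smul_eq_mul (ω.val z), ← map_smul,
      rep_mul, rep_mul, ← map_smul, ← map_smul, hcv, map_smul, map_smul, map_smul,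
      show ρ o v = v from hv ho.1, smul_eq_mul, mul_left_comm]
  show ‖_‖ ^ 2 = _
  rw [h5, norm_mul, hc, one_mul]

lemma IsUnitaryOn.of_finOver (hρ : ρ.IsIrreducible) (hsm : ∀ v, IsOpen (ρ.stab v : Set K))
    (h : IsUnitaryOn ρ ω B) (hZ : Z ≤ center K) (hfin : FinOver B Z) (hB : B ≤ Z) :
    IsUnitaryOn ρ ω Z := fun z hz => by
  obtain ⟨v, hv⟩ := hρ.exists_ne_zero
  have hO : IsOpen ((ρ.stab v ⊓ ω.1.ker : Subgroup K) : Set K) := (hsm v).inter (isOpen_fiber ω.2 1)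
  have := normal_of_le_center (hB.trans hZ)
  have h0 := hfin (B ⊔ (ρ.stab v ⊓ ω.1.ker)) (isOpen_mono le_sup_right hO) le_sup_left
  obtain ⟨n, hn, -, hzn⟩ := Subgroup.exists_pow_mem_of_relIndex_ne_zero h0 hz
  obtain ⟨b, hb, o, ho, hbo⟩ := mem_sup_of_normal_left.1 hzn.1
  obtain ⟨c, hc, hcv⟩ := h b hb
  have hcom : ∀ k v, ρ (z ^ n) (ρ k v) = ρ k (ρ (z ^ n) v) := fun k v => by
    rw [← rep_mul, ← rep_mul, mem_center_iff.1 (hZ (pow_mem hz n)) k]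
  have h1 : ω.val (z ^ n) • ρ (z ^ n) - c • (1 : Endℂ X) = 0 := by
    refine hρ.eq_zero_of_comm (fun k x => ?_) hv ?_
    · simp only [lsub_apply, lsmul_apply, map_sub, map_smul, hcom, one_apply]
    · rw [lsub_apply, lsmul_apply, ← hbo, val_mul, rep_mul,
        show ρ o v = v from ho.1, show ω.val o = 1 from congrArg uval (ho.2 : ω.1 o = 1),
        mul_one, hcv]
      exact sub_self _
  have h2 : (ω.val z • ρ z) ^ n = c • (1 : Endℂ X) := by
    rw [smul_pow, ← map_pow, show ω.val z ^ n = ω.val (z ^ n) by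
      rw [SmoothChar.val, SmoothChar.val, map_pow, Units.val_pow_eq_pow_val]]
    exact sub_eq_zero.1 h1
  obtain ⟨ζ, hζ⟩ := hρ.exists_eq_smul (T := ω.val z • ρ z) (fun k x => by
    rw [lsmul_apply, lsmul_apply, map_smul, ← rep_mul, ← rep_mul,
      mem_center_iff.1 (hZ hz) k]) hn.ne' h2
  refine ⟨ζ, ?_, fun x => congrArg (fun T : Endℂ X => T x) hζ⟩
  have h3 : ζ ^ n = c := by
    rw [hζ, smul_pow, one_pow] at h2
    exact smul_left_injective ℂ hv (congrArg (fun T : Endℂ X => T v) h2)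
  exact (pow_eq_one_iff_of_nonneg (norm_nonneg _) hn.ne').1 (by rw [← norm_pow, h3, hc])

variable [LocallyCompactSpace K] [SigmaCompactSpace K] {V : Rep.{u} ℂ K}

lemma isEssSquareIntegrable_iff (hV : isSmooth K V) (hirr : V.ρ.IsIrreducible) (hB : B ≤ center K)
    (hfin : FinOver B (center K)) (hU : HasCompactOpen K) : IsEssSquareIntegrable V ↔
    ∃ ω, IsUnitaryOn V.ρ ω B ∧ IsL2 B V.ρ ω := by
  refine exists_congr fun ω => ⟨fun ⟨h1, μ, hμ, h2⟩ => ⟨fun b hb => h1 b (hB hb), fun v ξ hξ => ?_⟩,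
    fun ⟨h1, h2⟩ => ?_⟩
  · obtain ⟨W, hW, hZW, h3⟩ := IsUnitaryOn.exists_isLevel h1 hB le_rfl hfin hU (O := V.ρ.stab v) (hV v)
    exact ⟨W, hW, h3 v le_rfl ξ, (hμ.integrable_iff le_rfl hU ⟨hZW, hW.isOpen, hW.finOver.mono_left hB⟩
      (h3 v le_rfl ξ)).1.1 (h2 v ⟨ξ, hξ⟩)⟩
  · have h3 := h1.of_finOver hirr hV le_rfl hfin hB
    obtain ⟨μ, hμ⟩ := IsHaarOnQuotient.exists_haar (center K)
    refine ⟨h3, μ, hμ, fun v ξ => ?_⟩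
    obtain ⟨W, hW, hZW, h4⟩ := h3.exists_isLevel hB le_rfl hfin hU (O := V.ρ.stab v) (hV v)
    obtain ⟨W', hW', h5, h6⟩ := h2 v ξ.1 ξ.2
    exact (hμ.integrable_iff le_rfl hU ⟨hZW, hW.isOpen, hW.finOver.mono_left hB⟩
      (h4 v le_rfl ξ.1)).1.2 ((hW'.summable_iff hW h5 (h4 v le_rfl ξ.1)).1 h6)

end

namespace Compression

open Representation

variable {ω : SmoothChar G}

include c in
lemma isL2_res (hHo : IsOpen (H : Set G)) (hBH : B ≤ H) (h : IsL2 B V.ρ ω) :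
    IsL2 (B.subgroupOf H) T.ρ (ω.res H) := fun w ξ hξ => by
  obtain ⟨W, h1, h2, h3⟩ := h (c.j w) (ξ ∘ₗ c.p) (c.comp_p_mem hHo hξ)
  have h4 : (fun h : H => ‖(ω.res H).val h * ξ (T.ρ h w)‖ ^ 2) =
      fun h : H => ‖ω.val h * (ξ ∘ₗ c.p) (V.ρ h (c.j w))‖ ^ 2 := funext fun h => by
    rw [c.rho_j, lcomp_apply, c.p_j]; rfl
  refine ⟨W.subgroupOf H, h1.subgroupOf hBH hHo, ?_, ?_⟩
  · rw [h4]; exact h2.subgroupOf H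
  · exact (RightInv.summable_subgroupOf (f := fun g => ‖ω.val g * (ξ ∘ₗ c.p) (V.ρ g (c.j w))‖ ^ 2)
      h2 H h3).congr fun q => (congrFun h4 q.out).symm

include c in
lemma isUnitaryOn_iff [Nontrivial T] (hs : IsScalarOn V.ρ B) (hBH : B ≤ H) :
    IsUnitaryOn V.ρ ω B ↔ IsUnitaryOn T.ρ (ω.res H) (B.subgroupOf H) := by
  obtain ⟨w, hw⟩ := _root_.exists_ne (0 : T)
  constructor
  · intro h b hb; obtain ⟨a, ha, h1⟩ := h b hb
    refine ⟨a, ha, fun w => ?_⟩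
    have h2 := congrArg c.p (h1 (c.j w))
    rwa [c.rho_j, map_smul, map_smul, c.p_j, c.p_j] at h2
  · intro h b hb; obtain ⟨a, ha⟩ := hs b hb
    obtain ⟨a', ha', h1⟩ := h ⟨b, hBH hb⟩ hb
    refine ⟨ω.val b * a, ?_, fun v => by rw [ha, mul_smul]⟩
    have h2 : (ω.val b * a) • w = a' • w := by
      rw [← h1 w, mul_smul]; refine congrArg (ω.val b • ·) ?_
      have h3 := congrArg c.p (ha (c.j w))
      rw [c.rho_j ⟨b, hBH hb⟩, map_smul, c.p_j, c.p_j] at h3; exact h3.symm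
    rw [smul_left_injective ℂ hw h2, ha']

end Compression

lemma IsLevel.map {B H : Subgroup K} {W : Subgroup H} (h : IsLevel (B.subgroupOf H) W) (hB : B ≤ H)
    (hH : IsOpen (H : Set K)) : IsLevel B (W.map H°) where
  le b hb := ⟨⟨b, hB hb⟩, h.le hb, rfl⟩
  isOpen := hH.isOpenMap_subtype_val _ h.isOpen
  finOver O hO hBO := by
    rw [← Subgroup.relIndex_comap]; exact h.finOver _ (hO.preimage csv) fun b hb => hBO hb

namespace Compression

open Representation

variable {ω : SmoothChar G}

include c in
lemma isL2_of [H.Normal] [H.FiniteIndex] [Nontrivial T] (hHo : IsOpen (H : Set G))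
    (hV : isSmooth G V) (hBH : B ≤ H) (hB : B ≤ center G)
    (hU : HasCompactOpen G) (hL : B.relIndex L ≠ 0)
    (hun : IsUnitaryOn V.ρ ω B) (h : IsL2 (B.subgroupOf H) T.ρ (ω.res H)) : IsL2 B V.ρ ω := by
  let F : V → Dual ℂ V → G → ℝ := fun v ξ g => ‖ω.val g * ξ (V.ρ g v)‖ ^ 2
  have hE : ∀ O : Subgroup G, IsOpen (O : Set G) → ∃ W, IsLevel B W ∧ ∀ v, O ≤ V.ρ.stab v → ∀ ξ,
      RightInv W (F v ξ) := fun O hO => by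
    obtain ⟨W, h1, -, h2⟩ := hun.exists_isLevel le_rfl hB (FinOver.refl _) hU hO
    exact ⟨W, h1, h2⟩
  let P : V → Dual ℂ V → Prop := fun v ξ => ∃ W, IsLevel B W ∧ RightInv W (F v ξ) ∧
    Summable fun q : G ⧸ W => F v ξ q.out
  have hP : ∀ {v ξ W}, P v ξ → IsLevel B W → RightInv W (F v ξ) →
      Summable fun q : G ⧸ W => F v ξ q.out := fun ⟨W', h1, h2, h3⟩ hW hW' =>
    (h1.summable_iff hW h2 hW').1 h3
  have hsq : ∀ a b : ℂ, ‖a + b‖ ^ 2 ≤ 2 * (‖a‖ ^ 2 + ‖b‖ ^ 2) := fun a b => by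
    nlinarith [norm_add_le a b, norm_nonneg (a + b), sq_nonneg (‖a‖ - ‖b‖)]
  have hsum : ∀ {v v₁ v₂ ξ ξ₁ ξ₂}, (∀ x, ξ (V.ρ x v) = ξ₁ (V.ρ x v₁) + ξ₂ (V.ρ x v₂)) →
      P v₁ ξ₁ → P v₂ ξ₂ → P v ξ := fun {v v₁ v₂ ξ ξ₁ ξ₂} h0 h1 h2 => by
    obtain ⟨W, hW, hi⟩ := hE (V.ρ.stab v ⊓ (V.ρ.stab v₁ ⊓ V.ρ.stab v₂))
      ((hV v).inter ((hV v₁).inter (hV v₂)))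
    have h3 := hP h1 hW (hi v₁ (inf_le_right.trans inf_le_left) ξ₁)
    have h4 := hP h2 hW (hi v₂ (inf_le_right.trans inf_le_right) ξ₂)
    refine ⟨W, hW, hi v inf_le_left ξ, Summable.of_nonneg_of_le (fun q => sq_nonneg _) (fun q => ?_)
      ((h3.add h4).mul_left 2)⟩
    show ‖_ * ξ _‖ ^ 2 ≤ _
    rw [h0, mul_add]; exact hsq _ _
  have hzero : ∀ v ξ, (∀ x, F v ξ x = 0) → P v ξ := fun v ξ h0 => by
    obtain ⟨W, h1, h2⟩ := hE (V.ρ.stab v) (hV v)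
    exact ⟨W, h1, h2 v le_rfl ξ, summable_zero.congr fun q => (h0 _).symm⟩
  have hθ : ∀ l : L, ‖ω.val l * θ l‖ = 1 := fun l => by
    obtain ⟨w, hw⟩ := _root_.exists_ne (0 : T)
    obtain ⟨n, hn, -, hl⟩ := Subgroup.exists_pow_mem_of_relIndex_ne_zero hL l.2
    obtain ⟨a, ha, h1⟩ := hun _ hl.1; have h2 := congrArg c.p (h1 (c.j w))
    have h3 : V.ρ ((l : G) ^ n) (c.j w) = ((θ l ^ n : ℂˣ) : ℂ) • c.j w := by
      rw [← map_pow]; exact c.rho_j_L (l ^ n) w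
    rw [h3, map_smul, map_smul, map_smul, c.p_j, smul_smul] at h2
    have h4 := smul_left_injective ℂ hw h2
    refine (pow_eq_one_iff_of_nonneg (norm_nonneg _) hn.ne').1 ?_
    rw [← norm_pow, ← ha, ← h4, mul_pow, SmoothChar.val, SmoothChar.val, map_pow,
      Units.val_pow_eq_pow_val, Units.val_pow_eq_pow_val]
  have hbase : ∀ w, ∀ η ∈ smoothVectors T.ρ.dual, P (c.j w) (η ∘ₗ c.p) := fun w η hη => by
    obtain ⟨W, h1, h2, h3⟩ := h w η hη
    let f' : H → ℝ := fun h => ‖(ω.res H).val h * η (T.ρ h w)‖ ^ 2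
    have h0 : ∀ g ∉ L ⊔ H, F (c.j w) (η ∘ₗ c.p) g = 0 := fun g hg => by
      show ‖_ * η (c.p _)‖ ^ 2 = 0
      rw [c.zero_off g hg, map_zero, mul_zero, norm_zero, zero_pow two_ne_zero]
    have hff : ∀ (l : L) (h : H), F (c.j w) (η ∘ₗ c.p) (l * h) = f' h := fun l h => by
      show ‖ω.val (l * h) * η (c.p (V.ρ (l * h) (c.j w)))‖ ^ 2 = ‖ω.val h * η (T.ρ h w)‖ ^ 2
      rw [c.rho_mul_j, map_smul, c.p_j, map_smul, smul_eq_mul, val_mul, mul_mul_mul_comm, norm_mul,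
        hθ, one_mul]
    have hWH : W.map H° ≤ H := Subgroup.map_subtype_le W
    have hinv : RightInv (W.map H°) (F (c.j w) (η ∘ₗ c.p)) := by
      rintro x _ ⟨k, hk, rfl⟩
      by_cases hx : x ∈ L ⊔ H
      · obtain ⟨l, h, rfl⟩ := exists_mul hx
        rw [mul_assoc, H.subtype_apply, ← coe_mul, hff, hff]; exact h2 h k hk
      · rw [h0 x hx, h0 (x * H° k) fun h' => hx ((Subgroup.mul_mem_cancel_right _
          ((le_sup_right : H ≤ L ⊔ H) k.2)).1 h')]
    have h4 := (Compression.tsum_eq_mul (L := L) hWH (f' := fun h => (f' h : ℂ))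
      (hinv.comp ((↑) : ℝ → ℂ)) (fun g hg => by rw [h0 g hg, Complex.ofReal_zero])
      fun l h => by rw [hff]).1
    have h5 : (W.map H°).subgroupOf H = W :=
      Subgroup.comap_map_eq_self_of_injective H.subtype_injective W
    rw [h5, Complex.summable_ofReal, Complex.summable_ofReal] at h4
    exact ⟨_, h1.map hBH hHo, hinv, h4.2 h3⟩
  have hleft : ∀ {v ξ} g, P v ξ → P v (V.ρ.dual g ξ) := fun {v ξ} g ⟨W, h1, h2, h3⟩ => by
    have h4 : F v (V.ρ.dual g ξ) = fun x => ‖ω.val g‖ ^ 2 * F v ξ (g⁻¹ * x) := funext fun x => by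
      show ‖ω.val x * ξ (V.ρ g⁻¹ (V.ρ x v))‖ ^ 2 = ‖ω.val g‖ ^ 2 * ‖ω.val (g⁻¹ * x) * _‖ ^ 2
      rw [← mul_pow, ← norm_mul, ← mul_assoc, ← val_mul, mul_inv_cancel_left, rep_mul]
    refine ⟨W, h1, ?_, ?_⟩
    · rw [h4]; exact (h2.mul_left g⁻¹).comp (‖ω.val g‖ ^ 2 * ·)
    · rw [h4]; exact ((h2.summable_mul_left g⁻¹).2 h3).mul_left _
  have hright : ∀ {v ξ} g, P v ξ → P (V.ρ g v) ξ := fun {v ξ} g ⟨W, h1, h2, h3⟩ => by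
    have h4 : F (V.ρ g v) ξ = fun x => ‖ω.val g⁻¹‖ ^ 2 * F v ξ (x * g) := funext fun x => by
      show ‖ω.val x * ξ (V.ρ x (V.ρ g v))‖ ^ 2 = ‖ω.val g⁻¹‖ ^ 2 * ‖ω.val (x * g) * _‖ ^ 2
      rw [← mul_pow, ← norm_mul, ← mul_assoc, mul_comm (ω.val g⁻¹), ← val_mul, mul_inv_cancel_right,
        rep_mul]
    refine ⟨_, h1.conj hB g, ?_, ?_⟩
    · rw [h4]; exact (h2.mul_right g).comp (‖ω.val g⁻¹‖ ^ 2 * ·)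
    · rw [h4]; exact (h2.summable_mul_right g h3).mul_left _
  have key : ∀ w, ∀ ξ ∈ smoothVectors V.ρ.dual, P (c.j w) ξ := fun w ξ hξ =>
    c.induction_dual hHo (P := fun ξ => P (c.j w) ξ) (hzero _ _ fun x => by
      show ‖_ * (0 : ℂ)‖ ^ 2 = 0
      simp) (fun ξ _ η _ h1 h2 => hsum (fun x => rfl) h1 h2) (fun g η hη => hleft g (hbase w η hη)) ξ hξ
  intro v ξ hξ
  show P v ξ
  induction v using c.induction_vec with
  | h0 =>
    refine hzero _ _ fun x => ?_
    show ‖_ * ξ (V.ρ x 0)‖ ^ 2 = 0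
    simp
  | hadd v v' h1 h2 =>
    exact hsum (fun x => by rw [map_add, map_add]) h1 h2
  | h g w => exact hright g (key w ξ hξ)

end Compression

section

lemma SmoothChar.exists_norm_eq [H.FiniteIndex] (hHo : IsOpen (H : Set G)) (ω : SmoothChar H) :
    ∃ ω' : SmoothChar G, (∀ b (hb : b ∈ H), b ∈ center G → ‖ω'.val b‖ = ‖ω.val ⟨b, hb⟩‖) ∧ ∃ ℓ : H →
    ℝ, (∀ a b, ℓ (a * b) = ℓ a + ℓ b) ∧ (∀ h : H, ‖ω'.val h‖ = Real.exp (ℓ h) * ‖ω.val h‖) ∧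
    ∃ O : Subgroup H, IsOpen (O : Set H) ∧ ∀ o ∈ O, ℓ o = 0 := by
  let lg : ℂˣ →* Multiplicative ℝ :=
    { toFun := fun z => .ofAdd (Real.log ‖(z : ℂ)‖)
      map_one' := by simp
      map_mul' := fun a b => by
        rw [Units.val_mul, norm_mul, Real.log_mul (by simp) (by simp), ofAdd_add] }
  let n : ℝ := H.index
  have hn : n ≠ 0 := Nat.cast_ne_zero.2 index_ne_zero
  let t : G →* Multiplicative ℝ := MonoidHom.transfer (lg.comp ω.1)
  let ex : Multiplicative ℝ →* ℂˣ :=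
    { toFun := fun x => Units.mk0 (Complex.exp ((x.toAdd / n : ℝ) : ℂ)) (Complex.exp_ne_zero _)
      map_one' := uext (by simp)
      map_mul' := fun a b => uext (by
        rw [toAdd_mul, add_div, Complex.ofReal_add]; exact Complex.exp_add _ _) }
  have hex : ∀ x, ‖(ex x : ℂ)‖ = Real.exp (x.toAdd / n) := fun x => Complex.norm_exp_ofReal _
  -- the transfer is locally trivial
  let O₁ : Subgroup G := ω.1.ker.map H°
  have hO₁ : IsOpen (O₁ : Set G) := hHo.isOpenMap_subtype_val _ (isOpen_fiber ω.2 1)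
  let O : Subgroup G := ⨅ q : G ⧸ H, O₁.comap (MulAut.conj q.out⁻¹).toMonoidHom
  have hO : IsOpen (O : Set G) := by
    have h1 : (O : Set G) = ⋂ q : G ⧸ H, (fun x => q.out⁻¹ * x * q.out) ⁻¹' O₁ := by
      ext x; simp [O]
    rw [h1]; exact isOpen_iInter_of_finite fun q => hO₁.preimage (by fun_prop)
  have htO : ∀ x ∈ O, t x = 1 := fun x hx => by
    have := ofFinite (Quotient (MulAction.orbitRel (zpowers x) (G ⧸ H)))
    refine (MonoidHom.transfer_eq_prod_quotient_orbitRel_zpowers_quot (lg.comp ω.1) x).trans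
      (Finset.prod_eq_one fun q _ => ?_)
    obtain ⟨k, hk, hkx⟩ := Subgroup.mem_iInf.1
      (pow_mem hx (Function.minimalPeriod (x • ·) q.out)) q.out
    rw [mcomp_apply]; refine (congrArg (fun k : H => lg (ω.1 k)) (sext ?_)).trans
      ((congrArg lg (hk : ω.1 k = 1)).trans (map_one lg))
    rw [← H.subtype_apply k, hkx]; simp
  have hsm : ex.comp t ∈ smoothChars G := (IsLocallyConstant.iff_exists_open _).2 fun x =>
    ⟨(fun y => x⁻¹ * y) ⁻¹' O, hO.preimage (by fun_prop), by simp [O.one_mem], fun y hy => by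
      have h1 := htO _ hy
      rw [map_mul, map_inv, inv_mul_eq_one] at h1; exact congrArg ex h1.symm⟩
  have hpos : ∀ h, 0 < ‖ω.val h‖ := fun h => norm_pos_iff.2 (ω.1 h).ne_zero
  refine ⟨⟨ex.comp t, hsm⟩, fun b hb hbc => ?_, fun h => (t h).toAdd / n - Real.log ‖ω.val h‖,
    fun a b => ?_, fun h => ?_, O.subgroupOf H ⊓ ω.1.ker,
    (hO.preimage csv).inter (isOpen_fiber ω.2 1), fun o ho => ?_⟩
  · have h1 : t b = lg (ω.1 ⟨b, hb⟩) ^ H.index := by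
      refine (MonoidHom.transfer_eq_pow (lg.comp ω.1) b fun k g _ => ?_).trans ?_
      · rw [mul_assoc, ← mem_center_iff.1 (pow_mem hbc k) g, inv_mul_cancel_left]
      · rw [← map_pow, ← map_pow]; rfl
    refine (hex (t b)).trans ?_
    rw [h1, toAdd_pow, nsmul_eq_mul, mul_div_cancel_left₀ _ hn]; exact Real.exp_log (hpos _)
  · have h1 : Real.log ‖ω.val (a * b)‖ = Real.log ‖ω.val a‖ + Real.log ‖ω.val b‖ := by
      rw [Representation.val_mul, norm_mul, Real.log_mul (hpos a).ne' (hpos b).ne']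
    show (t (a * b)).toAdd / n - Real.log ‖ω.val (a * b)‖ = _
    rw [h1, map_mul, toAdd_mul]; ring
  · rw [Real.exp_sub, Real.exp_log (hpos h), div_mul_cancel₀ _ (hpos h).ne']; exact hex (t h)
  · have h1 : ω.val o = 1 := congrArg uval (ho.2 : ω.1 o = 1)
    show (t o).toAdd / n - Real.log ‖ω.val o‖ = 0
    rw [h1, show t o = 1 from htO _ ho.1]; simp

end

namespace Compression

open Representation

include c in
lemma exists_isL2_iff [H.Normal] [H.FiniteIndex] (hHo : IsOpen (H : Set G)) (hV : isSmooth G V)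
    (hT : isSmooth H T) (hTi : T.ρ.IsIrreducible) (hs : IsScalarOn V.ρ B) (hBH : B ≤ H)
    (hB : B ≤ center G) (hU : HasCompactOpen G) (hL : B.relIndex L ≠ 0) :
    (∃ ω, IsUnitaryOn V.ρ ω B ∧ IsL2 B V.ρ ω) ↔ ∃ ω, IsUnitaryOn T.ρ ω (B.subgroupOf H) ∧
    IsL2 (B.subgroupOf H) T.ρ ω := by
  have := ((irr_iff_submodule T.ρ).1 hTi).1
  constructor
  · rintro ⟨ω, h1, h2⟩
    exact ⟨ω.res H, (c.isUnitaryOn_iff hs hBH).1 h1, c.isL2_res hHo hBH h2⟩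
  rintro ⟨ω, h1, h2⟩
  obtain ⟨ω', hω, ℓ, hℓ, hℓω, O, hO, hℓO⟩ := ω.exists_norm_eq hHo
  have hBH' : B.subgroupOf H ≤ center H := fun b hb =>
    mem_center_iff.2 fun h => sext (mem_center_iff.1 (hB hb) h)
  have hUH := HasCompactOpen.subgroup hU hHo
  have hℓB : ∀ b ∈ B.subgroupOf H, ℓ b = 0 := fun b hb => by
    have h3 := hℓω b; rw [hω b b.2 (hB hb)] at h3
    exact Real.exp_eq_one_iff _ |>.1 (mul_right_cancel₀ (norm_ne_zero_iff.2 (ω.1 b).ne_zero)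
      (h3.symm.trans (one_mul _).symm))
  have hun : IsUnitaryOn T.ρ (ω'.res H) (B.subgroupOf H) := fun b hb => by
    obtain ⟨a, ha, h3⟩ := h1 b hb; have h0 := (ω.1 b).ne_zero
    refine ⟨ω'.val b * (ω.val b)⁻¹ * a, ?_, fun w => ?_⟩
    · rw [norm_mul, norm_mul, ha, norm_inv, hω b b.2 (hB hb), mul_one]
      exact mul_inv_cancel₀ (norm_ne_zero_iff.2 h0)
    · rw [mul_smul, ← h3, smul_smul, mul_assoc]; show _ = (ω'.val b * ((ω.1 b : ℂ)⁻¹ * ω.1 b)) • _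
      rw [inv_mul_cancel₀ h0, mul_one]; rfl
  have h3 := (c.isUnitaryOn_iff hs hBH).2 hun
  refine ⟨ω', h3, c.isL2_of hHo hV hBH hB hU hL h3 fun w ξ hξ => ?_⟩
  obtain ⟨W, hW, hi, hsum⟩ := h2 w ξ hξ
  obtain ⟨W', hW', -, hi'⟩ := hun.exists_isLevel le_rfl hBH' (FinOver.refl _) hUH (O := W ⊓ T.ρ.stab w)
      (hW.isOpen.inter (hT w))
  have hW₁ := hW.inf hW'.isOpen hW'.le
  obtain ⟨C, hC⟩ := hTi.exists_support_bound hBH' hUH hT h1 h2 hℓ hℓB hO hℓO w hξ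
  refine ⟨W ⊓ W', hW₁, (hi' w inf_le_right ξ).mono inf_le_right, ?_⟩
  have hsum' := (hW.summable_iff hW₁ hi (hi.mono inf_le_left)).1 hsum
  refine Summable.of_nonneg_of_le (fun _ => by positivity) (fun q => ?_)
    (hsum'.mul_left (Real.exp C ^ 2))
  rw [← mul_pow]
  refine pow_le_pow_left₀ (norm_nonneg _) ?_ 2
  rw [norm_mul, norm_mul, show ‖(ω'.res H).val q.out‖ = _ from hℓω q.out, mul_assoc]
  by_cases hq : C < |ℓ q.out|
  · rw [hC _ hq, norm_zero, mul_zero, mul_zero, mul_zero]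
  · exact mul_le_mul_of_nonneg_right (Real.exp_le_exp.2 ((le_abs_self _).trans (not_lt.1 hq)))
      (by positivity)

end Compression

namespace IsHaarOnQuotient

variable {B Z N H : Subgroup K} {μ : Measure (K ⧸ B)}

open scoped Pointwise in
lemma map_comap_cosetMap [N.Normal] (h : IsHaarOnQuotient B μ) (hH : IsOpen (H : Set K))
    (hcomm : ∀ n ∈ N, ∀ h ∈ H, h * n = n * h) (hBZ : B ≤ Z) (hZN : Z ≤ N) (hBN : B ≤ N ⊓ H)
    (hle : B.subgroupOf H ≤ (N ⊓ H).subgroupOf H)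
    (hZ : ∀ x ∈ Z.subgroupOf (N ⊔ H), x ∈ N.subgroupOf (N ⊔ H))
    (hN : ∀ x ∈ (N ⊓ H).subgroupOf H, inclusion (le_sup_right : H ≤ N ⊔ H) x ∈
      N.subgroupOf (N ⊔ H)) (h0 : (N ⊓ H).relIndex N ≠ 0) :
    ((μ.map (quotientMapOfLE hBZ)).comap (cosetMap (N ⊔ H)° (Z.subgroupOf (N ⊔ H)) Z le_rfl)).map
        (cosetMap (hid ↥(N ⊔ H)) (Z.subgroupOf (N ⊔ H)) (N.subgroupOf (N ⊔ H)) hZ) =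
      ((N ⊓ H).relIndex N : ENNReal) • ((μ.comap (cosetRes H B)).map (quotientMapOfLE hle)).map
          (cosetMap (inclusion le_sup_right) ((N ⊓ H).subgroupOf H) (N.subgroupOf (N ⊔ H)) hN) := by
  have hNH : IsOpen ((N ⊔ H : Subgroup K) : Set K) := isOpen_mono le_sup_right hH
  have hp := continuous_quotMap hBZ
  have hq := continuous_quotMap hle
  have hf : Continuous (cosetMap (inclusion (le_sup_right : H ≤ N ⊔ H))
      ((N ⊓ H).subgroupOf H) (N.subgroupOf (N ⊔ H)) hN) := continuous_quot_lift _
    (QuotientGroup.continuous_mk.comp (continuous_subtype_val.subtype_mk _))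
  have hf' : Continuous (cosetMap (hid ↥(N ⊔ H)) (Z.subgroupOf (N ⊔ H))
      (N.subgroupOf (N ⊔ H)) hZ) := continuous_quot_lift _ continuous_mk
  have hj := (isOpenEmb_cosetMap (B := B) hH).measurableEmbedding
  have hg := (isOpenEmb_cosetMap (B := Z) hNH).measurableEmbedding
  have := h.invariant
  ext S hS
  rw [map_apply hf'.measurable hS, hg.comap_apply, map_apply hp.measurable
    (hg.measurableSet_image.2 (hf'.measurable hS)), Measure.smul_apply,
    map_apply hf.measurable hS, map_apply hq.measurable (hf.measurable hS),
    hj.comap_apply, smul_eq_mul]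
  set A' := quotientMapOfLE hBZ ⁻¹' (cosetMap (N ⊔ H)°
    (Z.subgroupOf (N ⊔ H)) Z le_rfl '' (cosetMap (hid ↥(N ⊔ H)) (Z.subgroupOf (N ⊔ H))
      (N.subgroupOf (N ⊔ H)) hZ ⁻¹' S))
  set A := cosetRes H B '' (quotientMapOfLE hle ⁻¹' (cosetMap (inclusion le_sup_right)
      ((N ⊓ H).subgroupOf H) (N.subgroupOf (N ⊔ H)) hN ⁻¹' S))
  have hA : MeasurableSet A := hj.measurableSet_image.2 (hq.measurable (hf.measurable hS))
  let D : Subgroup N := (N ⊓ H).subgroupOf N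
  have hD : ∀ n : N, n ∈ D ↔ (n : K) ∈ H := fun n => ⟨fun h => h.2, fun h => ⟨n.2, h⟩⟩
  have : D.FiniteIndex := ⟨h0⟩
  have hmem : ∀ x : ↥(N ⊔ H), ∀ n : N, ∀ h : H, (x : K) = n * h →
      ((x : ↥(N ⊔ H) ⧸ N.subgroupOf (N ⊔ H)) : ↥(N ⊔ H) ⧸ N.subgroupOf (N ⊔ H)) =
        (inclusion le_sup_right h : ↥(N ⊔ H)) := fun x n h hx => by
    refine (QuotientGroup.eq.2 (mem_subgroupOf.2 ?_)).symm
    show ((h : K)⁻¹ * x) ∈ N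
    rw [hx, ← hcomm n n.2 h h.2, inv_mul_cancel_left]; exact n.2
  have hAS : ∀ a : K ⧸ B, a ∈ A ↔ ∃ h : H, ((inclusion le_sup_right h : ↥(N ⊔ H)) :
      ↥(N ⊔ H) ⧸ N.subgroupOf (N ⊔ H)) ∈ S ∧ ((h : K) : K ⧸ B) = a := fun a => by
    constructor
    · rintro ⟨h, hh, rfl⟩
      obtain ⟨h, rfl⟩ := mk_surjective h; exact ⟨h, hh, rfl⟩
    · rintro ⟨h, hh, rfl⟩
      exact ⟨(h : H ⧸ B.subgroupOf H), hh, rfl⟩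
  have hA' : A' = ⋃ q : N ⧸ D, (q.out : K) • A := by
    ext y; rw [Set.mem_iUnion]
    constructor
    · obtain ⟨y, rfl⟩ := mk_surjective y; rintro ⟨x, hx, hxy⟩
      obtain ⟨x, rfl⟩ := mk_surjective x; have hxy' : ((x : K) : K ⧸ Z) = (y : K ⧸ Z) := hxy
      have hxN := hZN (QuotientGroup.eq.1 hxy')
      have hy : y ∈ N ⊔ H := ((N ⊔ H).mul_mem_cancel_left ((N ⊔ H).inv_mem x.2)).1
        ((le_sup_left : N ≤ N ⊔ H) hxN)
      have hxy'' : (x : ↥(N ⊔ H) ⧸ N.subgroupOf (N ⊔ H)) = ((⟨y, hy⟩ : ↥(N ⊔ H)) : _) :=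
        QuotientGroup.eq.2 (mem_subgroupOf.2 hxN)
      obtain ⟨n, hn, h, hh, rfl⟩ := mem_sup_of_normal_left.1 hy
      obtain ⟨m, hm⟩ := mk_out_eq_mul D ⟨n, hn⟩
      have hm' : ((((⟨n, hn⟩ : N) : N ⧸ D).out : N) : K) = n * m := congrArg sval hm
      have h1 : n * h = (((⟨n, hn⟩ : N) : N ⧸ D).out : N) * ((m : K)⁻¹ * h) := by
        rw [hm', mul_assoc, mul_inv_cancel_left]
      have h2 : (m : K)⁻¹ * h ∈ H := H.mul_mem (H.inv_mem ((hD m).1 m.2)) hh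
      refine ⟨_, Set.mem_smul_set.2 ⟨(((m : K)⁻¹ * h : K) : K ⧸ B), (hAS _).2 ⟨⟨_, h2⟩, ?_, rfl⟩,
        congrArg (fun x : K => (x : K ⧸ B)) h1.symm⟩⟩
      rw [← hmem ⟨n * h, hy⟩ _ ⟨_, h2⟩ h1, ← hxy'']; exact hx
    · rintro ⟨q, hq⟩
      obtain ⟨a, ha, rfl⟩ := Set.mem_smul_set.1 hq; obtain ⟨h, hh, rfl⟩ := (hAS a).1 ha
      have hx : (q.out : K) * h ∈ N ⊔ H := Subgroup.mul_mem_sup q.out.2 h.2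
      refine ⟨((⟨_, hx⟩ : ↥(N ⊔ H)) : _), ?_, rfl⟩
      rw [← hmem ⟨_, hx⟩ _ h rfl] at hh; exact hh
  have hdis : Pairwise (Function.onFun Disjoint fun q : N ⧸ D => (q.out : K) • A) :=
    fun q q' hqq => Set.disjoint_left.2 fun a h1 h2 => hqq (by
      obtain ⟨a, ha, rfl⟩ := Set.mem_smul_set.1 h1; obtain ⟨h, -, rfl⟩ := (hAS a).1 ha
      obtain ⟨a', ha', he⟩ := Set.mem_smul_set.1 h2; obtain ⟨h', -, rfl⟩ := (hAS a').1 ha'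
      have he' : (((q'.out : K) * h' : K) : K ⧸ B) = ((q.out : K) * h : K) := he
      have h3 : ((q'.out : K) * h')⁻¹ * (q.out * h) ∈ H := (hBN (QuotientGroup.eq.1 he')).2
      rw [mul_inv_rev, mul_assoc, H.mul_mem_cancel_left (H.inv_mem h'.2), ← mul_assoc,
        H.mul_mem_cancel_right h.2] at h3
      rw [← q.out_eq', ← q'.out_eq']
      exact (QuotientGroup.eq.2 ((hD (q'.out⁻¹ * q.out)).2 h3)).symm)
  rw [hA', measure_iUnion hdis fun q => hA.const_smul _]
  simp_rw [measure_smul]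
  rw [ENNReal.tsum_const, ENat.card_eq_coe_natCard]
  rfl

end IsHaarOnQuotient

namespace Compression

open Representation

variable [LocallyCompactSpace G] [SigmaCompactSpace G]

include c in
lemma exists_isFormalDegree_iff [H.Normal] [H.FiniteIndex] [Nontrivial T] (hHo : IsOpen (H : Set G))
    (hV : isSmooth G V) (hT : isSmooth H T) (hBH : B ≤ H) (hB : B ≤ center G)
    (hs : IsScalarOn V.ρ B) (hU : HasCompactOpen G) {ω : SmoothChar G} (hL2 : IsL2 B V.ρ ω) :
    (∃ μ, IsFormalDegree V B μ) ↔ ∃ ν, IsFormalDegree T (B.subgroupOf H) ν := by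
  have h0 : (H.relIndex (L ⊔ H) : ENNReal) ≠ 0 :=
    Nat.cast_ne_zero.2 (inferInstance : (H.subgroupOf (L ⊔ H)).FiniteIndex).index_ne_zero
  have ht : (H.relIndex (L ⊔ H) : ENNReal) ≠ ⊤ := ENNReal.natCast_ne_top _
  refine ⟨fun ⟨μ, h⟩ => ⟨_, c.isFormalDegree hHo hV hBH hB hs hU rfl h0 h⟩, fun ⟨ν, h⟩ => ?_⟩
  have := normal_of_le_center hB
  obtain ⟨μ, hμ⟩ := IsHaarOnQuotient.exists_haar B
  have : LocallyCompactSpace H := hHo.locallyCompactSpace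
  obtain ⟨a, ha, ha', rfl⟩ := ((hμ.comap_cosetMap hB hHo).smul h0 ht).exists_eq_smul h.1
  refine ⟨a • μ, c.isFormalDegree_of hHo hV hT hBH hB hs hU rfl (hμ.smul ha ha') hL2 ?_⟩
  have e := Measure.comap_smul (mα := cosetBorel H _) (f := cosetRes H B) (μ := μ) a
  rw [smul_comm] at h
  exact (congrArg (fun m => IsFormalDegree T (B.subgroupOf H) ((H.relIndex (L ⊔ H) : ENNReal) • m))
    e).mpr h

end Compression

end

theorem proposition3 {A Gbar : Type*} {G : Type u}
    [CommGroup A] [Finite A] [IsCyclic A] [TopologicalSpace A] [DiscreteTopology A]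
    [Group Gbar] [TopologicalSpace Gbar] [IsTopologicalGroup Gbar] [T2Space Gbar]
    [LocallyCompactSpace Gbar] [TotallyDisconnectedSpace Gbar] [SigmaCompactSpace Gbar]
    [Group G] [TopologicalSpace G] [IsTopologicalGroup G]
    (ι : A →* G) (pr : G →* Gbar) (hcov : IsCentralCovering ι pr)
    (H N : Subgroup G) (hs : IsSpecialPair pr H N)
    (d : ℕ) (hd : (Subgroup.center N).index = d ^ 2)
    (ψ : SmoothChar ↥(N ⊓ H)) (χ : SmoothChar ↥(N ⊓ Subgroup.center G))
    (hψ : ψ.Genuine ι) (hχ : χ.Genuine ι) (hψχ : ψ.Consistent χ)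
    (φ : SmoothChar ↥(N ⊓ H ⊓ Subgroup.center G)) (hφ : φ = ψ.restrict inf_le_left) :
    -- (1) Lagrangian induction exists for all choices, is an equivalence, and does not depend on
    -- the choices up to natural equivalence
    ((∃ L, IsLagrangian N L) ∧
      (∀ L, IsLagrangian N L → ∃ D : LagrangianDatum H N ψ χ, D.L = L) ∧
      (∀ D : LagrangianDatum H N ψ χ, ∃ F, D.IsLInd F) ∧
      (∀ F, IsLInd H N ψ χ F → F.IsEquivalence) ∧
      (∀ F F', IsLInd H N ψ χ F → IsLInd H N ψ χ F' → Nonempty (F ≅ F'))) ∧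
    -- (2) decomposition of the induced representation
    ((∀ F : ∀ χ' : ConsistentChars (N ⊓ Subgroup.center G) ψ,
          RepLoc H.subtype ψ ⥤ RepLoc (MonoidHom.id G) χ'.1,
        (∀ χ' : ConsistentChars (N ⊓ Subgroup.center G) ψ, IsLInd H N ψ χ'.1 (F χ')) →
        IsNatDirectSum (RepLoc.incl H.subtype ψ ⋙ smoothInd H.subtype)
          (fun i : Fin d × ConsistentChars (N ⊓ Subgroup.center G) ψ =>
            F i.2 ⋙ RepLoc.incl (MonoidHom.id G) i.2.1)) ∧
      Finite (ConsistentChars (N ⊓ Subgroup.center G) ψ) ∧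
      Nat.card (ConsistentChars (N ⊓ Subgroup.center G) ψ) =
        (N ⊓ H ⊓ Subgroup.center G).relIndex (N ⊓ Subgroup.center G) ∧
      (N ⊓ H ⊓ Subgroup.center G).relIndex (N ⊓ Subgroup.center G) =
        (N ⊓ H).relIndex (N ⊓ Subgroup.centralizer (N : Set G))) ∧
    -- (3) decomposition of the restriction
    ((∀ E : ∀ ψ' : ConsistentChars (N ⊓ H) χ,
          RepLoc H.subtype ψ'.1 ≌ RepLoc (MonoidHom.id G) χ,
        (∀ ψ' : ConsistentChars (N ⊓ H) χ, IsLInd H N ψ'.1 χ (E ψ').functor) →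
        IsNatDirectSum
          (RepLoc.incl (MonoidHom.id G) χ ⋙ smoothRes H.subtype continuous_subtype_val)
          (fun i : Fin d × ConsistentChars (N ⊓ H) χ =>
            (E i.2).inverse ⋙ RepLoc.incl H.subtype i.2.1)) ∧
      Finite (ConsistentChars (N ⊓ H) χ) ∧
      Nat.card (ConsistentChars (N ⊓ H) χ) =
        (N ⊓ H ⊓ Subgroup.center G).relIndex (N ⊓ H) ∧
      (N ⊓ H ⊓ Subgroup.center G).relIndex (N ⊓ H) =
        (N ⊓ Subgroup.center G).relIndex (N ⊓ Subgroup.centralizer (N : Set G))) ∧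
    -- (4) contragredients
    (∀ (F : RepLoc H.subtype ψ ⥤ RepLoc (MonoidHom.id G) χ)
        (F' : RepLoc H.subtype ψ⁻¹ ⥤ RepLoc (MonoidHom.id G) χ⁻¹),
      IsLInd H N ψ χ F → IsLInd H N ψ⁻¹ χ⁻¹ F' →
      Nonempty (((RepLoc.hasLocalDual H.subtype ψ).ι ⋙ F ⋙
          RepLoc.incl (MonoidHom.id G) χ).op ⋙ contragredient G ≅
        RepLoc.contragredient H.subtype ψ ⋙ F' ⋙ RepLoc.incl (MonoidHom.id G) χ⁻¹)) ∧
    -- (5) conjugation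
    ((∀ (g : G) (F F'), IsLInd H N ψ χ F → IsLInd H N (ψ.conj hs.normal_inf g) χ F' →
        Nonempty (RepLoc.conj hs.normal_left hs.normal_inf ψ g ⋙ F' ≅ F)) ∧
      (∀ g ∈ N ⊔ H, ∀ c ∈ IrrLoc H.subtype φ,
        SmoothCls.map (smoothConj hs.normal_left g) c = c) ∧
      (∀ E : ∀ ψ' : ConsistentChars (N ⊓ H) χ,
          RepLoc H.subtype ψ'.1 ≌ RepLoc (MonoidHom.id G) χ,
        (∀ ψ' : ConsistentChars (N ⊓ H) χ, IsLInd H N ψ'.1 χ (E ψ').functor) →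
        ∀ π : RepLoc (MonoidHom.id G) χ, π.obj.ρ.IsIrreducible →
          Set.range (fun ψ' : ConsistentChars (N ⊓ H) χ =>
              ((RepLoc.incl H.subtype ψ'.1).obj ((E ψ').inverse.obj π)).cls) ∈
            conjOrbits hs.normal_left φ)) ∧
    -- (6) twisting by characters of the base group
    ((∀ (ω : SmoothChar Gbar) (F F'), IsLInd H N ψ χ F →
        IsLInd H N (ψ * (ω.comap pr hcov.continuous_pr).res (N ⊓ H))
          (χ * (ω.comap pr hcov.continuous_pr).res (N ⊓ Subgroup.center G)) F' →
        Nonempty (RepLoc.twist H.subtype continuous_subtype_val ψ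
            (ω.comap pr hcov.continuous_pr) ⋙ F' ≅
          F ⋙ RepLoc.twist (MonoidHom.id G) continuous_id χ (ω.comap pr hcov.continuous_pr))) ∧
      H ⊔ (N ⊓ Subgroup.centralizer (N : Set G)) = H ⊔ (N ⊓ Subgroup.center G) ∧
      (∀ ω : SmoothChar Gbar,
        (∀ x ∈ H ⊔ (N ⊓ Subgroup.centralizer (N : Set G)), ω.val (pr x) = 1) →
        ∀ F, IsLInd H N ψ χ F →
          Nonempty (F ⋙ RepLoc.incl (MonoidHom.id G) χ ⋙
              smoothTwist (ω.comap pr hcov.continuous_pr) ≅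
            F ⋙ RepLoc.incl (MonoidHom.id G) χ)) ∧
      (∀ ω ω' : SmoothChar Gbar,
        (∀ x ∈ H ⊔ (N ⊓ Subgroup.centralizer (N : Set G)), ω.val (pr x) = ω'.val (pr x)) →
        ∀ π : RepLoc (MonoidHom.id G) χ, Nonempty
          ((smoothTwist (ω.comap pr hcov.continuous_pr)).obj
              ((RepLoc.incl (MonoidHom.id G) χ).obj π) ≅
            (smoothTwist (ω'.comap pr hcov.continuous_pr)).obj
              ((RepLoc.incl (MonoidHom.id G) χ).obj π)))) ∧
    -- (7) twisting orbits when `G / H` is abelian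
    (commutator G ≤ H →
      ∀ F : ∀ χ' : ConsistentChars (N ⊓ Subgroup.center G) ψ,
          RepLoc H.subtype ψ ⥤ RepLoc (MonoidHom.id G) χ'.1,
        (∀ χ' : ConsistentChars (N ⊓ Subgroup.center G) ψ, IsLInd H N ψ χ'.1 (F χ')) →
        ∀ τ : RepLoc H.subtype ψ, τ.obj.ρ.IsIrreducible →
          Set.range (fun χ' : ConsistentChars (N ⊓ Subgroup.center G) ψ =>
              ((RepLoc.incl (MonoidHom.id G) χ'.1).obj ((F χ').obj τ)).cls) ∈
            twistOrbits H φ) ∧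
    -- (8) the bijection of orbits when `G / H` is abelian
    (commutator G ≤ H →
      ∃! Φ : ↥(conjOrbits hs.normal_left φ) ≃ ↥(twistOrbits H φ),
        ∀ (ψ' : SmoothChar ↥(N ⊓ H)) (χ' : SmoothChar ↥(N ⊓ Subgroup.center G)),
          ψ'.Consistent φ → χ'.Consistent φ → ∀ F, IsLInd H N ψ' χ' F →
          ∀ τ : RepLoc H.subtype ψ', τ.obj.ρ.IsIrreducible →
          ∀ O : ↥(conjOrbits hs.normal_left φ),
            ((RepLoc.incl H.subtype ψ').obj τ).cls ∈ O.1 →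
            ((RepLoc.incl (MonoidHom.id G) χ').obj (F.obj τ)).cls ∈ (Φ O).1) ∧
    -- (9) essential square-integrability and formal degrees
    (CompactSpace (↥(H ⊓ Subgroup.centralizer (H : Set G)) ⧸
        (N ⊓ H).subgroupOf (H ⊓ Subgroup.centralizer (H : Set G))) →
      ∀ F, IsLInd H N ψ χ F → ∀ τ : RepLoc H.subtype ψ, τ.obj.ρ.IsIrreducible →
        (IsEssSquareIntegrable (F.obj τ).obj ↔ IsEssSquareIntegrable τ.obj) ∧
        (IsEssSquareIntegrable τ.obj →
          -- the formal degrees exist simultaneously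
          ((∃ μ, IsFormalDegree (F.obj τ).obj (N ⊓ Subgroup.center G) μ) ↔
            ∃ ν, IsFormalDegree τ.obj ((N ⊓ H).subgroupOf H) ν) ∧
          ((∃ μ, IsFormalDegree (F.obj τ).obj (N ⊓ H ⊓ Subgroup.center G) μ) ↔
            ∃ ν, IsFormalDegree τ.obj ((N ⊓ H ⊓ Subgroup.center G).subgroupOf H) ν) ∧
          -- the first formula, as an identity of measures on `NH / N`
          (∀ (μ : Measure (G ⧸ (N ⊓ Subgroup.center G)))
              (ν : Measure (↥H ⧸ (N ⊓ H).subgroupOf H)),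
            IsFormalDegree (F.obj τ).obj (N ⊓ Subgroup.center G) μ →
            IsFormalDegree τ.obj ((N ⊓ H).subgroupOf H) ν →
            ν.map (cosetMap (Subgroup.inclusion (le_sup_right : H ≤ N ⊔ H))
                ((N ⊓ H).subgroupOf H) (N.subgroupOf (N ⊔ H)) (fun _ hx => hx.1)) =
              (d : ENNReal)⁻¹ • (μ.comap (cosetMap (N ⊔ H).subtype
                  ((N ⊓ Subgroup.center G).subgroupOf (N ⊔ H)) (N ⊓ Subgroup.center G)
                  le_rfl)).map
                (cosetMap (MonoidHom.id ↥(N ⊔ H))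
                  ((N ⊓ Subgroup.center G).subgroupOf (N ⊔ H)) (N.subgroupOf (N ⊔ H))
                  (fun _ hx => hx.1))) ∧
          -- the second formula
          (∀ (μ : Measure (G ⧸ (N ⊓ H ⊓ Subgroup.center G)))
              (ν : Measure (↥H ⧸ (N ⊓ H ⊓ Subgroup.center G).subgroupOf H)),
            IsFormalDegree (F.obj τ).obj (N ⊓ H ⊓ Subgroup.center G) μ →
            IsFormalDegree τ.obj ((N ⊓ H ⊓ Subgroup.center G).subgroupOf H) ν →
            ν = ENNReal.ofReal (Real.sqrt ((N ⊓ H).relIndex N *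
                (N ⊓ H ⊓ Subgroup.center G).relIndex (N ⊓ Subgroup.center G))) •
              μ.comap (cosetMap H.subtype ((N ⊓ H ⊓ Subgroup.center G).subgroupOf H)
                (N ⊓ H ⊓ Subgroup.center G) le_rfl)))) := by
  have hgen : ∀ {B : Subgroup G} (κ : SmoothChar B), κ.Genuine ι →
      ∀ c ∈ ι.range, ∀ hB : c ∈ B, κ.1 ⟨c, hB⟩ = 1 → c = 1 := by
    rintro B κ hκ _ ⟨a, rfl⟩ hB h
    rw [hκ a hB (congrArg uval h), map_one]
  have hc : CharData ι.range H N φ.1 :=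
    { data := hs.data hcov
      injective := fun c hC h => by
        subst hφ; exact hgen ψ hψ c hC ((hs.data hcov).C_le_base hC).1 h }
  have hψφ : ψ.Extends φ.1 := by
    subst hφ; exact fun x hx => ⟨hx.1, rfl⟩
  have hχφ : χ.Extends φ.1 := fun x hx => ⟨⟨hx.1.1, hx.2⟩, by
    rw [← hψφ.apply hx.1 hx]; exact uext (hψχ x hx.1 ⟨hx.1.1, hx.2⟩).symm⟩
  have hε := hc.genuine_inj
  have hH := hs.normal_left
  have hB := hs.normal_inf
  have hres : ∀ E : ∀ ψ' : ConsistentChars (N ⊓ H) χ, RepLoc H° ψ'.1 ≌ RepLoc idG χ,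
      (∀ ψ' : ConsistentChars (N ⊓ H) χ, IsLInd H N ψ'.1 χ (E ψ').functor) →
      ∀ (ψ' : ConsistentChars (N ⊓ H) χ) (D : LagrangianDatum H N ψ'.1 χ) (hψ' : ψ'.1.Extends φ.1),
        Nonempty ((E ψ').inverse ≅ D.eig hc hψ') := fun E hE ψ' D hψ' =>
    (hE ψ').nonempty_iso_inverse hc D hψ' ⟨(E ψ').counitIso⟩
  have hle : Z[N] ≤ N ⊓ centralizer (N : Set G) :=
    inf_le_inf_left _ (Subgroup.center_le_centralizer _)
  have hω : ∀ (ω : SmoothChar Gbar) x, (ω.comap pr hcov.continuous_pr).1 x = ω.1 (pr x) :=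
    fun _ _ => rfl
  refine ⟨⟨hc.data.exists_lagrangian, fun L hL => hc.data.exists_extension_char hL ψ χ hψχ,
    fun D => D.exists_isLInd hc hψφ, fun F hF => hF.isEquivalence hc hψφ,
    fun F F' hF hF' => hF.nonempty_iso hc hψφ hF'⟩, ⟨fun F hF => hc.isNatDirectSum_ind hd hψφ hψχ F hF,
    (hc.finite_card_center ψ χ hψχ).1, (hc.finite_card_center ψ χ hψχ).2,
    hc.data.relIndex_center_eq hε⟩, ⟨fun E hE => hc.isNatDirectSum_res hd hχφ hψχ
      (fun ψ' => (E ψ').inverse) (hres E hE),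
    (hc.finite_card_inf ψ χ hψχ).1, (hc.finite_card_inf ψ χ hψχ).2, hc.data.relIndex_inf_eq hε⟩,
    fun F F' hF hF' => hF.nonempty_contragredient_iso hc hψφ hF',
    ⟨fun g F F' hF hF' => hF.nonempty_conj_iso hc hψφ hH hB g hF',
      fun g hg c _ => hc.map_conj_of_mem hH hg c,
      fun E hE π hπ => hc.range_mem_conjOrbits hχφ hψχ hH hB φ rfl
        (fun ψ' => (E ψ').inverse) (hres E hE) π hπ⟩,
    ⟨fun ω F F' hF hF' => hF.nonempty_twist_iso hc hψφ _ (hc.twist _ fun c hC => ?_) hF',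
      hc.data.sup_center_eq hε, fun ω h F hF => (hF.nonempty_comp_smoothTwist_iso hc hψφ _ hF
        (fun x hx => uext (h x (le_sup_left (a := H) hx))) (SmoothChar.eq_mul_res _ χ
          fun x hx => uext (h x (le_sup_right (a := H) (hle hx))))).map Iso.symm,
      fun ω ω' h π => IsLInd.nonempty_smoothTwist_iso hc hψφ hψχ
        (fun x hx => uext (h x (le_sup_left (a := H) hx)))
        (fun x hx => uext (h x (le_sup_right (a := H) (hle hx)))) π⟩,
    fun hG F hF τ hτ => hc.range_mem_twistOrbits hG hψφ hψχ φ rfl F hF τ hτ,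
    fun hG => hc.existsUnique_orbit_equiv hG hH hB φ rfl hψφ hχφ, ?_⟩
  · obtain ⟨a, rfl⟩ := hC
    rw [hω, show pr (ι a) = 1 from (hcov.isSES.mulExact _).2 ⟨a, rfl⟩, map_one]
  · intro hcpt F hF τ hτ; have hpr := hcov.isProperMap
    have := hpr.locallyCompactSpace_group; have := hpr.sigmaCompactSpace
    have hU : HasCompactOpen G := by
      obtain ⟨U, h1, h2⟩ := exists_isCompact_isOpen_subgroup Gbar
      exact ⟨U.comap pr, h1.preimage hcov.continuous_pr, hpr.isCompact_preimage h2⟩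
    have hs := hc.data; have := hs.normal_H; have := hs.normal_N; have := hs.finiteIndex_H
    have hHo := hs.isOpen_H; obtain ⟨hπ, D, ⟨c⟩⟩ := hF.exists_compression hc hψφ hτ
    have hL := D.2; have hVs := (F.obj τ).property.1; have hTs := τ.property.1
    have := ((Representation.irr_iff_submodule τ.obj.ρ).1 hτ).1
    have := ((Representation.irr_iff_submodule (F.obj τ).obj.ρ).1 hπ).1
    let B := N ⊓ H ⊓ center G
    have hBH : B ≤ H := inf_le_left.trans inf_le_right
    have hB : B ≤ center G := inf_le_right; have hBM : B ≤ N ⊓ H := inf_le_left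
    have hBZ : B ≤ Z[N] := le_inf (hBM.trans inf_le_left) hB
    have hZc : Z[N] ≤ center G := inf_le_right
    have hMH : (N ⊓ H).subgroupOf H ≤ center H := fun m hm =>
      mem_center_iff.2 fun h => sext (hs.comm_NH hm.1 h.2)
    have hBM' : B.subgroupOf H ≤ (N ⊓ H).subgroupOf H := fun b hb => hBM hb
    have hBH' : B.subgroupOf H ≤ center H := hBM'.trans hMH
    have : LocallyCompactSpace H := hHo.locallyCompactSpace
    have hHe := (isClosed_of_isOpen H hHo).isClosedEmbedding_subtypeVal
    have : SigmaCompactSpace H := hHe.sigmaCompactSpace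
    have hUH := HasCompactOpen.subgroup hU hHo; have hB0 := hs.relIndex_base_ne_zero hε
    have hr : ∀ {P : Subgroup G}, P ≤ N → B.relIndex P ≠ 0 := fun hP h =>
      hB0 (relIndex_eq_zero_of_le_right hP h)
    have hfZ : FinOver B Z[N] := .of_relIndex (hr inf_le_left)
    have hfM : FinOver (B.subgroupOf H) ((N ⊓ H).subgroupOf H) := .of_relIndex (by
      rw [Subgroup.relIndex_subgroupOf inf_le_right]; exact hr inf_le_left)
    have hfH : FinOver (B.subgroupOf H) (center H) := by
      have h1 : FinOver ((N ⊓ H).subgroupOf H) (inclusion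
          (inf_le_left : H ⊓ centralizer (H : Set G) ≤ H)).range :=
        FinOver.of_compactSpace (D := (N ⊓ H).subgroupOf _) (continuous_subtype_val.subtype_mk _) fun z hz => hz
      refine (h1.mono fun z hz => ⟨⟨z, z.2, mem_centralizer_iff.2 fun h hh =>
        congrArg sval (mem_center_iff.1 hz ⟨h, hh⟩)⟩, rfl⟩).trans hfM hMH
    have hfG : FinOver B (center G) := fun O hO hBO h0 => by
      have h1 : O.relIndex (H ⊓ center G) ≠ 0 := fun h1 =>
        hfH (O.subgroupOf H) (hO.preimage csv) (fun b hb => hBO hb)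
          (relIndex_eq_zero_of_le_right (K := (H ⊓ center G).subgroupOf H)
            (fun z hz => mem_center_iff.2 fun h =>
              sext (mem_center_iff.1 hz.2 h))
            ((Subgroup.relIndex_subgroupOf inf_le_left).trans h1))
      have h2 := Subgroup.relIndex_inf_mul_relIndex O H (center G)
      rw [relIndex_eq_zero_of_le_left inf_le_left h0] at h2
      exact mul_ne_zero h1 (hs.relIndex_H_ne_zero _) h2
    have hsZ : Representation.IsScalarOn (F.obj τ).obj.ρ Z[N] := fun z hz =>
      ⟨_, (F.obj τ).rho_eq_smul hπ (k := z) hz (mem_center_iff.1 hz.2)⟩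
    have hsB : Representation.IsScalarOn (F.obj τ).obj.ρ B := fun b hb => hsZ b (hBZ hb)
    have hsM : Representation.IsScalarOn τ.obj.ρ ((N ⊓ H).subgroupOf H) := fun m hm =>
      ⟨_, τ.rho_eq_smul hτ (k := m) hm (mem_center_iff.1 (hMH hm))⟩
    have hess := c.exists_isL2_iff hHo hVs hTs hτ hsB hBH hB hU (hr hL.le)
    rw [isEssSquareIntegrable_iff hVs hπ hB hfG hU, isEssSquareIntegrable_iff hTs hτ hBH' hfH hUH]
    -- indices
    let a := (N ⊓ H).relIndex (N ⊓ centralizer (N : Set G))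
    have hLd := hs.relIndex_Z_lagrangian_eq hε hL hd
    have hML : (N ⊓ H).relIndex D.L = d * a := by
      rw [← relIndex_mul_relIndex _ _ _ hs.inf_le_Z hL.Z_le, hLd, mul_comm]
    have hrL : H.relIndex (D.L ⊔ H) = d * a := by
      rw [relIndex_sup_right, ← inf_relIndex_right, ← hML,
        ← inf_relIndex_right (N ⊓ H), inf_right_comm, inf_eq_right.2 hL.le, inf_comm]
    have hMN : (N ⊓ H).relIndex N = d * (d * a) := by
      rw [← relIndex_mul_relIndex _ _ _ (hs.le_lagrangian hL) hL.le, hML,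
        hs.relIndex_lagrangian hε hL, hLd, mul_comm]
    have hM0 : (N ⊓ H).relIndex N ≠ 0 := fun h => hB0 (relIndex_eq_zero_of_le_left hBM h)
    have hd0 : d ≠ 0 := left_ne_zero_of_mul (hMN ▸ hM0)
    have hda : ((d * a : ℕ) : ENNReal) ≠ 0 := Nat.cast_ne_zero.2 (right_ne_zero_of_mul (hMN ▸ hM0))
    have hFD : ∀ {μ : Measure (G ⧸ B)}, IsFormalDegree (F.obj τ).obj B μ →
        IsFormalDegree τ.obj (B.subgroupOf H) (((d * a : ℕ) : ENNReal) •
          μ.comap (cosetRes H B)) := fun h =>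
      c.isFormalDegree hHo hVs hBH hB hsB hU (by rw [hrL]) hda h
    refine ⟨hess, fun h2 => ⟨?_, ?_, fun μ ν hμ hν => ?_, fun μ ν hμ hν => ?_⟩⟩
    · obtain ⟨ω, -, hL2⟩ := hess.2 h2; rw [exists_isFormalDegree_iff hVs hsZ hBZ hZc hfZ hU,
        exists_isFormalDegree_iff hTs hsM hBM' hMH hfM hUH]
      exact c.exists_isFormalDegree_iff hHo hVs hTs hBH hB hsB hU hL2
    · obtain ⟨ω, -, hL2⟩ := hess.2 h2
      exact c.exists_isFormalDegree_iff hHo hVs hTs hBH hB hsB hU hL2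
    · obtain ⟨μ, hμ₀, rfl⟩ := hμ.1.exists_map_eq hBZ hZc hfZ hU
      have h3 := hFD ((isFormalDegree_map_iff hVs hsZ hμ₀ hBZ hZc hfZ hU).1 hμ)
      rw [hν.eq hTs hMH hUH ((isFormalDegree_map_iff hTs hsM h3.1 hBM' hMH hfM hUH).2 h3)]
      refine Eq.trans ?_ (congrArg ((d : ENNReal)⁻¹ • ·) (hμ₀.map_comap_cosetMap hHo
        (fun n hn h hh => hs.comm_NH hn hh) hBZ inf_le_left hBM hBM' (fun x hx => hx.1)
        (fun x hx => hx.1) hM0).symm)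
      refine (congrArg _ (Measure.map_smul ..)).trans ((Measure.map_smul ..).trans ?_)
      show _ = (d : ENNReal)⁻¹ • _
      rw [hMN, Nat.cast_mul d (d * a), mul_smul, smul_smul, ENNReal.inv_mul_cancel
        (Nat.cast_ne_zero.2 hd0) (ENNReal.natCast_ne_top d), one_smul]
    · rw [hν.eq hTs hBH' hUH (hFD hμ), hs.relIndex_center_eq hε]; congr 1
      rw [hMN, show ((d * (d * a) : ℕ) : ℝ) * (a : ℕ) = ((d * a : ℕ) : ℝ) ^ 2 by push_cast; ring,
        Real.sqrt_sq (Nat.cast_nonneg _), ENNReal.ofReal_natCast]
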